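/- Let $n\in\{1,2\}$, let $g:(0,\infty)\to\mathbb R$ be $\mathcal C^2$ and let $J\subset[0,\infty)$. Use the Fourier transform $\hat u(\xi)=(2\pi)^{-n/2}\int_{\mathbb R^n}e^{-ix\cdot\xi}u(x)\,dx$, write $m(D)u$ for the multiplier with symbol $m(\xi)$, and $\frac1\infty=0$, $p'=\frac p{p-1}$. Let $\varphi_0$ be a smooth nonnegative even function supported in $[-\frac45,\frac45]$, equal to $1$ on $[-\frac35,\frac35]$ and nonincreasing on $[0,\infty)$; put $Q_k(y)=\varphi_0(2^{-k-1}y)-\varphi_0(2^{-k}y)$ and $\mathbb Z_J=\{k\in\mathbb Z:[2^{k-1},2^{k+1}]\subset J\}$. For $\sigma\in(0,1]$ a pair $(q,r)\in[2,\infty]^2$ is called sharp $\sigma$-admissible if $\frac1q+\frac\sigma r=\frac\sigma2$ and $(q,r,\sigma)\ne(2,\infty,1)$. Let $0<\sigma<1$ and $\beta_0,\beta,\gamma\in\mathbb R$, and assume the following. (i) There are $C>0$ and a smooth function $P$ supported in $\{\frac12\le|y|\le2\}$ and equal to $1$ on $\{\frac35\le|y|\le\frac85\}$ such that, for all $t\ne0$,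 $\delta>0$, $k\in\mathbb Z_J$ and $x\in\mathbb R^n$, $$\Big|\int_{\Omega_n} e^{ix\cdot\xi}e^{i\frac t\delta g(\delta|\xi|)}P\big(\tfrac{\delta|\xi|}{2^k}\big)\,d\xi\Big|\le C\,2^{\gamma k}\frac{\delta^{\beta_0}}{|t|^\sigma},$$ where $\Omega_1=(0,\infty)$ and $\Omega_2=\mathbb R^2$. (ii) There is $C>0$ such that, for all $t\ne0$, $\delta>0$ and $x\in\mathbb R^n$, $$\Big|\int_{\mathbb R^n} e^{ix\cdot\xi}e^{i\frac t\delta g(\delta|\xi|)}|\xi|^{-\gamma}\sum_{k\in\mathbb Z_J}Q_k(\delta|\xi|)\,d\xi\Big|\le C\frac{\delta^{\beta}}{|t|^\sigma}.$$ Here the integral is an oscillatory integral: it denotes a function of $x$ whose Fourier transform on $\mathbb R^n\setminus\{0\}$ is $(2\pi)^{n/2}$ times the displayed symbol. Let $\chi$ be a bounded function, smooth on $(0,\infty)$, with $\chi\sum_{k\in\mathbb Z_J}Q_k=\chi$ on $(0,\infty)$. Then for all sharp $\sigma$-admissible pairs $(q,r)$ and $(\tilde q,\tilde r)$, the values $r=\infty$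 and $\tilde r=\infty$ included, there is $C_2>0$ such that for every $\delta>0$: 1. for every $f\in L^2(\mathbb R^n)$, $$\big\|e^{i\frac t\delta g(\delta|D|)}\chi(\delta|D|)f\big\|_{L^q_tL^r_x}\le C_2\,\delta^{\beta(\frac12-\frac1r)}\big\||D|^{\gamma(\frac12-\frac1r)}\chi(\delta|D|)f\big\|_{L^2};$$ 2. for every $F\in L^{q'}_t(\mathbb R;L^{r'}_x(\mathbb R^n))$, $$\Big\|\int_{\mathbb R}e^{-i\frac s\delta g(\delta|D|)}\chi(\delta|D|)F(s)\,ds\Big\|_{L^2}\le C_2\,\delta^{\beta(\frac12-\frac1r)}\big\||D|^{\gamma(\frac12-\frac1r)}\chi(\delta|D|)F\big\|_{L^{q'}_tL^{r'}_x};$$ 3. for every $F$ in $L^{q'}_tL^{r'}_x$ or in $L^{\tilde q'}_tL^{\tilde r'}_x$, $$\Big\|\int_{\mathbb R}e^{i\frac{t-s}\delta g(\delta|D|)}\chi(\delta|D|)F(s)\,ds\Big\|_{L^q_tL^r_x}\le C_2\,\delta^{\beta(1-\frac1r-\frac1{\tilde r})}\big\||D|^{\gamma(1-\frac1r-\frac1{\tilde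 r})}\chi(\delta|D|)F\big\|_{L^{\tilde q'}_tL^{\tilde r'}_x};$$ 4. if moreover $(r,\tilde r)\in\{(2,\infty),(\infty,2),(\infty,\infty)\}$, the estimate in 3 also holds with $\int_{\mathbb R}$ replaced by $\int_{s<t}$. Each estimate is claimed whenever its right-hand side is finite. The time integrals are weak integrals: tested against functions whose Fourier transform lies in $C_c^\infty(\mathbb R^n\setminus\{0\})$, the integrand is absolutely integrable in $s$. The left-hand sides in 3 and 4 are taken, for almost every $t$, to be the representative with no zero-frequency component, i.e. $\varepsilon^n\int v(x)\phi(\varepsilon x)\,dx\to0$ as $\varepsilon\to0^+$ for every Schwartz function $\phi$. -/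

import Mathlib

open MeasureTheory Filter Topology Set
open scoped ENNReal ContDiff SchwartzMap

noncomputable section

namespace Strichartz

/-- The space `ℝⁿ` with its Euclidean norm. -/
abbrev Eu (n : ℕ) : Type := EuclideanSpace ℝ (Fin n)

/-! ### Littlewood-Paley decomposition -/

/-- The even bump function `φ₀` from which the Littlewood-Paley decomposition is built. -/
structure IsLPBump (φ₀ : ℝ → ℝ) : Prop where
  smooth : ContDiff ℝ ∞ φ₀
  nonneg : ∀ y, 0 ≤ φ₀ y
  even : ∀ y, φ₀ (-y) = φ₀ y
  support : Function.support φ₀ ⊆ Icc (-(4 / 5)) (4 / 5)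
  eq_one : ∀ y ∈ Icc (-(3 / 5) : ℝ) (3 / 5), φ₀ y = 1
  antitone : AntitoneOn φ₀ (Ici 0)

/-- `Q_j(y) = φ₀(2^{-j-1} y) - φ₀(2^{-j} y)`. -/
def Q (φ₀ : ℝ → ℝ) (j : ℤ) (y : ℝ) : ℝ :=
  φ₀ ((2 : ℝ) ^ (-j - 1) * y) - φ₀ ((2 : ℝ) ^ (-j) * y)

/-- `ℤ_J = {k ∈ ℤ : [2^{k-1}, 2^{k+1}] ⊆ J}`. -/
def ZJ (J : Set ℝ) : Set ℤ :=
  {k | Icc ((2 : ℝ) ^ (k - 1)) ((2 : ℝ) ^ (k + 1)) ⊆ J}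

/-- `∑_{k ∈ ℤ_J} Q_k(y)`; at each `y` only finitely many terms are nonzero. -/
def sumQ (φ₀ : ℝ → ℝ) (J : Set ℝ) (y : ℝ) : ℝ :=
  ∑' k : ZJ J, Q φ₀ k y

/-- A smooth profile supported in the annulus `1/2 ≤ |y| ≤ 2` and equal to `1` in the annulus
`3/5 ≤ |y| ≤ 8/5`. -/
structure IsAnnulusProfile (P : ℝ → ℂ) : Prop where
  smooth : ContDiff ℝ ∞ P
  support : Function.support P ⊆ {y | 1 / 2 ≤ |y| ∧ |y| ≤ 2}
  eq_one : ∀ y : ℝ, 3 / 5 ≤ |y| → |y| ≤ 8 / 5 → P y = 1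

/-! ### Fourier transform, symbols and oscillatory integrals -/

/-- The Fourier transform `(2π)^{-n/2} ∫ e^{-i x·ξ} f(ξ) dξ`. -/
def FT {n : ℕ} (f : Eu n → ℂ) (x : Eu n) : ℂ :=
  (((2 * Real.pi) ^ (-(n : ℝ) / 2) : ℝ) : ℂ) *
    ∫ ξ : Eu n, Complex.exp (-(Complex.I * ((inner ℝ x ξ : ℝ) : ℂ))) * f ξ

/-- The symbol `e^{i (t/δ) g(δ|ξ|)}` of the propagator `e^{i (t/δ) g(δ|D|)}`. -/
def propSymbol {n : ℕ} (g : ℝ → ℝ) (δ t : ℝ) (ξ : Eu n) : ℂ :=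
  Complex.exp (Complex.I * ((t / δ * g (δ * ‖ξ‖) : ℝ) : ℂ))

/-- The symbol `χ(δ|ξ|)` of `χ(δ|D|)`. -/
def cutSymbol {n : ℕ} (χ : ℝ → ℂ) (δ : ℝ) (ξ : Eu n) : ℂ := χ (δ * ‖ξ‖)

/-- The symbol `|ξ|^a χ(δ|ξ|)` of `|D|^a χ(δ|D|)`. -/
def powCutSymbol {n : ℕ} (a : ℝ) (χ : ℝ → ℂ) (δ : ℝ) (ξ : Eu n) : ℂ :=
  ((‖ξ‖ ^ a : ℝ) : ℂ) * χ (δ * ‖ξ‖)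

/-- The domain of integration of the dyadic integrals: the half-line `ξ > 0` if `n = 1`, and the
whole space otherwise. -/
def freqDomain (n : ℕ) : Set (Eu n) := {ξ | n = 1 → ∀ i, 0 < ξ i}

/-- The dyadic oscillatory integral
`I⁰_{t,x,k} = ∫ e^{i x·ξ} e^{i (t/δ) g(δ|ξ|)} P(δ|ξ|/2^k) dξ`,
over `ℝ₊` if `n = 1` and over `ℝ²` if `n = 2`. -/
def dyadicIntegral {n : ℕ} (g : ℝ → ℝ) (P : ℝ → ℂ) (δ t : ℝ) (k : ℤ) (x : Eu n) : ℂ :=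
  ∫ ξ in freqDomain n, Complex.exp (Complex.I * ((inner ℝ x ξ : ℝ) : ℂ)) *
    propSymbol g δ t ξ * P (δ * ‖ξ‖ / (2 : ℝ) ^ k)

/-- Test functions on the frequency side: `C_c^∞(ℝⁿ ∖ {0})`. -/
structure IsFreqTest {n : ℕ} (θ : Eu n → ℂ) : Prop where
  smooth : ContDiff ℝ ∞ θ
  compact : HasCompactSupport θ
  away : (0 : Eu n) ∉ tsupport θ

/-- `K(x) = ∫ e^{i x·ξ} m(ξ) dξ` as an oscillatory integral: the Fourier transform of `K` is
`(2π)^{n/2} m` in the sense of distributions on `ℝⁿ ∖ {0}`. The symbol `m` need not be integrable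
at infinity, nor near the origin. -/
def IsOscIntegral {n : ℕ} (m K : Eu n → ℂ) : Prop :=
  ∀ θ : Eu n → ℂ, IsFreqTest θ →
    ∫ x, K x * FT θ x = (((2 * Real.pi) ^ ((n : ℝ) / 2) : ℝ) : ℂ) * ∫ ξ, m ξ * θ ξ

/-- `v = m(D) u`, that is `v̂ = m û` in the sense of distributions on `ℝⁿ ∖ {0}`
(using `∫ v̂ θ = ∫ v θ̂`). -/
def IsMultiplierImage {n : ℕ} (m u v : Eu n → ℂ) : Prop :=
  ∀ θ : Eu n → ℂ, IsFreqTest θ →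
    ∫ x, v x * FT θ x = ∫ x, u x * FT (fun ξ => m ξ * θ ξ) x

/-- `v = ∫_S M(s, D) F(s) ds` as a weak integral: after pairing with a test function, the
integrand is absolutely integrable in `s` and its integral is the pairing of `v`. -/
def IsTimeIntegral {n : ℕ} (S : Set ℝ) (M : ℝ → Eu n → ℂ) (F : ℝ → Eu n → ℂ)
    (v : Eu n → ℂ) : Prop :=
  ∀ θ : Eu n → ℂ, IsFreqTest θ →
    IntegrableOn (fun s => ∫ x, F s x * FT (fun ξ => M s ξ * θ ξ) x) S ∧
    ∫ x, v x * FT θ x = ∫ s in S, ∫ x, F s x * FT (fun ξ => M s ξ * θ ξ) x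

/-- `v` has no component at the zero frequency: its averages at large scales tend to `0`. This
holds for every `v ∈ L^r` with `r < ∞`; in `L^∞` it excludes the nonzero constants, which pair to
zero with all the test functions above. -/
def VanishesAtZeroFreq {n : ℕ} (v : Eu n → ℂ) : Prop :=
  ∀ φ : 𝓢(Eu n, ℂ),
    Tendsto (fun ε : ℝ => ((ε ^ n : ℝ) : ℂ) * ∫ x, v x * φ (ε • x)) (𝓝[>] 0) (𝓝 0)

/-! ### Mixed Lebesgue norms and admissible pairs -/

/-- The norm `‖u‖_{L^q_t L^r_x}`. -/
def mixedNorm {n : ℕ} (q r : ℝ≥0∞) (u : ℝ → Eu n → ℂ) : ℝ≥0∞ :=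
  eLpNorm (fun t => eLpNorm (u t) r volume) q volume

/-- `u ∈ L^q_t(ℝ; L^r_x(ℝⁿ))`. -/
def MemMixed {n : ℕ} (q r : ℝ≥0∞) (u : ℝ → Eu n → ℂ) : Prop :=
  AEStronglyMeasurable (Function.uncurry u) (volume : Measure (ℝ × Eu n)) ∧ mixedNorm q r u < ⊤

/-- `1 / p` as a real number, with `1 / ∞ = 0`. -/
def recip (p : ℝ≥0∞) : ℝ := (p⁻¹).toReal

/-- The pair `(q, r)` is sharp `σ`-admissible. -/
def SharpAdmissible (σ : ℝ) (q r : ℝ≥0∞) : Prop :=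
  2 ≤ q ∧ 2 ≤ r ∧ recip q + σ * recip r = σ / 2 ∧ ¬ (q = 2 ∧ r = ⊤ ∧ σ = 1)

/-- `u(t) = ∫_{S t} e^{i ((t-s)/δ) g(δ|D|)} χ(δ|D|) F(s) ds` for almost every `t`. -/
def IsDuhamel {n : ℕ} (g : ℝ → ℝ) (χ : ℝ → ℂ) (δ : ℝ) (S : ℝ → Set ℝ)
    (F u : ℝ → Eu n → ℂ) : Prop :=
  AEStronglyMeasurable (Function.uncurry u) (volume : Measure (ℝ × Eu n)) ∧
  ∀ᵐ t : ℝ, VanishesAtZeroFreq (u t) ∧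
    IsTimeIntegral (S t) (fun s ξ => propSymbol g δ (t - s) ξ * cutSymbol χ δ ξ) F (u t)

/-- `G(t) = |D|^a χ(δ|D|) F(t)` for almost every `t`. -/
def IsPowCut {n : ℕ} (a : ℝ) (χ : ℝ → ℂ) (δ : ℝ) (F G : ℝ → Eu n → ℂ) : Prop :=
  ∀ᵐ t : ℝ, IsMultiplierImage (powCutSymbol a χ δ) (F t) (G t)

end Strichartz

end

/-! Write $\psi(\xi)=g(\delta|\xi|)/\delta$. All four estimates are read off from weighted $L^2$
bounds for one object, the spectral integral $Z(\xi)=\int e^{-is\psi(\xi)}\hat G(s,\xi)\,ds$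
(`specInt`), with $G$ bounded, measurable and of bounded support (`Nice`).

Two endpoints are direct. For $r=2$, Plancherel and Minkowski give $\|Z\|_2\le\|G\|_{L^1_tL^2_x}$
(`lintegral_specInt_sq_le`). For $r=\infty$, expanding $|Z|^2$ and using (ii) as a kernel bound at
time $t-s$ gives $\int m|Z|^2\lesssim\delta^\beta\iint\|G(t)\|_1\|G(s)\|_1|t-s|^{-\sigma}\,ds\,dt$,
where $m$ is the symbol $|\xi|^{-\gamma}\sum_kQ_k(\delta|\xi|)$ (`lintegral_mul_specInt_sq_le`). The
diagonal Hardy-Littlewood-Sobolev inequality (`hls_diag`) bounds the double integral by the square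
of the norm in $L^{2/(2-\sigma)}_tL^1_x$.

For intermediate $r$, put $\theta=1-2/r$ and $w=\delta^\beta|\xi|^\gamma$. On the support of
$\chi(\delta|\cdot|)$ the sum of the $Q_k$ is $1$, so the endpoints concern the weights $w^0$ and
$w^{-1}$, and $w^{-\theta}$ is wanted. The layer cake formula writes $w^{-\theta}$ as an integral
over levels $\lambda$; at level $\lambda$ the function $G$ is cut at height
$c(t)\lambda^{(1+\theta)/2}$, the low part is estimated by the first endpoint and the high part by
the second. With $c(t)$ a suitable power of $\|G(t)\|_{r'}$ both contributions are controlled by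
$\|G\|_{L^{q'}L^{r'}}$ (`lintegral_rpow_specInt_le`, `specBound_wt`). The weights are interpolated
directly, so the endpoint $r=\infty$ is one of the two starting points of the argument.

A bound $\|WZ\|_2\le A\|G\|$ (`SpecBound`) is dual to the homogeneous estimate, because mixed norms
are determined by pairings with nice functions (`mixedNorm_le_of_pairing`). By density it yields the
dual estimate, and two such bounds combined by Cauchy-Schwarz in $\xi$ yield the inhomogeneous one.
The retarded estimate follows from a Christ-Kiselev argument (`norm_retInt_le`): since $\sigma<1$,
both $q'$ and $\tilde q'$ are below $2$, so $\frac1{q'}+\frac1{\tilde q'}>1$.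

Two further points concern the meaning of the solutions. The Duhamel operators are first built with
smooth frequency cutoffs and then passed to the limit; convergence rests on the uniform smallness of
the spectral tails of all integrals over half-lines (`SpecBound.exists_tail_le`), and the limit
keeps no zero-frequency component (`vanishesAtZeroFreq_of_tendsto`). Finally the estimates are
proved for $G=|D|^a\chi(\delta|D|)F$ and the identities are claimed for $F$; the two are linked
because functions in $L^p$, $1\le p\le2$, have Fourier transforms that are functions away from the
origin (`IsMultiplierImage.integral_mul_FT_eq`). -/

namespace Strichartz

/-! ### The Fourier transform -/

section Fourier

open FourierTransform

variable {n : ℕ}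

/-- The normalisation constant `(2π)^{-n/2}` of the Fourier transform. -/
noncomputable def ftConst (n : ℕ) : ℝ := (2 * Real.pi) ^ (-(n : ℝ) / 2)

lemma ftConst_pos (n : ℕ) : 0 < ftConst n := Real.rpow_pos_of_pos (by positivity) _

lemma ftConst_inv (n : ℕ) : (ftConst n)⁻¹ = (2 * Real.pi) ^ ((n : ℝ) / 2) := by
  rw [ftConst, neg_div, Real.rpow_neg (by positivity), inv_inv]

lemma ftConst_sq (n : ℕ) : ftConst n * ftConst n = ((2 * Real.pi) ^ n)⁻¹ := by
  rw [ftConst, ← Real.rpow_add (by positivity), ← Real.rpow_natCast, ← Real.rpow_neg (by positivity)]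
  ring_nf

/-- The character `e^{-i x·ξ}`. -/
noncomputable def ftKer (x ξ : Eu n) : ℂ := Complex.exp (-(Complex.I * ((inner ℝ x ξ : ℝ) : ℂ)))

lemma ftKer_comm (x ξ : Eu n) : ftKer x ξ = ftKer ξ x := by
  rw [ftKer, ftKer, real_inner_comm]

@[simp] lemma norm_ftKer (x ξ : Eu n) : ‖ftKer x ξ‖ = 1 := by
  rw [ftKer, ← mul_neg, ← Complex.ofReal_neg, mul_comm, Complex.norm_exp_ofReal_mul_I]

@[fun_prop] lemma continuous_ftKer : Continuous (fun p : Eu n × Eu n => ftKer p.1 p.2) := by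
  unfold ftKer; fun_prop

lemma FT_def (f : Eu n → ℂ) (x : Eu n) : FT f x = (ftConst n : ℂ) * ∫ ξ, ftKer x ξ * f ξ := rfl

lemma FT_eq_fourier (f : Eu n → ℂ) (x : Eu n) :
    FT f x = (ftConst n : ℂ) * 𝓕 f ((2 * Real.pi)⁻¹ • x) := by
  rw [FT_def, Real.fourier_eq']
  congr 2
  ext ξ
  rw [smul_eq_mul, ftKer]
  congr 2
  rw [inner_smul_right, real_inner_comm]
  push_cast
  have : (Real.pi : ℂ) ≠ 0 := by exact_mod_cast Real.pi_ne_zero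
  field_simp

lemma FT_smul_eq_fourier (f : Eu n → ℂ) (y : Eu n) :
    FT f ((2 * Real.pi) • y) = (ftConst n : ℂ) * 𝓕 f y := by
  rw [FT_eq_fourier, inv_smul_smul₀ (by positivity)]

lemma norm_FT_le (f : Eu n → ℂ) (x : Eu n) : ‖FT f x‖ ≤ ftConst n * ∫ ξ, ‖f ξ‖ := by
  rw [FT_def, norm_mul, Complex.norm_real, Real.norm_of_nonneg (ftConst_pos n).le]
  gcongr
  · exact (ftConst_pos n).le
  · refine (norm_integral_le_integral_norm _).trans_eq ?_
    simp

lemma FT_const_mul (a : ℂ) (f : Eu n → ℂ) (x : Eu n) : FT (fun ξ => a * f ξ) x = a * FT f x := by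
  rw [FT_def, FT_def, mul_left_comm a, ← integral_const_mul a]
  congr 2
  funext ξ
  ring

lemma integrable_ftKer_mul {f : Eu n → ℂ} (hf : Integrable f) (x : Eu n) :
    Integrable (fun ξ => ftKer x ξ * f ξ) := by
  refine hf.bdd_mul (c := 1) ?_ (ae_of_all _ fun ξ => (norm_ftKer x ξ).le)
  exact (Continuous.aestronglyMeasurable (by fun_prop))

lemma FT_add {f h : Eu n → ℂ} (hf : Integrable f) (hh : Integrable h) (x : Eu n) :
    FT (fun ξ => f ξ + h ξ) x = FT f x + FT h x := by
  simp only [FT_def, mul_add]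
  rw [integral_add (integrable_ftKer_mul hf x) (integrable_ftKer_mul hh x), mul_add]

lemma FT_sub {f h : Eu n → ℂ} (hf : Integrable f) (hh : Integrable h) (x : Eu n) :
    FT (fun ξ => f ξ - h ξ) x = FT f x - FT h x := by
  simp only [FT_def, mul_sub]
  rw [integral_sub (integrable_ftKer_mul hf x) (integrable_ftKer_mul hh x), mul_sub]

lemma continuous_FT {f : Eu n → ℂ} (hf : Integrable f) : Continuous (FT f) := by
  have h : Continuous fun x => ∫ ξ, ftKer x ξ * f ξ := by
    refine continuous_of_dominated (bound := fun ξ => ‖f ξ‖)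
      (fun x => (integrable_ftKer_mul hf x).1) (fun x => ae_of_all _ fun ξ => by simp) hf.norm
      (ae_of_all _ fun ξ => ?_)
    fun_prop
  exact continuous_const.mul h

lemma integrable_prod_ftKer_mul {f h : Eu n → ℂ} (hf : Integrable f) (hh : Integrable h) :
    Integrable (fun p : Eu n × Eu n => ftKer p.1 p.2 * (f p.1 * h p.2)) := by
  refine (hf.mul_prod hh).bdd_mul (c := 1) ?_ (ae_of_all _ fun p => (norm_ftKer _ _).le)
  exact continuous_ftKer.aestronglyMeasurable

lemma integral_mul_FT {f h : Eu n → ℂ} (hf : Integrable f) (hh : Integrable h) :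
    ∫ x, f x * FT h x = ∫ ξ, FT f ξ * h ξ := by
  have h1 : ∀ x, f x * FT h x = (ftConst n : ℂ) * ∫ ξ, ftKer x ξ * (f x * h ξ) := fun x => by
    rw [FT_def, mul_left_comm, ← integral_const_mul]
    congr 2; funext ξ; ring
  have h2 : ∀ ξ, FT f ξ * h ξ = (ftConst n : ℂ) * ∫ x, ftKer x ξ * (f x * h ξ) := fun ξ => by
    rw [FT_def, mul_assoc, ← integral_mul_const]
    congr 2; ext x; rw [ftKer_comm]; ring
  simp_rw [h1, h2, integral_const_mul]
  congr 1
  exact integral_integral_swap (integrable_prod_ftKer_mul hf hh)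

/-- The `L²` isometry `S f (y) = (2π)^{n/2} f (2π y)`. -/
noncomputable def dil (f : Eu n → ℂ) (y : Eu n) : ℂ :=
  ((ftConst n)⁻¹ : ℝ) * f ((2 * Real.pi) • y)

/-- The unitary dilation converts the present normalisation into that of the character $e^{-2\pi i
x\cdot\xi}$, so the $L^2$ theory of `𝓕` transfers to `FT` without constants. -/
lemma dil_FT (f : Eu n → ℂ) : dil (FT f) = 𝓕 f := by
  ext y
  rw [dil, FT_smul_eq_fourier, ← mul_assoc, ← Complex.ofReal_mul,
    inv_mul_cancel₀ (ftConst_pos n).ne', Complex.ofReal_one, one_mul]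

lemma quasiMeasurePreserving_smul {c : ℝ} (hc : c ≠ 0) :
    Measure.QuasiMeasurePreserving (fun y : Eu n => c • y) volume volume := by
  refine ⟨measurable_const_smul c, ?_⟩
  rw [Measure.map_addHaar_smul _ hc]
  exact Measure.smul_absolutelyContinuous

lemma eLpNorm_dil {f : Eu n → ℂ} (hf : AEStronglyMeasurable f volume) :
    eLpNorm (dil f) 2 volume = eLpNorm f 2 volume := by
  have hpi : (2 * Real.pi) ≠ 0 := by positivity
  have h1 : dil f = (((ftConst n)⁻¹ : ℝ) : ℂ) • (f ∘ fun y : Eu n => (2 * Real.pi) • y) := rfl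
  have h2 : eLpNorm (f ∘ fun y : Eu n => (2 * Real.pi) • y) 2 volume =
      ENNReal.ofReal (ftConst n) * eLpNorm f 2 volume := by
    rw [← eLpNorm_map_measure _ (measurable_const_smul _).aemeasurable,
      Measure.map_addHaar_smul _ hpi, eLpNorm_smul_measure_of_ne_top (by simp), smul_eq_mul]
    · congr 1
      rw [abs_of_pos (by positivity)]
      have : Module.finrank ℝ (Eu n) = n := by simp
      rw [this, ← ftConst_sq, ENNReal.ofReal_rpow_of_nonneg (by have := ftConst_pos n; positivity)
        (by simp)]
      congr 1
      rw [Real.mul_rpow (ftConst_pos n).le (ftConst_pos n).le,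
        ← Real.rpow_add (ftConst_pos n)]
      norm_num
    · rw [Measure.map_addHaar_smul _ hpi]
      exact hf.smul_measure _
  rw [h1, eLpNorm_const_smul, h2, ← mul_assoc]
  rw [← ofReal_norm, Complex.norm_real, Real.norm_of_nonneg
    (inv_nonneg.2 (ftConst_pos n).le), ← ENNReal.ofReal_mul (inv_nonneg.2 (ftConst_pos n).le),
    inv_mul_cancel₀ (ftConst_pos n).ne', ENNReal.ofReal_one, one_mul]

lemma aestronglyMeasurable_dil {f : Eu n → ℂ} (hf : AEStronglyMeasurable f volume) :
    AEStronglyMeasurable (dil f) volume :=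
  (hf.comp_quasiMeasurePreserving (quasiMeasurePreserving_smul (by positivity))).const_mul _

lemma memLp_dil {f : Eu n → ℂ} (hf : MemLp f 2 volume) : MemLp (dil f) 2 volume :=
  ⟨aestronglyMeasurable_dil hf.1, (eLpNorm_dil hf.1).trans_lt hf.2⟩

lemma integral_dil_mul_dil (f h : Eu n → ℂ) : ∫ y, dil f y * dil h y = ∫ x, f x * h x := by
  have : ∀ y, dil f y * dil h y = (((ftConst n)⁻¹ : ℝ) * ((ftConst n)⁻¹ : ℝ) : ℂ) *
      (fun x => f x * h x) ((2 * Real.pi) • y) := fun y => by simp only [dil]; ring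
  simp_rw [this]
  rw [integral_const_mul, Measure.integral_comp_smul volume (fun x => f x * h x)]
  have h3 : Module.finrank ℝ (Eu n) = n := by simp
  rw [h3, abs_of_pos (by positivity), ← ftConst_sq, Complex.real_smul, ← mul_assoc]
  have : (ftConst n : ℂ) ≠ 0 := by exact_mod_cast (ftConst_pos n).ne'
  push_cast
  field_simp

/-- The inverse of `dil`. -/
noncomputable def undil (f : Eu n → ℂ) (x : Eu n) : ℂ :=
  (ftConst n : ℝ) * f ((2 * Real.pi)⁻¹ • x)

lemma dil_undil (f : Eu n → ℂ) : dil (undil f) = f := by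
  ext y
  have : (ftConst n : ℂ) ≠ 0 := by exact_mod_cast (ftConst_pos n).ne'
  rw [dil, undil, inv_smul_smul₀ (by positivity), ← mul_assoc]
  push_cast
  rw [inv_mul_cancel₀ this, one_mul]

lemma aestronglyMeasurable_undil {f : Eu n → ℂ} (hf : AEStronglyMeasurable f volume) :
    AEStronglyMeasurable (undil f) volume :=
  (hf.comp_quasiMeasurePreserving (quasiMeasurePreserving_smul (by positivity))).const_mul _

lemma eLpNorm_undil {f : Eu n → ℂ} (hf : AEStronglyMeasurable f volume) :
    eLpNorm (undil f) 2 volume = eLpNorm f 2 volume := by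
  rw [← eLpNorm_dil (aestronglyMeasurable_undil hf), dil_undil]

/-- The Hilbert space `L²(ℝⁿ)`. -/
noncomputable abbrev L2 (n : ℕ) := Lp (α := Eu n) ℂ 2 (volume : Measure (Eu n))

lemma integral_fourier_mul_schwartz (f : L2 n) (φ : 𝓢(Eu n, ℂ)) :
    ∫ x, (𝓕 f : L2 n) x * φ x = ∫ x, f x * (𝓕 φ : 𝓢(Eu n, ℂ)) x := by
  have h := congrArg (fun T => T φ) (Lp.fourier_toTemperedDistribution_eq f)
  simp only [TemperedDistribution.fourier_apply, Lp.toTemperedDistribution_apply,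
    smul_eq_mul] at h
  simp_rw [mul_comm] at h ⊢
  exact h.symm

/-- The `L²` and the `L¹` Fourier transforms agree. -/
lemma fourier_toLp_ae {f : Eu n → ℂ} (hf : Integrable f) (hf2 : MemLp f 2 volume) :
    ((𝓕 (hf2.toLp f) : L2 n) : Eu n → ℂ) =ᵐ[volume] 𝓕 f := by
  have hcont : Continuous (𝓕 f) := by
    have := continuous_FT hf
    have h2 : 𝓕 f = fun y => dil (FT f) y := by rw [dil_FT]
    rw [h2]
    unfold dil
    fun_prop
  have hloc : LocallyIntegrable (fun x => (𝓕 (hf2.toLp f) : L2 n) x - 𝓕 f x) volume :=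
    ((Lp.memLp _).locallyIntegrable (by norm_num)).sub hcont.locallyIntegrable
  -- Both transforms are locally integrable, so it is enough to compare them against compactly
  -- supported smooth functions, where each satisfies the multiplication formula.
  have := ae_eq_zero_of_integral_contDiff_smul_eq_zero hloc ?_
  · filter_upwards [this] with x hx
    exact sub_eq_zero.1 hx
  intro g g_smooth g_cpt
  have hg₁ : HasCompactSupport (Complex.ofRealCLM ∘ g) := g_cpt.comp_left rfl
  have hg₂ : ContDiff ℝ ∞ (Complex.ofRealCLM ∘ g) := by fun_prop
  set φ : 𝓢(Eu n, ℂ) := hg₁.toSchwartzMap hg₂ with hφ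
  have hφg : ∀ x, φ x = (g x : ℂ) := fun x => rfl
  have h1 := integral_fourier_mul_schwartz (hf2.toLp f) φ
  have h2 : ∫ x, (hf2.toLp f) x * (𝓕 φ : 𝓢(Eu n, ℂ)) x = ∫ x, 𝓕 f x * φ x := by
    have h3 : ∫ x, (hf2.toLp f) x * (𝓕 φ : 𝓢(Eu n, ℂ)) x = ∫ x, f x * 𝓕 (φ : Eu n → ℂ) x := by
      refine integral_congr_ae ?_
      filter_upwards [hf2.coeFn_toLp] with x hx
      rw [hx, SchwartzMap.fourier_coe]
    rw [h3]
    have h5 := VectorFourier.integral_fourierIntegral_smul_eq_flip (L := innerₗ (Eu n))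
      (μ := volume) (ν := volume) Real.continuous_fourierChar continuous_inner hf φ.integrable
    rw [flip_innerₗ] at h5
    exact h5.symm
  have h4 : ∀ x, g x • ((𝓕 (hf2.toLp f) : L2 n) x - 𝓕 f x) =
      (𝓕 (hf2.toLp f) : L2 n) x * φ x - 𝓕 f x * φ x := fun x => by
    rw [hφg, Complex.real_smul]; ring
  simp_rw [h4]
  rw [integral_sub, h1, h2, sub_self]
  · exact (Lp.memLp _).integrable_mul (φ.memLp 2 volume)
  · refine (φ.integrable).bdd_mul (c := ∫ x, ‖f x‖) hcont.aestronglyMeasurable ?_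
    refine ae_of_all _ fun x => ?_
    exact VectorFourier.norm_fourierIntegral_le_integral_norm _ _ _ _ _

/-- Both sides are continuous in $h$ for the $L^2$ norm and agree for Schwartz $h$, which are dense.
-/
lemma integral_fourier_mul (f h : L2 n) :
    ∫ x, (𝓕 f : L2 n) x * h x = ∫ x, f x * (𝓕 h : L2 n) x := by
  let B : L2 n →L[ℂ] L2 n →L[ℂ] ℂ := (ContinuousLinearMap.mul ℂ ℂ).lpPairing volume 2 2
  have hB : ∀ f h : L2 n, B f h = ∫ x, f x * h x := fun f h =>
    ContinuousLinearMap.lpPairing_eq_integral _ _ _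
  have key : ∀ h : L2 n, B (𝓕 f) h = B f (𝓕 h) := by
    intro h
    refine DenseRange.induction_on (p := fun h => B (𝓕 f) h = B f (𝓕 h))
      (SchwartzMap.denseRange_toLpCLM (p := 2) (F := ℂ) ENNReal.ofNat_ne_top) h ?_ ?_
    · exact isClosed_eq (B (𝓕 f)).continuous
        ((B f).continuous.comp (Lp.fourierTransformₗᵢ (Eu n) ℂ).continuous)
    · intro φ
      rw [hB, hB]
      have h1 := integral_fourier_mul_schwartz f φ
      have e1 : (SchwartzMap.toLpCLM ℝ ℂ 2 volume φ : L2 n) = φ.toLp 2 := rfl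
      rw [e1, SchwartzMap.toLp_fourier_eq]
      calc _ = ∫ x, (𝓕 f : L2 n) x * φ x := by
            refine integral_congr_ae ?_
            filter_upwards [φ.coeFn_toLp 2] with x hx
            rw [hx]
        _ = _ := h1
        _ = _ := by
            refine integral_congr_ae ?_
            filter_upwards [(𝓕 φ : 𝓢(Eu n, ℂ)).coeFn_toLp 2] with x hx
            rw [hx]
  rw [← hB, ← hB, key]

/-- Plancherel's theorem. -/
theorem eLpNorm_FT {f : Eu n → ℂ} (hf : Integrable f) (hf2 : MemLp f 2 volume) :
    eLpNorm (FT f) 2 volume = eLpNorm f 2 volume := by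
  rw [← eLpNorm_dil (continuous_FT hf).aestronglyMeasurable, dil_FT,
    ← eLpNorm_congr_ae (fourier_toLp_ae hf hf2), ← eLpNorm_congr_ae hf2.coeFn_toLp]
  have := Lp.norm_fourier_eq (hf2.toLp f)
  rw [Lp.norm_def, Lp.norm_def] at this
  exact (ENNReal.toReal_eq_toReal_iff' (Lp.memLp _).2.ne (Lp.memLp _).2.ne).1 this

theorem memLp_FT {f : Eu n → ℂ} (hf : Integrable f) (hf2 : MemLp f 2 volume) :
    MemLp (FT f) 2 volume :=
  ⟨(continuous_FT hf).aestronglyMeasurable, (eLpNorm_FT hf hf2).trans_lt hf2.2⟩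

/-- Every `f ∈ L²` has a Fourier transform in `L²`. -/
theorem exists_hat {f : Eu n → ℂ} (hf : MemLp f 2 volume) :
    ∃ fh : Eu n → ℂ, MemLp fh 2 volume ∧ eLpNorm fh 2 volume = eLpNorm f 2 volume ∧
      ∀ h : Eu n → ℂ, Integrable h → MemLp h 2 volume → ∫ x, f x * FT h x = ∫ ξ, fh ξ * h ξ := by
  have hd := memLp_dil hf
  refine ⟨(𝓕 (hd.toLp (dil f)) : L2 n), Lp.memLp _, ?_, fun h hh hh2 => ?_⟩
  · have := Lp.norm_fourier_eq (hd.toLp (dil f))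
    rw [Lp.norm_def, Lp.norm_def] at this
    rw [(ENNReal.toReal_eq_toReal_iff' (Lp.memLp _).2.ne (Lp.memLp _).2.ne).1 this,
      eLpNorm_congr_ae hd.coeFn_toLp, eLpNorm_dil hf.1]
  · have h1 := integral_fourier_mul (hd.toLp (dil f)) (hh2.toLp h)
    rw [← integral_dil_mul_dil, dil_FT]
    calc _ = ∫ x, (hd.toLp (dil f)) x * (𝓕 (hh2.toLp h) : L2 n) x := by
          refine integral_congr_ae ?_
          filter_upwards [hd.coeFn_toLp, fourier_toLp_ae hh hh2] with x hx hx2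
          rw [hx, hx2]
      _ = _ := h1.symm
      _ = _ := by
          refine integral_congr_ae ?_
          filter_upwards [hh2.coeFn_toLp] with x hx
          rw [hx]

/-- Every `V ∈ L²` is the Fourier transform of some `v ∈ L²`. -/
theorem exists_unhat {V : Eu n → ℂ} (hV : MemLp V 2 volume) :
    ∃ v : Eu n → ℂ, MemLp v 2 volume ∧ eLpNorm v 2 volume = eLpNorm V 2 volume ∧
      ∀ h : Eu n → ℂ, Integrable h → MemLp h 2 volume → ∫ x, v x * FT h x = ∫ ξ, V ξ * h ξ := by
  set g : L2 n := 𝓕⁻ (hV.toLp V) with hg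
  have hgV : (𝓕 g : L2 n) = hV.toLp V := FourierTransform.fourier_fourierInv_eq _
  have hgm := (Lp.memLp g).1
  refine ⟨undil g, ⟨aestronglyMeasurable_undil hgm, ?_⟩, ?_, fun h hh hh2 => ?_⟩
  · rw [eLpNorm_undil hgm]; exact (Lp.memLp g).2
  · rw [eLpNorm_undil hgm]
    have := Lp.norm_fourier_eq g
    rw [hgV, Lp.norm_def, Lp.norm_def] at this
    rw [← (ENNReal.toReal_eq_toReal_iff' (Lp.memLp _).2.ne (Lp.memLp _).2.ne).1 this,
      eLpNorm_congr_ae hV.coeFn_toLp]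
  · have h1 := integral_fourier_mul g (hh2.toLp h)
    rw [← integral_dil_mul_dil, dil_FT, dil_undil]
    calc _ = ∫ x, g x * (𝓕 (hh2.toLp h) : L2 n) x := by
          refine integral_congr_ae ?_
          filter_upwards [fourier_toLp_ae hh hh2] with x hx2
          rw [hx2]
      _ = _ := h1.symm
      _ = _ := by
          rw [hgV]
          refine integral_congr_ae ?_
          filter_upwards [hh2.coeFn_toLp, hV.coeFn_toLp] with x hx hx2
          rw [hx, hx2]

/-- The inverse Fourier transform. -/
noncomputable def IFT (H : Eu n → ℂ) (x : Eu n) : ℂ :=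
  (starRingEnd ℂ) (FT (fun ξ => (starRingEnd ℂ) (H ξ)) x)

lemma enorm_IFT (H : Eu n → ℂ) (x : Eu n) :
    ‖IFT H x‖ₑ = ‖FT (fun ξ => (starRingEnd ℂ) (H ξ)) x‖ₑ := by
  rw [IFT, ← ofReal_norm, ← ofReal_norm, RCLike.norm_conj]

lemma memLp_conj {f : Eu n → ℂ} {p : ℝ≥0∞} (hf : MemLp f p volume) :
    MemLp (fun x => (starRingEnd ℂ) (f x)) p volume := hf.star

lemma integrable_conj {f : Eu n → ℂ} (hf : Integrable f) :
    Integrable (fun x => (starRingEnd ℂ) (f x)) := by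
  rw [← memLp_one_iff_integrable] at hf ⊢
  exact memLp_conj hf

lemma eLpNorm_conj (f : Eu n → ℂ) (p : ℝ≥0∞) :
    eLpNorm (fun x => (starRingEnd ℂ) (f x)) p volume = eLpNorm f p volume :=
  eLpNorm_congr_norm_ae (ae_of_all _ fun x => by simp)

lemma memLp_IFT {H : Eu n → ℂ} (hH : Integrable H) (hH2 : MemLp H 2 volume) :
    MemLp (IFT H) 2 volume := memLp_conj (memLp_FT (integrable_conj hH) (memLp_conj hH2))

/-- Fourier inversion in weak form. -/
theorem integral_IFT_mul_FT {H h : Eu n → ℂ} (hH : Integrable H) (hH2 : MemLp H 2 volume)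
    (hh : Integrable h) (hh2 : MemLp h 2 volume) :
    ∫ x, IFT H x * FT h x = ∫ ξ, H ξ * h ξ := by
  set K : Eu n → ℂ := fun ξ => (starRingEnd ℂ) (H ξ) with hK
  have hKi : Integrable K := integrable_conj hH
  have hK2 : MemLp K 2 volume := memLp_conj hH2
  have h0 : ∀ x, dil (IFT H) x = (starRingEnd ℂ) (dil (FT K) x) := fun x => by
    simp [dil, IFT, hK]
  rw [← integral_dil_mul_dil, dil_FT]
  simp_rw [h0, dil_FT]
  -- Plancherel is a statement on the sesquilinear inner product; taking the conjugate $K$ of $H$ as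
  -- first argument turns it into the bilinear pairing.
  have h1 := Lp.inner_fourier_eq (hK2.toLp K) (hh2.toLp h)
  rw [MeasureTheory.L2.inner_def, MeasureTheory.L2.inner_def] at h1
  calc _ = ∫ x, inner ℂ ((𝓕 (hK2.toLp K) : L2 n) x) ((𝓕 (hh2.toLp h) : L2 n) x) := by
        refine integral_congr_ae ?_
        filter_upwards [fourier_toLp_ae hh hh2, fourier_toLp_ae hKi hK2] with x hx hx2
        rw [hx, hx2, RCLike.inner_apply, mul_comm]
    _ = _ := h1
    _ = _ := by
        refine integral_congr_ae ?_
        filter_upwards [hh2.coeFn_toLp, hK2.coeFn_toLp] with x hx hx2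
        rw [hx, hx2, RCLike.inner_apply, mul_comm, hK]
        simp

/-- The Fourier transform of a test function, as a Schwartz function. -/
lemma exists_schwartz_FT {θ : Eu n → ℂ} (h1 : ContDiff ℝ ∞ θ) (h2 : HasCompactSupport θ) :
    ∃ φ : 𝓢(Eu n, ℂ), ∀ x, φ x = FT θ x := by
  set ψ : 𝓢(Eu n, ℂ) := h2.toSchwartzMap h1
  have hpi : (2 * Real.pi)⁻¹ ≠ (0 : ℝ) := by positivity
  let e : Eu n ≃L[ℝ] Eu n := ContinuousLinearEquiv.smulLeft (Units.mk0 _ hpi)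
  refine ⟨(ftConst n : ℂ) • SchwartzMap.compCLMOfContinuousLinearEquiv ℂ e (𝓕 ψ), fun x => ?_⟩
  rw [FT_eq_fourier]
  rfl

end Fourier


/-! ### The diagonal Hardy-Littlewood-Sobolev inequality on the line -/

lemma lintegral_Ioi_rpow {a c : ℝ} (ha : a < -1) (hc : 0 < c) :
    ∫⁻ x in Ioi c, ENNReal.ofReal (x ^ a) = ENNReal.ofReal (-c ^ (a + 1) / (a + 1)) := by
  rw [← integral_Ioi_rpow_of_lt ha hc, ofReal_integral_eq_lintegral_ofReal
    (integrableOn_Ioi_rpow_of_lt ha hc)]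
  filter_upwards [ae_restrict_mem measurableSet_Ioi] with x hx
  exact Real.rpow_nonneg (hc.trans hx).le _

lemma lintegral_Ioc_rpow {a c : ℝ} (ha : -1 < a) (hc : 0 ≤ c) :
    ∫⁻ x in Ioc 0 c, ENNReal.ofReal (x ^ a) = ENNReal.ofReal (c ^ (a + 1) / (a + 1)) := by
  have h1 := integral_rpow (a := 0) (b := c) (Or.inl ha)
  rw [Real.zero_rpow (by linarith), sub_zero, intervalIntegral.integral_of_le hc] at h1
  rw [← h1, ofReal_integral_eq_lintegral_ofReal]
  · exact (intervalIntegrable_iff_integrableOn_Ioc_of_le hc).1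
      (intervalIntegral.intervalIntegrable_rpow' ha)
  filter_upwards [ae_restrict_mem measurableSet_Ioc] with x hx
  exact Real.rpow_nonneg hx.1.le _

lemma lintegral_comp_abs (f : ℝ → ℝ≥0∞) :
    ∫⁻ x, f |x| = 2 * ∫⁻ x in Ioi 0, f x := by
  rw [← lintegral_add_compl _ measurableSet_Ioi (A := Ioi (0 : ℝ)), compl_Ioi, two_mul]
  congr 1
  · exact setLIntegral_congr_fun measurableSet_Ioi fun x hx => by rw [abs_of_pos hx]
  · rw [setLIntegral_congr (Iio_ae_eq_Iic (a := (0 : ℝ))).symm]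
    have h1 := (Measure.measurePreserving_neg (volume : Measure ℝ)).setLIntegral_comp_preimage_emb
      (MeasurableEquiv.neg ℝ).measurableEmbedding (fun x => f |x|) (Iio 0)
    rw [← h1]
    have h2 : (Neg.neg ⁻¹' Iio (0 : ℝ)) = Ioi 0 := by ext; simp
    rw [h2]
    exact setLIntegral_congr_fun measurableSet_Ioi fun x hx => by rw [abs_neg, abs_of_pos hx]

/-- The Riesz kernel `|u|^{-κ}`. -/
noncomputable def riesz (κ u : ℝ) : ℝ≥0∞ := ENNReal.ofReal (|u| ^ (-κ))

lemma measurable_riesz (κ : ℝ) : Measurable (riesz κ) := by unfold riesz; fun_prop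

lemma riesz_neg (κ u : ℝ) : riesz κ (-u) = riesz κ u := by simp [riesz]

lemma lintegral_riesz_near {κ R : ℝ} (h1 : κ < 1) (hR : 0 < R) (t : ℝ) :
    ∫⁻ s, {s | |t - s| ≤ R}.indicator (fun s => riesz κ (t - s)) s =
      ENNReal.ofReal (2 / (1 - κ) * R ^ (1 - κ)) := by
  have e : ∀ s, {s | |t - s| ≤ R}.indicator (fun s => riesz κ (t - s)) s =
      (fun u : ℝ => (Iic R).indicator (fun x => ENNReal.ofReal (x ^ (-κ))) |u|) (t - s) := fun s => by
    simp only [indicator, mem_ofPred_eq, mem_Iic, riesz]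
  simp_rw [e]
  rw [lintegral_sub_left_eq_self (fun u : ℝ => (Iic R).indicator
    (fun x => ENNReal.ofReal (x ^ (-κ))) |u|) t, lintegral_comp_abs,
    lintegral_indicator measurableSet_Iic, Measure.restrict_restrict measurableSet_Iic,
    inter_comm, Ioi_inter_Iic, lintegral_Ioc_rpow (by linarith) hR.le,
    show (2 : ℝ≥0∞) = ENNReal.ofReal 2 by simp, ← ENNReal.ofReal_mul (by norm_num)]
  congr 1
  rw [show -κ + 1 = 1 - κ by ring]
  ring

/-- The exponent $2/\kappa$ is conjugate to $2/(2-\kappa)$, the exponent of the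
Hardy-Littlewood-Sobolev inequality; at this power the kernel becomes $|u|^{-2}$, whatever $\kappa$
is. -/
lemma lintegral_riesz_far {κ R : ℝ} (h0 : 0 < κ) (hR : 0 < R) (t : ℝ) :
    ∫⁻ s, {s | |t - s| ≤ R}ᶜ.indicator (fun s => riesz κ (t - s)) s ^ (2 / κ) =
      ENNReal.ofReal (2 / R) := by
  have e : ∀ s, {s | |t - s| ≤ R}ᶜ.indicator (fun s => riesz κ (t - s)) s ^ (2 / κ) =
      (fun u : ℝ => (Ioi R).indicator (fun x => ENNReal.ofReal (x ^ (-2 : ℝ))) |u|) (t - s) :=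
    fun s => by
    by_cases h : |t - s| ≤ R
    · simp [h, h0]
    · simp only [not_le] at h
      simp only [indicator, mem_compl_iff, mem_ofPred_eq, not_le, h, if_true, mem_Ioi, riesz]
      rw [ENNReal.ofReal_rpow_of_nonneg (by positivity) (by positivity),
        ← Real.rpow_mul (abs_nonneg _)]
      congr 2
      field_simp
  simp_rw [e]
  rw [lintegral_sub_left_eq_self (fun u : ℝ => (Ioi R).indicator
    (fun x => ENNReal.ofReal (x ^ (-2 : ℝ))) |u|) t, lintegral_comp_abs,
    lintegral_indicator measurableSet_Ioi, Measure.restrict_restrict measurableSet_Ioi,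
    Ioi_inter_Ioi, max_eq_left hR.le, lintegral_Ioi_rpow (by norm_num) hR,
    show (2 : ℝ≥0∞) = ENNReal.ofReal 2 by simp, ← ENNReal.ofReal_mul (by norm_num)]
  congr 1
  norm_num [Real.rpow_neg_one]
  ring

/-- The integral is split at distance $R$ from $t$. Near $t$, $f(s)$ is replaced by $f(t)$ and the
kernel is integrated; far from $t$, Hölder with $\|f\|_p\le1$ applies. Restricting to $f(s)\le f(t)$
is what makes the near part harmless. -/
lemma hls_inner {κ : ℝ} (h0 : 0 < κ) (h1 : κ < 1) {f : ℝ → ℝ≥0∞} (hf : Measurable f)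
    (hf1 : ∫⁻ t, f t ^ (2 / (2 - κ)) ≤ 1) {t : ℝ} (ht : f t ≠ ⊤) :
    f t * ∫⁻ s, {s | f s ≤ f t}.indicator (fun s => f s * riesz κ (t - s)) s ≤
      ENNReal.ofReal (2 / (1 - κ) + 2 ^ (κ / 2)) * f t ^ (2 / (2 - κ)) := by
  rcases eq_or_ne (f t) 0 with h00 | h00
  · rw [h00]; simp
  obtain ⟨y, hy⟩ : ∃ y : ℝ, 0 < y ∧ f t = ENNReal.ofReal y :=
    ⟨(f t).toReal, ENNReal.toReal_pos h00 ht, (ENNReal.ofReal_toReal ht).symm⟩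
  obtain ⟨hy0, hy⟩ := hy
  set p : ℝ := 2 / (2 - κ) with hp
  have hκ2 : 0 < 2 - κ := by linarith
  have hp0 : 0 < p := by positivity
  -- This radius balances the two parts: $y^2R^{1-\kappa}=yR^{-\kappa/2}=y^p$.
  set R : ℝ := y ^ (-p) with hR
  have hR0 : 0 < R := Real.rpow_pos_of_pos hy0 _
  set N : Set ℝ := {s | |t - s| ≤ R} with hN
  have hNm : MeasurableSet N := by
    have : Measurable fun s => |t - s| := by fun_prop
    exact this measurableSet_Iic
  have hmeas : Measurable fun s => riesz κ (t - s) := (measurable_riesz κ).comp (by fun_prop)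
  have hpw : ∀ s, {s | f s ≤ f t}.indicator (fun s => f s * riesz κ (t - s)) s ≤
      f t * N.indicator (fun s => riesz κ (t - s)) s +
        f s * Nᶜ.indicator (fun s => riesz κ (t - s)) s := fun s => by
    by_cases hs : f s ≤ f t
    · simp only [indicator, mem_ofPred_eq, hs, if_true]
      by_cases hsN : s ∈ N
      · simp only [hsN, if_true, mem_compl_iff, not_true, if_false, mul_zero, add_zero]
        gcongr
      · simp [hsN]
    · simp [hs]
  have hnear := lintegral_riesz_near h1 hR0 t
  have hfar := lintegral_riesz_far h0 hR0 t
  have hconj : p.HolderConjugate (2 / κ) := by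
    rw [Real.holderConjugate_iff]
    constructor
    · rw [hp, lt_div_iff₀ hκ2]; linarith
    · rw [hp]; field_simp; ring
  have hhol := ENNReal.lintegral_mul_le_Lp_mul_Lq volume hconj hf.aemeasurable
    (hmeas.indicator hNm.compl).aemeasurable
  simp only [Pi.mul_apply] at hhol
  have hfar2 : ∫⁻ s, f s * Nᶜ.indicator (fun s => riesz κ (t - s)) s ≤
      ENNReal.ofReal ((2 / R) ^ (κ / 2)) := by
    refine hhol.trans ?_
    rw [hfar, show 1 / (2 / κ) = κ / 2 by rw [one_div_div],
      ENNReal.ofReal_rpow_of_nonneg (by positivity) (by positivity)]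
    have h1 : (∫⁻ a, f a ^ p) ^ (1 / p) ≤ 1 := ENNReal.rpow_le_one hf1 (by positivity)
    exact mul_le_of_le_one_left' h1
  have hint : ∫⁻ s, {s | f s ≤ f t}.indicator (fun s => f s * riesz κ (t - s)) s ≤
      ENNReal.ofReal (y * (2 / (1 - κ) * R ^ (1 - κ)) + (2 / R) ^ (κ / 2)) := by
    refine (lintegral_mono hpw).trans ?_
    rw [lintegral_add_left ((hmeas.indicator hNm).const_mul _),
      lintegral_const_mul _ (hmeas.indicator hNm), hnear, hy,
      ← ENNReal.ofReal_mul hy0.le, ENNReal.ofReal_add]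
    · gcongr
    · have : 0 < 1 - κ := by linarith
      positivity
    · positivity
  rw [hy] at hint ⊢
  refine (mul_le_mul_right hint _).trans ?_
  rw [ENNReal.ofReal_rpow_of_nonneg hy0.le hp0.le, ← ENNReal.ofReal_mul hy0.le,
    ← ENNReal.ofReal_mul (by have : 0 < 1 - κ := by linarith
                             positivity)]
  refine ENNReal.ofReal_le_ofReal (le_of_eq ?_)
  have e1 : y * y * R ^ (1 - κ) = y ^ p := by
    rw [hR, ← Real.rpow_mul hy0.le]
    have : y * y = y ^ (2 : ℝ) := by rw [← sq]; norm_cast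
    rw [this, ← Real.rpow_add hy0]
    congr 1
    rw [hp]; field_simp; ring
  have e2 : y * (2 / R) ^ (κ / 2) = 2 ^ (κ / 2) * y ^ p := by
    rw [Real.div_rpow (by norm_num) hR0.le, hR, ← Real.rpow_mul hy0.le]
    rw [div_eq_mul_inv, ← Real.rpow_neg hy0.le]
    have : y ^ p = y ^ (1 : ℝ) * y ^ (-(-p * (κ / 2))) := by
      rw [← Real.rpow_add hy0]
      congr 1
      rw [hp]; field_simp; ring
    rw [this, Real.rpow_one]; ring
  calc _ = 2 / (1 - κ) * (y * y * R ^ (1 - κ)) + y * (2 / R) ^ (κ / 2) := by ring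
    _ = _ := by rw [e1, e2]; ring

/-- The constant in the Hardy-Littlewood-Sobolev inequality. -/
noncomputable def hlsConst (κ : ℝ) : ℝ := 2 * (2 / (1 - κ) + 2 ^ (κ / 2))

/-- The kernel is symmetric, so the integral is at most twice its part over $f(s)\le f(t)$; there
`hls_inner` bounds the integrand in $t$ by a multiple of $f(t)^p$, which integrates to at most $1$.
-/
theorem hls_diag {κ : ℝ} (h0 : 0 < κ) (h1 : κ < 1) {f : ℝ → ℝ≥0∞} (hf : Measurable f)
    (hf1 : ∫⁻ t, f t ^ (2 / (2 - κ)) ≤ 1) :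
    ∫⁻ t, ∫⁻ s, f t * f s * riesz κ (t - s) ≤ ENNReal.ofReal (hlsConst κ) := by
  set D : ℝ × ℝ → ℝ≥0∞ := fun p => {q : ℝ × ℝ | f q.2 ≤ f q.1}.indicator
    (fun q => f q.1 * f q.2 * riesz κ (q.1 - q.2)) p with hD
  have hrm : Measurable fun p : ℝ × ℝ => riesz κ (p.1 - p.2) :=
    (measurable_riesz κ).comp (by fun_prop)
  have hDm : Measurable D := by
    refine Measurable.indicator (by fun_prop) (measurableSet_le (by fun_prop) (by fun_prop))
  have hp0 : 0 < 2 / (2 - κ) := by have : 0 < 2 - κ := by linarith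
                                   positivity
  have hfin : ∀ᵐ t, f t ≠ ⊤ := by
    have := ae_lt_top (hf.pow_const (2 / (2 - κ))) (hf1.trans_lt ENNReal.one_lt_top).ne
    filter_upwards [this] with t ht htop
    rw [htop, ENNReal.top_rpow_of_pos hp0] at ht
    exact lt_irrefl _ ht
  have hhalf : ∫⁻ t, ∫⁻ s, D (t, s) ≤ ENNReal.ofReal (2 / (1 - κ) + 2 ^ (κ / 2)) := by
    calc ∫⁻ t, ∫⁻ s, D (t, s) ≤
        ∫⁻ t, ENNReal.ofReal (2 / (1 - κ) + 2 ^ (κ / 2)) * f t ^ (2 / (2 - κ)) := by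
          refine lintegral_mono_ae ?_
          filter_upwards [hfin] with t ht
          refine le_trans (le_of_eq ?_) (hls_inner h0 h1 hf hf1 ht)
          rw [← lintegral_const_mul]
          · refine lintegral_congr fun s => ?_
            simp only [hD, indicator, mem_ofPred_eq]
            split_ifs <;> simp [mul_assoc]
          · refine Measurable.indicator ?_ (measurableSet_le hf measurable_const)
            exact hf.mul ((measurable_riesz κ).comp (by fun_prop))
      _ = ENNReal.ofReal (2 / (1 - κ) + 2 ^ (κ / 2)) * ∫⁻ t, f t ^ (2 / (2 - κ)) :=
          lintegral_const_mul _ (hf.pow_const _)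
      _ ≤ _ := mul_le_of_le_one_right' hf1
  have hswap : ∫⁻ t, ∫⁻ s, D (s, t) = ∫⁻ t, ∫⁻ s, D (t, s) :=
    lintegral_lintegral_swap (hDm.comp measurable_swap).aemeasurable
  calc ∫⁻ t, ∫⁻ s, f t * f s * riesz κ (t - s) ≤ ∫⁻ t, ∫⁻ s, (D (t, s) + D (s, t)) := by
        refine lintegral_mono fun t => lintegral_mono fun s => ?_
        simp only [hD, indicator, mem_ofPred_eq]
        rcases le_total (f s) (f t) with h | h
        · simp only [h, if_true]; exact le_self_add
        · simp only [h, if_true]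
          refine le_trans (le_of_eq ?_) le_add_self
          rw [mul_comm (f t), ← riesz_neg, neg_sub]
    _ = (∫⁻ t, ∫⁻ s, D (t, s)) + ∫⁻ t, ∫⁻ s, D (s, t) := by
        have hm2 : Measurable fun t => ∫⁻ s, D (t, s) := hDm.lintegral_prod_right'
        rw [← lintegral_add_left hm2]
        refine lintegral_congr fun t => ?_
        exact lintegral_add_left (hDm.comp measurable_prodMk_left) _
    _ ≤ ENNReal.ofReal (2 / (1 - κ) + 2 ^ (κ / 2)) + ENNReal.ofReal (2 / (1 - κ) + 2 ^ (κ / 2)) := by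
        rw [hswap]; exact add_le_add hhalf hhalf
    _ = _ := by
        have : 0 < 1 - κ := by linarith
        rw [← ENNReal.ofReal_add (by positivity) (by positivity), hlsConst]
        congr 1; ring

/-! ### A Christ-Kiselev lemma -/

section ChristKiselev

variable {b : ℝ → ℝ → ℂ} {M : ℝ}

lemma intervalIntegrable_of_bdd {f : ℝ → ℂ} (hf : Measurable f) (hM : ∀ t, ‖f t‖ ≤ M) (a c : ℝ) :
    IntervalIntegrable f volume a c := by
  refine (intervalIntegrable_const (c := M)).mono_fun hf.aestronglyMeasurable.restrict ?_
  exact ae_of_all _ fun t => (hM t).trans (le_abs_self M)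

lemma measurable_retarded (hb : Measurable (Function.uncurry b)) (a : ℝ) :
    Measurable fun t => ∫ s in a..t, b s t := by
  have h : ∀ t, ∫ s in a..t, b s t = (∫ s, (Ioc a t).indicator (fun s => b s t) s) -
      ∫ s, (Ioc t a).indicator (fun s => b s t) s := fun t => by
    rw [intervalIntegral, integral_indicator measurableSet_Ioc,
      integral_indicator measurableSet_Ioc]
  simp_rw [h]
  have hb' : Measurable fun p : ℝ × ℝ => b p.2 p.1 := hb.comp measurable_swap
  refine Measurable.sub ?_ ?_
  · refine (StronglyMeasurable.integral_prod_right (ν := volume)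
      (f := fun t s => (Ioc a t).indicator (fun s => b s t) s) ?_).measurable
    refine Measurable.stronglyMeasurable ?_
    have : Function.uncurry (fun t s => (Ioc a t).indicator (fun s => b s t) s) =
        ({p : ℝ × ℝ | a < p.2} ∩ {p : ℝ × ℝ | p.2 ≤ p.1}).indicator (fun p => b p.2 p.1) := by
      ext ⟨t, s⟩; simp [indicator, Function.uncurry]
    rw [this]
    exact hb'.indicator ((measurableSet_lt (by fun_prop) (by fun_prop)).inter
      (measurableSet_le (by fun_prop) (by fun_prop)))
  · refine (StronglyMeasurable.integral_prod_right (ν := volume)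
      (f := fun t s => (Ioc t a).indicator (fun s => b s t) s) ?_).measurable
    refine Measurable.stronglyMeasurable ?_
    have : Function.uncurry (fun t s => (Ioc t a).indicator (fun s => b s t) s) =
        ({p : ℝ × ℝ | p.1 < p.2} ∩ {p : ℝ × ℝ | p.2 ≤ a}).indicator (fun p => b p.2 p.1) := by
      ext ⟨t, s⟩; simp [indicator, Function.uncurry]
    rw [this]
    exact hb'.indicator ((measurableSet_lt (by fun_prop) (by fun_prop)).inter
      (measurableSet_le (by fun_prop) (by fun_prop)))

lemma measurable_intervalIntegral (hb : Measurable (Function.uncurry b)) (a c : ℝ) :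
    Measurable fun t => ∫ s in a..c, b s t := by
  have hb' : StronglyMeasurable fun p : ℝ × ℝ => b p.2 p.1 :=
    (hb.comp measurable_swap).stronglyMeasurable
  unfold intervalIntegral
  exact (hb'.integral_prod_right' (ν := volume.restrict (Ioc a c))).measurable.sub
    (hb'.integral_prod_right' (ν := volume.restrict (Ioc c a))).measurable

/-- The truncated double integral `∫_a^c ∫_a^t b(s,t) ds dt`. -/
noncomputable def retInt (b : ℝ → ℝ → ℂ) (a c : ℝ) : ℂ := ∫ t in a..c, ∫ s in a..t, b s t

lemma norm_inner_le (hM : ∀ s t, ‖b s t‖ ≤ M) {a t c : ℝ} (h : a ≤ t) (h2 : t ≤ c) :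
    ‖∫ s in a..t, b s t‖ ≤ M * (c - a) := by
  refine (intervalIntegral.norm_integral_le_of_norm_le_const (C := M) fun s _ => hM s t).trans ?_
  rw [abs_of_nonneg (by linarith)]
  have : 0 ≤ M := (norm_nonneg _).trans (hM 0 0)
  gcongr

lemma intervalIntegrable_retarded (hb : Measurable (Function.uncurry b))
    (hM : ∀ s t, ‖b s t‖ ≤ M) {a m c : ℝ} (h1 : a ≤ m) (h2 : m ≤ c) :
    IntervalIntegrable (fun t => ∫ s in a..t, b s t) volume m c := by
  refine (intervalIntegrable_const (c := M * (c - a))).mono_fun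
    (measurable_retarded hb a).aestronglyMeasurable.restrict ?_
  refine (ae_restrict_iff' measurableSet_uIoc).2 (ae_of_all _ fun t ht => ?_)
  rw [uIoc_of_le h2] at ht
  exact (norm_inner_le hM (h1.trans ht.1.le) ht.2).trans (le_abs_self _)

/-- The triangle $a\le s\le t\le c$ is the union of the triangles over $[a,m]$ and $[m,c]$ and the
rectangle $[a,m]\times[m,c]$. -/
lemma retInt_split (hb : Measurable (Function.uncurry b)) (hM : ∀ s t, ‖b s t‖ ≤ M) {a m c : ℝ}
    (h1 : a ≤ m) (h2 : m ≤ c) :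
    retInt b a c = retInt b a m + retInt b m c + ∫ t in m..c, ∫ s in a..m, b s t := by
  rw [retInt, retInt, retInt, ← intervalIntegral.integral_add_adjacent_intervals
    (intervalIntegrable_retarded hb hM le_rfl h1) (intervalIntegrable_retarded hb hM h1 h2),
    add_assoc, ← intervalIntegral.integral_add
    (intervalIntegrable_retarded hb hM le_rfl h2)]
  · congr 1
    refine intervalIntegral.integral_congr fun t _ => ?_
    have hbt : Measurable fun s => b s t := hb.comp measurable_prodMk_right
    rw [add_comm, intervalIntegral.integral_add_adjacent_intervals
      (intervalIntegrable_of_bdd hbt (fun s => hM s t) _ _)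
      (intervalIntegrable_of_bdd hbt (fun s => hM s t) _ _)]
  · refine intervalIntegrable_of_bdd (M := M * |m - a|) (measurable_intervalIntegral hb a m)
      (fun t => intervalIntegral.norm_integral_le_of_norm_le_const fun s _ => hM s t) _ _

/-- The triangle is bisected repeatedly at the midpoints of $\Omega$. Generation $i$ has $2^i$
rectangles, each bounded by $A(2^{-i}\Delta\Omega)^\kappa$, so the generations form a geometric
series of ratio $2^{1-\kappa}<1$. The triangles left after $j$ steps have total area $O(2^{-j})$ by
the hypothesis on $c-a$, and $b$ is bounded, so they vanish in the limit. -/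
theorem norm_retInt_le (hb : Measurable (Function.uncurry b)) (hM : ∀ s t, ‖b s t‖ ≤ M)
    {Ω : ℝ → ℝ} (hΩ : Continuous Ω) {K : ℝ}
    (hK : ∀ a c, a ≤ c → c - a ≤ K * (Ω c - Ω a)) (hΩm : Monotone Ω) {A κ : ℝ} (hκ : 1 < κ)
    (hA : ∀ a m c, a ≤ m → m ≤ c →
      ‖∫ t in m..c, ∫ s in a..m, b s t‖ ≤ A * (Ω c - Ω a) ^ κ) {a c : ℝ} (hac : a ≤ c) :
    ‖retInt b a c‖ ≤ A * (1 - 2 ^ (1 - κ))⁻¹ * (Ω c - Ω a) ^ κ := by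
  have hM0 : 0 ≤ M := (norm_nonneg _).trans (hM 0 0)
  set x : ℝ := 2 ^ (1 - κ) with hx
  have hx0 : 0 < x := by positivity
  have hx1 : x < 1 := Real.rpow_lt_one_of_one_lt_of_neg (by norm_num) (by linarith)
  have key : ∀ j : ℕ, ∀ a c, a ≤ c → ‖retInt b a c‖ ≤
      A * (Ω c - Ω a) ^ κ * ∑ i ∈ Finset.range j, x ^ i +
        M * (K * (Ω c - Ω a)) ^ 2 * (1 / 2) ^ j := by
    intro j
    induction j with
    | zero =>
      intro a c hac
      simp only [Finset.range_zero, Finset.sum_empty, mul_zero, zero_add, pow_zero, mul_one]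
      have h1 : ‖retInt b a c‖ ≤ (M * (c - a)) * |c - a| := by
        refine intervalIntegral.norm_integral_le_of_norm_le_const fun t ht => ?_
        rw [uIoc_of_le hac] at ht
        exact norm_inner_le hM ht.1.le ht.2
      refine h1.trans ?_
      rw [abs_of_nonneg (by linarith), mul_assoc, ← sq]
      have h2 := hK a c hac
      have h3 : 0 ≤ c - a := by linarith
      gcongr
    | succ j ih =>
      intro a c hac
      -- The cut is at the midpoint in the clock $\Omega$, not in time; it exists by the
      -- intermediate value theorem.
      obtain ⟨m, hm, hmΩ⟩ : ∃ m ∈ Icc a c, Ω m = (Ω a + Ω c) / 2 := by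
        have := intermediate_value_Icc hac hΩ.continuousOn
        have hle := hΩm hac
        exact this ⟨by linarith, by linarith⟩
      rw [retInt_split hb hM hm.1 hm.2]
      have e1 : Ω m - Ω a = (Ω c - Ω a) / 2 := by rw [hmΩ]; ring
      have e2 : Ω c - Ω m = (Ω c - Ω a) / 2 := by rw [hmΩ]; ring
      have i1 := ih a m hm.1
      have i2 := ih m c hm.2
      rw [e1] at i1
      rw [e2] at i2
      have i3 := hA a m c hm.1 hm.2
      refine ((norm_add_le _ _).trans (add_le_add (norm_add_le _ _) le_rfl)).trans ?_
      refine (add_le_add (add_le_add i1 i2) i3).trans (le_of_eq ?_)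
      have hΩac : 0 ≤ Ω c - Ω a := sub_nonneg.2 (hΩm hac)
      -- Each half contributes the factor $x/2$, so the two halves together shift the geometric sum
      -- by one factor $x$; the rectangle supplies its new leading term.
      have e3 : ((Ω c - Ω a) / 2) ^ κ = (Ω c - Ω a) ^ κ * (x / 2) := by
        rw [Real.div_rpow hΩac (by norm_num), hx, Real.rpow_sub (by norm_num), Real.rpow_one]
        field_simp
      rw [e3, Finset.sum_range_succ', pow_zero, pow_succ]
      have : ∑ k ∈ Finset.range j, x ^ (k + 1) = x * ∑ k ∈ Finset.range j, x ^ k := by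
        rw [Finset.mul_sum]; exact Finset.sum_congr rfl fun k _ => by ring
      rw [this]
      ring
  have hlim : Tendsto (fun j : ℕ => A * (Ω c - Ω a) ^ κ * ∑ i ∈ Finset.range j, x ^ i +
      M * (K * (Ω c - Ω a)) ^ 2 * (1 / 2) ^ j) atTop
      (𝓝 (A * (Ω c - Ω a) ^ κ * (1 - x)⁻¹ + M * (K * (Ω c - Ω a)) ^ 2 * 0)) := by
    refine Tendsto.add ?_ ?_
    · exact ((hasSum_geometric_of_lt_one hx0.le hx1).tendsto_sum_nat).const_mul _
    · exact (tendsto_pow_atTop_nhds_zero_of_lt_one (by norm_num) (by norm_num)).const_mul _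
  have := ge_of_tendsto' hlim fun j => key j a c hac
  refine this.trans (le_of_eq ?_)
  ring

end ChristKiselev


/-! ### Mixed Lebesgue norms -/

section ENNRealNorm

variable {α : Type*} [MeasurableSpace α] {μ : Measure α}

lemma eLpNorm_ennreal_mono {f h : α → ℝ≥0∞} (p : ℝ≥0∞) (hfh : ∀ᵐ t ∂μ, f t ≤ h t) :
    eLpNorm f p μ ≤ eLpNorm h p μ :=
  eLpNorm_mono_enorm_ae (by simpa using hfh)

lemma eLpNorm_ennreal_const_mul (c : ℝ≥0∞) {f : α → ℝ≥0∞} (hf : Measurable f) {p : ℝ≥0∞}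
    (hp : p ≠ 0) : eLpNorm (fun t => c * f t) p μ = c * eLpNorm f p μ := by
  rcases eq_or_ne p ⊤ with rfl | hpt
  · simp only [eLpNorm_exponent_top, eLpNormEssSup, enorm_eq_self]
    exact ENNReal.essSup_const_mul
  · have hp' := ENNReal.toReal_pos hp hpt
    simp only [eLpNorm_eq_lintegral_rpow_enorm_toReal hp hpt, enorm_eq_self]
    simp_rw [ENNReal.mul_rpow_of_nonneg _ _ hp'.le]
    rw [lintegral_const_mul _ (hf.pow_const _), ENNReal.mul_rpow_of_nonneg _ _ (by positivity),
      ← ENNReal.rpow_mul, mul_one_div_cancel hp'.ne', ENNReal.rpow_one]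

/-- Hölder's inequality for all pairs of conjugate exponents. -/
lemma lintegral_mul_le_eLpNorm {p p' : ℝ≥0∞} [hpp : ENNReal.HolderConjugate p p']
    {f h : α → ℝ≥0∞} (hf : Measurable f) (hh : Measurable h) :
    ∫⁻ t, f t * h t ∂μ ≤ eLpNorm f p μ * eLpNorm h p' μ := by
  rcases eq_or_ne p ⊤ with rfl | hp
  · have : p' = 1 := (ENNReal.HolderConjugate.eq_top_iff_eq_one ⊤ p').1 rfl
    subst this
    rw [eLpNorm_one_eq_lintegral_enorm, ← lintegral_const_mul _ (by simpa using hh)]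
    refine lintegral_mono_ae ?_
    filter_upwards [ae_le_eLpNormEssSup (f := f) (μ := μ)] with t ht
    simp only [enorm_eq_self, eLpNorm_exponent_top] at ht ⊢
    gcongr
  rcases eq_or_ne p' ⊤ with rfl | hp'
  · have : p = 1 := by
      have := hpp.symm
      exact (ENNReal.HolderConjugate.eq_top_iff_eq_one ⊤ p).1 rfl
    subst this
    rw [eLpNorm_one_eq_lintegral_enorm, ← lintegral_mul_const _ (by simpa using hf)]
    refine lintegral_mono_ae ?_
    filter_upwards [ae_le_eLpNormEssSup (f := h) (μ := μ)] with t ht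
    simp only [enorm_eq_self, eLpNorm_exponent_top] at ht ⊢
    gcongr
  have hc := ENNReal.HolderConjugate.toReal_of_ne_top (p := p) (q := p') hp hp'
  have h0 : p ≠ 0 := ENNReal.HolderConjugate.ne_zero p p'
  have h0' : p' ≠ 0 := by have := hpp.symm; exact ENNReal.HolderConjugate.ne_zero p' p
  have := ENNReal.lintegral_mul_le_Lp_mul_Lq μ hc hf.aemeasurable hh.aemeasurable
  simpa [eLpNorm_eq_lintegral_rpow_enorm_toReal h0 hp,
    eLpNorm_eq_lintegral_rpow_enorm_toReal h0' hp'] using this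

/-- Fatou's lemma for the `L^p` norms of nonnegative functions. -/
lemma eLpNorm_le_liminf {F : ℕ → α → ℝ≥0∞} (hF : ∀ N, Measurable (F N)) {f : α → ℝ≥0∞} (p : ℝ≥0∞)
    (hf : ∀ᵐ t ∂μ, f t ≤ liminf (fun N => F N t) atTop) :
    eLpNorm f p μ ≤ liminf (fun N => eLpNorm (F N) p μ) atTop := by
  refine (eLpNorm_ennreal_mono p hf).trans ?_
  rcases eq_or_ne p 0 with rfl | h0
  · simp
  rcases eq_or_ne p ⊤ with rfl | hp
  · simp only [eLpNorm_exponent_top, eLpNormEssSup, enorm_eq_self]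
    exact ENNReal.essSup_liminf_le _
  · have hp0 := ENNReal.toReal_pos h0 hp
    -- A positive power is an order isomorphism of $[0,\infty]$ and so commutes with lower limits.
    have hcomm : ∀ (e : ℝ), 0 < e → ∀ u : ℕ → ℝ≥0∞,
        liminf u atTop ^ e = liminf (fun N => u N ^ e) atTop := fun e he u => by
      have h_rpow_mono := ENNReal.strictMono_rpow_of_pos he
      have h_rpow_surj := (ENNReal.rpow_left_bijective he.ne').2
      refine (h_rpow_mono.orderIsoOfSurjective _ h_rpow_surj).liminf_apply ?_ ?_ ?_ ?_
      all_goals isBoundedDefault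
    simp only [eLpNorm_eq_lintegral_rpow_enorm_toReal h0 hp, enorm_eq_self]
    rw [← hcomm _ (by positivity)]
    refine ENNReal.rpow_le_rpow ?_ (by positivity)
    simp_rw [hcomm _ hp0]
    exact lintegral_liminf_le fun N => (hF N).pow_const _

lemma eLpNorm_le_of_liminf {F : ℕ → α → ℝ≥0∞} (hF : ∀ N, Measurable (F N)) {f : α → ℝ≥0∞}
    {p C : ℝ≥0∞} (hf : ∀ᵐ t ∂μ, f t ≤ liminf (fun N => F N t) atTop)
    (hC : ∀ N, eLpNorm (F N) p μ ≤ C) : eLpNorm f p μ ≤ C :=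
  (eLpNorm_le_liminf hF p hf).trans
    ((liminf_le_liminf (Eventually.of_forall hC)).trans (by simp))

/-- Minkowski for the partial sums, then Fatou. -/
lemma eLpNorm_tsum_le {F : ℕ → α → ℝ≥0∞} (hF : ∀ N, Measurable (F N)) {p : ℝ≥0∞} (hp : 1 ≤ p) :
    eLpNorm (fun t => ∑' N, F N t) p μ ≤ ∑' N, eLpNorm (F N) p μ := by
  refine eLpNorm_le_of_liminf (F := fun N t => ∑ k ∈ Finset.range N, F k t)
    (fun N => Finset.measurable_fun_sum _ fun k _ => hF k) ?_ fun N => ?_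
  · refine ae_of_all _ fun t => le_of_eq ?_
    exact (ENNReal.summable.hasSum.tendsto_sum_nat).liminf_eq.symm
  · have := eLpNorm_sum_le (μ := μ) (p := p) (f := F) (s := Finset.range N)
      (fun k _ => (hF k).aestronglyMeasurable) hp
    refine le_trans (le_of_eq ?_) (this.trans (ENNReal.sum_le_tsum _))
    congr 1; ext t; simp

lemma ae_lt_top_of_eLpNorm {f : α → ℝ≥0∞} (hf : Measurable f) {p : ℝ≥0∞} (hp : p ≠ 0)
    (h : eLpNorm f p μ < ⊤) : ∀ᵐ t ∂μ, f t < ⊤ := by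
  rcases eq_or_ne p ⊤ with rfl | hpt
  · filter_upwards [ae_le_eLpNormEssSup (f := f) (μ := μ)] with t ht
    exact (by simpa using ht : f t ≤ _).trans_lt (by simpa using h)
  · have hp0 := ENNReal.toReal_pos hp hpt
    rw [eLpNorm_eq_lintegral_rpow_enorm_toReal hp hpt,
      ENNReal.rpow_lt_top_iff_of_pos (by positivity)] at h
    simp only [enorm_eq_self] at h
    filter_upwards [ae_lt_top (hf.pow_const _) h.ne] with t ht
    exact (ENNReal.rpow_lt_top_iff_of_pos hp0).1 ht

end ENNRealNorm

variable {n : ℕ}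

lemma measurable_slice {u : ℝ → Eu n → ℂ} (hu : Measurable (Function.uncurry u)) (t : ℝ) :
    Measurable (u t) := hu.comp measurable_prodMk_left

/-- The slice norms of a jointly measurable function are measurable. -/
lemma measurable_eLpNorm_slice {u : ℝ → Eu n → ℂ} (hu : Measurable (Function.uncurry u))
    (r : ℝ≥0∞) : Measurable fun t => eLpNorm (u t) r volume := by
  rcases eq_or_ne r 0 with rfl | h0
  · simp
  have hen : Measurable fun p : ℝ × Eu n => ‖u p.1 p.2‖ₑ := hu.enorm
  rcases eq_or_ne r ⊤ with rfl | hr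
  · refine measurable_of_Iic fun a => ?_
    -- An essential supremum is at most $a$ exactly when the section of the superlevel set is null,
    -- and measures of sections depend measurably on $t$.
    have : (fun t => eLpNorm (u t) ⊤ volume) ⁻¹' Iic a =
        (fun t => volume (Prod.mk t ⁻¹' {p : ℝ × Eu n | a < ‖u p.1 p.2‖ₑ})) ⁻¹' {0} := by
      ext t
      simp only [mem_preimage, mem_Iic, mem_singleton_iff, eLpNorm_exponent_top, eLpNormEssSup]
      constructor
      · intro h
        refine measure_mono_null ?_ (meas_essSup_lt (μ := volume) (f := fun x => ‖u t x‖ₑ))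
        intro x hx
        exact lt_of_le_of_lt h hx
      · intro h
        refine essSup_le_of_ae_le a ?_
        rw [EventuallyLE, ae_iff]
        refine Eq.trans (congrArg _ ?_) h
        ext x
        simp
    rw [this]
    exact measurable_measure_prodMk_left (measurableSet_lt measurable_const hen)
      (measurableSet_singleton 0)
  · simp only [eLpNorm_eq_lintegral_rpow_enorm_toReal h0 hr]
    exact (Measurable.lintegral_prod_right' (hen.pow_const _)).pow_const _

lemma mixedNorm_congr {q r : ℝ≥0∞} {u v : ℝ → Eu n → ℂ}
    (h : ∀ᵐ t, u t =ᵐ[volume] v t) : mixedNorm q r u = mixedNorm q r v := by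
  refine eLpNorm_congr_ae ?_
  filter_upwards [h] with t ht
  exact eLpNorm_congr_ae ht

lemma mixedNorm_mono {q r : ℝ≥0∞} {u v : ℝ → Eu n → ℂ} (h : ∀ t x, ‖u t x‖ₑ ≤ ‖v t x‖ₑ) :
    mixedNorm q r u ≤ mixedNorm q r v :=
  eLpNorm_ennreal_mono q (ae_of_all _ fun t => eLpNorm_mono_enorm (h t))

lemma mixedNorm_add_le {q r : ℝ≥0∞} (hq : 1 ≤ q) (hr : 1 ≤ r) {u v : ℝ → Eu n → ℂ}
    (hu : Measurable (Function.uncurry u)) (hv : Measurable (Function.uncurry v)) :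
    mixedNorm q r (fun t x => u t x + v t x) ≤ mixedNorm q r u + mixedNorm q r v := by
  refine le_trans (eLpNorm_ennreal_mono q (ae_of_all _ fun t => ?_)) (eLpNorm_add_le
    (measurable_eLpNorm_slice hu r).aestronglyMeasurable
    (measurable_eLpNorm_slice hv r).aestronglyMeasurable hq)
  exact eLpNorm_add_le (measurable_slice hu t).aestronglyMeasurable
    (measurable_slice hv t).aestronglyMeasurable hr

lemma mixedNorm_sub_comm {q r : ℝ≥0∞} (u v : ℝ → Eu n → ℂ) :
    mixedNorm q r (fun t x => u t x - v t x) = mixedNorm q r (fun t x => v t x - u t x) := by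
  unfold mixedNorm
  congr 1; ext t
  exact eLpNorm_congr_enorm_ae (ae_of_all _ fun x => enorm_sub_rev _ _)

/-- Hölder's inequality for mixed norms. -/
lemma lintegral_mul_le_mixedNorm {q q' r r' : ℝ≥0∞} [ENNReal.HolderConjugate q q']
    [ENNReal.HolderConjugate r r'] {u v : ℝ → Eu n → ℂ}
    (hu : Measurable (Function.uncurry u)) (hv : Measurable (Function.uncurry v)) :
    ∫⁻ t, ∫⁻ x, ‖u t x‖ₑ * ‖v t x‖ₑ ≤ mixedNorm q r u * mixedNorm q' r' v := by
  refine le_trans (lintegral_mono fun t => ?_) (lintegral_mul_le_eLpNorm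
    (measurable_eLpNorm_slice hu r) (measurable_eLpNorm_slice hv r'))
  have := lintegral_mul_le_eLpNorm (p := r) (p' := r') (μ := (volume : Measure (Eu n)))
    (measurable_slice hu t).enorm (measurable_slice hv t).enorm
  simpa only [eLpNorm_enorm] using this

/-- Completeness of the mixed-norm spaces, with slicewise convergence. -/
theorem exists_mixed_limit {q r : ℝ≥0∞} (hq : 1 ≤ q) (hr : 1 ≤ r) {u : ℕ → ℝ → Eu n → ℂ}
    (hu : ∀ N, Measurable (Function.uncurry (u N))) {K : ℝ≥0∞} (hK : K ≠ ⊤)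
    (hcau : ∀ N, mixedNorm q r (fun t x => u (N + 1) t x - u N t x) ≤ K * (1 / 4) ^ N) :
    ∃ v : ℝ → Eu n → ℂ, Measurable (Function.uncurry v) ∧
      (∀ᵐ t, Tendsto (fun N => eLpNorm (fun x => u N t x - v t x) r volume) atTop (𝓝 0)) ∧
      (∀ C, (∀ N, mixedNorm q r (u N) ≤ C) → mixedNorm q r v ≤ C) := by
  have hdm : ∀ N, Measurable (Function.uncurry (fun t x => u (N + 1) t x - u N t x)) := fun N =>
    (hu (N + 1)).sub (hu N)
  set d : ℕ → ℝ → ℝ≥0∞ := fun N t => eLpNorm (fun x => u (N + 1) t x - u N t x) r volume with hd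
  have hdmeas : ∀ N, Measurable (d N) := fun N => measurable_eLpNorm_slice (hdm N) r
  have hq0 : q ≠ 0 := (zero_lt_one.trans_le hq).ne'
  -- The weights $2^N$ cost only half of the decay $4^{-N}$ of the increments. Finiteness of $D(t)$
  -- then gives, for almost every $t$, the geometric rate $2^{-N}D(t)$ for the slices.
  set D : ℝ → ℝ≥0∞ := fun t => ∑' N, (2 : ℝ≥0∞) ^ N * d N t with hD
  have hDm : Measurable D := Measurable.tsum fun N => (hdmeas N).const_mul _
  have hDfin : ∀ᵐ t, D t < ⊤ := by
    refine ae_lt_top_of_eLpNorm hDm hq0 ?_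
    refine (eLpNorm_tsum_le (fun N => (hdmeas N).const_mul _) hq).trans_lt ?_
    calc ∑' N, eLpNorm (fun t => (2 : ℝ≥0∞) ^ N * d N t) q volume
        ≤ ∑' N, K * (1 / 2 : ℝ≥0∞) ^ N := by
          refine ENNReal.tsum_le_tsum fun N => ?_
          rw [eLpNorm_ennreal_const_mul _ (hdmeas N) hq0]
          refine (mul_le_mul_right (hcau N) _).trans (le_of_eq ?_)
          rw [mul_left_comm, ← mul_pow]
          congr 2
          rw [show (4 : ℝ≥0∞) = 2 * 2 by norm_num, one_div, one_div,
            ENNReal.mul_inv (by simp) (by simp), ← mul_assoc,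
            ENNReal.mul_inv_cancel (by simp) (by simp), one_mul]
      _ < ⊤ := by
          rw [ENNReal.tsum_mul_left, ENNReal.tsum_geometric]
          refine ENNReal.mul_lt_top hK.lt_top ?_
          simp
  -- Taking the pointwise limit, with a default value where there is none, keeps joint
  -- measurability; the $L^r$ limit of almost every slice is then identified with it.
  set v : ℝ → Eu n → ℂ := fun t x => limUnder atTop (fun N => u N t x) with hv
  have hvm : Measurable (Function.uncurry v) :=
    (StronglyMeasurable.limUnder (l := atTop) (fun N => (hu N).stronglyMeasurable)).measurable
  have hlim : ∀ᵐ t, Tendsto (fun N => eLpNorm (fun x => u N t x - v t x) r volume) atTop (𝓝 0) := by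
    filter_upwards [hDfin] with t ht
    -- The summand $1$ makes the Cauchy bound strict, also when $D(t)=0$.
    set B : ℕ → ℝ≥0∞ := fun N => (1 / 2) ^ N * (D t + 1) with hB
    have hBsum : ∑' i, B i ≠ ⊤ := by
      rw [ENNReal.tsum_mul_right, ENNReal.tsum_geometric]
      exact ENNReal.mul_ne_top (by simp) (ENNReal.add_ne_top.2 ⟨ht.ne, by simp⟩)
    have hum : ∀ N, AEStronglyMeasurable (u N t) volume := fun N =>
      (measurable_slice (hu N) t).aestronglyMeasurable
    have hstep : ∀ N k, eLpNorm (u (N + k) t - u N t) r volume ≤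
        ∑ i ∈ Finset.range k, d (N + i) t := by
      intro N k
      induction k with
      | zero => simp
      | succ k ih =>
        have e : u (N + (k + 1)) t - u N t =
            (fun x => u (N + k + 1) t x - u (N + k) t x) + (u (N + k) t - u N t) := by
          ext x
          simp only [Pi.sub_apply, Pi.add_apply, ← add_assoc]
          ring
        rw [e, Finset.sum_range_succ, add_comm (∑ i ∈ _, _)]
        refine (eLpNorm_add_le ((hum _).sub (hum _)) ((hum _).sub (hum _)) hr).trans ?_
        exact add_le_add le_rfl ih
    have htail : ∀ N k, eLpNorm (u (N + k) t - u N t) r volume ≤ (1 / 2) ^ N * D t := by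
      intro N k
      refine (hstep N k).trans ?_
      have h2 : ∀ i, d (N + i) t ≤ (1 / 2) ^ N * (2 ^ (N + i) * d (N + i) t) := by
        intro i
        rw [pow_add, ← mul_assoc, ← mul_assoc, ← mul_pow, one_div,
          ENNReal.inv_mul_cancel (by simp) (by simp), one_pow, one_mul]
        exact le_mul_of_one_le_left' (one_le_pow₀ (by norm_num))
      refine (Finset.sum_le_sum fun i _ => h2 i).trans ?_
      rw [← Finset.mul_sum]
      gcongr
      refine (ENNReal.sum_le_tsum (f := fun i => (2 : ℝ≥0∞) ^ (N + i) * d (N + i) t) _).trans ?_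
      exact ENNReal.tsum_comp_le_tsum_of_injective (add_right_injective N)
        (fun i => (2 : ℝ≥0∞) ^ i * d i t)
    have hmono : ∀ {N m : ℕ}, N ≤ m → (1 / 2 : ℝ≥0∞) ^ m ≤ (1 / 2) ^ N := fun h =>
      pow_le_pow_right_of_le_one' (by simp) h
    have hcau2 : ∀ N k m : ℕ, N ≤ k → N ≤ m → eLpNorm (u k t - u m t) r volume < B N := by
      have hB0 : ∀ N, (1 / 2) ^ N * D t < B N := fun N => by
        refine ENNReal.mul_lt_mul_right ?_ ?_ (ENNReal.lt_add_right ht.ne one_ne_zero)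
        · exact pow_ne_zero _ (by simp)
        · exact ENNReal.pow_ne_top (by simp)
      have hord : ∀ N k m : ℕ, N ≤ m → m ≤ k → eLpNorm (u k t - u m t) r volume < B N := by
        intro N k m hN hmk
        obtain ⟨j, rfl⟩ := Nat.exists_eq_add_of_le hmk
        exact (htail m j).trans_lt (lt_of_le_of_lt (mul_le_mul_left (hmono hN) _) (hB0 N))
      intro N k m hk hm
      rcases le_total m k with h | h
      · exact hord N k m hm h
      · rw [eLpNorm_sub_comm]; exact hord N m k hk h
    have hae := Lp.ae_tendsto_of_cauchy_eLpNorm hum hr hBsum hcau2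
    refine Lp.cauchy_tendsto_of_tendsto hum (v t) hBsum hcau2 ?_
    filter_upwards [hae] with x hx
    exact tendsto_nhds_limUnder hx
  refine ⟨v, hvm, hlim, fun C hC => ?_⟩
  refine eLpNorm_le_of_liminf (fun N => measurable_eLpNorm_slice (hu N) r) ?_ hC
  filter_upwards [hlim] with t ht
  have h1 : ∀ N, eLpNorm (v t) r volume ≤
      eLpNorm (u N t) r volume + eLpNorm (fun x => u N t x - v t x) r volume := fun N => by
    have e : v t = u N t - (fun x => u N t x - v t x) := by ext x; simp
    conv_lhs => rw [e]
    have := measurable_slice hvm t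
    have := measurable_slice (hu N) t
    exact eLpNorm_sub_le (by fun_prop) (by fun_prop) hr
  by_cases htop : liminf (fun N => eLpNorm (u N t) r volume) atTop = ⊤
  · rw [htop]; exact le_top
  refine ENNReal.le_of_forall_pos_le_add fun ε hε _ => ?_
  have h2 : ∀ᶠ N in atTop, eLpNorm (v t) r volume ≤ eLpNorm (u N t) r volume + ε := by
    filter_upwards [ht.eventually_le_const (show (0 : ℝ≥0∞) < ε by simpa using hε)] with N hN
    exact (h1 N).trans (by gcongr)
  have h3 : eLpNorm (v t) r volume - ε ≤ liminf (fun N => eLpNorm (u N t) r volume) atTop := by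
    refine le_liminf_of_le (by isBoundedDefault) ?_
    filter_upwards [h2] with N hN
    exact tsub_le_iff_right.2 hN
  exact tsub_le_iff_right.1 h3

/-! ### Bounded functions of bounded support, and truncation -/

/-- Jointly measurable, bounded functions with bounded support. -/
structure Nice (G : ℝ → Eu n → ℂ) : Prop where
  meas : Measurable (Function.uncurry G)
  bdd : ∃ M, ∀ t x, ‖G t x‖ ≤ M
  supp : ∃ R, ∀ t x, R < |t| ∨ R < ‖x‖ → G t x = 0

open Classical in
/-- Truncation to a bounded function of bounded support. -/
noncomputable def trunc (N : ℕ) (G : ℝ → Eu n → ℂ) (t : ℝ) (x : Eu n) : ℂ :=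
  if |t| ≤ N ∧ ‖x‖ ≤ N ∧ ‖G t x‖ ≤ N then G t x else 0

lemma nice_trunc {G : ℝ → Eu n → ℂ} (hG : Measurable (Function.uncurry G)) (N : ℕ) :
    Nice (trunc N G) := by
  classical
  refine ⟨?_, ⟨N, fun t x => ?_⟩, ⟨N, fun t x h => ?_⟩⟩
  · refine Measurable.ite (p := fun p : ℝ × Eu n => |p.1| ≤ N ∧ ‖p.2‖ ≤ N ∧ ‖G p.1 p.2‖ ≤ N)
      ?_ hG measurable_const
    have hG' : Measurable fun p : ℝ × Eu n => G p.1 p.2 := hG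
    have h1 : MeasurableSet {p : ℝ × Eu n | |p.1| ≤ N} :=
      measurableSet_le (by fun_prop) measurable_const
    have h2 : MeasurableSet {p : ℝ × Eu n | ‖p.2‖ ≤ N} :=
      measurableSet_le (by fun_prop) measurable_const
    have h3 : MeasurableSet {p : ℝ × Eu n | ‖G p.1 p.2‖ ≤ N} :=
      measurableSet_le (by fun_prop) measurable_const
    exact h1.inter (h2.inter h3)
  · unfold trunc; split_ifs with h
    · exact h.2.2
    · simp
  · unfold trunc
    rw [if_neg]
    rintro ⟨h1, h2, -⟩
    rcases h with h | h <;> linarith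

lemma enorm_trunc_le (N : ℕ) (G : ℝ → Eu n → ℂ) (t : ℝ) (x : Eu n) :
    ‖trunc N G t x‖ₑ ≤ ‖G t x‖ₑ := by
  unfold trunc; split_ifs <;> simp

lemma enorm_sub_trunc_le (N : ℕ) (G : ℝ → Eu n → ℂ) (t : ℝ) (x : Eu n) :
    ‖G t x - trunc N G t x‖ₑ ≤ ‖G t x‖ₑ := by
  unfold trunc; split_ifs <;> simp

lemma eventually_trunc_eq (G : ℝ → Eu n → ℂ) (t : ℝ) (x : Eu n) :
    ∀ᶠ N : ℕ in atTop, trunc N G t x = G t x := by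
  filter_upwards [eventually_ge_atTop (⌈|t|⌉₊ + ⌈‖x‖⌉₊ + ⌈‖G t x‖⌉₊)] with N hN
  have h1 := Nat.le_ceil |t|
  have h2 := Nat.le_ceil ‖x‖
  have h3 := Nat.le_ceil ‖G t x‖
  have hN' : ((⌈|t|⌉₊ : ℝ) + ⌈‖x‖⌉₊ + ⌈‖G t x‖⌉₊) ≤ N := by exact_mod_cast hN
  have p1 : (0 : ℝ) ≤ ⌈|t|⌉₊ := by positivity
  have p2 : (0 : ℝ) ≤ ⌈‖x‖⌉₊ := by positivity
  have p3 : (0 : ℝ) ≤ ⌈‖G t x‖⌉₊ := by positivity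
  unfold trunc
  rw [if_pos ⟨by linarith, by linarith, by linarith⟩]

lemma tendsto_eLpNorm_of_dominated {α : Type*} [MeasurableSpace α] {μ : Measure α}
    {F : ℕ → α → ℝ≥0∞} {B : α → ℝ≥0∞} (hF : ∀ N, Measurable (F N)) {p : ℝ≥0∞} (h0 : p ≠ 0)
    (hp : p ≠ ⊤) (hFB : ∀ N t, F N t ≤ B t) (hB : eLpNorm B p μ ≠ ⊤)
    (hlim : ∀ᵐ t ∂μ, Tendsto (fun N => F N t) atTop (𝓝 0)) :
    Tendsto (fun N => eLpNorm (F N) p μ) atTop (𝓝 0) := by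
  have hp0 := ENNReal.toReal_pos h0 hp
  simp only [eLpNorm_eq_lintegral_rpow_enorm_toReal h0 hp, enorm_eq_self] at hB ⊢
  have h1 : Tendsto (fun N => ∫⁻ t, F N t ^ p.toReal ∂μ) atTop (𝓝 (∫⁻ _, 0 ∂μ)) := by
    refine tendsto_lintegral_of_dominated_convergence (fun t => B t ^ p.toReal)
      (fun N => (hF N).pow_const _)
      (fun N => ae_of_all _ fun t => ENNReal.rpow_le_rpow (hFB N t) hp0.le) ?_ ?_
    · intro htop
      rw [htop, ENNReal.top_rpow_of_pos (by positivity)] at hB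
      exact hB rfl
    · filter_upwards [hlim] with t ht
      have := (ENNReal.continuous_rpow_const (y := p.toReal)).tendsto 0 |>.comp ht
      simpa [ENNReal.zero_rpow_of_pos hp0, Function.comp_def] using this
  have h2 := (ENNReal.continuous_rpow_const (y := 1 / p.toReal)).tendsto 0
  rw [lintegral_zero] at h1
  have h3 := h2.comp h1
  rwa [ENNReal.zero_rpow_of_pos (by positivity)] at h3

/-- Dominated convergence is applied twice, in $x$ for almost every $t$ and then in $t$; this is
where both exponents have to be finite. -/
lemma tendsto_mixedNorm_sub_trunc {q r : ℝ≥0∞} (hq : q ≠ 0) (hq' : q ≠ ⊤) (hr : r ≠ 0)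
    (hr' : r ≠ ⊤) {G : ℝ → Eu n → ℂ} (hG : Measurable (Function.uncurry G))
    (hGf : mixedNorm q r G ≠ ⊤) :
    Tendsto (fun N => mixedNorm q r (fun t x => G t x - trunc N G t x)) atTop (𝓝 0) := by
  have hm : ∀ N, Measurable (Function.uncurry (fun t x => G t x - trunc N G t x)) := fun N =>
    hG.sub (nice_trunc hG N).meas
  refine tendsto_eLpNorm_of_dominated (fun N => measurable_eLpNorm_slice (hm N) r) hq hq'
    (fun N t => eLpNorm_mono_enorm (enorm_sub_trunc_le N G t)) hGf ?_
  have hfin := ae_lt_top_of_eLpNorm (measurable_eLpNorm_slice hG r) hq hGf.lt_top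
  filter_upwards [hfin] with t ht
  simp_rw [← eLpNorm_enorm (fun x => G t x - trunc _ G t x)]
  refine tendsto_eLpNorm_of_dominated (B := fun x => ‖G t x‖ₑ)
    (fun N => (measurable_slice (hm N) t).enorm) hr hr'
    (fun N x => enorm_sub_trunc_le N G t x) (by simpa only [eLpNorm_enorm] using ht.ne) ?_
  refine ae_of_all _ fun x => ?_
  refine tendsto_const_nhds.congr' ?_
  filter_upwards [eventually_trunc_eq G t x] with N hN
  simp [hN]


/-! ### Norming the mixed Lebesgue spaces by nice functions -/

section Norming

variable {n : ℕ}

/-- Duality on the line for a bounded function cut off to a set of finite measure. -/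
lemma eLpNorm_le_of_pairing {q q' : ℝ≥0∞} (hq1 : 1 < q) [hqq : ENNReal.HolderConjugate q q']
    {y : ℝ → ℝ} (hy : Measurable y) (hy0 : ∀ t, 0 ≤ y t) {Y : ℝ} (hyY : ∀ t, y t ≤ Y)
    {T : Set ℝ} (hT : MeasurableSet T) (hTfin : volume T ≠ ⊤) {A : ℝ≥0∞}
    (h : ∀ φ : ℝ → ℝ, Measurable φ → (∀ t, 0 ≤ φ t) → (∃ Φ, ∀ t, φ t ≤ Φ) →
      (∀ t, t ∉ T → φ t = 0) →
      ∫⁻ t, ENNReal.ofReal (φ t * y t) ≤ A * eLpNorm (fun t => ENNReal.ofReal (φ t)) q' volume) :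
    eLpNorm (T.indicator fun t => ENNReal.ofReal (y t)) q volume ≤ A := by
  rcases eq_or_ne q ⊤ with rfl | hqt
  · have : q' = 1 := (ENNReal.HolderConjugate.eq_top_iff_eq_one ⊤ q').1 rfl
    subst this
    rw [eLpNorm_exponent_top, eLpNormEssSup]
    refine le_of_forall_gt_imp_ge_of_dense fun a ha => essSup_le_of_ae_le a ?_
    rw [EventuallyLE, ae_iff]
    -- For $q=\infty$ the test function is the indicator of the set where $y$ exceeds $a>A$; if this
    -- set had positive measure, the hypothesis would give $a\le A$.
    set S : Set ℝ := T ∩ {t | a < ENNReal.ofReal (y t)} with hS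
    have hSm : MeasurableSet S := hT.inter (measurableSet_lt measurable_const (by fun_prop))
    refine measure_mono_null (t := S) ?_ ?_
    · intro t ht
      by_cases htT : t ∈ T
      · refine ⟨htT, ?_⟩
        simpa [indicator_of_mem htT] using ht
      · exfalso; simp [indicator_of_notMem htT] at ht
    · by_contra hS0
      have hSfin : volume S ≠ ⊤ := ((measure_mono inter_subset_left).trans_lt hTfin.lt_top).ne
      have h1 := h (S.indicator 1) (measurable_one.indicator hSm)
        (fun t => indicator_nonneg (by simp) _)
        ⟨1, fun t => indicator_le_self' (by simp) t |>.trans (by simp)⟩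
        (fun t ht => indicator_of_notMem (fun h => ht h.1) _)
      have e1 : ∀ t, ENNReal.ofReal (S.indicator (1 : ℝ → ℝ) t * y t) =
          S.indicator (fun t => ENNReal.ofReal (y t)) t := fun t => by
        by_cases ht : t ∈ S <;> simp [ht]
      have e2 : ∀ t, ‖ENNReal.ofReal (S.indicator (1 : ℝ → ℝ) t)‖ₑ =
          S.indicator (fun _ => (1 : ℝ≥0∞)) t := fun t => by
        by_cases ht : t ∈ S <;> simp [ht]
      simp_rw [e1] at h1
      rw [eLpNorm_one_eq_lintegral_enorm] at h1
      simp_rw [e2] at h1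
      rw [lintegral_indicator hSm, lintegral_indicator hSm, setLIntegral_const, one_mul] at h1
      have h2 : a * volume S ≤ ∫⁻ t in S, ENNReal.ofReal (y t) := by
        rw [← setLIntegral_const]
        exact setLIntegral_mono (by fun_prop) fun t ht => ht.2.le
      have h3 := h2.trans h1
      exact absurd ((ENNReal.mul_le_mul_iff_left hS0 hSfin).1 h3) (not_le.2 ha)
  · have hq't : q' ≠ ⊤ := by
      rintro rfl
      have := hqq.symm
      have : q = 1 := (ENNReal.HolderConjugate.eq_top_iff_eq_one ⊤ q).1 rfl
      exact hq1.ne' this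
    have hc := ENNReal.HolderConjugate.toReal_of_ne_top (p := q) (q := q') hqt hq't
    have h0 : q ≠ 0 := ENNReal.HolderConjugate.ne_zero q q'
    have h0' : q' ≠ 0 := by have := hqq.symm; exact ENNReal.HolderConjugate.ne_zero q' q
    set a := q.toReal
    set a' := q'.toReal
    have ha : 1 < a := hc.lt
    have ha' : 0 < a' := hc.symm.pos
    set X : ℝ≥0∞ := ∫⁻ t, (T.indicator fun t => ENNReal.ofReal (y t)) t ^ a with hX
    have hXf : X ≠ ⊤ := by
      have : X ≤ ∫⁻ t, T.indicator (fun _ => ENNReal.ofReal Y ^ a) t := by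
        refine lintegral_mono fun t => ?_
        by_cases ht : t ∈ T
        · simp only [indicator_of_mem ht]
          have := hyY t
          gcongr
        · simp [indicator_of_notMem ht, zero_lt_one.trans ha]
      rw [lintegral_indicator hT, setLIntegral_const] at this
      refine (this.trans_lt (ENNReal.mul_lt_top ?_ hTfin.lt_top)).ne
      exact ENNReal.rpow_lt_top_of_nonneg (by linarith) ENNReal.ofReal_ne_top
    -- The extremal function of Hölder's inequality. It is admissible since $y$ is bounded, and
    -- $X<\infty$ because also $T$ has finite measure; finiteness is needed to cancel $X^{1/a'}$
    -- below.
    have h1 := h (T.indicator fun t => y t ^ (a - 1)) ((hy.pow_const _).indicator hT)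
      (fun t => indicator_nonneg (fun t _ => Real.rpow_nonneg (hy0 t) _) _)
      ⟨Y ^ (a - 1), fun t => by
        have : 0 ≤ Y := (hy0 0).trans (hyY 0)
        by_cases ht : t ∈ T
        · rw [indicator_of_mem ht]
          exact Real.rpow_le_rpow (hy0 t) (hyY t) (by linarith)
        · rw [indicator_of_notMem ht]; positivity⟩
      (fun t ht => indicator_of_notMem ht _)
    have e1 : ∀ t, ENNReal.ofReal (T.indicator (fun t => y t ^ (a - 1)) t * y t) =
        (T.indicator fun t => ENNReal.ofReal (y t)) t ^ a := fun t => by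
      by_cases ht : t ∈ T
      · rw [indicator_of_mem ht, indicator_of_mem ht,
          ENNReal.ofReal_rpow_of_nonneg (hy0 t) (by linarith)]
        congr 1
        rcases (hy0 t).eq_or_lt with h00 | h00
        · rw [← h00, mul_zero, Real.zero_rpow (by linarith)]
        · rw [← Real.rpow_add_one h00.ne', sub_add_cancel]
      · simp [indicator_of_notMem ht, zero_lt_one.trans ha]
    have e2 : ∀ t, ‖ENNReal.ofReal (T.indicator (fun t => y t ^ (a - 1)) t)‖ₑ ^ a' =
        (T.indicator fun t => ENNReal.ofReal (y t)) t ^ a := fun t => by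
      by_cases ht : t ∈ T
      · rw [indicator_of_mem ht, indicator_of_mem ht, enorm_eq_self,
          ENNReal.ofReal_rpow_of_nonneg (hy0 t) (by linarith),
          ENNReal.ofReal_rpow_of_nonneg (Real.rpow_nonneg (hy0 t) _) ha'.le,
          ← Real.rpow_mul (hy0 t), hc.sub_one_mul_conj]
      · simp [indicator_of_notMem ht, zero_lt_one.trans ha, ha']
    simp_rw [e1] at h1
    rw [eLpNorm_eq_lintegral_rpow_enorm_toReal h0' hq't, lintegral_congr e2] at h1
    rw [eLpNorm_eq_lintegral_rpow_enorm_toReal h0 hqt]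
    simp only [enorm_eq_self]
    rw [← hX] at h1
    change X ^ (1 / a) ≤ A
    rcases eq_or_ne X 0 with hX0 | hX0
    · rw [hX0, ENNReal.zero_rpow_of_pos (by positivity)]; exact zero_le
    have h2 : X = X ^ (1 / a) * X ^ (1 / a') := by
      rw [← ENNReal.rpow_add _ _ hX0 hXf]
      have : 1 / a + 1 / a' = 1 := by simpa using hc.inv_add_inv_eq_one
      rw [this, ENNReal.rpow_one]
    have h3 : X ^ (1 / a) * X ^ (1 / a') ≤ A * X ^ (1 / a') := by rw [← h2]; exact h1
    refine (ENNReal.mul_le_mul_iff_left ?_ ?_).1 h3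
    · exact (ENNReal.rpow_pos (pos_iff_ne_zero.2 hX0) hXf).ne'
    · exact (ENNReal.rpow_lt_top_of_nonneg (by positivity) hXf).ne

variable {u : ℝ → Eu n → ℂ} {M : ℝ}

/-- The `L^ρ` norm of `u t` on the ball of radius `N`, as a real number. -/
noncomputable def ballNorm (u : ℝ → Eu n → ℂ) (ρ : ℝ) (N : ℕ) (t : ℝ) : ℝ :=
  (∫ x in Metric.closedBall (0 : Eu n) N, ‖u t x‖ ^ ρ) ^ (1 / ρ)

lemma measurable_ballNorm (hu : Measurable (Function.uncurry u)) (ρ : ℝ) (N : ℕ) :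
    Measurable (ballNorm u ρ N) := by
  have hu' : Measurable fun p : ℝ × Eu n => u p.1 p.2 := hu
  have : StronglyMeasurable fun p : ℝ × Eu n => ‖u p.1 p.2‖ ^ ρ :=
    (hu'.norm.pow_const _).stronglyMeasurable
  exact (this.integral_prod_right'
    (ν := volume.restrict (Metric.closedBall (0 : Eu n) N))).measurable.pow_const _

lemma ballNorm_nonneg (ρ : ℝ) (N : ℕ) (t : ℝ) : 0 ≤ ballNorm u ρ N t := by
  unfold ballNorm; positivity

lemma volume_closedBall_ne_top (N : ℕ) : volume (Metric.closedBall (0 : Eu n) N) ≠ ⊤ :=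
  (isCompact_closedBall _ _).measure_lt_top.ne

lemma integrableOn_norm_rpow (hu : Measurable (Function.uncurry u)) (hM : ∀ t x, ‖u t x‖ ≤ M)
    {ρ : ℝ} (hρ : 0 ≤ ρ) (N : ℕ) (t : ℝ) :
    IntegrableOn (fun x => ‖u t x‖ ^ ρ) (Metric.closedBall (0 : Eu n) N) := by
  refine Measure.integrableOn_of_bounded (M := M ^ ρ) (volume_closedBall_ne_top N)
    ((measurable_slice hu t).norm.pow_const _).aestronglyMeasurable (ae_of_all _ fun x => ?_)
  rw [Real.norm_of_nonneg (by positivity)]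
  exact Real.rpow_le_rpow (norm_nonneg _) (hM t x) hρ

lemma ballNorm_le (hu : Measurable (Function.uncurry u)) (hM : ∀ t x, ‖u t x‖ ≤ M) {ρ : ℝ}
    (hρ : 0 < ρ) (N : ℕ) : ∃ Y, ∀ t, ballNorm u ρ N t ≤ Y := by
  refine ⟨(volume.real (Metric.closedBall (0 : Eu n) N) * M ^ ρ) ^ (1 / ρ), fun t => ?_⟩
  refine Real.rpow_le_rpow (by positivity) ?_ (by positivity)
  have hfin : IntegrableOn (fun _ : Eu n => M ^ ρ) (Metric.closedBall (0 : Eu n) N) :=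
    integrableOn_const (volume_closedBall_ne_top N)
  refine (setIntegral_mono (integrableOn_norm_rpow hu hM hρ.le N t) hfin
    fun x => Real.rpow_le_rpow (norm_nonneg _) (hM t x) hρ.le).trans ?_
  rw [setIntegral_const, smul_eq_mul]

lemma ofReal_ballNorm (hu : Measurable (Function.uncurry u)) (hM : ∀ t x, ‖u t x‖ ≤ M) {ρ : ℝ}
    (hρ : 0 < ρ) (N : ℕ) (t : ℝ) : ENNReal.ofReal (ballNorm u ρ N t) =
      eLpNorm (u t) (ENNReal.ofReal ρ) (volume.restrict (Metric.closedBall (0 : Eu n) N)) := by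
  rw [eLpNorm_eq_lintegral_rpow_enorm_toReal (by simpa using hρ) ENNReal.ofReal_ne_top,
    ENNReal.toReal_ofReal hρ.le, ballNorm, ← ENNReal.ofReal_rpow_of_nonneg (by positivity)
    (by positivity), ofReal_integral_eq_lintegral_ofReal (integrableOn_norm_rpow hu hM hρ.le N t)
    (ae_of_all _ fun x => by positivity)]
  congr 2
  ext x
  rw [← ofReal_norm, ENNReal.ofReal_rpow_of_nonneg (norm_nonneg _) hρ.le]

/-- The extremal function of the duality between `L^ρ` and its dual, on a ball. -/
noncomputable def extremal (u : ℝ → Eu n → ℂ) (ρ : ℝ) (N : ℕ) (φ : ℝ → ℝ) (t : ℝ) (x : Eu n) : ℂ :=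
  (Metric.closedBall (0 : Eu n) N).indicator (fun x =>
    ((φ t * ballNorm u ρ N t ^ (1 - ρ) * ‖u t x‖ ^ (ρ - 2) : ℝ) : ℂ) *
      (starRingEnd ℂ) (u t x)) x

lemma rpow_sub_two_mul {a ρ : ℝ} (ha : 0 ≤ a) (hρ : 1 < ρ) : a ^ (ρ - 2) * a = a ^ (ρ - 1) := by
  rcases ha.eq_or_lt with h | h
  · rw [← h, mul_zero, Real.zero_rpow (by linarith)]
  · rw [← Real.rpow_add_one h.ne']; ring_nf

lemma norm_extremal {ρ : ℝ} (hρ : 1 < ρ) (N : ℕ) {φ : ℝ → ℝ} (hφ : ∀ t, 0 ≤ φ t) (t : ℝ)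
    (x : Eu n) : ‖extremal u ρ N φ t x‖ = (Metric.closedBall (0 : Eu n) N).indicator
      (fun x => φ t * ballNorm u ρ N t ^ (1 - ρ) * ‖u t x‖ ^ (ρ - 1)) x := by
  have h0 := hφ t
  have h1 := ballNorm_nonneg (u := u) ρ N t
  by_cases hx : x ∈ Metric.closedBall (0 : Eu n) N
  · rw [extremal, indicator_of_mem hx, indicator_of_mem hx, norm_mul, RCLike.norm_conj,
      Complex.norm_real, Real.norm_of_nonneg (by positivity), mul_assoc,
      rpow_sub_two_mul (norm_nonneg _) hρ]
  · rw [extremal, indicator_of_notMem hx, indicator_of_notMem hx, norm_zero]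

lemma mul_extremal {ρ : ℝ} (hρ : 1 < ρ) (N : ℕ) (φ : ℝ → ℝ) (t : ℝ) (x : Eu n) :
    u t x * extremal u ρ N φ t x = (((Metric.closedBall (0 : Eu n) N).indicator
      (fun x => φ t * ballNorm u ρ N t ^ (1 - ρ) * ‖u t x‖ ^ ρ) x : ℝ) : ℂ) := by
  by_cases hx : x ∈ Metric.closedBall (0 : Eu n) N
  · rw [extremal, indicator_of_mem hx, indicator_of_mem hx, mul_left_comm, Complex.mul_conj,
      Complex.normSq_eq_norm_sq, ← Complex.ofReal_mul, mul_assoc]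
    congr 2
    rw [sq, ← mul_assoc, rpow_sub_two_mul (norm_nonneg _) hρ]
    rcases (norm_nonneg (u t x)).eq_or_lt with h | h
    · rw [← h, mul_zero, Real.zero_rpow (by linarith)]
    · rw [← Real.rpow_add_one h.ne', sub_add_cancel]
  · rw [extremal, indicator_of_notMem hx, indicator_of_notMem hx, mul_zero, Complex.ofReal_zero]

lemma measurable_extremal (hu : Measurable (Function.uncurry u)) (ρ : ℝ) (N : ℕ) {φ : ℝ → ℝ}
    (hφ : Measurable φ) : Measurable (Function.uncurry (extremal u ρ N φ)) := by
  have hu' : Measurable fun p : ℝ × Eu n => u p.1 p.2 := hu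
  have hb := measurable_ballNorm hu ρ N
  have : Function.uncurry (extremal u ρ N φ) =
      {p : ℝ × Eu n | p.2 ∈ Metric.closedBall (0 : Eu n) N}.indicator (fun p =>
        ((φ p.1 * ballNorm u ρ N p.1 ^ (1 - ρ) * ‖u p.1 p.2‖ ^ (ρ - 2) : ℝ) : ℂ) *
      (starRingEnd ℂ) (u p.1 p.2)) := by
    ext ⟨t, x⟩
    simp only [Function.uncurry, extremal, indicator, mem_ofPred_eq]
  rw [this]
  refine Measurable.indicator ?_ (measurable_snd Metric.isClosed_closedBall.measurableSet)
  have h1 : Measurable fun p : ℝ × Eu n =>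
      φ p.1 * ballNorm u ρ N p.1 ^ (1 - ρ) * ‖u p.1 p.2‖ ^ (ρ - 2) :=
    ((hφ.comp measurable_fst).mul ((hb.comp measurable_fst).pow_const _)).mul
      (hu'.norm.pow_const _)
  exact (Complex.measurable_ofReal.comp h1).mul
    (Complex.continuous_conj.measurable.comp hu')

/-- The set of times on which the extremal function is used. -/
def goodTimes (u : ℝ → Eu n → ℂ) (ρ : ℝ) (N : ℕ) : Set ℝ :=
  {t | |t| ≤ N} ∩ {t | 1 / ((N : ℝ) + 1) < ballNorm u ρ N t}

lemma measurableSet_goodTimes (hu : Measurable (Function.uncurry u)) (ρ : ℝ) (N : ℕ) :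
    MeasurableSet (goodTimes u ρ N) :=
  (measurableSet_le (by fun_prop) measurable_const).inter
    (measurableSet_lt measurable_const (measurable_ballNorm hu ρ N))

lemma volume_goodTimes (ρ : ℝ) (N : ℕ) : volume (goodTimes u ρ N) ≠ ⊤ := by
  have : goodTimes u ρ N ⊆ Icc (-(N : ℝ)) N := fun t ht => abs_le.1 ht.1
  exact ((measure_mono this).trans_lt measure_Icc_lt_top).ne

lemma nice_extremal (hu : Measurable (Function.uncurry u)) (hM : ∀ t x, ‖u t x‖ ≤ M) {ρ : ℝ}
    (hρ : 1 < ρ) (N : ℕ) {φ : ℝ → ℝ} (hφ : Measurable φ) (hφ0 : ∀ t, 0 ≤ φ t) {Φ : ℝ}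
    (hΦ : ∀ t, φ t ≤ Φ) (hφT : ∀ t, t ∉ goodTimes u ρ N → φ t = 0) :
    Nice (extremal u ρ N φ) := by
  have hΦ0 : 0 ≤ Φ := (hφ0 0).trans (hΦ 0)
  have hM0 : 0 ≤ M := (norm_nonneg _).trans (hM 0 0)
  refine ⟨measurable_extremal hu ρ N hφ,
    ⟨Φ * (1 / ((N : ℝ) + 1)) ^ (1 - ρ) * M ^ (ρ - 1), fun t x => ?_⟩, ⟨N, fun t x h => ?_⟩⟩
  · rw [norm_extremal hρ N hφ0]
    refine indicator_apply_le' (fun _ => ?_) (fun _ => by positivity)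
    by_cases ht : t ∈ goodTimes u ρ N
    · have h1 : ballNorm u ρ N t ^ (1 - ρ) ≤ (1 / ((N : ℝ) + 1)) ^ (1 - ρ) :=
        Real.rpow_le_rpow_of_nonpos (by positivity) ht.2.le (by linarith)
      have h2 : ‖u t x‖ ^ (ρ - 1) ≤ M ^ (ρ - 1) :=
        Real.rpow_le_rpow (norm_nonneg _) (hM t x) (by linarith)
      have h3 := ballNorm_nonneg (u := u) ρ N t
      have h4 := hΦ t
      have h5 := hφ0 t
      gcongr
    · rw [hφT t ht]; simp; positivity
  · rcases h with h | h
    · have : φ t = 0 := hφT t fun ht => absurd ht.1 (not_le.2 h)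
      simp [extremal, this]
    · exact indicator_of_notMem (by simpa using h) _

/-- Since $(\rho-1)\rho'=\rho$, the factor `ballNorm` to the power $1-\rho$ normalises the slice: on
good times its dual norm is exactly $\varphi(t)$. -/
lemma eLpNorm_extremal_le (hu : Measurable (Function.uncurry u)) (hM : ∀ t x, ‖u t x‖ ≤ M)
    {ρ ρ' : ℝ} (hρ : ρ.HolderConjugate ρ') (N : ℕ) {φ : ℝ → ℝ} (hφ0 : ∀ t, 0 ≤ φ t)
    (hφT : ∀ t, t ∉ goodTimes u ρ N → φ t = 0) (t : ℝ) :
    eLpNorm (extremal u ρ N φ t) (ENNReal.ofReal ρ') volume ≤ ENNReal.ofReal (φ t) := by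
  by_cases ht : t ∈ goodTimes u ρ N
  swap
  · have : extremal u ρ N φ t = 0 := by ext x; simp [extremal, hφT t ht]
    rw [this]; simp
  have hy : 0 < ballNorm u ρ N t := lt_trans (by positivity) ht.2
  have hρ' := hρ.symm.pos
  have hp := hφ0 t
  rw [eLpNorm_eq_lintegral_rpow_enorm_toReal (by simpa using hρ') ENNReal.ofReal_ne_top,
    ENNReal.toReal_ofReal hρ'.le]
  have e1 : ∀ x, ‖extremal u ρ N φ t x‖ₑ ^ ρ' = (Metric.closedBall (0 : Eu n) N).indicator
      (fun x => ENNReal.ofReal (φ t ^ ρ' * ballNorm u ρ N t ^ (-ρ)) *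
        ENNReal.ofReal (‖u t x‖ ^ ρ)) x := fun x => by
    rw [← ofReal_norm, norm_extremal hρ.lt N hφ0]
    by_cases hx : x ∈ Metric.closedBall (0 : Eu n) N
    · rw [indicator_of_mem hx, indicator_of_mem hx, ENNReal.ofReal_rpow_of_nonneg
        (by positivity) hρ'.le, ← ENNReal.ofReal_mul (by positivity)]
      congr 1
      rw [Real.mul_rpow (by positivity) (by positivity), Real.mul_rpow hp (by positivity),
        ← Real.rpow_mul hy.le, ← Real.rpow_mul (norm_nonneg _), hρ.sub_one_mul_conj]
      congr 3
      have := hρ.sub_one_mul_conj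
      linarith
    · rw [indicator_of_notMem hx, indicator_of_notMem hx]; simp [hρ']
  simp_rw [e1]
  rw [lintegral_indicator Metric.isClosed_closedBall.measurableSet, lintegral_const_mul _
    (by have := measurable_slice hu t; fun_prop),
    ← ofReal_integral_eq_lintegral_ofReal (integrableOn_norm_rpow hu hM hρ.pos.le N t)
      (ae_of_all _ fun x => by positivity)]
  have e2 : ∫ x in Metric.closedBall (0 : Eu n) N, ‖u t x‖ ^ ρ = ballNorm u ρ N t ^ ρ := by
    rw [ballNorm, ← Real.rpow_mul (by positivity), one_div_mul_cancel hρ.pos.ne', Real.rpow_one]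
  rw [e2, ← ENNReal.ofReal_mul (by positivity), mul_assoc, ← Real.rpow_add hy, neg_add_cancel,
    Real.rpow_zero, mul_one, ENNReal.ofReal_rpow_of_nonneg (by positivity) (by positivity),
    ← Real.rpow_mul hp, mul_one_div_cancel hρ'.ne', Real.rpow_one]

/-- The extremal slice attains Hölder's inequality, so the space integral is $\varphi(t)$ times the
slice norm. This reduces duality in the mixed norm to duality on the line. -/
lemma enorm_integral_mul_extremal (hu : Measurable (Function.uncurry u))
    (hM : ∀ t x, ‖u t x‖ ≤ M) {ρ : ℝ} (hρ : 1 < ρ) (N : ℕ) {φ : ℝ → ℝ} (hφ : Measurable φ)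
    (hφ0 : ∀ t, 0 ≤ φ t) {Φ : ℝ} (hΦ : ∀ t, φ t ≤ Φ)
    (hφT : ∀ t, t ∉ goodTimes u ρ N → φ t = 0) :
    ‖∫ t, ∫ x, u t x * extremal u ρ N φ t x‖ₑ =
      ∫⁻ t, ENNReal.ofReal (φ t * ballNorm u ρ N t) := by
  have hρ0 : 0 < ρ := by linarith
  have e1 : ∀ t, ∫ x, u t x * extremal u ρ N φ t x = ((φ t * ballNorm u ρ N t : ℝ) : ℂ) :=
    fun t => by
    simp_rw [mul_extremal hρ]
    rw [integral_complex_ofReal, integral_indicator Metric.isClosed_closedBall.measurableSet,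
      integral_const_mul]
    have e2 : ∫ x in Metric.closedBall (0 : Eu n) N, ‖u t x‖ ^ ρ = ballNorm u ρ N t ^ ρ := by
      rw [ballNorm, ← Real.rpow_mul (by positivity), one_div_mul_cancel hρ0.ne', Real.rpow_one]
    rw [e2]
    by_cases ht : t ∈ goodTimes u ρ N
    · have hy : 0 < ballNorm u ρ N t := lt_trans (by positivity) ht.2
      rw [mul_assoc, ← Real.rpow_add hy]
      simp
    · simp [hφT t ht]
  simp_rw [e1]
  obtain ⟨Y, hY⟩ := ballNorm_le hu hM hρ0 N
  have hnn : ∀ t, 0 ≤ φ t * ballNorm u ρ N t := fun t =>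
    mul_nonneg (hφ0 t) (ballNorm_nonneg ρ N t)
  have hint : Integrable (fun t => φ t * ballNorm u ρ N t) := by
    have hon : IntegrableOn (fun t => φ t * ballNorm u ρ N t) (goodTimes u ρ N) := by
      refine Measure.integrableOn_of_bounded (M := Φ * Y) (volume_goodTimes ρ N)
        (hφ.mul (measurable_ballNorm hu ρ N)).aestronglyMeasurable (ae_of_all _ fun t => ?_)
      rw [Real.norm_of_nonneg (hnn t)]
      exact mul_le_mul (hΦ t) (hY t) (ballNorm_nonneg ρ N t) ((hφ0 t).trans (hΦ t))
    refine (integrableOn_iff_integrable_of_support_subset fun t ht => ?_).1 hon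
    by_contra h
    exact ht (by simp [hφT t h])
  rw [integral_complex_ofReal, ← ofReal_norm, Complex.norm_real, Real.norm_of_nonneg
    (integral_nonneg hnn), ofReal_integral_eq_lintegral_ofReal hint (ae_of_all _ hnn)]

/-- The cut-off slice norms. -/
lemma eLpNorm_goodTimes_le {q q' r' : ℝ≥0∞} (hq1 : 1 < q) [hqq : ENNReal.HolderConjugate q q']
    (hu : Measurable (Function.uncurry u)) (hM : ∀ t x, ‖u t x‖ ≤ M) {A : ℝ≥0∞}
    (hA : ∀ G : ℝ → Eu n → ℂ, Nice G → ‖∫ t, ∫ x, u t x * G t x‖ₑ ≤ A * mixedNorm q' r' G)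
    {ρ ρ' : ℝ} (hρ : ρ.HolderConjugate ρ') (N : ℕ) {c : ℝ≥0∞}
    (hc : ∀ f : Eu n → ℂ, Measurable f → (∀ x ∉ Metric.closedBall (0 : Eu n) N, f x = 0) →
      eLpNorm f r' volume ≤ c * eLpNorm f (ENNReal.ofReal ρ') volume) :
    eLpNorm ((goodTimes u ρ N).indicator fun t => ENNReal.ofReal (ballNorm u ρ N t)) q volume ≤
      A * c := by
  have hq'0 : q' ≠ 0 := by have := hqq.symm; exact ENNReal.HolderConjugate.ne_zero q' q
  obtain ⟨Y, hY⟩ := ballNorm_le hu hM hρ.pos N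
  refine eLpNorm_le_of_pairing (q' := q') hq1 (measurable_ballNorm hu ρ N) (ballNorm_nonneg ρ N) hY
    (measurableSet_goodTimes hu ρ N) (volume_goodTimes ρ N) fun φ hφ hφ0 ⟨Φ, hΦ⟩ hφT => ?_
  rw [← enorm_integral_mul_extremal hu hM hρ.lt N hφ hφ0 hΦ hφT]
  refine (hA _ (nice_extremal hu hM hρ.lt N hφ hφ0 hΦ hφT)).trans ?_
  rw [mul_assoc]
  gcongr
  rw [← eLpNorm_ennreal_const_mul _ (by fun_prop) hq'0]
  refine eLpNorm_ennreal_mono _ (ae_of_all _ fun t => ?_)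
  refine (hc _ (measurable_slice (measurable_extremal hu ρ N hφ) t) fun x hx => ?_).trans ?_
  · exact indicator_of_notMem hx _
  · gcongr
    exact eLpNorm_extremal_le hu hM hρ N hφ0 hφT t

lemma le_liminf_cut {y : ℕ → ℝ≥0∞} {z : ℕ → ℝ≥0∞} {Y : ℝ≥0∞} (h : Y ≤ liminf y atTop)
    (hz : ∀ᶠ k in atTop, y k ≤ z k) : Y ≤ liminf z atTop :=
  h.trans (liminf_le_liminf hz)

/-- The essential supremum is bounded by the lower limit of the `L^p` norms. -/
lemma eLpNorm_top_le_liminf {f : Eu n → ℂ} (hf : Measurable f) {B : Set (Eu n)}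
    (hB : volume B ≠ ⊤) :
    eLpNorm f ⊤ (volume.restrict B) ≤
      liminf (fun k : ℕ => eLpNorm f (ENNReal.ofReal (k + 2)) (volume.restrict B)) atTop := by
  have : IsFiniteMeasure (volume.restrict B) := ⟨by simpa using hB.lt_top⟩
  refine le_of_forall_lt_imp_le_of_dense fun a ha => ?_
  set S : Set (Eu n) := {x | a ≤ ‖f x‖ₑ} with hS
  have hS0 : (volume.restrict B) S ≠ 0 := by
    intro h0
    refine absurd ha (not_lt.2 ?_)
    rw [eLpNorm_exponent_top]
    refine essSup_le_of_ae_le a ?_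
    rw [EventuallyLE, ae_iff]
    refine measure_mono_null (fun x hx => ?_) h0
    exact (not_le.1 hx).le
  have hSf : (volume.restrict B) S ≠ ⊤ := measure_ne_top _ _
  set m := (volume.restrict B) S
  -- Chebyshev's inequality on the set where $|f|\ge a$, of measure $m$; the factor $m^{1/(k+2)}$
  -- tends to $1$.
  have h1 : ∀ k : ℕ, a * m ^ (1 / ((k : ℝ) + 2)) ≤
      eLpNorm f (ENNReal.ofReal (k + 2)) (volume.restrict B) := fun k => by
    have hk : (0 : ℝ) < k + 2 := by positivity
    have := mul_meas_ge_le_pow_eLpNorm' (volume.restrict B)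
      (p := ENNReal.ofReal ((k : ℝ) + 2)) (by simpa using hk) ENNReal.ofReal_ne_top
      hf.aestronglyMeasurable a
    rw [ENNReal.toReal_ofReal hk.le] at this
    have h2 := ENNReal.rpow_le_rpow this (show 0 ≤ 1 / ((k : ℝ) + 2) by positivity)
    rwa [ENNReal.mul_rpow_of_nonneg _ _ (by positivity), ← ENNReal.rpow_mul, ← ENNReal.rpow_mul,
      mul_one_div_cancel hk.ne', ENNReal.rpow_one, ENNReal.rpow_one] at h2
  have hlim : Tendsto (fun k : ℕ => a * m ^ (1 / ((k : ℝ) + 2))) atTop (𝓝 (a * 1)) := by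
    refine ENNReal.Tendsto.const_mul ?_ (Or.inl one_ne_zero)
    have h3 : Tendsto (fun k : ℕ => 1 / ((k : ℝ) + 2)) atTop (𝓝 0) := by
      refine Tendsto.const_div_atTop ?_ _
      exact tendsto_atTop_add_const_right _ _ tendsto_natCast_atTop_atTop
    have h4 : Tendsto (fun e : ℝ => m ^ e) (𝓝 0) (𝓝 (m ^ (0 : ℝ))) := by
      have h5 : ∀ e : ℝ, m ^ e = ENNReal.ofReal (m.toReal ^ e) := fun e => by
        rw [← ENNReal.ofReal_rpow_of_pos (ENNReal.toReal_pos hS0 hSf), ENNReal.ofReal_toReal hSf]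
      simp_rw [h5]
      refine (ENNReal.continuous_ofReal.tendsto _).comp ?_
      exact (Real.continuous_const_rpow (ENNReal.toReal_pos hS0 hSf).ne').tendsto 0
    rw [ENNReal.rpow_zero] at h4
    exact h4.comp h3
  rw [mul_one] at hlim
  rw [← hlim.liminf_eq]
  exact liminf_le_liminf (Eventually.of_forall h1)

/-- The norm of a bounded function `u` in `L^q_t L^r_x` is determined by its pairings with nice
functions. -/
theorem mixedNorm_le_of_pairing {q q' r r' : ℝ≥0∞} (hq1 : 1 < q) (hr1 : 1 < r)
    [hqq : ENNReal.HolderConjugate q q'] [hrr : ENNReal.HolderConjugate r r']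
    (hu : Measurable (Function.uncurry u)) (hM : ∀ t x, ‖u t x‖ ≤ M) {A : ℝ≥0∞}
    (hA : ∀ G : ℝ → Eu n → ℂ, Nice G → ‖∫ t, ∫ x, u t x * G t x‖ₑ ≤ A * mixedNorm q' r' G) :
    mixedNorm q r u ≤ A := by
  classical
  set Y : ℕ → ℝ → ℝ≥0∞ := fun N t =>
    eLpNorm (u t) r (volume.restrict (Metric.closedBall (0 : Eu n) N)) with hYdef
  have hball : ∀ N : ℕ, MeasurableSet (Metric.closedBall (0 : Eu n) (N : ℝ)) := fun N =>
    Metric.isClosed_closedBall.measurableSet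
  have hYind : ∀ N t, Y N t =
      eLpNorm ((Metric.closedBall (0 : Eu n) (N : ℝ)).indicator (u t)) r volume := fun N t =>
    (eLpNorm_indicator_eq_eLpNorm_restrict (hball N)).symm
  have hYm : ∀ N, Measurable (Y N) := fun N => by
    rw [show Y N = _ from funext (hYind N)]
    refine measurable_eLpNorm_slice ?_ r
    have : Function.uncurry (fun t => (Metric.closedBall (0 : Eu n) (N : ℝ)).indicator (u t)) =
        {p : ℝ × Eu n | p.2 ∈ Metric.closedBall (0 : Eu n) (N : ℝ)}.indicator
          (Function.uncurry u) := by
      ext ⟨t, x⟩; simp [indicator, Function.uncurry]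
    rw [this]
    exact hu.indicator (measurable_snd (hball N))
  -- The slice norm over a ball, kept only at bounded times and where it exceeds $1/(N+1)$; these
  -- are the restrictions under which the extremal functions are nice.
  set W : ℕ → ℝ → ℝ≥0∞ := fun N =>
    ({t : ℝ | |t| ≤ N} ∩ {t | ENNReal.ofReal (1 / ((N : ℝ) + 1)) < Y N t}).indicator (Y N) with hW
  have hWm : ∀ N, Measurable (W N) := fun N => (hYm N).indicator
    ((measurableSet_le (by fun_prop) measurable_const).inter
      (measurableSet_lt measurable_const (hYm N)))
  have hWA : ∀ N, eLpNorm (W N) q volume ≤ A := by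
    intro N
    rcases eq_or_ne r ⊤ with rfl | hrt
    · have hr' : r' = 1 := (ENNReal.HolderConjugate.eq_top_iff_eq_one ⊤ r').1 rfl
      subst hr'
      set V := volume (Metric.closedBall (0 : Eu n) (N : ℝ)) with hV
      have hVt : V ≠ ⊤ := volume_closedBall_ne_top N
      have hV0 : V ≠ 0 ∨ V = 0 := (ne_or_eq _ _)
      -- For $r=\infty$ there is no extremal function, so the finite exponents $\rho=k+2$ are used.
      -- Hölder on the ball compares $L^1$ with $L^{\rho'}$ at the cost of a factor
      -- $(1+V)^{1/(k+2)}$, which tends to $1$; adding $1$ to $V$ keeps the base positive.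
      have hk : ∀ k : ℕ, eLpNorm ((goodTimes u (k + 2) N).indicator
          fun t => ENNReal.ofReal (ballNorm u (k + 2) N t)) q volume ≤
          A * (1 + V) ^ (1 / ((k : ℝ) + 2)) := by
        intro k
        have hconj : ((k : ℝ) + 2).HolderConjugate (Real.conjExponent (k + 2)) :=
          Real.HolderConjugate.conjExponent (by have : (0 : ℝ) ≤ k := by positivity
                                                linarith)
        refine eLpNorm_goodTimes_le (q' := q') hq1 hu hM hA hconj N fun f hf hfB => ?_
        have hfind : f = (Metric.closedBall (0 : Eu n) (N : ℝ)).indicator f := by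
          ext x
          by_cases hx : x ∈ Metric.closedBall (0 : Eu n) (N : ℝ)
          · rw [indicator_of_mem hx]
          · rw [indicator_of_notMem hx, hfB x hx]
        rw [hfind, eLpNorm_indicator_eq_eLpNorm_restrict (hball N),
          eLpNorm_indicator_eq_eLpNorm_restrict (hball N)]
        refine (eLpNorm_le_eLpNorm_mul_rpow_measure_univ
          (q := ENNReal.ofReal (Real.conjExponent (k + 2))) ?_ hf.aestronglyMeasurable).trans ?_
        · rw [ENNReal.one_le_ofReal]; exact hconj.symm.lt.le
        · rw [mul_comm, Measure.restrict_apply_univ, ENNReal.toReal_ofReal hconj.symm.pos.le]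
          have e : 1 / (1 : ℝ≥0∞).toReal - 1 / Real.conjExponent ((k : ℝ) + 2) =
              1 / ((k : ℝ) + 2) := by
            have := hconj.inv_add_inv_eq_one
            simp only [one_div, ENNReal.toReal_one, inv_one]
            linarith
          rw [e]
          gcongr
          exact le_add_self
      have hlim : Tendsto (fun k : ℕ => A * (1 + V) ^ (1 / ((k : ℝ) + 2))) atTop (𝓝 (A * 1)) := by
        refine ENNReal.Tendsto.const_mul ?_ (Or.inl one_ne_zero)
        have h3 : Tendsto (fun k : ℕ => 1 / ((k : ℝ) + 2)) atTop (𝓝 0) := by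
          refine Tendsto.const_div_atTop ?_ _
          exact tendsto_atTop_add_const_right _ _ tendsto_natCast_atTop_atTop
        have hm0 : (0 : ℝ) < (1 + V).toReal :=
          ENNReal.toReal_pos (by simp) (ENNReal.add_ne_top.2 ⟨by simp, hVt⟩)
        have h5 : ∀ e : ℝ, (1 + V) ^ e = ENNReal.ofReal ((1 + V).toReal ^ e) := fun e => by
          rw [← ENNReal.ofReal_rpow_of_pos hm0,
            ENNReal.ofReal_toReal (ENNReal.add_ne_top.2 ⟨by simp, hVt⟩)]
        have h4 : Tendsto (fun e : ℝ => (1 + V) ^ e) (𝓝 0) (𝓝 ((1 + V) ^ (0 : ℝ))) := by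
          simp_rw [h5]
          exact (ENNReal.continuous_ofReal.tendsto _).comp
            ((Real.continuous_const_rpow hm0.ne').tendsto 0)
        rw [ENNReal.rpow_zero] at h4
        exact h4.comp h3
      rw [mul_one] at hlim
      rw [← hlim.liminf_eq]
      refine (eLpNorm_le_liminf (F := fun k : ℕ => (goodTimes u (k + 2) N).indicator
        fun t => ENNReal.ofReal (ballNorm u (k + 2) N t)) (fun k => ?_) q ?_).trans
        (liminf_le_liminf (Eventually.of_forall hk))
      · exact (ENNReal.measurable_ofReal.comp (measurable_ballNorm hu _ N)).indicator
          (measurableSet_goodTimes hu _ N)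
      refine ae_of_all _ fun t => ?_
      by_cases ht : t ∈ {t : ℝ | |t| ≤ N} ∩ {t | ENNReal.ofReal (1 / ((N : ℝ) + 1)) < Y N t}
      swap
      · simp only [hW, indicator_of_notMem ht]; exact zero_le
      simp only [hW, indicator_of_mem ht]
      have hl := eLpNorm_top_le_liminf (measurable_slice hu t)
        (volume_closedBall_ne_top (n := n) N)
      have hl' : Y N t ≤ liminf (fun k : ℕ => ENNReal.ofReal (ballNorm u (k + 2) N t)) atTop := by
        refine hl.trans (le_of_eq ?_)
        congr 1; ext k
        rw [ofReal_ballNorm hu hM (by positivity)]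
      refine le_liminf_cut hl' ?_
      filter_upwards [eventually_lt_of_lt_liminf (ht.2.trans_le hl')] with k hk
      rw [indicator_of_mem]
      exact ⟨ht.1, (ENNReal.ofReal_lt_ofReal_iff_of_nonneg (by positivity)).1 hk⟩
    · have hr't : r' ≠ ⊤ := by
        rintro rfl
        have := hrr.symm
        have : r = 1 := (ENNReal.HolderConjugate.eq_top_iff_eq_one ⊤ r).1 rfl
        exact hr1.ne' this
      have hconj := ENNReal.HolderConjugate.toReal_of_ne_top (p := r) (q := r') hrt hr't
      have h := eLpNorm_goodTimes_le (q' := q') hq1 hu hM hA hconj N (c := 1) fun f _ _ => by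
        rw [one_mul, ENNReal.ofReal_toReal hr't]
      rw [mul_one] at h
      refine le_trans (eLpNorm_ennreal_mono q (ae_of_all _ fun t => ?_)) h
      by_cases ht : t ∈ {t : ℝ | |t| ≤ N} ∩ {t | ENNReal.ofReal (1 / ((N : ℝ) + 1)) < Y N t}
      swap
      · simp only [hW, indicator_of_notMem ht]; exact zero_le
      simp only [hW, indicator_of_mem ht]
      have hYb : Y N t = ENNReal.ofReal (ballNorm u r.toReal N t) := by
        rw [ofReal_ballNorm hu hM hconj.pos, ENNReal.ofReal_toReal hrt]
      have h2 := ht.2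
      rw [indicator_of_mem, ← hYb]
      refine ⟨ht.1, ?_⟩
      have h3 : ENNReal.ofReal (1 / ((N : ℝ) + 1)) < Y N t := h2
      rw [hYb] at h3
      exact (ENNReal.ofReal_lt_ofReal_iff_of_nonneg (by positivity)).1 h3
  refine eLpNorm_le_of_liminf hWm (ae_of_all _ fun t => ?_) hWA
  have hYlim : eLpNorm (u t) r volume ≤ liminf (fun N => Y N t) atTop := by
    simp_rw [hYind]
    refine Lp.eLpNorm_lim_le_liminf_eLpNorm
      (fun N => ((measurable_slice hu t).indicator (hball N)).aestronglyMeasurable) _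
      (ae_of_all _ fun x => ?_)
    refine tendsto_const_nhds.congr' ?_
    filter_upwards [eventually_ge_atTop ⌈‖x‖⌉₊] with N hN
    rw [indicator_of_mem]
    simpa using (Nat.le_ceil ‖x‖).trans (by exact_mod_cast hN)
  rcases eq_or_ne (eLpNorm (u t) r volume) 0 with h0 | h0
  · rw [h0]; exact zero_le
  refine le_liminf_cut hYlim ?_
  -- At a time with nonzero slice norm the lower limit of $Y_N(t)$ is positive while the thresholds
  -- $1/(N+1)$ tend to $0$, so the cut is eventually inactive.
  have hpos : (0 : ℝ≥0∞) < liminf (fun N => Y N t) atTop := (pos_iff_ne_zero.2 h0).trans_le hYlim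
  obtain ⟨c, hc0, hc⟩ := exists_between hpos
  have hsmall : Tendsto (fun N : ℕ => ENNReal.ofReal (1 / ((N : ℝ) + 1))) atTop (𝓝 0) := by
    have := (ENNReal.continuous_ofReal.tendsto _).comp
      (tendsto_one_div_add_atTop_nhds_zero_nat (𝕜 := ℝ))
    simpa [Function.comp_def] using this
  filter_upwards [eventually_lt_of_lt_liminf hc, hsmall.eventually_lt_const hc0,
    eventually_ge_atTop ⌈|t|⌉₊] with N hN1 hN2 hN3
  simp only [hW]
  rw [indicator_of_mem]
  exact ⟨(Nat.le_ceil |t|).trans (by exact_mod_cast hN3), hN2.trans hN1⟩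

end Norming


variable {n : ℕ}

/-! ### Symbols on annuli and smooth cutoffs -/

/-- Bounded measurable functions supported in an annulus. -/
structure IsAnn (h : Eu n → ℂ) : Prop where
  meas : Measurable h
  bdd : ∃ M, ∀ ξ, ‖h ξ‖ ≤ M
  supp : ∃ c R : ℝ, 0 < c ∧ ∀ ξ, ‖ξ‖ < c ∨ R < ‖ξ‖ → h ξ = 0

/-- Measurable symbols that are bounded on every annulus. -/
structure AnnBdd (w : Eu n → ℂ) : Prop where
  meas : Measurable w
  bdd : ∀ c R : ℝ, 0 < c → ∃ M, ∀ ξ, c ≤ ‖ξ‖ → ‖ξ‖ ≤ R → ‖w ξ‖ ≤ M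

lemma AnnBdd.mul {w v : Eu n → ℂ} (hw : AnnBdd w) (hv : AnnBdd v) :
    AnnBdd (fun ξ => w ξ * v ξ) := by
  refine ⟨hw.meas.mul hv.meas, fun c R hc => ?_⟩
  obtain ⟨M, hM⟩ := hw.bdd c R hc
  obtain ⟨L, hL⟩ := hv.bdd c R hc
  refine ⟨M * L, fun ξ h1 h2 => ?_⟩
  rw [norm_mul]
  exact mul_le_mul (hM ξ h1 h2) (hL ξ h1 h2) (norm_nonneg _) ((norm_nonneg _).trans (hM ξ h1 h2))

lemma AnnBdd.mul_isAnn {w h : Eu n → ℂ} (hw : AnnBdd w) (hh : IsAnn h) :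
    IsAnn (fun ξ => w ξ * h ξ) := by
  obtain ⟨M, hM⟩ := hh.bdd
  obtain ⟨c, R, hc, hs⟩ := hh.supp
  obtain ⟨L, hL⟩ := hw.bdd c R hc
  refine ⟨hw.meas.mul hh.meas, ⟨max (L * M) 0, fun ξ => ?_⟩, c, R, hc, fun ξ hξ => by
    rw [hs ξ hξ, mul_zero]⟩
  by_cases h1 : ‖ξ‖ < c ∨ R < ‖ξ‖
  · rw [hs ξ h1]; simp
  · push Not at h1
    rw [norm_mul]
    refine le_max_of_le_left ?_
    exact mul_le_mul (hL ξ h1.1 h1.2) (hM ξ) (norm_nonneg _)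
      ((norm_nonneg _).trans (hL ξ h1.1 h1.2))

lemma annBdd_of_bdd {w : Eu n → ℂ} (hw : Measurable w) {M : ℝ} (hM : ∀ ξ, ξ ≠ 0 → ‖w ξ‖ ≤ M) :
    AnnBdd w :=
  ⟨hw, fun _ _ hc => ⟨M, fun ξ h _ => hM ξ (norm_pos_iff.1 (hc.trans_le h))⟩⟩

lemma IsAnn.annBdd {h : Eu n → ℂ} (hh : IsAnn h) : AnnBdd h :=
  let ⟨_, hM⟩ := hh.bdd; annBdd_of_bdd hh.meas fun ξ _ => hM ξ

lemma IsAnn.conj {h : Eu n → ℂ} (hh : IsAnn h) : IsAnn (fun ξ => (starRingEnd ℂ) (h ξ)) := by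
  obtain ⟨M, hM⟩ := hh.bdd
  obtain ⟨c, R, hc, hs⟩ := hh.supp
  exact ⟨Complex.continuous_conj.measurable.comp hh.meas, ⟨M, fun ξ => by simpa using hM ξ⟩,
    c, R, hc, fun ξ hξ => by simp [hs ξ hξ]⟩

lemma AnnBdd.conj {h : Eu n → ℂ} (hh : AnnBdd h) : AnnBdd (fun ξ => (starRingEnd ℂ) (h ξ)) :=
  ⟨Complex.continuous_conj.measurable.comp hh.meas, fun c R hc => by
    simpa using hh.bdd c R hc⟩

lemma IsAnn.sub {h k : Eu n → ℂ} (hh : IsAnn h) (hk : IsAnn k) : IsAnn (fun ξ => h ξ - k ξ) := by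
  obtain ⟨M, hM⟩ := hh.bdd
  obtain ⟨c, R, hc, hs⟩ := hh.supp
  obtain ⟨M', hM'⟩ := hk.bdd
  obtain ⟨c', R', hc', hs'⟩ := hk.supp
  refine ⟨hh.meas.sub hk.meas, ⟨M + M', fun ξ => (norm_sub_le _ _).trans
    (add_le_add (hM ξ) (hM' ξ))⟩, min c c', max R R', lt_min hc hc', fun ξ hξ => ?_⟩
  rw [hs ξ, hs' ξ, sub_zero]
  · rcases hξ with h | h
    · exact Or.inl (h.trans_le (min_le_right _ _))
    · exact Or.inr ((le_max_right _ _).trans_lt h)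
  · rcases hξ with h | h
    · exact Or.inl (h.trans_le (min_le_left _ _))
    · exact Or.inr ((le_max_left _ _).trans_lt h)

lemma memLp_of_bdd_supp {f : Eu n → ℂ} (hf : Measurable f) {M R : ℝ} (hM : ∀ x, ‖f x‖ ≤ M)
    (hR : ∀ x, R < ‖x‖ → f x = 0) (p : ℝ≥0∞) : MemLp f p volume := by
  have h1 : f = (Metric.closedBall (0 : Eu n) R).indicator f := by
    ext x
    by_cases hx : x ∈ Metric.closedBall (0 : Eu n) R
    · rw [indicator_of_mem hx]
    · rw [indicator_of_notMem hx, hR x (by simpa using hx)]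
  rw [h1, memLp_indicator_iff_restrict Metric.isClosed_closedBall.measurableSet]
  have : IsFiniteMeasure (volume.restrict (Metric.closedBall (0 : Eu n) R)) :=
    ⟨by simpa using (isCompact_closedBall (0 : Eu n) R).measure_lt_top⟩
  exact MemLp.of_bound hf.aestronglyMeasurable M (ae_of_all _ hM)

lemma IsAnn.memLp {h : Eu n → ℂ} (hh : IsAnn h) (p : ℝ≥0∞) : MemLp h p volume := by
  obtain ⟨M, hM⟩ := hh.bdd
  obtain ⟨c, R, -, hs⟩ := hh.supp
  exact memLp_of_bdd_supp hh.meas hM (fun x hx => hs x (Or.inr hx)) p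

lemma IsAnn.integrable {h : Eu n → ℂ} (hh : IsAnn h) : Integrable h :=
  memLp_one_iff_integrable.1 (hh.memLp 1)

lemma IsFreqTest.isAnn {θ : Eu n → ℂ} (hθ : IsFreqTest θ) : IsAnn θ := by
  obtain ⟨M, hM⟩ := hθ.smooth.continuous.bounded_above_of_compact_support hθ.compact
  obtain ⟨R, hR⟩ := hθ.compact.isBounded.subset_closedBall (0 : Eu n)
  obtain ⟨c, hc, hcs⟩ := Metric.isOpen_iff.1 (isClosed_tsupport θ).isOpen_compl 0 hθ.away
  refine ⟨hθ.smooth.continuous.measurable, ⟨M, hM⟩, c, R, hc, fun ξ hξ => ?_⟩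
  by_contra h0
  have hmem : ξ ∈ tsupport θ := subset_tsupport θ h0
  rcases hξ with h | h
  · exact hcs (by simpa using h) hmem
  · have := hR hmem
    rw [mem_closedBall_zero_iff] at this
    linarith

/-- A fixed smooth bump function on `ℝⁿ`. -/
noncomputable def etaBump (n : ℕ) : ContDiffBump (0 : Eu n) := ⟨1, 2, one_pos, one_lt_two⟩

/-- The bump function as a complex valued function. -/
noncomputable def eta (ξ : Eu n) : ℂ := ((etaBump n ξ : ℝ) : ℂ)

lemma contDiff_eta : ContDiff ℝ ∞ (eta (n := n)) :=
  Complex.ofRealCLM.contDiff.comp (etaBump n).contDiff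

lemma eta_eq_one {ξ : Eu n} (h : ‖ξ‖ ≤ 1) : etaBump n ξ = 1 :=
  (etaBump n).one_of_mem_closedBall (by simpa [etaBump] using h)

lemma eta_eq_zero {ξ : Eu n} (h : 2 ≤ ‖ξ‖) : etaBump n ξ = 0 :=
  (etaBump n).zero_of_le_dist (by simpa [etaBump] using h)

lemma hasCompactSupport_eta : HasCompactSupport (eta (n := n)) :=
  (etaBump n).hasCompactSupport.comp_left Complex.ofReal_zero

/-- Smooth cutoffs to annuli, exhausting `ℝⁿ ∖ {0}`. -/
noncomputable def cutoff (N : ℕ) (ξ : Eu n) : ℝ :=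
  etaBump n (((N : ℝ) + 2)⁻¹ • ξ) * (1 - etaBump n (((N : ℝ) + 2) • ξ))

lemma cutoff_nonneg (N : ℕ) (ξ : Eu n) : 0 ≤ cutoff N ξ :=
  mul_nonneg (etaBump n).nonneg (sub_nonneg.2 (etaBump n).le_one)

lemma cutoff_le_one (N : ℕ) (ξ : Eu n) : cutoff N ξ ≤ 1 :=
  mul_le_one₀ (etaBump n).le_one (sub_nonneg.2 (etaBump n).le_one)
    (sub_le_self _ (etaBump n).nonneg)

/-- Where the inner bump is nonzero the outer one equals $1$, so the product is a difference. In
this form the $L^1$ norm of its Fourier transform is visibly bounded uniformly in $N$, both terms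
being dilates of `eta`. -/
lemma cutoff_eq_sub (N : ℕ) (ξ : Eu n) : (cutoff N ξ : ℂ) =
    eta (((N : ℝ) + 2)⁻¹ • ξ) - eta (((N : ℝ) + 2) • ξ) := by
  have hN : (0 : ℝ) < (N : ℝ) + 2 := by positivity
  rw [cutoff, eta, eta, ← Complex.ofReal_sub]
  congr 1
  by_cases h : 2 ≤ ‖((N : ℝ) + 2) • ξ‖
  · rw [eta_eq_zero h]; ring
  · push Not at h
    rw [norm_smul, Real.norm_of_nonneg hN.le] at h
    rw [eta_eq_one (ξ := ((N : ℝ) + 2)⁻¹ • ξ)]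
    · ring
    · rw [norm_smul, norm_inv, Real.norm_of_nonneg hN.le, inv_mul_le_iff₀ hN]
      have h0 : (0 : ℝ) ≤ N := by positivity
      nlinarith [norm_nonneg ξ]

lemma cutoff_eq_one {N : ℕ} {ξ : Eu n} (h1 : ‖ξ‖ ≤ (N : ℝ) + 2) (h2 : 2 ≤ ((N : ℝ) + 2) * ‖ξ‖) :
    cutoff N ξ = 1 := by
  have hN : (0 : ℝ) < (N : ℝ) + 2 := by positivity
  rw [cutoff, eta_eq_one, eta_eq_zero]
  · ring
  · rwa [norm_smul, Real.norm_of_nonneg hN.le]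
  · rwa [norm_smul, norm_inv, Real.norm_of_nonneg hN.le, inv_mul_le_iff₀ hN, mul_one]

lemma eventually_cutoff_eq_one {c : ℝ} (hc : 0 < c) (R : ℝ) :
    ∀ᶠ N : ℕ in atTop, ∀ ξ : Eu n, c ≤ ‖ξ‖ → ‖ξ‖ ≤ R → cutoff N ξ = 1 := by
  filter_upwards [eventually_ge_atTop (⌈R⌉₊ + ⌈2 / c⌉₊)] with N hN ξ h1 h2
  have hN' : ((⌈R⌉₊ : ℝ) + ⌈2 / c⌉₊) ≤ N := by exact_mod_cast hN
  have e1 := Nat.le_ceil R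
  have e2 := Nat.le_ceil (2 / c)
  have p1 : (0 : ℝ) ≤ ⌈R⌉₊ := by positivity
  have p2 : (0 : ℝ) ≤ ⌈2 / c⌉₊ := by positivity
  refine cutoff_eq_one (by linarith) ?_
  have h3 : 2 / c ≤ (N : ℝ) + 2 := by linarith
  rw [div_le_iff₀ hc] at h3
  have : (0 : ℝ) ≤ (N : ℝ) + 2 := by positivity
  nlinarith

lemma contDiff_cutoff (N : ℕ) : ContDiff ℝ ∞ (fun ξ : Eu n => (cutoff N ξ : ℂ)) := by
  simp_rw [cutoff_eq_sub]
  exact (contDiff_eta.comp (contDiff_const_smul _)).sub (contDiff_eta.comp (contDiff_const_smul _))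

lemma cutoff_supp (N : ℕ) {ξ : Eu n} (h : ‖ξ‖ < ((N : ℝ) + 2)⁻¹ ∨ 2 * ((N : ℝ) + 2) < ‖ξ‖) :
    cutoff N ξ = 0 := by
  have hN : (0 : ℝ) < (N : ℝ) + 2 := by positivity
  rcases h with h | h
  · rw [cutoff, eta_eq_one (ξ := ((N : ℝ) + 2) • ξ)]
    · ring
    · rw [norm_smul, Real.norm_of_nonneg hN.le]
      have := mul_lt_mul_of_pos_left h hN
      rw [mul_inv_cancel₀ hN.ne'] at this
      exact this.le
  · rw [cutoff, eta_eq_zero, zero_mul]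
    rw [norm_smul, norm_inv, Real.norm_of_nonneg hN.le, le_inv_mul_iff₀ hN]
    linarith


variable {n : ℕ}

/-! ### Fourier transforms of products -/

lemma ftKer_add (x y ξ : Eu n) : ftKer (x + y) ξ = ftKer x ξ * ftKer y ξ := by
  simp only [ftKer]
  rw [← Complex.exp_add, inner_add_left]
  push_cast
  ring_nf

lemma FT_mul_FT {f k : Eu n → ℂ} (hf : Integrable f) (hk : Integrable k) (x : Eu n) :
    FT (fun ξ => k ξ * FT f ξ) x = (ftConst n : ℂ) * ∫ y, FT k (x + y) * f y := by
  rw [FT_def]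
  congr 1
  have := integral_mul_FT (integrable_ftKer_mul hk x) hf
  simp_rw [← mul_assoc, this]
  congr 1; funext y
  rw [FT_def, FT_def]
  congr 3; funext ξ
  rw [ftKer_add]; ring

/-- Up to reflection, $\widehat{k\hat f}$ is a constant times the convolution of $\hat k$ and $f$,
so this is Young's inequality in $L^1$. Nothing is required of $\hat f$ at infinity. -/
lemma lintegral_FT_mul_FT {f k : Eu n → ℂ} (hf : Integrable f) (hfm : Measurable f)
    (hk : Integrable k) :
    ∫⁻ x, ‖FT (fun ξ => k ξ * FT f ξ) x‖ₑ ≤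
      ENNReal.ofReal (ftConst n) * ((∫⁻ x, ‖FT k x‖ₑ) * ∫⁻ y, ‖f y‖ₑ) := by
  have hkc := continuous_FT hk
  have h1 : ∀ x, ‖FT (fun ξ => k ξ * FT f ξ) x‖ₑ ≤
      ENNReal.ofReal (ftConst n) * ∫⁻ y, ‖FT k (x + y)‖ₑ * ‖f y‖ₑ := fun x => by
    rw [FT_mul_FT hf hk, enorm_mul]
    gcongr
    · rw [← ofReal_norm, Complex.norm_real, Real.norm_of_nonneg (ftConst_pos n).le]
    · refine (enorm_integral_le_lintegral_enorm _).trans_eq ?_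
      simp_rw [enorm_mul]
  have hm : Measurable fun p : Eu n × Eu n => ‖FT k (p.1 + p.2)‖ₑ * ‖f p.2‖ₑ :=
    (hkc.comp (by fun_prop : Continuous fun p : Eu n × Eu n => p.1 + p.2)).measurable.enorm.mul
      (hfm.comp measurable_snd).enorm
  refine (lintegral_mono h1).trans ?_
  rw [lintegral_const_mul _ hm.lintegral_prod_right']
  gcongr
  rw [lintegral_lintegral_swap hm.aemeasurable, ← lintegral_const_mul _ hfm.enorm]
  refine lintegral_mono fun y => ?_
  simp only
  have hky : Measurable fun x => ‖FT k (x + y)‖ₑ :=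
    (hkc.comp (by fun_prop : Continuous fun x => x + y)).measurable.enorm
  rw [lintegral_mul_const _ hky, lintegral_add_right_eq_self (fun x => ‖FT k x‖ₑ) y]

lemma conj_FT (f : Eu n → ℂ) (ξ : Eu n) :
    (starRingEnd ℂ) (FT f ξ) = FT (fun y => (starRingEnd ℂ) (f (-y))) ξ := by
  rw [FT_def, FT_def, map_mul, Complex.conj_ofReal, ← integral_conj,
    ← integral_neg_eq_self (fun y => ftKer ξ y * (starRingEnd ℂ) (f (-y)))]
  congr 2; funext y
  rw [map_mul, neg_neg]
  congr 1
  simp only [ftKer]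
  rw [← Complex.exp_conj]
  simp

lemma lintegral_FT_mul_conj_FT {f k : Eu n → ℂ} (hf : Integrable f) (hfm : Measurable f)
    (hk : Integrable k) :
    ∫⁻ x, ‖FT (fun ξ => k ξ * (starRingEnd ℂ) (FT f ξ)) x‖ₑ ≤
      ENNReal.ofReal (ftConst n) * ((∫⁻ x, ‖FT k x‖ₑ) * ∫⁻ y, ‖f y‖ₑ) := by
  simp_rw [conj_FT]
  refine (lintegral_FT_mul_FT (integrable_conj hf.comp_neg)
    (Complex.continuous_conj.measurable.comp (hfm.comp measurable_neg)) hk).trans_eq ?_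
  congr 2
  rw [← lintegral_neg_eq_self (fun y => ‖f y‖ₑ)]
  congr 1; funext y
  rw [← ofReal_norm, ← ofReal_norm, RCLike.norm_conj]

open FourierTransform in
lemma contDiff_FT {f : Eu n → ℂ} (hf : Measurable f) {M R : ℝ} (hM : ∀ x, ‖f x‖ ≤ M)
    (hR : ∀ x, R < ‖x‖ → f x = 0) : ContDiff ℝ ∞ (FT f) := by
  have h1 : ContDiff ℝ ((⊤ : ℕ∞) : WithTop ℕ∞) (𝓕 f) := by
    refine Real.contDiff_fourier fun k _ => ?_
    have h2 : MemLp (fun v : Eu n => ((‖v‖ ^ k : ℝ) : ℂ) * f v) 1 volume := by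
      have hm : Measurable fun v : Eu n => ((‖v‖ ^ k : ℝ) : ℂ) * f v :=
        Measurable.mul (by fun_prop) hf
      refine memLp_of_bdd_supp hm (M := |R| ^ k * M) (R := R)
        (fun x => ?_) (fun x hx => by rw [hR x hx, mul_zero]) 1
      have hM0 : 0 ≤ M := (norm_nonneg _).trans (hM x)
      rw [norm_mul, Complex.norm_real, Real.norm_of_nonneg (by positivity)]
      by_cases hx : R < ‖x‖
      · rw [hR x hx, norm_zero, mul_zero]
        positivity
      · push Not at hx
        gcongr
        · exact hx.trans (le_abs_self R)
        · exact hM x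
    have h3 := (memLp_one_iff_integrable.1 h2).norm
    refine h3.congr (ae_of_all _ fun v => ?_)
    simp
  have h2 : FT f = fun x => (ftConst n : ℂ) * 𝓕 f ((2 * Real.pi)⁻¹ • x) := by
    funext x; exact FT_eq_fourier f x
  rw [h2]
  exact contDiff_const.mul (h1.comp (contDiff_const_smul _))

lemma FT_comp_smul (f : Eu n → ℂ) {a : ℝ} (ha : 0 < a) (x : Eu n) :
    FT (fun ξ => f (a • ξ)) x = (((a ^ n)⁻¹ : ℝ) : ℂ) * FT f (a⁻¹ • x) := by
  rw [FT_def, FT_def]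
  have := Measure.integral_comp_smul (volume : Measure (Eu n))
    (fun ξ => ftKer (a⁻¹ • x) ξ * f ξ) a
  have h3 : Module.finrank ℝ (Eu n) = n := by simp
  rw [h3, abs_of_pos (by positivity), Complex.real_smul] at this
  rw [mul_left_comm, ← this]
  congr 2; funext ξ
  congr 1
  simp only [ftKer, inner_smul_left, inner_smul_right]
  simp only [conj_trivial]
  rw [← mul_assoc, mul_inv_cancel₀ ha.ne', one_mul]

lemma lintegral_FT_comp_smul {f : Eu n → ℂ} (hf : Integrable f) {a : ℝ} (ha : 0 < a) :
    ∫⁻ x, ‖FT (fun ξ => f (a • ξ)) x‖ₑ = ∫⁻ x, ‖FT f x‖ₑ := by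
  simp_rw [FT_comp_smul f ha, enorm_mul]
  have hm := (continuous_FT hf).measurable.enorm
  have hm' : Measurable fun x : Eu n => ‖FT f (a⁻¹ • x)‖ₑ := hm.comp (measurable_const_smul a⁻¹)
  rw [lintegral_const_mul _ hm',
    ← lintegral_map (f := fun y => ‖FT f y‖ₑ) hm (measurable_const_smul a⁻¹),
    Measure.map_addHaar_smul _ (inv_ne_zero ha.ne'), lintegral_smul_measure, smul_eq_mul,
    ← mul_assoc]
  have h3 : Module.finrank ℝ (Eu n) = n := by simp
  rw [h3, ← ofReal_norm, Complex.norm_real, Real.norm_of_nonneg (by positivity),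
    ← ENNReal.ofReal_mul (by positivity), abs_of_pos (by positivity)]
  have : (a ^ n)⁻¹ * (a⁻¹ ^ n)⁻¹ = 1 := by
    rw [inv_pow, inv_inv]; exact inv_mul_cancel₀ (by positivity)
  rw [this]; simp

lemma integrable_eta : Integrable (eta (n := n)) :=
  contDiff_eta.continuous.integrable_of_hasCompactSupport hasCompactSupport_eta

lemma lintegral_FT_eta : ∫⁻ x, ‖FT (eta (n := n)) x‖ₑ ≠ ⊤ := by
  obtain ⟨φ, hφ⟩ := exists_schwartz_FT (contDiff_eta (n := n)) hasCompactSupport_eta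
  simp_rw [← hφ]
  exact φ.integrable.2.ne

/-- The $L^1$ norm of the Fourier transform does not change when the symbol is dilated; hence the
bound does not depend on $N$, which is what permits the cutoff to be removed later. -/
lemma lintegral_FT_cutoff_le (N : ℕ) :
    ∫⁻ x, ‖FT (fun ξ : Eu n => (cutoff N ξ : ℂ)) x‖ₑ ≤ 2 * ∫⁻ x, ‖FT (eta (n := n)) x‖ₑ := by
  have hN : (0 : ℝ) < (N : ℝ) + 2 := by positivity
  have hi : ∀ a : ℝ, 0 < a → Integrable fun ξ : Eu n => eta (a • ξ) := fun a ha =>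
    integrable_eta.comp_smul ha.ne'
  simp_rw [cutoff_eq_sub, FT_sub (hi _ (inv_pos.2 hN)) (hi _ hN)]
  refine (lintegral_mono fun x => enorm_sub_le).trans ?_
  rw [lintegral_add_left (continuous_FT (hi _ (inv_pos.2 hN))).measurable.enorm,
    lintegral_FT_comp_smul integrable_eta (inv_pos.2 hN), lintegral_FT_comp_smul integrable_eta hN,
    two_mul]

/-- Makes products of Fourier transforms of nice functions, which are smooth but do not vanish near
the origin or at infinity, admissible as test functions. -/
lemma isFreqTest_cutoff_mul (N : ℕ) {h : Eu n → ℂ} (hh : ContDiff ℝ ∞ h) :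
    IsFreqTest (fun ξ => (cutoff N ξ : ℂ) * h ξ) := by
  refine ⟨(contDiff_cutoff N).mul hh, ?_, ?_⟩
  · refine HasCompactSupport.intro (isCompact_closedBall (0 : Eu n) (2 * ((N : ℝ) + 2)))
      fun ξ hξ => ?_
    rw [cutoff_supp N (Or.inr (by simpa using hξ))]
    simp
  · rw [notMem_tsupport_iff_eventuallyEq]
    filter_upwards [Metric.ball_mem_nhds (0 : Eu n) (ε := ((N : ℝ) + 2)⁻¹) (by positivity)]
      with ξ hξ
    rw [cutoff_supp N (Or.inl (by simpa using hξ))]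
    simp

lemma isAnn_cutoff (N : ℕ) : IsAnn (fun ξ : Eu n => (cutoff N ξ : ℂ)) := by
  have := (isFreqTest_cutoff_mul (n := n) N (h := fun _ => 1) contDiff_const).isAnn
  simpa using this

/-! ### The unimodular symbols and the spectral integral -/

/-- The symbol `e^{i t ψ(ξ)}`. -/
noncomputable def osc (ψ : Eu n → ℝ) (t : ℝ) (ξ : Eu n) : ℂ :=
  Complex.exp (Complex.I * ((t * ψ ξ : ℝ) : ℂ))

lemma norm_osc (ψ : Eu n → ℝ) (t : ℝ) (ξ : Eu n) : ‖osc ψ t ξ‖ = 1 := by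
  rw [osc, mul_comm, Complex.norm_exp_ofReal_mul_I]

lemma enorm_osc (ψ : Eu n → ℝ) (t : ℝ) (ξ : Eu n) : ‖osc ψ t ξ‖ₑ = 1 := by
  rw [← ofReal_norm, norm_osc, ENNReal.ofReal_one]

lemma osc_add (ψ : Eu n → ℝ) (s t : ℝ) (ξ : Eu n) :
    osc ψ (s + t) ξ = osc ψ s ξ * osc ψ t ξ := by
  simp only [osc]
  rw [← Complex.exp_add]
  push_cast
  ring_nf

lemma conj_osc (ψ : Eu n → ℝ) (t : ℝ) (ξ : Eu n) :
    (starRingEnd ℂ) (osc ψ t ξ) = osc ψ (-t) ξ := by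
  simp only [osc]
  rw [← Complex.exp_conj]
  simp

lemma measurable_osc {ψ : Eu n → ℝ} (hψ : Measurable ψ) :
    Measurable fun p : ℝ × Eu n => osc ψ p.1 p.2 := by
  unfold osc
  have : Measurable fun p : ℝ × Eu n => p.1 * ψ p.2 := measurable_fst.mul (hψ.comp measurable_snd)
  fun_prop

lemma measurable_osc_right {ψ : Eu n → ℝ} (hψ : Measurable ψ) (t : ℝ) : Measurable (osc ψ t) :=
  (measurable_osc hψ).comp measurable_prodMk_left

lemma annBdd_osc {ψ : Eu n → ℝ} (hψ : Measurable ψ) (t : ℝ) : AnnBdd (osc ψ t) :=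
  annBdd_of_bdd (measurable_osc_right hψ t) fun ξ _ => (norm_osc ψ t ξ).le

lemma Nice.memLp {G : ℝ → Eu n → ℂ} (hG : Nice G) (t : ℝ) (p : ℝ≥0∞) : MemLp (G t) p volume := by
  obtain ⟨M, hM⟩ := hG.bdd
  obtain ⟨R, hR⟩ := hG.supp
  exact memLp_of_bdd_supp (measurable_slice hG.meas t) (hM t) (fun x hx => hR t x (Or.inr hx)) p

lemma Nice.integrable {G : ℝ → Eu n → ℂ} (hG : Nice G) (t : ℝ) : Integrable (G t) :=
  memLp_one_iff_integrable.1 (hG.memLp t 1)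

lemma measurable_FT_slice {G : ℝ → Eu n → ℂ} (hG : Measurable (Function.uncurry G)) :
    Measurable fun p : ℝ × Eu n => FT (G p.1) p.2 := by
  have hG' : Measurable fun p : ℝ × Eu n => G p.1 p.2 := hG
  have h : StronglyMeasurable fun p : (ℝ × Eu n) × Eu n => ftKer p.1.2 p.2 * G p.1.1 p.2 := by
    refine Measurable.stronglyMeasurable (Measurable.mul ?_ ?_)
    · exact (continuous_ftKer.comp (by fun_prop :
        Continuous fun p : (ℝ × Eu n) × Eu n => (p.1.2, p.2))).measurable
    · exact hG'.comp (by fun_prop : Measurable fun p : (ℝ × Eu n) × Eu n => (p.1.1, p.2))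
  exact (h.integral_prod_right' (ν := volume)).measurable.const_mul _

lemma Nice.FT_bdd {G : ℝ → Eu n → ℂ} (hG : Nice G) :
    ∃ K R : ℝ, 0 ≤ K ∧ (∀ s ξ, ‖FT (G s) ξ‖ ≤ K) ∧ ∀ s ξ, R < |s| → FT (G s) ξ = 0 := by
  obtain ⟨M, hM⟩ := hG.bdd
  obtain ⟨R, hR⟩ := hG.supp
  have hM0 : 0 ≤ M := (norm_nonneg _).trans (hM 0 0)
  refine ⟨ftConst n * (M * volume.real (Metric.closedBall (0 : Eu n) R)), R,
    mul_nonneg (ftConst_pos n).le (by positivity), fun s ξ => (norm_FT_le _ _).trans ?_,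
    fun s ξ hs => ?_⟩
  · refine mul_le_mul_of_nonneg_left ?_ (ftConst_pos n).le
    have h1 : ∀ x, ‖G s x‖ ≤ (Metric.closedBall (0 : Eu n) R).indicator (fun _ => M) x := by
      intro x
      by_cases hx : x ∈ Metric.closedBall (0 : Eu n) R
      · rw [indicator_of_mem hx]; exact hM s x
      · rw [indicator_of_notMem hx, hR s x (Or.inr (by simpa using hx)), norm_zero]
    have hc : volume (Metric.closedBall (0 : Eu n) R) ≠ ⊤ :=
      (isCompact_closedBall _ _).measure_lt_top.ne
    refine (integral_mono (hG.integrable s).norm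
      ((integrable_indicator_iff Metric.isClosed_closedBall.measurableSet).2
        (integrableOn_const hc)) h1).trans_eq ?_
    rw [integral_indicator Metric.isClosed_closedBall.measurableSet, setIntegral_const, smul_eq_mul,
      mul_comm]
  · have : G s = fun _ => 0 := by funext x; exact hR s x (Or.inl hs)
    rw [FT_def, this]; simp

/-- The integrand of the spectral integral. -/
noncomputable def specKer (ψ : Eu n → ℝ) (G : ℝ → Eu n → ℂ) (s : ℝ) (ξ : Eu n) : ℂ :=
  osc ψ (-s) ξ * FT (G s) ξ

/-- `∫ e^{-i s ψ(ξ)} Ĝ(s, ξ) ds`. -/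
noncomputable def specInt (ψ : Eu n → ℝ) (G : ℝ → Eu n → ℂ) (ξ : Eu n) : ℂ :=
  ∫ s, specKer ψ G s ξ

section
variable {ψ : Eu n → ℝ} {G : ℝ → Eu n → ℂ}

lemma measurable_specKer (hψ : Measurable ψ) (hG : Measurable (Function.uncurry G)) :
    Measurable fun p : ℝ × Eu n => specKer ψ G p.1 p.2 :=
  ((measurable_osc hψ).comp (by fun_prop : Measurable fun p : ℝ × Eu n => (-p.1, p.2))).mul
    (measurable_FT_slice hG)

lemma enorm_specKer (s : ℝ) (ξ : Eu n) : ‖specKer ψ G s ξ‖ₑ = ‖FT (G s) ξ‖ₑ := by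
  rw [specKer, enorm_mul, enorm_osc, one_mul]

lemma norm_specKer (s : ℝ) (ξ : Eu n) : ‖specKer ψ G s ξ‖ = ‖FT (G s) ξ‖ := by
  rw [specKer, norm_mul, norm_osc, one_mul]

lemma Nice.specKer_dom (hG : Nice G) : ∃ κ : ℝ → ℝ, Integrable κ ∧ Measurable κ ∧
    (∀ s, 0 ≤ κ s) ∧ ∀ s ξ, ‖specKer ψ G s ξ‖ ≤ κ s := by
  obtain ⟨K, R, hK, h1, h2⟩ := hG.FT_bdd
  refine ⟨(Icc (-R) R).indicator fun _ => K,
    (integrable_indicator_iff measurableSet_Icc).2 (integrableOn_const (by simp)),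
    measurable_const.indicator measurableSet_Icc, fun s => indicator_nonneg (fun _ _ => hK) s,
    fun s ξ => ?_⟩
  rw [norm_specKer]
  by_cases hs : s ∈ Icc (-R) R
  · rw [indicator_of_mem hs]; exact h1 s ξ
  · rw [indicator_of_notMem hs, h2 s ξ, norm_zero]
    by_contra hcon
    exact hs (abs_le.1 (not_lt.1 hcon))

lemma Nice.integrable_specKer (hψ : Measurable ψ) (hG : Nice G) (ξ : Eu n) :
    Integrable fun s => specKer ψ G s ξ := by
  obtain ⟨κ, h1, -, -, h2⟩ := hG.specKer_dom (ψ := ψ)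
  exact h1.mono' ((measurable_specKer hψ hG.meas).comp measurable_prodMk_right).aestronglyMeasurable
    (ae_of_all _ fun s => h2 s ξ)

lemma measurable_specInt (hψ : Measurable ψ) (hG : Measurable (Function.uncurry G)) :
    Measurable (specInt ψ G) :=
  ((measurable_specKer hψ hG).comp measurable_swap).stronglyMeasurable.integral_prod_right'
    (ν := volume) |>.measurable

/-- The endpoint $r=2$. The unimodular factors disappear in absolute value; expanding the square,
Cauchy-Schwarz in $\xi$ and Plancherel for each pair $(s,t)$ leave a product of two equal time
integrals. -/
lemma lintegral_specInt_sq_le (hG : Nice G) :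
    ∫⁻ ξ, ‖specInt ψ G ξ‖ₑ ^ 2 ≤ (∫⁻ s, eLpNorm (G s) 2 volume) ^ 2 := by
  have hFm := measurable_FT_slice hG.meas
  have h1 : ∀ ξ, ‖specInt ψ G ξ‖ₑ ^ 2 ≤ ∫⁻ s, ∫⁻ t, ‖FT (G s) ξ‖ₑ * ‖FT (G t) ξ‖ₑ := fun ξ => by
    have h2 : ‖specInt ψ G ξ‖ₑ ≤ ∫⁻ s, ‖FT (G s) ξ‖ₑ :=
      (enorm_integral_le_lintegral_enorm _).trans_eq (by simp_rw [enorm_specKer])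
    have hm : Measurable fun s => ‖FT (G s) ξ‖ₑ := (hFm.comp measurable_prodMk_right).enorm
    simp_rw [lintegral_const_mul _ hm]
    rw [lintegral_mul_const _ hm, ← sq]
    gcongr
  refine (lintegral_mono h1).trans ?_
  have hm3 : Measurable fun p : (Eu n × ℝ) × ℝ => ‖FT (G p.1.2) p.1.1‖ₑ * ‖FT (G p.2) p.1.1‖ₑ :=
    (hFm.comp (by fun_prop : Measurable fun p : (Eu n × ℝ) × ℝ => (p.1.2, p.1.1))).enorm.mul
      (hFm.comp (by fun_prop : Measurable fun p : (Eu n × ℝ) × ℝ => (p.2, p.1.1))).enorm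
  have hm5 : Measurable (Function.uncurry fun (ξ : Eu n) (s : ℝ) =>
      ∫⁻ t, ‖FT (G s) ξ‖ₑ * ‖FT (G t) ξ‖ₑ) := hm3.lintegral_prod_right'
  rw [lintegral_lintegral_swap hm5.aemeasurable]
  have hnm := measurable_eLpNorm_slice hG.meas 2
  rw [sq, ← lintegral_mul_const _ hnm]
  refine lintegral_mono fun s => ?_
  have hm4 : Measurable (Function.uncurry fun (ξ : Eu n) (t : ℝ) =>
      ‖FT (G s) ξ‖ₑ * ‖FT (G t) ξ‖ₑ) :=
    hm3.comp (f := fun p : Eu n × ℝ => ((p.1, s), p.2)) (by fun_prop)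
  rw [lintegral_lintegral_swap hm4.aemeasurable, ← lintegral_const_mul _ hnm]
  refine lintegral_mono fun t => ?_
  have hs : Measurable fun ξ => ‖FT (G s) ξ‖ₑ := (hFm.comp measurable_prodMk_left).enorm
  have ht : Measurable fun ξ => ‖FT (G t) ξ‖ₑ := (hFm.comp measurable_prodMk_left).enorm
  have key := lintegral_mul_le_eLpNorm (p := 2) (p' := 2) (μ := (volume : Measure (Eu n))) hs ht
  rwa [eLpNorm_enorm, eLpNorm_enorm, eLpNorm_FT (hG.integrable s) (hG.memLp s 2),
    eLpNorm_FT (hG.integrable t) (hG.memLp t 2)] at key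

end


variable {n : ℕ}

/-! ### The dispersive bound in quadratic form -/

lemma Nice.contDiff_FT {G : ℝ → Eu n → ℂ} (hG : Nice G) (s : ℝ) : ContDiff ℝ ∞ (FT (G s)) := by
  obtain ⟨M, hM⟩ := hG.bdd
  obtain ⟨R, hR⟩ := hG.supp
  exact Strichartz.contDiff_FT (measurable_slice hG.meas s) (hM s) fun x hx => hR s x (Or.inr hx)

/-- The constant in the quadratic dispersive bound. -/
noncomputable def dispConst (n : ℕ) : ℝ≥0∞ :=
  ENNReal.ofReal (ftConst n) * (ENNReal.ofReal (ftConst n) *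
    (2 * ∫⁻ x, ‖FT (eta (n := n)) x‖ₑ))

lemma dispConst_ne_top : dispConst n ≠ ⊤ :=
  ENNReal.mul_ne_top ENNReal.ofReal_ne_top (ENNReal.mul_ne_top ENNReal.ofReal_ne_top
    (ENNReal.mul_ne_top (by simp) lintegral_FT_eta))

/-- Young's inequality is applied twice, once for each factor. The bound by $\|f\|_1\|h\|_1$,
uniform in $N$, is the $L^1\times L^1$ side of the dispersive estimate. -/
lemma lintegral_FT_cutoff_mul_le (N : ℕ) {f h : Eu n → ℂ} (hf : Integrable f) (hfm : Measurable f)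
    (hh : Integrable h) (hhm : Measurable h) :
    ∫⁻ x, ‖FT (fun ξ => (cutoff N ξ : ℂ) * (FT f ξ * (starRingEnd ℂ) (FT h ξ))) x‖ₑ ≤
      dispConst n * ((∫⁻ x, ‖f x‖ₑ) * ∫⁻ x, ‖h x‖ₑ) := by
  have hk : Integrable fun ξ : Eu n => (cutoff N ξ : ℂ) * FT f ξ := by
    refine (isAnn_cutoff N).integrable.mul_bdd (c := ftConst n * ∫ x, ‖f x‖)
      (continuous_FT hf).aestronglyMeasurable (ae_of_all _ fun ξ => norm_FT_le f ξ)
  simp_rw [← mul_assoc]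
  refine (lintegral_FT_mul_conj_FT hh hhm hk).trans ?_
  have h1 := lintegral_FT_mul_FT hf hfm (isAnn_cutoff (n := n) N).integrable
  have h2 := lintegral_FT_cutoff_le (n := n) N
  calc _ ≤ ENNReal.ofReal (ftConst n) * ((ENNReal.ofReal (ftConst n) *
        ((2 * ∫⁻ x, ‖FT (eta (n := n)) x‖ₑ) * ∫⁻ y, ‖f y‖ₑ)) * ∫⁻ y, ‖h y‖ₑ) := by
        gcongr
        exact h1.trans (by gcongr)
    _ = _ := by rw [dispConst]; ring

variable {ψ : Eu n → ℝ} {m : Eu n → ℝ}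

lemma specInt_mul_conj (G : ℝ → Eu n → ℂ) (ξ : Eu n) :
    specInt ψ G ξ * (starRingEnd ℂ) (specInt ψ G ξ) =
      ∫ z : ℝ × ℝ, specKer ψ G z.1 ξ * (starRingEnd ℂ) (specKer ψ G z.2 ξ) := by
  have h := integral_prod_mul (μ := (volume : Measure ℝ)) (ν := (volume : Measure ℝ))
    (fun s => specKer ψ G s ξ) (fun s => (starRingEnd ℂ) (specKer ψ G s ξ))
  rw [integral_conj] at h
  exact h.symm

lemma measurable_mul_riesz {f : ℝ → ℝ≥0∞} (hf : Measurable f) (κ : ℝ) :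
    Measurable fun p : ℝ × ℝ => f p.1 * f p.2 * riesz κ (p.1 - p.2) :=
  ((hf.comp measurable_fst).mul (hf.comp measurable_snd)).mul
    ((measurable_riesz κ).comp (measurable_fst.sub measurable_snd))

/-- The kernel bound holds only for $t\ne s$, and the diagonal is a null set. -/
lemma lintegral_prod_le_riesz {f : ℝ → ℝ≥0∞} (hf : Measurable f) (κ : ℝ) (c : ℝ≥0∞)
    {F : ℝ × ℝ → ℝ≥0∞} (hF : Measurable F)
    (h : ∀ t s, t ≠ s → F (s, t) ≤ c * (f t * f s * riesz κ (t - s))) :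
    ∫⁻ z, F z ≤ c * ∫⁻ t, ∫⁻ s, f t * f s * riesz κ (t - s) := by
  have hm2 := measurable_mul_riesz hf κ
  have hm3 : ∀ t, Measurable fun s => f t * f s * riesz κ (t - s) := fun t =>
    hm2.comp measurable_prodMk_left
  have hm4 : Measurable fun t => ∫⁻ s, f t * f s * riesz κ (t - s) := hm2.lintegral_prod_right'
  rw [Measure.volume_eq_prod, lintegral_prod_symm _ hF.aemeasurable, ← lintegral_const_mul _ hm4]
  refine lintegral_mono fun t => ?_
  rw [← lintegral_const_mul _ (hm3 t)]
  refine lintegral_mono_ae ?_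
  filter_upwards [compl_mem_ae_iff.2 (measure_singleton (μ := (volume : Measure ℝ)) t)] with s hs
  exact h t s fun hcon => hs (by simp [hcon])

/-- The $TT^*$ computation. Expanding $|Z|^2$ and exchanging integrals leaves, for each $(s,t)$, the
symbol $e^{i(t-s)\psi}m$ tested against $\hat G(s)\overline{\hat G(t)}$ times the cutoff, to which
the dispersive hypothesis applies. -/
lemma enorm_cutoff_specInt_le (hψ : Measurable ψ) (hm0 : ∀ ξ, 0 ≤ m ξ)
    (hm : AnnBdd (fun ξ => (m ξ : ℂ))) {κ : ℝ} {Λ : ℝ≥0∞}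
    (hK : ∀ t, t ≠ 0 → ∀ θ : Eu n → ℂ, IsFreqTest θ →
      ‖∫ ξ, osc ψ t ξ * (m ξ : ℂ) * θ ξ‖ₑ ≤ Λ * riesz κ t * ∫⁻ x, ‖FT θ x‖ₑ)
    {G : ℝ → Eu n → ℂ} (hG : Nice G) (N : ℕ) :
    ∫⁻ ξ, ENNReal.ofReal (cutoff N ξ) * (ENNReal.ofReal (m ξ) * ‖specInt ψ G ξ‖ₑ ^ 2) ≤
      dispConst n * Λ * ∫⁻ t, ∫⁻ s,
        eLpNorm (G t) 1 volume * eLpNorm (G s) 1 volume * riesz κ (t - s) := by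
  set h : Eu n → ℂ := fun ξ => (m ξ : ℂ) * (cutoff N ξ : ℂ) with hh
  have hann : IsAnn h := hm.mul_isAnn (isAnn_cutoff N)
  set Z := specInt ψ G with hZ
  obtain ⟨κ₁, hκi, hκm, hκ0, hκb⟩ := hG.specKer_dom (ψ := ψ)
  have hkm := measurable_specKer hψ hG.meas
  -- the triple integrand
  set T : Eu n → ℝ × ℝ → ℂ := fun ξ z =>
    h ξ * (specKer ψ G z.1 ξ * (starRingEnd ℂ) (specKer ψ G z.2 ξ)) with hT
  have hTm : Measurable (Function.uncurry T) := by
    have e1 : Measurable fun p : Eu n × ℝ × ℝ => specKer ψ G p.2.1 p.1 :=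
      hkm.comp (f := fun p : Eu n × ℝ × ℝ => (p.2.1, p.1)) (by fun_prop)
    have e2 : Measurable fun p : Eu n × ℝ × ℝ => specKer ψ G p.2.2 p.1 :=
      hkm.comp (f := fun p : Eu n × ℝ × ℝ => (p.2.2, p.1)) (by fun_prop)
    exact (hann.meas.comp measurable_fst).mul
      (e1.mul (Complex.continuous_conj.measurable.comp e2))
  have hTi : Integrable (Function.uncurry T) (volume.prod (volume : Measure (ℝ × ℝ))) := by
    refine (hann.integrable.norm.mul_prod (hκi.mul_prod hκi)).mono' hTm.aestronglyMeasurable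
      (ae_of_all _ fun p => ?_)
    simp only [Function.uncurry, hT, norm_mul, RCLike.norm_conj]
    gcongr
    · exact hκ0 _
    · exact hκb _ _
    · exact hκb _ _
  have hswap := integral_integral_swap hTi
  have hlhs : ∀ ξ, ∫ z, T ξ z = ((m ξ * cutoff N ξ * ‖Z ξ‖ ^ 2 : ℝ) : ℂ) := fun ξ => by
    simp only [hT]
    rw [integral_const_mul, ← specInt_mul_conj, Complex.mul_conj, Complex.normSq_eq_norm_sq, hh]
    push_cast
    ring
  have hnn : ∀ ξ, 0 ≤ m ξ * cutoff N ξ * ‖Z ξ‖ ^ 2 := fun ξ =>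
    mul_nonneg (mul_nonneg (hm0 ξ) (cutoff_nonneg N ξ)) (by positivity)
  have hint : Integrable fun ξ => m ξ * cutoff N ξ * ‖Z ξ‖ ^ 2 := by
    have := hTi.integral_prod_left
    simp only [Function.uncurry, hlhs] at this
    exact this.re.congr (ae_of_all _ fun ξ => Complex.ofReal_re _)
  have h1 : ∫⁻ ξ, ENNReal.ofReal (cutoff N ξ) * (ENNReal.ofReal (m ξ) * ‖Z ξ‖ₑ ^ 2) =
      ‖∫ ξ, ∫ z, T ξ z‖ₑ := by
    simp_rw [hlhs]
    rw [integral_complex_ofReal, ← ofReal_norm, Complex.norm_real,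
      Real.norm_of_nonneg (integral_nonneg hnn),
      ofReal_integral_eq_lintegral_ofReal hint (ae_of_all _ hnn)]
    congr 1; funext ξ
    rw [ENNReal.ofReal_mul (mul_nonneg (hm0 ξ) (cutoff_nonneg N ξ)), ENNReal.ofReal_mul (hm0 ξ),
      ENNReal.ofReal_pow (norm_nonneg _), ofReal_norm]
    ring
  have h2 : ∀ t s : ℝ, t ≠ s → ‖∫ ξ, T ξ (s, t)‖ₑ ≤ dispConst n * Λ *
      (eLpNorm (G t) 1 volume * eLpNorm (G s) 1 volume * riesz κ (t - s)) := fun t s hts => by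
    have hθ := isFreqTest_cutoff_mul N ((hG.contDiff_FT s).mul
      (Complex.conjCLE.contDiff.comp (hG.contDiff_FT t)))
    have h3 := hK (t - s) (sub_ne_zero.2 hts) _ hθ
    have h4 := lintegral_FT_cutoff_mul_le N (hG.integrable s) (measurable_slice hG.meas s)
      (hG.integrable t) (measurable_slice hG.meas t)
    have e : ∫ ξ, T ξ (s, t) = ∫ ξ, osc ψ (t - s) ξ * (m ξ : ℂ) *
        ((cutoff N ξ : ℂ) * (FT (G s) ξ * (starRingEnd ℂ) (FT (G t) ξ))) := by
      congr 1; funext ξ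
      simp only [hT, hh, specKer, map_mul, conj_osc, neg_neg]
      rw [sub_eq_add_neg, osc_add]
      ring
    rw [e]
    refine h3.trans ((mul_le_mul_right h4 _).trans_eq ?_)
    rw [eLpNorm_one_eq_lintegral_enorm, eLpNorm_one_eq_lintegral_enorm]
    ring
  rw [h1, hswap]
  clear_value T h Z
  refine (enorm_integral_le_lintegral_enorm _).trans ?_
  have hm1 : Measurable fun z : ℝ × ℝ => ‖∫ ξ, T ξ z‖ₑ :=
    ((hTm.comp measurable_swap).stronglyMeasurable.integral_prod_right'
      (ν := volume)).measurable.enorm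
  exact lintegral_prod_le_riesz (measurable_eLpNorm_slice hG.meas 1) κ _ hm1 h2

/-- The cutoffs converge to $1$ away from the origin, a null set since $n>0$, and the integrand is
nonnegative, so Fatou removes them from the uniform bound. -/
theorem lintegral_mul_specInt_sq_le (hn : 0 < n) (hψ : Measurable ψ) (hm0 : ∀ ξ, 0 ≤ m ξ)
    (hm : AnnBdd (fun ξ => (m ξ : ℂ))) {κ : ℝ} {Λ : ℝ≥0∞}
    (hK : ∀ t, t ≠ 0 → ∀ θ : Eu n → ℂ, IsFreqTest θ →
      ‖∫ ξ, osc ψ t ξ * (m ξ : ℂ) * θ ξ‖ₑ ≤ Λ * riesz κ t * ∫⁻ x, ‖FT θ x‖ₑ)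
    {G : ℝ → Eu n → ℂ} (hG : Nice G) :
    ∫⁻ ξ, ENNReal.ofReal (m ξ) * ‖specInt ψ G ξ‖ₑ ^ 2 ≤
      dispConst n * Λ * ∫⁻ t, ∫⁻ s,
        eLpNorm (G t) 1 volume * eLpNorm (G s) 1 volume * riesz κ (t - s) := by
  have : Nonempty (Fin n) := ⟨⟨0, hn⟩⟩
  have hmm : Measurable m := by
    have := Complex.measurable_re.comp hm.meas
    simpa [Function.comp_def] using this
  have hZm := measurable_specInt hψ hG.meas
  have hF : ∀ N : ℕ, Measurable fun ξ : Eu n =>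
      ENNReal.ofReal (cutoff N ξ) * (ENNReal.ofReal (m ξ) * ‖specInt ψ G ξ‖ₑ ^ 2) := fun N => by
    have hc : Measurable fun ξ : Eu n => cutoff N ξ := by
      have := Complex.measurable_re.comp (isAnn_cutoff (n := n) N).meas
      simpa [Function.comp_def] using this
    exact hc.ennreal_ofReal.mul (hmm.ennreal_ofReal.mul (hZm.enorm.pow_const 2))
  have hlim : liminf (fun N : ℕ => ∫⁻ ξ, ENNReal.ofReal (cutoff N ξ) *
      (ENNReal.ofReal (m ξ) * ‖specInt ψ G ξ‖ₑ ^ 2)) atTop ≤ dispConst n * Λ * ∫⁻ t, ∫⁻ s,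
        eLpNorm (G t) 1 volume * eLpNorm (G s) 1 volume * riesz κ (t - s) :=
    (liminf_le_liminf (Eventually.of_forall fun N =>
      enorm_cutoff_specInt_le hψ hm0 hm hK hG N)).trans_eq (liminf_const _)
  refine le_trans (lintegral_mono_ae ?_) ((lintegral_liminf_le hF).trans hlim)
  filter_upwards [compl_mem_ae_iff.2 (measure_singleton (μ := (volume : Measure (Eu n))) 0)]
    with ξ hξ
  have h1 : (fun N => ENNReal.ofReal (cutoff N ξ) *
      (ENNReal.ofReal (m ξ) * ‖specInt ψ G ξ‖ₑ ^ 2)) =ᶠ[atTop] fun _ =>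
      ENNReal.ofReal (m ξ) * ‖specInt ψ G ξ‖ₑ ^ 2 := by
    filter_upwards [eventually_cutoff_eq_one (n := n) (norm_pos_iff.2 hξ) ‖ξ‖] with N hN
    rw [hN ξ le_rfl le_rfl, ENNReal.ofReal_one, one_mul]
  rw [liminf_congr h1]
  simp


variable {n : ℕ}

/-! ### Real interpolation -/

lemma eLpNorm_two_sq {α E : Type*} [MeasurableSpace α] {μ : Measure α} [TopologicalSpace E]
    [ContinuousENorm E] (f : α → E) :
    eLpNorm f 2 μ ^ 2 = ∫⁻ x, ‖f x‖ₑ ^ 2 ∂μ := by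
  rw [eLpNorm_eq_lintegral_rpow_enorm_toReal (by simp) (by simp), ← ENNReal.rpow_natCast,
    ← ENNReal.rpow_mul]
  simp

lemma eLpNorm_rpow_self {α E : Type*} [MeasurableSpace α] {μ : Measure α} [TopologicalSpace E]
    [ContinuousENorm E] (f : α → E) {R : ℝ} (hR : 0 < R) :
    eLpNorm f (ENNReal.ofReal R) μ ^ R = ∫⁻ x, ‖f x‖ₑ ^ R ∂μ := by
  rw [eLpNorm_eq_lintegral_rpow_enorm_toReal (by simpa using hR) (by simp),
    ENNReal.toReal_ofReal hR.le, ← ENNReal.rpow_mul, one_div_mul_cancel hR.ne', ENNReal.rpow_one]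

lemma ENNReal.le_of_sq_le_sq {a b : ℝ≥0∞} (h : a ^ 2 ≤ b ^ 2) : a ≤ b :=
  (ENNReal.pow_le_pow_left_iff two_ne_zero).1 h

/-- Cauchy–Schwarz in the parameter of a family of quadratic forms. -/
lemma lintegral_quadratic_le {α : Type*} [MeasurableSpace α] {ν : Measure α} [SFinite ν]
    {μ : Measure ℝ} [SFinite μ] {a : ℝ → α → ℝ≥0∞} (ha : Measurable (Function.uncurry a))
    {b : α → ℝ≥0∞} (hb : ∀ t, eLpNorm (fun l => a l t) 2 μ ≤ b t)
    {k : α → α → ℝ≥0∞} (hk : Measurable (Function.uncurry k)) :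
    ∫⁻ l, ∫⁻ t, ∫⁻ s, a l t * a l s * k t s ∂ν ∂ν ∂μ ≤ ∫⁻ t, ∫⁻ s, b t * b s * k t s ∂ν ∂ν := by
  have h3 : Measurable fun p : (ℝ × α) × α => a p.1.1 p.1.2 * a p.1.1 p.2 * k p.1.2 p.2 := by
    have e1 : Measurable fun p : (ℝ × α) × α => a p.1.1 p.1.2 :=
      ha.comp (f := fun p : (ℝ × α) × α => p.1) (by fun_prop)
    have e2 : Measurable fun p : (ℝ × α) × α => a p.1.1 p.2 :=
      ha.comp (f := fun p : (ℝ × α) × α => (p.1.1, p.2)) (by fun_prop)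
    have e3 : Measurable fun p : (ℝ × α) × α => k p.1.2 p.2 :=
      hk.comp (f := fun p : (ℝ × α) × α => (p.1.2, p.2)) (by fun_prop)
    exact (e1.mul e2).mul e3
  have h4 : Measurable (Function.uncurry fun (l : ℝ) (t : α) =>
      ∫⁻ s, a l t * a l s * k t s ∂ν) := h3.lintegral_prod_right'
  rw [lintegral_lintegral_swap h4.aemeasurable]
  refine lintegral_mono fun t => ?_
  have h5 : Measurable (Function.uncurry fun (l : ℝ) (s : α) => a l t * a l s * k t s) :=
    h3.comp (f := fun p : ℝ × α => ((p.1, t), p.2)) (by fun_prop)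
  rw [lintegral_lintegral_swap h5.aemeasurable]
  refine lintegral_mono fun s => ?_
  have m1 : ∀ t, Measurable fun l => a l t := fun t => ha.comp measurable_prodMk_right
  have m2 : Measurable fun l => a l t * a l s := (m1 t).mul (m1 s)
  rw [lintegral_mul_const _ m2]
  gcongr
  exact (lintegral_mul_le_eLpNorm (p := 2) (p' := 2) (m1 t) (m1 s)).trans
    (mul_le_mul' (hb t) (hb s))

lemma lintegral_lintegral_mul_self {α : Type*} [MeasurableSpace α] {ν : Measure α}
    {f : α → ℝ≥0∞} (hf : Measurable f) : ∫⁻ t, ∫⁻ s, f t * f s ∂ν ∂ν = (∫⁻ t, f t ∂ν) ^ 2 := by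
  simp_rw [lintegral_const_mul _ hf]
  rw [lintegral_mul_const _ hf, sq]

/-- Minkowski's inequality in `L²`. -/
lemma lintegral_sq_lintegral_le {α : Type*} [MeasurableSpace α] {ν : Measure α} [SFinite ν]
    {μ : Measure ℝ} [SFinite μ] {a : ℝ → α → ℝ≥0∞} (ha : Measurable (Function.uncurry a))
    {b : α → ℝ≥0∞} (hbm : Measurable b) (hb : ∀ t, eLpNorm (fun l => a l t) 2 μ ≤ b t) :
    ∫⁻ l, (∫⁻ t, a l t ∂ν) ^ 2 ∂μ ≤ (∫⁻ t, b t ∂ν) ^ 2 := by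
  have h := lintegral_quadratic_le (ν := ν) ha hb (k := fun _ _ => 1) measurable_const
  simp only [mul_one] at h
  rw [lintegral_lintegral_mul_self hbm] at h
  refine le_trans (le_of_eq ?_) h
  congr 1; funext l
  exact (lintegral_lintegral_mul_self (ha.comp measurable_prodMk_left)).symm

/-- The measure `λ^a dλ` on the half line. -/
noncomputable def powMeasure (a : ℝ) : Measure ℝ :=
  (volume.restrict (Ioi 0)).withDensity fun l => ENNReal.ofReal (l ^ a)

noncomputable instance (a : ℝ) : SFinite (powMeasure a) := by unfold powMeasure; infer_instance

lemma lintegral_powMeasure (a : ℝ) {f : ℝ → ℝ≥0∞} (hf : Measurable f) :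
    ∫⁻ l, f l ∂(powMeasure a) = ∫⁻ l in Ioi 0, ENNReal.ofReal (l ^ a) * f l := by
  rw [powMeasure, lintegral_withDensity_eq_lintegral_mul _ (by fun_prop) hf]
  rfl

lemma ae_powMeasure (a : ℝ) : ∀ᵐ l ∂(powMeasure a), 0 < l :=
  (withDensity_absolutelyContinuous _ _).ae_le (ae_restrict_mem measurableSet_Ioi)

section pointwise
variable {θ : ℝ}

/-- The threshold comparison for the splitting at height `c λ^((1+θ)/2)`. -/
lemma le_mul_rpow_iff {y c l : ℝ} (h0 : 0 < θ) (hy : 0 < y) (hc : 0 < c) (hl : 0 < l) :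
    y ≤ c * l ^ ((1 + θ) / 2) ↔ (y / c) ^ (2 / (1 + θ)) ≤ l := by
  have h1 : 0 < 2 / (1 + θ) := by positivity
  have h2 : (l ^ ((1 + θ) / 2)) ^ (2 / (1 + θ)) = l := by
    rw [← Real.rpow_mul hl.le, show (1 + θ) / 2 * (2 / (1 + θ)) = 1 by field_simp, Real.rpow_one]
  rw [mul_comm, ← div_le_iff₀ hc]
  conv_rhs => rw [← h2]
  exact (Real.rpow_le_rpow_iff (by positivity) (by positivity) h1).symm

open Classical in
-- A value $y$ counts as low exactly for $\lambda\ge L=(y/c)^{2/(1+\theta)}$, and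
-- $y^2\int_L^\infty\lambda^{-\theta-1}d\lambda=y^2L^{-\theta}/\theta$. The exponent $(1+\theta)/2$
-- of the height makes this a multiple of $y^{2/(1+\theta)}=y^{r'}$.
lemma lintegral_low_le {y c : ℝ} (h0 : 0 < θ) (hy : 0 ≤ y) (hc : 0 < c) :
    ∫⁻ l, (if y ≤ c * l ^ ((1 + θ) / 2) then ENNReal.ofReal y else 0) ^ 2 ∂(powMeasure (-θ - 1)) ≤
      ENNReal.ofReal (1 / θ * c ^ (2 * θ / (1 + θ)) * y ^ (2 / (1 + θ))) := by
  rcases hy.eq_or_lt with h | h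
  · simp [← h]
  set L := (y / c) ^ (2 / (1 + θ)) with hL
  have hL0 : 0 < L := by positivity
  have hm : Measurable fun l : ℝ =>
      (if y ≤ c * l ^ ((1 + θ) / 2) then ENNReal.ofReal y else 0) ^ 2 :=
    (Measurable.ite (measurableSet_le measurable_const (by fun_prop)) measurable_const
      measurable_const).pow_const 2
  rw [lintegral_powMeasure _ hm]
  have h1 : ∀ l ∈ Ioi (0 : ℝ), ENNReal.ofReal (l ^ (-θ - 1)) *
      (if y ≤ c * l ^ ((1 + θ) / 2) then ENNReal.ofReal y else 0) ^ 2 =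
      (Ici L).indicator (fun l => ENNReal.ofReal (y ^ 2) * ENNReal.ofReal (l ^ (-θ - 1))) l := by
    intro l hl
    by_cases hl2 : L ≤ l
    · rw [if_pos ((le_mul_rpow_iff h0 h hc hl).2 hl2), indicator_of_mem (by exact hl2),
        ENNReal.ofReal_pow hy, mul_comm]
    · rw [if_neg (fun hcon => hl2 ((le_mul_rpow_iff h0 h hc hl).1 hcon)),
        indicator_of_notMem (by exact hl2)]
      simp
  rw [setLIntegral_congr_fun measurableSet_Ioi h1, lintegral_indicator measurableSet_Ici,
    Measure.restrict_restrict measurableSet_Ici, lintegral_const_mul _ (by fun_prop)]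
  have h2 : Ici L ∩ Ioi 0 = Ici L := inter_eq_left.2 fun x hx => hL0.trans_le hx
  rw [h2, setLIntegral_congr Ioi_ae_eq_Ici.symm, lintegral_Ioi_rpow (by linarith) hL0,
    ← ENNReal.ofReal_mul (by positivity)]
  apply le_of_eq
  congr 1
  have e : (-L ^ (-θ - 1 + 1) / (-θ - 1 + 1)) = 1 / θ * L ^ (-θ) := by
    rw [show -θ - 1 + 1 = -θ by ring]; field_simp
  rw [e, hL, ← Real.rpow_mul (by positivity), Real.div_rpow hy hc.le, ← Real.rpow_natCast y 2]
  rw [show c ^ (2 * θ / (1 + θ)) = (c ^ (2 / (1 + θ) * -θ))⁻¹ by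
    rw [← Real.rpow_neg hc.le]; congr 1; ring]
  have e2 : y ^ (2 / (1 + θ)) = y ^ ((2 : ℕ) : ℝ) * y ^ (2 / (1 + θ) * -θ) := by
    rw [← Real.rpow_add h]; congr 1; push_cast; field_simp; ring
  rw [e2]
  ring

open Classical in
-- Here $\lambda$ runs over $(0,L)$, and $y^2L^{1-\theta}/(1-\theta)$ is a multiple of
-- $(y^{2/(1+\theta)})^2$: the same power of $y$ as for the low part, squared because the high part
-- is taken in $L^2$ in $\lambda$ of an $L^1$ norm in $x$.
lemma lintegral_high_le {y c : ℝ} (h0 : 0 < θ) (hθ1 : θ < 1) (hy : 0 ≤ y) (hc : 0 < c) :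
    ∫⁻ l, (if y ≤ c * l ^ ((1 + θ) / 2) then 0 else ENNReal.ofReal y) ^ 2 ∂(powMeasure (-θ)) ≤
      ENNReal.ofReal (1 / (1 - θ) * (c ^ (-(1 - θ) / (1 + θ)) * y ^ (2 / (1 + θ))) ^ 2) := by
  rcases hy.eq_or_lt with h | h
  · simp [← h]
  set L := (y / c) ^ (2 / (1 + θ)) with hL
  have hL0 : 0 < L := by positivity
  have h1θ : 0 < 1 - θ := by linarith
  have hm : Measurable fun l : ℝ =>
      (if y ≤ c * l ^ ((1 + θ) / 2) then 0 else ENNReal.ofReal y) ^ 2 :=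
    (Measurable.ite (measurableSet_le measurable_const (by fun_prop)) measurable_const
      measurable_const).pow_const 2
  rw [lintegral_powMeasure _ hm]
  have h1 : ∀ l ∈ Ioi (0 : ℝ), ENNReal.ofReal (l ^ (-θ)) *
      (if y ≤ c * l ^ ((1 + θ) / 2) then 0 else ENNReal.ofReal y) ^ 2 ≤
      (Iic L).indicator (fun l => ENNReal.ofReal (y ^ 2) * ENNReal.ofReal (l ^ (-θ))) l := by
    intro l hl
    by_cases hl2 : L ≤ l
    · rw [if_pos ((le_mul_rpow_iff h0 h hc hl).2 hl2)]
      simp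
    · rw [if_neg (fun hcon => hl2 ((le_mul_rpow_iff h0 h hc hl).1 hcon)),
        indicator_of_mem (by exact (not_le.1 hl2).le), ENNReal.ofReal_pow hy, mul_comm]
  refine (setLIntegral_mono_ae' measurableSet_Ioi (ae_of_all _ h1)).trans ?_
  rw [lintegral_indicator measurableSet_Iic,
    Measure.restrict_restrict measurableSet_Iic, lintegral_const_mul _ (by fun_prop)]
  have h2 : Iic L ∩ Ioi 0 = Ioc 0 L := by rw [inter_comm, Ioi_inter_Iic]
  rw [h2, lintegral_Ioc_rpow (by linarith) hL0.le, ← ENNReal.ofReal_mul (by positivity)]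
  apply le_of_eq
  congr 1
  rw [show -θ + 1 = 1 - θ by ring, hL, ← Real.rpow_mul (by positivity), Real.div_rpow hy hc.le,
    mul_pow, ← Real.rpow_natCast (c ^ _) 2, ← Real.rpow_natCast (y ^ _) 2, ← Real.rpow_mul hc.le,
    ← Real.rpow_mul hy]
  rw [show c ^ (-(1 - θ) / (1 + θ) * (2 : ℕ)) = (c ^ (2 / (1 + θ) * (1 - θ)))⁻¹ by
    rw [← Real.rpow_neg hc.le]; congr 1; push_cast; ring]
  have e2 : y ^ (2 / (1 + θ) * (2 : ℕ)) = y ^ 2 * y ^ (2 / (1 + θ) * (1 - θ)) := by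
    rw [← Real.rpow_natCast y 2, ← Real.rpow_add h]; congr 1; push_cast; field_simp; ring
  rw [e2]
  ring

end pointwise


variable {n : ℕ}

/-! ### Splitting a function at a height -/

section split
variable {G : ℝ → Eu n → ℂ} {c : ℝ → ℝ} {θ : ℝ}

open Classical in
/-- The part of `G` below the height `c(t) λ^((1+θ)/2)`. -/
noncomputable def lowPart (G : ℝ → Eu n → ℂ) (c : ℝ → ℝ) (θ l t : ℝ) (x : Eu n) : ℂ :=
  if ‖G t x‖ ≤ c t * l ^ ((1 + θ) / 2) then G t x else 0

open Classical in
/-- The part of `G` above the height `c(t) λ^((1+θ)/2)`. -/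
noncomputable def highPart (G : ℝ → Eu n → ℂ) (c : ℝ → ℝ) (θ l t : ℝ) (x : Eu n) : ℂ :=
  if ‖G t x‖ ≤ c t * l ^ ((1 + θ) / 2) then 0 else G t x

lemma lowPart_add_highPart (l t : ℝ) (x : Eu n) :
    lowPart G c θ l t x + highPart G c θ l t x = G t x := by
  unfold lowPart highPart; split_ifs <;> simp

lemma measurable_split (hG : Measurable (Function.uncurry G)) (hc : Measurable c) :
    Measurable (fun p : ℝ × ℝ × Eu n => lowPart G c θ p.1 p.2.1 p.2.2) ∧
    Measurable (fun p : ℝ × ℝ × Eu n => highPart G c θ p.1 p.2.1 p.2.2) := by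
  have h1 : Measurable fun p : ℝ × ℝ × Eu n => G p.2.1 p.2.2 :=
    hG.comp (f := fun p : ℝ × ℝ × Eu n => p.2) measurable_snd
  have h2 : Measurable fun p : ℝ × ℝ × Eu n => c p.2.1 * p.1 ^ ((1 + θ) / 2) := by
    have := hc.comp (f := fun p : ℝ × ℝ × Eu n => p.2.1) (by fun_prop)
    exact this.mul (measurable_fst.pow_const _)
  have h3 := measurableSet_le h1.norm h2
  exact ⟨Measurable.ite h3 h1 measurable_const, Measurable.ite h3 measurable_const h1⟩

lemma nice_split (hG : Nice G) (hc : Measurable c) (l : ℝ) :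
    Nice (lowPart G c θ l) ∧ Nice (highPart G c θ l) := by
  obtain ⟨M, hM⟩ := hG.bdd
  obtain ⟨R, hR⟩ := hG.supp
  have hM0 : 0 ≤ M := (norm_nonneg _).trans (hM 0 0)
  have hm := measurable_split (θ := θ) hG.meas hc
  refine ⟨⟨hm.1.comp (measurable_prodMk_left (x := l)), ⟨M, fun t x => ?_⟩,
    ⟨R, fun t x h => ?_⟩⟩, ⟨hm.2.comp (measurable_prodMk_left (x := l)), ⟨M, fun t x => ?_⟩,
    ⟨R, fun t x h => ?_⟩⟩⟩
  · unfold lowPart; split_ifs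
    · exact hM t x
    · simpa using hM0
  · simp [lowPart, hR t x h]
  · unfold highPart; split_ifs
    · simpa using hM0
    · exact hM t x
  · simp [highPart, hR t x h]

end split

lemma specInt_add {ψ : Eu n → ℝ} (hψ : Measurable ψ) {G H K : ℝ → Eu n → ℂ} (hG : Nice G)
    (hH : Nice H) (h : ∀ t x, G t x + H t x = K t x) (ξ : Eu n) :
    specInt ψ K ξ = specInt ψ G ξ + specInt ψ H ξ := by
  unfold specInt
  rw [← integral_add (hG.integrable_specKer hψ ξ) (hH.integrable_specKer hψ ξ)]
  congr 1; funext s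
  have : K s = fun x => G s x + H s x := by funext x; rw [h]
  simp only [specKer]
  rw [this, FT_add (hG.integrable s) (hH.integrable s)]
  ring

lemma specInt_const_mul {ψ : Eu n → ℝ} (a : ℂ) (G : ℝ → Eu n → ℂ) (ξ : Eu n) :
    specInt ψ (fun t x => a * G t x) ξ = a * specInt ψ G ξ := by
  unfold specInt
  rw [← integral_const_mul]
  congr 1; funext s
  simp only [specKer, FT_const_mul]
  ring

/-! ### Interpolation of the quadratic bound between its two endpoints -/

section
variable {σ θ : ℝ}

/-- The exponent used for the heights of the splitting. -/
noncomputable def heightExp (σ θ : ℝ) : ℝ := (2 + σ) / (2 - σ * θ)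

/-- The heights of the splitting. -/
noncomputable def height (σ θ : ℝ) (G : ℝ → Eu n → ℂ) (t : ℝ) : ℝ :=
  (eLpNorm (G t) (ENNReal.ofReal (2 / (1 + θ))) volume).toReal ^ heightExp σ θ

lemma measurable_height {G : ℝ → Eu n → ℂ} (hG : Measurable (Function.uncurry G)) :
    Measurable (height σ θ G) :=
  (measurable_eLpNorm_slice hG _).ennreal_toReal.pow_const _

lemma ae_eq_zero_or_height_pos (h0 : 0 < θ) {G : ℝ → Eu n → ℂ} (hG : Nice G) (t : ℝ) :
    G t =ᵐ[volume] 0 ∨ ∃ y : ℝ, 0 < y ∧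
      eLpNorm (G t) (ENNReal.ofReal (2 / (1 + θ))) volume = ENNReal.ofReal y ∧
      height σ θ G t = y ^ heightExp σ θ := by
  have hR : 0 < 2 / (1 + θ) := by positivity
  have hfin := (hG.memLp t (ENNReal.ofReal (2 / (1 + θ)))).2
  by_cases h : eLpNorm (G t) (ENNReal.ofReal (2 / (1 + θ))) volume = 0
  · left
    exact (eLpNorm_eq_zero_iff (hG.memLp t 1).1 (by simpa using hR)).1 h
  · exact Or.inr ⟨_, ENNReal.toReal_pos h hfin.ne, (ENNReal.ofReal_toReal hfin.ne).symm, rfl⟩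

/-- Tonelli in $(\lambda,x)$ followed by `lintegral_low_le` at each point. A slice that vanishes
almost everywhere is treated apart, because its height is not positive. -/
lemma eLpNorm_lowPart_le (hσ : 0 < σ) (hσ1 : σ < 1) (h0 : 0 < θ) (hθ1 : θ < 1)
    {G : ℝ → Eu n → ℂ} (hG : Nice G) (t : ℝ) :
    eLpNorm (fun l => eLpNorm (lowPart G (height σ θ G) θ l t) 2 volume) 2 (powMeasure (-θ - 1)) ≤
      ENNReal.ofReal ((1 / θ) ^ (1 / 2 : ℝ)) *
        eLpNorm (G t) (ENNReal.ofReal (2 / (1 + θ))) volume ^ (2 / (2 - σ * θ)) := by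
  classical
  have hst : 0 < 2 - σ * θ := by nlinarith
  rcases ae_eq_zero_or_height_pos (σ := σ) h0 hG t with h | ⟨y, hy, hN, hh⟩
  · have : ∀ l, eLpNorm (lowPart G (height σ θ G) θ l t) 2 volume = 0 := fun l => by
      rw [← eLpNorm_zero (p := 2) (ε := ℂ) (α := Eu n) (μ := volume)]
      refine eLpNorm_congr_ae (h.mono fun x hx => ?_)
      simp only [lowPart, hx]
      simp
    simp [this]
  refine ENNReal.le_of_sq_le_sq ?_
  have hm := (measurable_split (θ := θ) hG.meas (measurable_height (σ := σ) (θ := θ) hG.meas)).1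
  set c := height σ θ G with hc
  have hcpos : 0 < c t := by rw [hh]; positivity
  have hm2 : Measurable (Function.uncurry fun (l : ℝ) (x : Eu n) =>
      ‖lowPart G c θ l t x‖ₑ ^ 2) :=
    (hm.comp (f := fun p : ℝ × Eu n => (p.1, t, p.2)) (by fun_prop)).enorm.pow_const 2
  rw [eLpNorm_two_sq]
  simp_rw [enorm_eq_self, eLpNorm_two_sq]
  rw [lintegral_lintegral_swap hm2.aemeasurable]
  have h1 : ∀ x, ∫⁻ l, ‖lowPart G c θ l t x‖ₑ ^ 2 ∂(powMeasure (-θ - 1)) ≤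
      ENNReal.ofReal (1 / θ * c t ^ (2 * θ / (1 + θ))) * ‖G t x‖ₑ ^ (2 / (1 + θ)) := fun x => by
    have h2 := lintegral_low_le (y := ‖G t x‖) h0 (norm_nonneg _) hcpos
    rw [ENNReal.ofReal_mul (by positivity), ← ENNReal.ofReal_rpow_of_nonneg (norm_nonneg _)
      (by positivity), ofReal_norm] at h2
    refine le_trans (le_of_eq ?_) h2
    congr 1; funext l
    unfold lowPart
    split_ifs <;> simp
  refine (lintegral_mono h1).trans ?_
  rw [lintegral_const_mul _ ((measurable_slice hG.meas t).enorm.pow_const _),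
    ← eLpNorm_rpow_self _ (by positivity), hN, ENNReal.ofReal_rpow_of_pos hy,
    ENNReal.ofReal_rpow_of_pos hy, ← ENNReal.ofReal_mul (by positivity),
    ← ENNReal.ofReal_mul (by positivity), ← ENNReal.ofReal_pow (by positivity)]
  apply le_of_eq
  congr 1
  rw [hh, mul_pow, ← Real.rpow_natCast ((1 / θ) ^ _) 2, ← Real.rpow_natCast (y ^ _) 2,
    ← Real.rpow_mul (show 0 ≤ 1 / θ by positivity), ← Real.rpow_mul hy.le, ← Real.rpow_mul hy.le,
    mul_assoc,
    ← Real.rpow_add hy]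
  congr 1
  · norm_num
  · congr 1
    -- With $N=\|G(t)\|_{r'}$ and $c=N^h$ the power is
    -- $h\frac{2\theta}{1+\theta}+\frac2{1+\theta}=\frac4{2-\sigma\theta}$: the low part is bounded
    -- by $N^{q'}$, which is integrable in time.
    rw [heightExp]
    push_cast
    field_simp
    ring

/-- As for the low part, but the $L^1$ norm in $x$ sits inside the $L^2$ norm in $\lambda$, so
Minkowski's inequality takes the place of Tonelli. -/
lemma eLpNorm_highPart_le (hσ : 0 < σ) (hσ1 : σ < 1) (h0 : 0 < θ) (hθ1 : θ < 1)
    {G : ℝ → Eu n → ℂ} (hG : Nice G) (t : ℝ) :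
    eLpNorm (fun l => eLpNorm (highPart G (height σ θ G) θ l t) 1 volume) 2 (powMeasure (-θ)) ≤
      ENNReal.ofReal ((1 / (1 - θ)) ^ (1 / 2 : ℝ)) *
        eLpNorm (G t) (ENNReal.ofReal (2 / (1 + θ))) volume ^ ((2 - σ) / (2 - σ * θ)) := by
  classical
  have hst : 0 < 2 - σ * θ := by nlinarith
  have h1θ : 0 < 1 - θ := by linarith
  have h2σ : 0 < 2 - σ := by linarith
  rcases ae_eq_zero_or_height_pos (σ := σ) h0 hG t with h | ⟨y, hy, hN, hh⟩
  · have : ∀ l, eLpNorm (highPart G (height σ θ G) θ l t) 1 volume = 0 := fun l => by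
      rw [← eLpNorm_zero (p := 1) (ε := ℂ) (α := Eu n) (μ := volume)]
      refine eLpNorm_congr_ae (h.mono fun x hx => ?_)
      simp only [highPart, hx]
      simp
    simp [this]
  refine ENNReal.le_of_sq_le_sq ?_
  have hm := (measurable_split (θ := θ) hG.meas (measurable_height (σ := σ) (θ := θ) hG.meas)).2
  set c := height σ θ G with hc
  have hcpos : 0 < c t := by rw [hh]; positivity
  have hm2 : Measurable (Function.uncurry fun (l : ℝ) (x : Eu n) => ‖highPart G c θ l t x‖ₑ) :=
    (hm.comp (f := fun p : ℝ × Eu n => (p.1, t, p.2)) (by fun_prop)).enorm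
  have hbm : Measurable fun x => ENNReal.ofReal ((1 / (1 - θ)) ^ (1 / 2 : ℝ) *
      c t ^ (-(1 - θ) / (1 + θ))) * ‖G t x‖ₑ ^ (2 / (1 + θ)) :=
    ((measurable_slice hG.meas t).enorm.pow_const _).const_mul _
  rw [eLpNorm_two_sq]
  simp_rw [enorm_eq_self, eLpNorm_one_eq_lintegral_enorm]
  refine (lintegral_sq_lintegral_le hm2 hbm fun x => ?_).trans ?_
  · refine ENNReal.le_of_sq_le_sq ?_
    rw [eLpNorm_two_sq]
    have h2 := lintegral_high_le (y := ‖G t x‖) h0 hθ1 (norm_nonneg _) hcpos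
    have e : ENNReal.ofReal (1 / (1 - θ) * (c t ^ (-(1 - θ) / (1 + θ)) *
        ‖G t x‖ ^ (2 / (1 + θ))) ^ 2) = (ENNReal.ofReal ((1 / (1 - θ)) ^ (1 / 2 : ℝ) *
      c t ^ (-(1 - θ) / (1 + θ))) * ‖G t x‖ₑ ^ (2 / (1 + θ))) ^ 2 := by
      rw [← ofReal_norm, ENNReal.ofReal_rpow_of_nonneg (norm_nonneg _) (by positivity),
        ← ENNReal.ofReal_mul (by positivity), ← ENNReal.ofReal_pow (by positivity)]
      congr 1
      rw [mul_assoc, mul_pow ((1 / (1 - θ)) ^ _), ← Real.rpow_natCast ((1 / (1 - θ)) ^ _) 2,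
        ← Real.rpow_mul (by positivity)]
      norm_num
    rw [e] at h2
    refine le_trans (le_of_eq ?_) h2
    congr 1; funext l
    unfold highPart
    split_ifs <;> simp
  · gcongr
    rw [lintegral_const_mul _ ((measurable_slice hG.meas t).enorm.pow_const _),
      ← eLpNorm_rpow_self _ (by positivity), hN, ENNReal.ofReal_rpow_of_pos hy,
      ENNReal.ofReal_rpow_of_pos hy, ← ENNReal.ofReal_mul (by positivity),
      ← ENNReal.ofReal_mul (by positivity)]
    apply le_of_eq
    congr 1
    rw [hh, ← Real.rpow_mul hy.le, mul_assoc, ← Real.rpow_add hy]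
    congr 2
    -- The same $h$ gives
    -- $-h\frac{1-\theta}{1+\theta}+\frac2{1+\theta}=\frac{2-\sigma}{2-\sigma\theta}$, whose product
    -- with the exponent $\frac2{2-\sigma}$ of the Hardy-Littlewood-Sobolev inequality is again
    -- $q'$. These two requirements determine `heightExp`.
    rw [heightExp]
    field_simp
    ring

lemma measurable_eLpNorm_two {A : ℝ → ℝ → Eu n → ℂ}
    (hA : Measurable fun p : ℝ × ℝ × Eu n => A p.1 p.2.1 p.2.2) :
    Measurable (Function.uncurry fun (l t : ℝ) => eLpNorm (A l t) 2 volume) := by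
  have e : (Function.uncurry fun (l t : ℝ) => eLpNorm (A l t) 2 volume) =
      fun p : ℝ × ℝ => (∫⁻ x, ‖A p.1 p.2 x‖ₑ ^ 2) ^ (1 / 2 : ℝ) := by
    funext p
    rw [← eLpNorm_two_sq, ← ENNReal.rpow_natCast, ← ENNReal.rpow_mul]
    simp [Function.uncurry]
  rw [e]
  refine Measurable.pow_const ?_ _
  have h3 : Measurable fun p : (ℝ × ℝ) × Eu n => ‖A p.1.1 p.1.2 p.2‖ₑ ^ 2 :=
    (hA.comp (f := fun p : (ℝ × ℝ) × Eu n => (p.1.1, p.1.2, p.2)) (by fun_prop)).enorm.pow_const 2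
  exact h3.lintegral_prod_right'

lemma measurable_eLpNorm_one {A : ℝ → ℝ → Eu n → ℂ}
    (hA : Measurable fun p : ℝ × ℝ × Eu n => A p.1 p.2.1 p.2.2) :
    Measurable (Function.uncurry fun (l t : ℝ) => eLpNorm (A l t) 1 volume) := by
  simp_rw [eLpNorm_one_eq_lintegral_enorm]
  have h3 : Measurable fun p : (ℝ × ℝ) × Eu n => ‖A p.1.1 p.1.2 p.2‖ₑ :=
    (hA.comp (f := fun p : (ℝ × ℝ) × Eu n => (p.1.1, p.1.2, p.2)) (by fun_prop)).enorm
  exact h3.lintegral_prod_right'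

lemma measurable_double_riesz {b : ℝ → ℝ → ℝ≥0∞} (hb : Measurable (Function.uncurry b)) (κ : ℝ) :
    Measurable fun l => ∫⁻ t, ∫⁻ s, b l t * b l s * riesz κ (t - s) := by
  have h3 : Measurable fun p : (ℝ × ℝ) × ℝ => b p.1.1 p.1.2 * b p.1.1 p.2 *
      riesz κ (p.1.2 - p.2) := by
    have e1 : Measurable fun p : (ℝ × ℝ) × ℝ => b p.1.1 p.1.2 :=
      hb.comp (f := fun p : (ℝ × ℝ) × ℝ => p.1) (by fun_prop)
    have e2 : Measurable fun p : (ℝ × ℝ) × ℝ => b p.1.1 p.2 :=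
      hb.comp (f := fun p : (ℝ × ℝ) × ℝ => (p.1.1, p.2)) (by fun_prop)
    have e3 : Measurable fun p : (ℝ × ℝ) × ℝ => riesz κ (p.1.2 - p.2) :=
      (measurable_riesz κ).comp (f := fun p : (ℝ × ℝ) × ℝ => p.1.2 - p.2) (by fun_prop)
    exact (e1.mul e2).mul e3
  have h4 : Measurable fun p : ℝ × ℝ => ∫⁻ s, b p.1 p.2 * b p.1 s * riesz κ (p.2 - s) :=
    h3.lintegral_prod_right' (ν := volume)
  exact h4.lintegral_prod_right' (ν := volume)

lemma double_riesz_const_mul {f : ℝ → ℝ≥0∞} (hf : Measurable f) (κ : ℝ) (a : ℝ≥0∞) :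
    ∫⁻ t, ∫⁻ s, a * f t * (a * f s) * riesz κ (t - s) =
      a * a * ∫⁻ t, ∫⁻ s, f t * f s * riesz κ (t - s) := by
  have e : ∀ t s, a * f t * (a * f s) * riesz κ (t - s) =
      a * a * (f t * f s * riesz κ (t - s)) := fun t s => by ring
  have hm2 := measurable_mul_riesz hf κ
  have hm3 : ∀ t, Measurable fun s => f t * f s * riesz κ (t - s) := fun t =>
    hm2.comp measurable_prodMk_left
  have hm4 : Measurable fun t => ∫⁻ s, f t * f s * riesz κ (t - s) := hm2.lintegral_prod_right'
  simp_rw [e, lintegral_const_mul _ (hm3 _)]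
  rw [lintegral_const_mul _ hm4]

/-- Minkowski moves the $L^2$ norm in $\lambda$ inside the time integral of the first endpoint. -/
lemma lintegral_lowPart_le (hσ : 0 < σ) (hσ1 : σ < 1) (h0 : 0 < θ) (hθ1 : θ < 1)
    {G : ℝ → Eu n → ℂ} (hG : Nice G)
    (hG1 : ∫⁻ t, eLpNorm (G t) (ENNReal.ofReal (2 / (1 + θ))) volume ^ (2 / (2 - σ * θ)) ≤ 1) :
    ∫⁻ l, (∫⁻ t, eLpNorm (lowPart G (height σ θ G) θ l t) 2 volume) ^ 2 ∂(powMeasure (-θ - 1)) ≤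
      ENNReal.ofReal (1 / θ) := by
  have hms := measurable_split (θ := θ) hG.meas (measurable_height (σ := σ) (θ := θ) hG.meas)
  have hNm := (measurable_eLpNorm_slice hG.meas (ENNReal.ofReal (2 / (1 + θ)))).pow_const
    (2 / (2 - σ * θ))
  refine (lintegral_sq_lintegral_le (measurable_eLpNorm_two hms.1) (hNm.const_mul _)
    fun t => eLpNorm_lowPart_le hσ hσ1 h0 hθ1 hG t).trans ?_
  rw [lintegral_const_mul _ hNm, mul_pow, ← ENNReal.ofReal_pow (by positivity)]
  have e : ((1 / θ) ^ (1 / 2 : ℝ)) ^ 2 = 1 / θ := by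
    rw [← Real.rpow_natCast, ← Real.rpow_mul (by positivity)]; norm_num
  rw [e]
  exact mul_le_of_le_one_right' (pow_le_one' hG1 2)

/-- Cauchy-Schwarz in $\lambda$ inside the double time integral replaces the high part by a power of
the slice norm of $G$, to which the Hardy-Littlewood-Sobolev inequality is applied once, after the
integration in $\lambda$. -/
lemma lintegral_highPart_le (hσ : 0 < σ) (hσ1 : σ < 1) (h0 : 0 < θ) (hθ1 : θ < 1)
    {G : ℝ → Eu n → ℂ} (hG : Nice G)
    (hG1 : ∫⁻ t, eLpNorm (G t) (ENNReal.ofReal (2 / (1 + θ))) volume ^ (2 / (2 - σ * θ)) ≤ 1) :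
    ∫⁻ l, (∫⁻ t, ∫⁻ s, eLpNorm (highPart G (height σ θ G) θ l t) 1 volume *
      eLpNorm (highPart G (height σ θ G) θ l s) 1 volume * riesz σ (t - s)) ∂(powMeasure (-θ)) ≤
      ENNReal.ofReal (1 / (1 - θ)) * ENNReal.ofReal (hlsConst σ) := by
  have hst : 0 < 2 - σ * θ := by nlinarith
  have h1θ : 0 < 1 - θ := by linarith
  have h2σ : 0 < 2 - σ := by linarith
  have hms := measurable_split (θ := θ) hG.meas (measurable_height (σ := σ) (θ := θ) hG.meas)
  have hk : Measurable (Function.uncurry fun t s : ℝ => riesz σ (t - s)) :=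
    (measurable_riesz σ).comp (measurable_fst.sub measurable_snd)
  refine (lintegral_quadratic_le (ν := volume) (measurable_eLpNorm_one hms.2)
    (fun t => eLpNorm_highPart_le hσ hσ1 h0 hθ1 hG t) hk).trans ?_
  have hfm : Measurable fun t =>
    eLpNorm (G t) (ENNReal.ofReal (2 / (1 + θ))) volume ^ ((2 - σ) / (2 - σ * θ)) :=
    (measurable_eLpNorm_slice hG.meas _).pow_const _
  have hls := hls_diag hσ hσ1 hfm (by
    refine le_trans (le_of_eq ?_) hG1
    congr 1; funext t
    rw [← ENNReal.rpow_mul]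
    congr 1
    field_simp)
  have e : ENNReal.ofReal (1 / (1 - θ)) = ENNReal.ofReal ((1 / (1 - θ)) ^ (1 / 2 : ℝ)) *
      ENNReal.ofReal ((1 / (1 - θ)) ^ (1 / 2 : ℝ)) := by
    rw [← ENNReal.ofReal_mul (by positivity), ← Real.rpow_add (by positivity)]
    norm_num
  rw [double_riesz_const_mul hfm, e]
  gcongr

lemma enorm_add_sq_le (a b : ℂ) : ‖a + b‖ₑ ^ 2 ≤ 2 * ‖a‖ₑ ^ 2 + 2 * ‖b‖ₑ ^ 2 := by
  rw [← ofReal_norm, ← ofReal_norm, ← ofReal_norm, ← ENNReal.ofReal_pow (norm_nonneg _),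
    ← ENNReal.ofReal_pow (norm_nonneg _), ← ENNReal.ofReal_pow (norm_nonneg _),
    ← ENNReal.ofReal_ofNat 2, ← ENNReal.ofReal_mul (by norm_num),
    ← ENNReal.ofReal_mul (by norm_num), ← ENNReal.ofReal_add (by positivity) (by positivity)]
  apply ENNReal.ofReal_le_ofReal
  have := norm_add_le a b
  nlinarith [sq_nonneg (‖a‖ - ‖b‖), norm_nonneg (a + b)]

/-- On $\{w<\lambda\}$ one has $1\le\lambda w^{-1}$, so the high part can be measured by the
$w^{-1}$ endpoint at the cost of a factor $\lambda$, while the low part is measured without weight.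
-/
lemma lintegral_specInt_add_le {ψ : Eu n → ℝ} (hψ : Measurable ψ) {w : Eu n → ℝ}
    (hw : Measurable w) {E : Set (Eu n)} (hE : MeasurableSet E) (hwE : ∀ ξ ∈ E, 0 < w ξ)
    {A B G : ℝ → Eu n → ℂ} (hA : Nice A) (hB : Nice B) (hAB : ∀ t x, A t x + B t x = G t x)
    {l : ℝ} (hl : 0 < l) :
    ∫⁻ ξ in E ∩ {ξ | w ξ < l}, ‖specInt ψ G ξ‖ₑ ^ 2 ≤ 2 * (∫⁻ t, eLpNorm (A t) 2 volume) ^ 2 +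
      ENNReal.ofReal l * (2 * ∫⁻ ξ in E, ENNReal.ofReal (w ξ)⁻¹ * ‖specInt ψ B ξ‖ₑ ^ 2) := by
  have h1 : ∀ ξ ∈ E ∩ {ξ | w ξ < l}, ‖specInt ψ G ξ‖ₑ ^ 2 ≤ 2 * ‖specInt ψ A ξ‖ₑ ^ 2 +
      ENNReal.ofReal l * (2 * (ENNReal.ofReal (w ξ)⁻¹ * ‖specInt ψ B ξ‖ₑ ^ 2)) := by
    intro ξ hξ
    have hw0 := hwE ξ hξ.1
    rw [specInt_add hψ hA hB hAB ξ]
    refine (enorm_add_sq_le _ _).trans (add_le_add le_rfl ?_)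
    have h3 : 1 ≤ ENNReal.ofReal l * ENNReal.ofReal (w ξ)⁻¹ := by
      rw [← ENNReal.ofReal_mul hl.le, ← ENNReal.ofReal_one]
      apply ENNReal.ofReal_le_ofReal
      rw [← div_eq_mul_inv, le_div_iff₀ hw0, one_mul]
      exact (show w ξ < l from hξ.2).le
    calc 2 * ‖specInt ψ B ξ‖ₑ ^ 2 = 1 * (2 * ‖specInt ψ B ξ‖ₑ ^ 2) := (one_mul _).symm
      _ ≤ (ENNReal.ofReal l * ENNReal.ofReal (w ξ)⁻¹) * (2 * ‖specInt ψ B ξ‖ₑ ^ 2) := by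
        gcongr
      _ = _ := by ring
  have hZA := (measurable_specInt hψ hA.meas).enorm.pow_const 2
  have hZB := (measurable_specInt hψ hB.meas).enorm.pow_const 2
  refine (setLIntegral_mono_ae' (hE.inter (measurableSet_lt hw measurable_const))
    (ae_of_all _ h1)).trans ?_
  have hb : Measurable fun ξ => ENNReal.ofReal (w ξ)⁻¹ * ‖specInt ψ B ξ‖ₑ ^ 2 :=
    hw.inv.ennreal_ofReal.mul hZB
  rw [lintegral_add_left (hZA.const_mul 2),
    lintegral_const_mul _ hZA, lintegral_const_mul _ (hb.const_mul 2),
    lintegral_const_mul _ hb]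
  gcongr
  · exact (setLIntegral_le_lintegral _ _).trans (lintegral_specInt_sq_le hA)
  · exact inter_subset_left

/-- The layer cake formula for `w^{-θ}`. -/
lemma lintegral_rpow_neg_eq (h0 : 0 < θ) {w : Eu n → ℝ} (hw : Measurable w) {E : Set (Eu n)}
    (hE : MeasurableSet E) (hwE : ∀ ξ ∈ E, 0 < w ξ) {f : Eu n → ℝ≥0∞} (hf : Measurable f) :
    ∫⁻ ξ in E, ENNReal.ofReal (w ξ ^ (-θ)) * f ξ =
      ENNReal.ofReal θ * ∫⁻ l, (∫⁻ ξ in E ∩ {ξ | w ξ < l}, f ξ) ∂(powMeasure (-θ - 1)) := by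
  have hcake : ∀ ξ ∈ E, ENNReal.ofReal (w ξ ^ (-θ)) * f ξ = ENNReal.ofReal θ *
      ∫⁻ l, ({ξ | w ξ < l}.indicator f ξ) ∂(powMeasure (-θ - 1)) := by
    intro ξ hξ
    have hw0 := hwE ξ hξ
    have e : ∀ l, {ξ | w ξ < l}.indicator f ξ = (Ioi (w ξ)).indicator (fun _ => f ξ) l := fun l => by
      by_cases h : w ξ < l
      · rw [indicator_of_mem (by exact h), indicator_of_mem (by exact h)]
      · rw [indicator_of_notMem (by exact h), indicator_of_notMem (by exact h)]
    simp_rw [e]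
    rw [lintegral_powMeasure _ (measurable_const.indicator measurableSet_Ioi)]
    have e2 : ∀ l, ENNReal.ofReal (l ^ (-θ - 1)) * (Ioi (w ξ)).indicator (fun _ => f ξ) l =
        (Ioi (w ξ)).indicator (fun l => ENNReal.ofReal (l ^ (-θ - 1)) * f ξ) l := fun l => by
      by_cases h : l ∈ Ioi (w ξ)
      · rw [indicator_of_mem h, indicator_of_mem h]
      · rw [indicator_of_notMem h, indicator_of_notMem h, mul_zero]
    simp_rw [e2]
    rw [lintegral_indicator measurableSet_Ioi, Measure.restrict_restrict measurableSet_Ioi,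
      inter_eq_left.2 (Ioi_subset_Ioi hw0.le), lintegral_mul_const _ (by fun_prop),
      lintegral_Ioi_rpow (by linarith) hw0, ← mul_assoc, ← ENNReal.ofReal_mul h0.le]
    congr 2
    rw [show -θ - 1 + 1 = -θ by ring]
    field_simp
  rw [setLIntegral_congr_fun hE hcake]
  have hjm : Measurable (Function.uncurry fun (ξ : Eu n) (l : ℝ) =>
      {ξ | w ξ < l}.indicator f ξ) := by
    have : (Function.uncurry fun (ξ : Eu n) (l : ℝ) => {ξ | w ξ < l}.indicator f ξ) =
        {p : Eu n × ℝ | w p.1 < p.2}.indicator fun p => f p.1 := by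
      funext p
      simp [Function.uncurry, indicator]
    rw [this]
    exact (hf.comp measurable_fst).indicator
      (measurableSet_lt (hw.comp measurable_fst) measurable_snd)
  have hjm2 : Measurable fun ξ => ∫⁻ l, ({ξ | w ξ < l}.indicator f ξ) ∂(powMeasure (-θ - 1)) :=
    hjm.lintegral_prod_right'
  rw [lintegral_const_mul _ hjm2, lintegral_lintegral_swap hjm.aemeasurable]
  congr 2; funext l
  have hml : MeasurableSet {ξ | w ξ < l} := measurableSet_lt hw measurable_const
  rw [lintegral_indicator hml, Measure.restrict_restrict hml, inter_comm]

/-- The interpolated quadratic bound, for a normalised function. -/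
lemma lintegral_rpow_specInt_le_of_normalised (hσ : 0 < σ) (hσ1 : σ < 1) (h0 : 0 < θ) (hθ1 : θ < 1)
    {ψ : Eu n → ℝ} (hψ : Measurable ψ) {w : Eu n → ℝ} (hw : Measurable w) {E : Set (Eu n)}
    (hE : MeasurableSet E) (hwE : ∀ ξ ∈ E, 0 < w ξ) {K : ℝ≥0∞}
    (hD : ∀ G : ℝ → Eu n → ℂ, Nice G →
      ∫⁻ ξ in E, ENNReal.ofReal (w ξ)⁻¹ * ‖specInt ψ G ξ‖ₑ ^ 2 ≤ K * ∫⁻ t, ∫⁻ s,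
        eLpNorm (G t) 1 volume * eLpNorm (G s) 1 volume * riesz σ (t - s))
    {G : ℝ → Eu n → ℂ} (hG : Nice G)
    (hG1 : ∫⁻ t, eLpNorm (G t) (ENNReal.ofReal (2 / (1 + θ))) volume ^ (2 / (2 - σ * θ)) ≤ 1) :
    ∫⁻ ξ in E, ENNReal.ofReal (w ξ ^ (-θ)) * ‖specInt ψ G ξ‖ₑ ^ 2 ≤
      ENNReal.ofReal θ * (2 * ENNReal.ofReal (1 / θ) +
        2 * (K * (ENNReal.ofReal (1 / (1 - θ)) * ENNReal.ofReal (hlsConst σ)))) := by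
  have hcm := measurable_height (σ := σ) (θ := θ) hG.meas
  have hms := measurable_split (θ := θ) hG.meas hcm
  have hXint := lintegral_lowPart_le hσ hσ1 h0 hθ1 hG hG1
  have hYint := lintegral_highPart_le hσ hσ1 h0 hθ1 hG hG1
  have hn := fun l => nice_split (θ := θ) hG hcm l
  have hXm : Measurable fun l =>
      (∫⁻ t, eLpNorm (lowPart G (height σ θ G) θ l t) 2 volume) ^ 2 :=
    ((measurable_eLpNorm_two hms.1).lintegral_prod_right' (ν := volume)).pow_const 2
  have hYm := measurable_double_riesz (measurable_eLpNorm_one hms.2) σ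
  set X : ℝ → ℝ≥0∞ := fun l => (∫⁻ t, eLpNorm (lowPart G (height σ θ G) θ l t) 2 volume) ^ 2
  set Y : ℝ → ℝ≥0∞ := fun l => ∫⁻ t, ∫⁻ s, eLpNorm (highPart G (height σ θ G) θ l t) 1 volume *
      eLpNorm (highPart G (height σ θ G) θ l s) 1 volume * riesz σ (t - s)
  have hfix : ∀ l : ℝ, 0 < l → ∫⁻ ξ in E ∩ {ξ | w ξ < l}, ‖specInt ψ G ξ‖ₑ ^ 2 ≤
      2 * X l + ENNReal.ofReal l * (2 * (K * Y l)) := fun l hl => by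
    refine (lintegral_specInt_add_le hψ hw hE hwE (hn l).1 (hn l).2
      (fun t x => lowPart_add_highPart l t x) hl).trans ?_
    gcongr
    exact hD _ (hn l).2
  clear_value X Y
  rw [lintegral_rpow_neg_eq h0 hw hE hwE ((measurable_specInt hψ hG.meas).enorm.pow_const 2)]
  gcongr
  refine (lintegral_mono_ae ((ae_powMeasure _).mono hfix)).trans ?_
  rw [lintegral_add_left (hXm.const_mul 2), lintegral_const_mul _ hXm]
  -- The factor $\lambda$ turns $\lambda^{-\theta-1}d\lambda$ into $\lambda^{-\theta}d\lambda$, the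
  -- measure in which the high part was estimated.
  have h2 : ∫⁻ l, ENNReal.ofReal l * (2 * (K * Y l)) ∂(powMeasure (-θ - 1)) =
      2 * (K * ∫⁻ l, Y l ∂(powMeasure (-θ))) := by
    have m2 : Measurable fun l => 2 * (K * Y l) := (hYm.const_mul K).const_mul 2
    have m3 : Measurable fun l => ENNReal.ofReal l * (2 * (K * Y l)) :=
      ENNReal.measurable_ofReal.mul m2
    rw [← lintegral_const_mul _ hYm, ← lintegral_const_mul _ (hYm.const_mul K),
      lintegral_powMeasure _ m3, lintegral_powMeasure _ m2]
    refine setLIntegral_congr_fun measurableSet_Ioi fun l hl => ?_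
    rw [← mul_assoc, ← ENNReal.ofReal_mul' (le_of_lt hl), ← Real.rpow_add_one (ne_of_gt hl)]
    ring_nf
  rw [h2]
  gcongr

end


variable {n : ℕ} {σ : ℝ}

/-! ### The spectral bound for admissible pairs -/

/-- The interpolation parameter `θ = 1 - 2/r`. -/
noncomputable def interpParam (r : ℝ≥0∞) : ℝ := 1 - 2 * recip r

lemma ofReal_recip {p : ℝ≥0∞} (hp : p ≠ 0) : ENNReal.ofReal (recip p) = p⁻¹ :=
  ENNReal.ofReal_toReal (ENNReal.inv_ne_top.2 hp)

lemma conjExponent_eq {p : ℝ≥0∞} (hp : 1 ≤ p) : p.conjExponent = (ENNReal.ofReal (1 - recip p))⁻¹ := by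
  have := ENNReal.HolderConjugate.conjExponent hp
  have h := ENNReal.HolderConjugate.inv_add_inv_eq_one p p.conjExponent
  have hp0 : p ≠ 0 := (zero_lt_one.trans_le hp).ne'
  have h1 : p⁻¹ ≠ ⊤ := ENNReal.inv_ne_top.2 hp0
  rw [ENNReal.ofReal_sub _ (show 0 ≤ recip p from ENNReal.toReal_nonneg), ofReal_recip hp0, ENNReal.ofReal_one, ← h,
    ENNReal.add_sub_cancel_left h1, inv_inv]

lemma recip_nonneg (p : ℝ≥0∞) : 0 ≤ recip p := ENNReal.toReal_nonneg

lemma recip_le_half {p : ℝ≥0∞} (hp : 2 ≤ p) : recip p ≤ 1 / 2 := by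
  have h : p⁻¹ ≤ 2⁻¹ := ENNReal.inv_le_inv.2 hp
  have := ENNReal.toReal_mono (by simp) h
  simpa [recip] using this

section
variable {q r : ℝ≥0∞}

lemma SharpAdmissible.one_le_left (h : SharpAdmissible σ q r) : 1 ≤ q := one_le_two.trans h.1

lemma SharpAdmissible.one_le_right (h : SharpAdmissible σ q r) : 1 ≤ r := one_le_two.trans h.2.1

lemma SharpAdmissible.interpParam_nonneg (h : SharpAdmissible σ q r) : 0 ≤ interpParam r := by
  have := recip_le_half h.2.1
  unfold interpParam; linarith

lemma interpParam_le_one (r : ℝ≥0∞) : interpParam r ≤ 1 := by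
  have := recip_nonneg r
  unfold interpParam; linarith

lemma SharpAdmissible.recip_left (h : SharpAdmissible σ q r) :
    recip q = σ * interpParam r / 2 := by
  have := h.2.2.1
  unfold interpParam; linarith

lemma SharpAdmissible.denom_pos (h : SharpAdmissible σ q r) (hσ : 0 < σ) (hσ1 : σ < 1) :
    0 < 2 - σ * interpParam r := by
  have h1 := interpParam_le_one r
  have h2 := h.interpParam_nonneg
  nlinarith

/-- With `conj_right`, this identifies $(q',r')$ with the exponents produced by the interpolation,
so sharp admissible pairs are exactly covered by $0\le\theta\le1$. -/
lemma SharpAdmissible.conj_left (h : SharpAdmissible σ q r) (hσ : 0 < σ) (hσ1 : σ < 1) :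
    q.conjExponent = ENNReal.ofReal (2 / (2 - σ * interpParam r)) := by
  have h1 := h.denom_pos hσ hσ1
  rw [conjExponent_eq h.one_le_left, h.recip_left, ← ENNReal.ofReal_inv_of_pos (by linarith)]
  congr 1
  field_simp

lemma SharpAdmissible.conj_right (h : SharpAdmissible σ q r) :
    r.conjExponent = ENNReal.ofReal (2 / (1 + interpParam r)) := by
  have h1 := h.interpParam_nonneg
  have h2 : recip r = (1 - interpParam r) / 2 := by unfold interpParam; ring
  rw [conjExponent_eq h.one_le_right, h2, ← ENNReal.ofReal_inv_of_pos (by linarith)]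
  congr 1
  rw [inv_eq_one_div, div_eq_div_iff (by linarith) (by linarith)]
  ring

end

/-! ### The interpolated bound without normalisation, endpoints included -/

section
variable {θ : ℝ}

/-- The constant in the interpolated quadratic bound. -/
noncomputable def interpConst (σ θ : ℝ) (K : ℝ≥0∞) : ℝ≥0∞ :=
  1 + K * ENNReal.ofReal (hlsConst σ) + ENNReal.ofReal θ * (2 * ENNReal.ofReal (1 / θ) +
        2 * (K * (ENNReal.ofReal (1 / (1 - θ)) * ENNReal.ofReal (hlsConst σ))))

lemma interpConst_ne_top {K : ℝ≥0∞} (hK : K ≠ ⊤) : interpConst σ θ K ≠ ⊤ := by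
  unfold interpConst
  finiteness

lemma mixedNorm_ofReal_rpow {P : ℝ} (hP : 0 < P) (R : ℝ≥0∞) (G : ℝ → Eu n → ℂ) :
    mixedNorm (ENNReal.ofReal P) R G ^ P = ∫⁻ t, eLpNorm (G t) R volume ^ P := by
  rw [mixedNorm, eLpNorm_rpow_self _ hP]
  simp

lemma mixedNorm_const_mul {q r : ℝ≥0∞} (hq : q ≠ 0) (a : ℂ) {G : ℝ → Eu n → ℂ}
    (hG : Measurable (Function.uncurry G)) :
    mixedNorm q r (fun t x => a * G t x) = ‖a‖ₑ * mixedNorm q r G := by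
  unfold mixedNorm
  rw [← eLpNorm_ennreal_const_mul _ (measurable_eLpNorm_slice hG r) hq]
  congr 1; funext t
  exact eLpNorm_const_smul a (G t) r volume

lemma Nice.const_mul {G : ℝ → Eu n → ℂ} (hG : Nice G) (a : ℂ) : Nice (fun t x => a * G t x) := by
  obtain ⟨M, hM⟩ := hG.bdd
  obtain ⟨R, hR⟩ := hG.supp
  refine ⟨hG.meas.const_mul a, ⟨‖a‖ * M, fun t x => ?_⟩, ⟨R, fun t x h => by simp [hR t x h]⟩⟩
  rw [norm_mul]
  exact mul_le_mul_of_nonneg_left (hM t x) (norm_nonneg a)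

lemma Nice.mixedNorm_lt_top {P R : ℝ} (hP : 0 < P) {G : ℝ → Eu n → ℂ} (hG : Nice G) :
    mixedNorm (ENNReal.ofReal P) (ENNReal.ofReal R) G < ⊤ := by
  obtain ⟨M, hM⟩ := hG.bdd
  obtain ⟨ρ, hρ⟩ := hG.supp
  have hM0 : 0 ≤ M := (norm_nonneg _).trans (hM 0 0)
  have hB : MemLp ((Metric.closedBall (0 : Eu n) ρ).indicator fun _ => M) (ENNReal.ofReal R)
      volume := by
    have hc : volume (Metric.closedBall (0 : Eu n) ρ) ≠ ⊤ :=
      (isCompact_closedBall _ _).measure_lt_top.ne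
    exact memLp_indicator_const _ Metric.isClosed_closedBall.measurableSet _ (Or.inr hc)
  set B := eLpNorm ((Metric.closedBall (0 : Eu n) ρ).indicator fun _ => M) (ENNReal.ofReal R) volume
  have h1 : ∀ t, eLpNorm (G t) (ENNReal.ofReal R) volume ≤ (Icc (-ρ) ρ).indicator (fun _ => B) t := by
    intro t
    by_cases ht : t ∈ Icc (-ρ) ρ
    · rw [indicator_of_mem ht]
      refine eLpNorm_mono fun x => ?_
      by_cases hx : x ∈ Metric.closedBall (0 : Eu n) ρ
      · rw [indicator_of_mem hx]; exact (hM t x).trans (le_abs_self M)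
      · rw [indicator_of_notMem hx, hρ t x (Or.inr (by simpa using hx))]
        simp
    · have : G t = 0 := by
        funext x
        refine hρ t x (Or.inl ?_)
        by_contra hcon
        exact ht (abs_le.1 (not_lt.1 hcon))
      rw [this]; simp
  have h2 : mixedNorm (ENNReal.ofReal P) (ENNReal.ofReal R) G ^ P < ⊤ := by
    rw [mixedNorm_ofReal_rpow hP]
    refine (lintegral_mono fun t => ENNReal.rpow_le_rpow (h1 t) hP.le).trans_lt ?_
    have e : ∀ t, (Icc (-ρ) ρ).indicator (fun _ => B) t ^ P =
        (Icc (-ρ) ρ).indicator (fun _ => B ^ P) t := fun t => by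
      by_cases ht : t ∈ Icc (-ρ) ρ
      · rw [indicator_of_mem ht, indicator_of_mem ht]
      · rw [indicator_of_notMem ht, indicator_of_notMem ht, ENNReal.zero_rpow_of_pos hP]
    simp_rw [e]
    rw [lintegral_indicator measurableSet_Icc, setLIntegral_const]
    exact ENNReal.mul_lt_top (ENNReal.rpow_lt_top_of_nonneg hP.le hB.2.ne) (by simp)
  exact (ENNReal.rpow_lt_top_iff_of_pos hP).1 h2

/-- Allows normalisation by real numbers $a>0$ with $a\ge m$ instead of by the norm $m$ itself,
which may be zero. -/
lemma le_mul_sq_of_forall {C F m : ℝ≥0∞} (hC : C ≠ ⊤) (hm : m ≠ ⊤)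
    (h : ∀ a : ℝ, 0 < a → m ≤ ENNReal.ofReal a → F ≤ C * ENNReal.ofReal a ^ 2) : F ≤ C * m ^ 2 := by
  have h1 : ∀ k : ℕ, F ≤ C * ENNReal.ofReal (m.toReal + 1 / ((k : ℝ) + 1)) ^ 2 := fun k => by
    have hp : 0 < 1 / ((k : ℝ) + 1) := by positivity
    have h0 : 0 ≤ m.toReal := ENNReal.toReal_nonneg
    refine h _ (by linarith) ?_
    conv_lhs => rw [← ENNReal.ofReal_toReal hm]
    exact ENNReal.ofReal_le_ofReal (by linarith)
  have h2 : Tendsto (fun k : ℕ => m.toReal + 1 / ((k : ℝ) + 1)) atTop (𝓝 m.toReal) := by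
    simpa using tendsto_const_nhds.add (tendsto_one_div_add_atTop_nhds_zero_nat (𝕜 := ℝ))
  have h3 := ENNReal.Tendsto.const_mul (a := C) ((ENNReal.continuous_pow 2).tendsto _ |>.comp
    (ENNReal.tendsto_ofReal h2)) (Or.inr hC)
  rw [ENNReal.ofReal_toReal hm] at h3
  exact ge_of_tendsto' h3 h1

/-- The interpolated quadratic bound. -/
theorem lintegral_rpow_specInt_le (hσ : 0 < σ) (hσ1 : σ < 1) (h0 : 0 ≤ θ) (hθ1 : θ ≤ 1)
    {ψ : Eu n → ℝ} (hψ : Measurable ψ) {w : Eu n → ℝ} (hw : Measurable w) {E : Set (Eu n)}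
    (hE : MeasurableSet E) (hwE : ∀ ξ ∈ E, 0 < w ξ) {K : ℝ≥0∞} (hK : K ≠ ⊤)
    (hD : ∀ G : ℝ → Eu n → ℂ, Nice G →
      ∫⁻ ξ in E, ENNReal.ofReal (w ξ)⁻¹ * ‖specInt ψ G ξ‖ₑ ^ 2 ≤ K * ∫⁻ t, ∫⁻ s,
        eLpNorm (G t) 1 volume * eLpNorm (G s) 1 volume * riesz σ (t - s))
    {G : ℝ → Eu n → ℂ} (hG : Nice G) :
    ∫⁻ ξ in E, ENNReal.ofReal (w ξ ^ (-θ)) * ‖specInt ψ G ξ‖ₑ ^ 2 ≤ interpConst σ θ K *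
      mixedNorm (ENNReal.ofReal (2 / (2 - σ * θ))) (ENNReal.ofReal (2 / (1 + θ))) G ^ 2 := by
  have hst : 0 < 2 - σ * θ := by nlinarith
  have hP : 0 < 2 / (2 - σ * θ) := by positivity
  have key : ∀ G : ℝ → Eu n → ℂ, Nice G →
      ∫⁻ t, eLpNorm (G t) (ENNReal.ofReal (2 / (1 + θ))) volume ^ (2 / (2 - σ * θ)) ≤ 1 →
      ∫⁻ ξ in E, ENNReal.ofReal (w ξ ^ (-θ)) * ‖specInt ψ G ξ‖ₑ ^ 2 ≤ interpConst σ θ K := by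
    intro G hG hG1
    -- The integration over levels diverges at $\theta=0$ and $\theta=1$. For $\theta=0$ the weight
    -- is trivial and the Plancherel endpoint applies.
    rcases h0.eq_or_lt with h | h
    · subst h
      simp only [neg_zero, Real.rpow_zero, ENNReal.ofReal_one, one_mul]
      simp only [mul_zero, sub_zero, add_zero, div_one, ENNReal.ofReal_ofNat] at hG1
      norm_num at hG1
      refine (setLIntegral_le_lintegral _ _).trans ((lintegral_specInt_sq_le hG).trans ?_)
      refine (pow_le_one' hG1 2).trans ?_
      rw [interpConst, add_assoc]
      exact le_self_add
    -- For $\theta=1$ the claim is the dispersive endpoint followed by the Hardy-Littlewood-Sobolev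
    -- inequality.
    rcases hθ1.eq_or_lt with h1 | h1
    · subst h1
      norm_num at hG1
      simp only [Real.rpow_neg_one]
      refine (hD G hG).trans ?_
      have := hls_diag hσ hσ1 (measurable_eLpNorm_slice hG.meas 1) hG1
      calc _ ≤ K * ENNReal.ofReal (hlsConst σ) := by gcongr
        _ ≤ 1 + K * ENNReal.ofReal (hlsConst σ) := le_add_self
        _ ≤ _ := le_self_add
    · exact (lintegral_rpow_specInt_le_of_normalised hσ hσ1 h h1 hψ hw hE hwE hD hG hG1).trans
        le_add_self
  -- Both sides are homogeneous of degree two in $G$, so the normalised bound is applied to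
  -- $a^{-1}G$.
  refine le_mul_sq_of_forall (interpConst_ne_top hK) (hG.mixedNorm_lt_top hP).ne fun a ha hma => ?_
  have hG' := hG.const_mul ((a⁻¹ : ℝ) : ℂ)
  have hea : ‖((a⁻¹ : ℝ) : ℂ)‖ₑ = ENNReal.ofReal a⁻¹ := by
    rw [← ofReal_norm, Complex.norm_real, Real.norm_of_nonneg (by positivity)]
  have h1 := key _ hG' (by
    rw [← mixedNorm_ofReal_rpow hP, mixedNorm_const_mul (by simpa using hP) _ hG.meas]
    refine ENNReal.rpow_le_one ?_ hP.le
    rw [hea]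
    calc _ ≤ ENNReal.ofReal a⁻¹ * ENNReal.ofReal a := by gcongr
      _ = 1 := by rw [← ENNReal.ofReal_mul (by positivity), inv_mul_cancel₀ ha.ne',
                ENNReal.ofReal_one])
  simp_rw [specInt_const_mul, enorm_mul, mul_pow, mul_left_comm _ (‖((a⁻¹ : ℝ) : ℂ)‖ₑ ^ 2)] at h1
  have hm : Measurable fun ξ => ENNReal.ofReal (w ξ ^ (-θ)) * ‖specInt ψ G ξ‖ₑ ^ 2 :=
    (hw.pow_const _).ennreal_ofReal.mul ((measurable_specInt hψ hG.meas).enorm.pow_const 2)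
  rw [lintegral_const_mul _ hm, hea] at h1
  have e : ENNReal.ofReal a ^ 2 * ENNReal.ofReal a⁻¹ ^ 2 = 1 := by
    rw [← mul_pow, ← ENNReal.ofReal_mul ha.le, mul_inv_cancel₀ ha.ne', ENNReal.ofReal_one, one_pow]
  calc _ = ENNReal.ofReal a ^ 2 * (ENNReal.ofReal a⁻¹ ^ 2 *
        ∫⁻ ξ in E, ENNReal.ofReal (w ξ ^ (-θ)) * ‖specInt ψ G ξ‖ₑ ^ 2) := by
        rw [← mul_assoc, e, one_mul]
    _ ≤ ENNReal.ofReal a ^ 2 * interpConst σ θ K := by gcongr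
    _ = _ := mul_comm _ _

end


variable {n : ℕ}

/-! ### Consequences of a spectral bound -/

lemma Nice.sub {G H : ℝ → Eu n → ℂ} (hG : Nice G) (hH : Nice H) :
    Nice (fun t x => G t x - H t x) := by
  obtain ⟨M, hM⟩ := hG.bdd
  obtain ⟨R, hR⟩ := hG.supp
  obtain ⟨M', hM'⟩ := hH.bdd
  obtain ⟨R', hR'⟩ := hH.supp
  refine ⟨hG.meas.sub hH.meas, ⟨M + M', fun t x => (norm_sub_le _ _).trans
    (add_le_add (hM t x) (hM' t x))⟩, ⟨max R R', fun t x h => ?_⟩⟩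
  rw [hR t x, hR' t x, sub_zero]
  · exact h.imp (fun h => (le_max_right _ _).trans_lt h) fun h => (le_max_right _ _).trans_lt h
  · exact h.imp (fun h => (le_max_left _ _).trans_lt h) fun h => (le_max_left _ _).trans_lt h

lemma Nice.conj {G : ℝ → Eu n → ℂ} (hG : Nice G) : Nice (fun t x => (starRingEnd ℂ) (G t x)) := by
  obtain ⟨M, hM⟩ := hG.bdd
  obtain ⟨R, hR⟩ := hG.supp
  exact ⟨Complex.continuous_conj.measurable.comp hG.meas, ⟨M, fun t x => by simpa using hM t x⟩,
    ⟨R, fun t x h => by simp [hR t x h]⟩⟩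

lemma mixedNorm_conj (q r : ℝ≥0∞) (G : ℝ → Eu n → ℂ) :
    mixedNorm q r (fun t x => (starRingEnd ℂ) (G t x)) = mixedNorm q r G := by
  unfold mixedNorm
  simp_rw [eLpNorm_conj]

/-- The free evolution of `h`. -/
noncomputable def evol (ψ : Eu n → ℝ) (h : Eu n → ℂ) (t : ℝ) (x : Eu n) : ℂ :=
  FT (fun ξ => osc ψ (-t) ξ * h ξ) x

section
variable {ψ : Eu n → ℝ}

lemma isAnn_osc_mul (hψ : Measurable ψ) {h : Eu n → ℂ} (hh : IsAnn h) (t : ℝ) :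
    IsAnn (fun ξ => osc ψ t ξ * h ξ) := (annBdd_osc hψ t).mul_isAnn hh

lemma measurable_evol (hψ : Measurable ψ) {h : Eu n → ℂ} (hh : Measurable h) :
    Measurable (Function.uncurry (evol ψ h)) := by
  refine measurable_FT_slice (G := fun t ξ => osc ψ (-t) ξ * h ξ) ?_
  exact ((measurable_osc hψ).comp (f := fun p : ℝ × Eu n => (-p.1, p.2)) (by fun_prop)).mul
    (hh.comp measurable_snd)

lemma norm_evol_le (h : Eu n → ℂ) (t : ℝ) (x : Eu n) :
    ‖evol ψ h t x‖ ≤ ftConst n * ∫ ξ, ‖h ξ‖ := by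
  refine (norm_FT_le _ _).trans_eq ?_
  simp [norm_osc]

lemma integral_mul_evol_slice (hψ : Measurable ψ) {h : Eu n → ℂ} (hh : IsAnn h)
    {G : ℝ → Eu n → ℂ} (hG : Nice G) (t : ℝ) :
    ∫ x, G t x * evol ψ h t x = ∫ ξ, specKer ψ G t ξ * h ξ := by
  unfold evol
  rw [integral_mul_FT (hG.integrable t) (isAnn_osc_mul hψ hh (-t)).integrable]
  congr 1; funext ξ
  rw [specKer]; ring

lemma integrable_specKer_mul (hψ : Measurable ψ) {h : Eu n → ℂ} (hh : IsAnn h)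
    {G : ℝ → Eu n → ℂ} (hG : Nice G) :
    Integrable (Function.uncurry fun (t : ℝ) (ξ : Eu n) => specKer ψ G t ξ * h ξ)
      (volume.prod volume) := by
  obtain ⟨κ, h1, -, -, h2⟩ := hG.specKer_dom (ψ := ψ)
  refine (h1.mul_prod hh.integrable.norm).mono' ((measurable_specKer hψ hG.meas).mul
    (hh.meas.comp measurable_snd)).aestronglyMeasurable (ae_of_all _ fun p => ?_)
  simp only [Function.uncurry, norm_mul]
  gcongr
  exact h2 _ _

/-- The duality behind all the estimates: pairing with a free evolution is pairing the spectral
integral with the initial datum. The annular support of $h$ justifies Fubini. -/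
lemma integral_mul_evol (hψ : Measurable ψ) {h : Eu n → ℂ} (hh : IsAnn h)
    {G : ℝ → Eu n → ℂ} (hG : Nice G) :
    ∫ t, ∫ x, G t x * evol ψ h t x = ∫ ξ, specInt ψ G ξ * h ξ := by
  simp_rw [integral_mul_evol_slice hψ hh hG]
  rw [integral_integral_swap (integrable_specKer_mul hψ hh hG)]
  congr 1; funext ξ
  rw [integral_mul_const, specInt]

end

lemma enorm_integral_mul_le {f h : Eu n → ℂ} (hf : AEStronglyMeasurable f volume)
    (hh : AEStronglyMeasurable h volume) {p p' : ℝ≥0∞} [ENNReal.HolderConjugate p p'] :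
    ‖∫ ξ, f ξ * h ξ‖ₑ ≤ eLpNorm f p volume * eLpNorm h p' volume := by
  refine (enorm_integral_le_lintegral_enorm _).trans ?_
  have := eLpNorm_smul_le_mul_eLpNorm (p := p) (q := p') (r := 1) hh hf
  rwa [eLpNorm_one_eq_lintegral_enorm] at this

lemma eLpNorm_le_of_tendsto_sub {f : ℕ → Eu n → ℂ} {V : Eu n → ℂ}
    (hf : ∀ k, AEStronglyMeasurable (f k) volume) (hV : AEStronglyMeasurable V volume)
    {p C : ℝ≥0∞} (hp : 1 ≤ p) (hC : ∀ k, eLpNorm (f k) p volume ≤ C)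
    (h : Tendsto (fun k => eLpNorm (f k - V) p volume) atTop (𝓝 0)) :
    eLpNorm V p volume ≤ C := by
  have h1 : ∀ k, eLpNorm V p volume ≤ C + eLpNorm (f k - V) p volume := fun k => by
    have e : V = f k - (f k - V) := by simp
    conv_lhs => rw [e]
    exact (eLpNorm_sub_le (hf k) ((hf k).sub hV) hp).trans (by gcongr; exact hC k)
  have h2 := (tendsto_const_nhds (x := C)).add h
  rw [add_zero] at h2
  exact ge_of_tendsto' h2 h1

/-- The bound `‖W ∫ e^{-isψ} Ĝ(s) ds‖₂ ≤ A ‖G‖` for nice functions `G`. -/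
structure SpecBound (ψ : Eu n → ℝ) (W : Eu n → ℂ) (q' r' A : ℝ≥0∞) : Prop where
  phase : Measurable ψ
  weight : AnnBdd W
  fin : A ≠ ⊤
  bound : ∀ G : ℝ → Eu n → ℂ, Nice G →
    eLpNorm (fun ξ => W ξ * specInt ψ G ξ) 2 volume ≤ A * mixedNorm q' r' G

section
variable {ψ : Eu n → ℝ} {W : Eu n → ℂ} {q q' r r' A : ℝ≥0∞}

/-- The homogeneous estimate. -/
theorem SpecBound.mixedNorm_evol_le [ENNReal.HolderConjugate q q'] [ENNReal.HolderConjugate r r']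
    (hB : SpecBound ψ W q' r' A) (hq : 1 < q) (hr : 1 < r) {h : Eu n → ℂ} (hh : IsAnn h) :
    mixedNorm q r (evol ψ fun ξ => W ξ * h ξ) ≤ A * eLpNorm h 2 volume := by
  have hWh := hB.weight.mul_isAnn hh
  refine mixedNorm_le_of_pairing (q' := q') (r' := r') hq hr
    (measurable_evol hB.phase hWh.meas) (norm_evol_le _) fun G hG => ?_
  simp_rw [mul_comm (evol ψ _ _ _)]
  rw [integral_mul_evol hB.phase hWh hG]
  have e : ∀ ξ, specInt ψ G ξ * (W ξ * h ξ) = W ξ * specInt ψ G ξ * h ξ := fun ξ => by ring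
  simp_rw [e]
  refine (enorm_integral_mul_le (p := 2) (p' := 2)
    (hB.weight.meas.mul (measurable_specInt hB.phase hG.meas)).aestronglyMeasurable
    hh.meas.aestronglyMeasurable).trans ?_
  calc _ ≤ A * mixedNorm q' r' G * eLpNorm h 2 volume := by
        gcongr
        exact hB.bound G hG
    _ = _ := by ring

lemma integrable_mixed_mul [ENNReal.HolderConjugate q q'] [ENNReal.HolderConjugate r r']
    {u G : ℝ → Eu n → ℂ} (hu : Measurable (Function.uncurry u))
    (hG : Measurable (Function.uncurry G)) (hu' : mixedNorm q r u < ⊤)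
    (hG' : mixedNorm q' r' G < ⊤) :
    Integrable (Function.uncurry fun t x => G t x * u t x)
      ((volume : Measure ℝ).prod (volume : Measure (Eu n))) := by
  refine ⟨(hG.mul hu).aestronglyMeasurable, ?_⟩
  have hm : Measurable (Function.uncurry fun t x => G t x * u t x) := hG.mul hu
  rw [HasFiniteIntegral, lintegral_prod _ hm.enorm.aemeasurable]
  refine lt_of_le_of_lt ?_ (ENNReal.mul_lt_top hu' hG')
  refine le_trans (le_of_eq ?_) (lintegral_mul_le_mixedNorm (q := q) (r := r) hu hG)
  simp only [Function.uncurry, enorm_mul, mul_comm]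

lemma tendsto_integral_mixed_mul [ENNReal.HolderConjugate q q'] [ENNReal.HolderConjugate r r']
    {u G : ℝ → Eu n → ℂ} {T : ℕ → ℝ → Eu n → ℂ} (hu : Measurable (Function.uncurry u))
    (hG : Measurable (Function.uncurry G)) (hT : ∀ k, Measurable (Function.uncurry (T k)))
    (hu' : mixedNorm q r u < ⊤) (hG' : mixedNorm q' r' G < ⊤)
    (hT' : ∀ k, mixedNorm q' r' (T k) < ⊤)
    (hlim : Tendsto (fun k => mixedNorm q' r' (fun t x => G t x - T k t x)) atTop (𝓝 0)) :
    Tendsto (fun k => ∫ t, ∫ x, T k t x * u t x) atTop (𝓝 (∫ t, ∫ x, G t x * u t x)) := by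
  have hi := integrable_mixed_mul hu hG hu' hG'
  have hik := fun k => integrable_mixed_mul hu (hT k) hu' (hT' k)
  have e1 := integral_prod _ hi
  have e2 := fun k => integral_prod _ (hik k)
  simp only [Function.uncurry] at e1 e2
  rw [← e1]
  simp_rw [← e2]
  rw [tendsto_iff_edist_tendsto_0]
  have hlim2 : Tendsto (fun k => mixedNorm q r u *
      mixedNorm q' r' (fun t x => G t x - T k t x)) atTop (𝓝 0) := by
    simpa using ENNReal.Tendsto.const_mul hlim (Or.inr hu'.ne)
  refine tendsto_of_tendsto_of_tendsto_of_le_of_le tendsto_const_nhds hlim2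
    (fun _ => zero_le) fun k => ?_
  simp only
  rw [edist_comm, edist_eq_enorm_sub]
  have e3 := integral_sub hi (hik k)
  simp only [Function.uncurry] at e3
  rw [← e3]
  refine (enorm_integral_le_lintegral_enorm _).trans ?_
  have hm : Measurable fun p : ℝ × Eu n => ‖G p.1 p.2 * u p.1 p.2 - T k p.1 p.2 * u p.1 p.2‖ₑ :=
    ((hG.mul hu).sub ((hT k).mul hu)).enorm
  rw [lintegral_prod _ hm.aemeasurable]
  refine le_trans (le_of_eq ?_) (lintegral_mul_le_mixedNorm (q := q) (r := r) hu (hG.sub (hT k)))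
  congr 1; funext t; congr 1; funext x
  rw [← sub_mul, mul_comm, enorm_mul]

/-- Nice functions converging fast to a given function. -/
lemma exists_fast_nice (hq : 1 ≤ q') (hq' : q' ≠ ⊤) (hr : 1 ≤ r') (hr' : r' ≠ ⊤)
    {G : ℝ → Eu n → ℂ} (hG : Measurable (Function.uncurry G)) (hGf : mixedNorm q' r' G ≠ ⊤) :
    ∃ T : ℕ → ℝ → Eu n → ℂ, (∀ k, Nice (T k)) ∧
      (∀ k, mixedNorm q' r' (T k) ≤ mixedNorm q' r' G) ∧
      (∀ k, mixedNorm q' r' (fun t x => G t x - T k t x) ≤ (1 / 4) ^ k) ∧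
      ∀ N k m, N ≤ k → N ≤ m → mixedNorm q' r' (fun t x => T k t x - T m t x) ≤
        2 * (1 / 4) ^ N := by
  have h1 := tendsto_mixedNorm_sub_trunc (zero_lt_one.trans_le hq).ne' hq'
    (zero_lt_one.trans_le hr).ne' hr' hG hGf
  have h2 : ∀ k : ℕ, ∃ N, mixedNorm q' r' (fun t x => G t x - trunc N G t x) < (1 / 4) ^ k :=
    fun k => ((tendsto_order.1 h1).2 _ (ENNReal.pow_pos (by simp) k)).exists
  choose φ hφ using h2
  have hn : ∀ k, Nice (trunc (φ k) G) := fun k => nice_trunc hG _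
  refine ⟨fun k => trunc (φ k) G, hn,
    fun k => mixedNorm_mono (enorm_trunc_le _ _), fun k => (hφ k).le, fun N k m hk hm => ?_⟩
  have e : (fun t x => trunc (φ k) G t x - trunc (φ m) G t x) = fun t x =>
      (G t x - trunc (φ m) G t x) + (trunc (φ k) G t x - G t x) := by
    funext t x; ring
  rw [e]
  refine (mixedNorm_add_le hq hr (hG.sub (hn m).meas) ((hn k).meas.sub hG)).trans ?_
  have hmono : ∀ k, N ≤ k → ((1 / 4 : ℝ≥0∞)) ^ k ≤ (1 / 4) ^ N := fun k hk =>
    pow_le_pow_right_of_le_one' (by norm_num) hk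
  rw [two_mul, mixedNorm_sub_comm (trunc (φ k) G) G]
  exact add_le_add ((hφ m).le.trans (hmono m hm)) ((hφ k).le.trans (hmono k hk))

lemma specInt_sub (hψ : Measurable ψ) {G H : ℝ → Eu n → ℂ} (hG : Nice G) (hH : Nice H)
    (ξ : Eu n) : specInt ψ (fun t x => G t x - H t x) ξ = specInt ψ G ξ - specInt ψ H ξ := by
  rw [specInt_add hψ (hG.sub hH) hH (K := G) (fun t x => by ring) ξ]
  ring

lemma tendsto_quarter_pow : Tendsto (fun k : ℕ => (1 / 4 : ℝ≥0∞) ^ k) atTop (𝓝 0) :=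
  ENNReal.tendsto_pow_atTop_nhds_zero_of_lt_one (by norm_num)

/-- The dual homogeneous estimate. -/
theorem SpecBound.exists_dual [ENNReal.HolderConjugate q q'] [ENNReal.HolderConjugate r r']
    (hB : SpecBound ψ W q' r' A) (hq : 1 < q) (hr : 1 < r) {G : ℝ → Eu n → ℂ}
    (hG : Measurable (Function.uncurry G)) (hGf : mixedNorm q' r' G < ⊤) :
    ∃ V : Eu n → ℂ, MemLp V 2 volume ∧ eLpNorm V 2 volume ≤ A * mixedNorm q' r' G ∧
      ∀ h : Eu n → ℂ, IsAnn h →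
        Integrable (fun s => ∫ x, G s x * evol ψ (fun ξ => W ξ * h ξ) s x) ∧
        ∫ ξ, V ξ * h ξ = ∫ s, ∫ x, G s x * evol ψ (fun ξ => W ξ * h ξ) s x := by
  have hq1 : 1 ≤ q' := (ENNReal.HolderConjugate.symm (p := q) (q := q')).one_le
  have hr1 : 1 ≤ r' := (ENNReal.HolderConjugate.symm (p := r) (q := r')).one_le
  have hq't : q' ≠ ⊤ := fun h => hq.ne' ((ENNReal.HolderConjugate.eq_top_iff_eq_one q' q).1 h)
  have hr't : r' ≠ ⊤ := fun h => hr.ne' ((ENNReal.HolderConjugate.eq_top_iff_eq_one r' r).1 h)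
  obtain ⟨T, hTn, hTG, hGT, hTT⟩ := exists_fast_nice hq1 hq't hr1 hr't hG hGf.ne
  set f : ℕ → Eu n → ℂ := fun k ξ => W ξ * specInt ψ (T k) ξ with hf
  have hfm : ∀ k, Measurable (f k) := fun k =>
    hB.weight.meas.mul (measurable_specInt hB.phase (hTn k).meas)
  have hfb : ∀ k, eLpNorm (f k) 2 volume ≤ A * mixedNorm q' r' G := fun k =>
    (hB.bound _ (hTn k)).trans (by gcongr; exact hTG k)
  have hf2 : ∀ k, MemLp (f k) 2 volume := fun k =>
    ⟨(hfm k).aestronglyMeasurable, (hfb k).trans_lt (ENNReal.mul_lt_top hB.fin.lt_top hGf)⟩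
  -- The spectral bound applied to differences of nice functions makes $WZ_k$ Cauchy in $L^2$; the
  -- summand $4^{-N}$ only serves to make the estimate strict.
  obtain ⟨V, hV, hlim⟩ := Lp.cauchy_complete_eLpNorm (μ := volume) (p := 2) (by norm_num) hf2
    (B := fun N => A * (2 * (1 / 4) ^ N) + (1 / 4) ^ N) (by
      rw [ENNReal.tsum_add, ENNReal.tsum_mul_left, ENNReal.tsum_mul_left, ENNReal.tsum_geometric]
      have : (1 - 1 / 4 : ℝ≥0∞)⁻¹ ≠ ⊤ := by
        rw [ENNReal.inv_ne_top]
        exact (tsub_pos_of_lt (by norm_num)).ne'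
      have := hB.fin
      finiteness) (fun N k m hk hm => by
      have e : f k - f m = fun ξ => W ξ * specInt ψ (fun t x => T k t x - T m t x) ξ := by
        funext ξ
        rw [specInt_sub hB.phase (hTn k) (hTn m)]
        simp only [hf, Pi.sub_apply]
        ring
      rw [e]
      refine lt_of_le_of_lt ((hB.bound _ ((hTn k).sub (hTn m))).trans
        (mul_le_mul_right (hTT N k m hk hm) A)) ?_
      refine ENNReal.lt_add_right ?_ (ENNReal.pow_pos (by simp) N).ne'
      exact ENNReal.mul_ne_top hB.fin (by finiteness))
  refine ⟨V, hV, ?_, fun h hh => ?_⟩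
  · exact eLpNorm_le_of_tendsto_sub (fun k => (hf2 k).1) hV.1 (by norm_num) hfb hlim
  · have hWh := hB.weight.mul_isAnn hh
    have hu := measurable_evol hB.phase hWh.meas
    have hu' : mixedNorm q r (evol ψ fun ξ => W ξ * h ξ) < ⊤ :=
      (hB.mixedNorm_evol_le hq hr hh).trans_lt (ENNReal.mul_lt_top hB.fin.lt_top (hh.memLp 2).2)
    refine ⟨(integrable_mixed_mul hu hG hu' hGf).integral_prod_left, ?_⟩
    have h1 := tendsto_integral_mixed_mul hu hG (fun k => (hTn k).meas) hu' hGf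
      (fun k => (hTG k).trans_lt hGf) (tendsto_of_tendsto_of_tendsto_of_le_of_le (g := fun _ : ℕ => (0 : ℝ≥0∞))
        tendsto_const_nhds tendsto_quarter_pow (fun _ => zero_le) hGT)
    refine tendsto_nhds_unique ?_ h1
    simp_rw [integral_mul_evol hB.phase hWh (hTn _)]
    have e : ∀ k ξ, specInt ψ (T k) ξ * (W ξ * h ξ) = f k ξ * h ξ := fun k ξ => by
      simp only [hf]; ring
    simp_rw [e]
    rw [tendsto_iff_edist_tendsto_0]
    have hlim2 : Tendsto (fun k => eLpNorm (f k - V) 2 volume * eLpNorm h 2 volume) atTop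
        (𝓝 0) := by
      simpa using ENNReal.Tendsto.mul_const hlim (Or.inr (hh.memLp 2).2.ne)
    refine tendsto_of_tendsto_of_tendsto_of_le_of_le tendsto_const_nhds hlim2
      (fun _ => zero_le) fun k => ?_
    simp only
    have e2 := integral_sub ((hf2 k).integrable_mul (hh.memLp 2)) (hV.integrable_mul (hh.memLp 2))
    simp only [Pi.mul_apply] at e2
    rw [edist_eq_enorm_sub, ← e2]
    simp_rw [← sub_mul]
    exact enorm_integral_mul_le ((hf2 k).1.sub hV.1) (hh.memLp 2).1

end


variable {n : ℕ}

/-! ### The Duhamel operators with frequency cutoff -/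

/-- The restriction of a space-time function to a set of times. -/
noncomputable def cutTime (I : Set ℝ) (G : ℝ → Eu n → ℂ) (s : ℝ) (x : Eu n) : ℂ :=
  I.indicator (fun s => G s x) s

/-- `∫_I e^{-i s ψ(ξ)} Ĝ(s, ξ) ds`. -/
noncomputable def partInt (ψ : Eu n → ℝ) (G : ℝ → Eu n → ℂ) (I : Set ℝ) (ξ : Eu n) : ℂ :=
  ∫ s in I, specKer ψ G s ξ

/-- The operator `∫_{S t} e^{i(t-s)ψ(D)} k(D) G(s) ds`. -/
noncomputable def duh (ψ : Eu n → ℝ) (k : Eu n → ℂ) (S : ℝ → Set ℝ) (G : ℝ → Eu n → ℂ) (t : ℝ)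
    (x : Eu n) : ℂ :=
  IFT (fun ξ => k ξ * (osc ψ t ξ * partInt ψ G (S t) ξ)) x

section
variable {ψ : Eu n → ℝ} {G : ℝ → Eu n → ℂ} {I J : Set ℝ}

lemma cutTime_of_mem {s : ℝ} (hs : s ∈ I) : cutTime I G s = G s := by
  funext x; exact indicator_of_mem hs _

lemma cutTime_of_notMem {s : ℝ} (hs : s ∉ I) : cutTime I G s = 0 := by
  funext x; exact indicator_of_notMem hs _

lemma Nice.cutTime (hG : Nice G) (hI : MeasurableSet I) : Nice (cutTime I G) := by
  obtain ⟨M, hM⟩ := hG.bdd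
  obtain ⟨R, hR⟩ := hG.supp
  have hM0 : 0 ≤ M := (norm_nonneg _).trans (hM 0 0)
  refine ⟨?_, ⟨M, fun t x => ?_⟩, ⟨R, fun t x h => ?_⟩⟩
  · have : Function.uncurry (Strichartz.cutTime I G) =
        {p : ℝ × Eu n | p.1 ∈ I}.indicator (Function.uncurry G) := by
      funext p
      simp [Function.uncurry, Strichartz.cutTime, indicator]
    rw [this]
    exact hG.meas.indicator (measurable_fst hI)
  · by_cases ht : t ∈ I
    · rw [cutTime_of_mem ht]; exact hM t x
    · rw [cutTime_of_notMem ht]; simpa using hM0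
  · by_cases ht : t ∈ I
    · rw [cutTime_of_mem ht]; exact hR t x h
    · rw [cutTime_of_notMem ht]; rfl

lemma specInt_cutTime (hI : MeasurableSet I) (ξ : Eu n) :
    specInt ψ (cutTime I G) ξ = partInt ψ G I ξ := by
  rw [specInt, partInt, ← integral_indicator hI]
  congr 1; funext s
  by_cases hs : s ∈ I
  · rw [indicator_of_mem hs, specKer, cutTime_of_mem hs, specKer]
  · rw [indicator_of_notMem hs, specKer, cutTime_of_notMem hs, FT_def]
    simp

lemma partInt_univ (ξ : Eu n) : partInt ψ G univ ξ = specInt ψ G ξ := by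
  rw [partInt, Measure.restrict_univ, specInt]

lemma measurable_partInt_family (hψ : Measurable ψ) (hG : Measurable (Function.uncurry G))
    {S : ℝ → Set ℝ} (hS : MeasurableSet {p : ℝ × ℝ | p.2 ∈ S p.1}) :
    Measurable fun p : ℝ × Eu n => partInt ψ G (S p.1) p.2 := by
  have hSt : ∀ t, MeasurableSet (S t) := fun t => measurable_prodMk_left (x := t) hS
  have e : ∀ p : ℝ × Eu n, partInt ψ G (S p.1) p.2 =
      ∫ s, {p : (ℝ × Eu n) × ℝ | p.2 ∈ S p.1.1}.indicator
        (fun p => specKer ψ G p.2 p.1.2) (p, s) := fun p => by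
    rw [partInt, ← integral_indicator (hSt p.1)]
    congr 1
  simp_rw [e]
  have h1 : Measurable fun p : (ℝ × Eu n) × ℝ => specKer ψ G p.2 p.1.2 :=
    (measurable_specKer hψ hG).comp (f := fun p : (ℝ × Eu n) × ℝ => (p.2, p.1.2)) (by fun_prop)
  have h2 : MeasurableSet {p : (ℝ × Eu n) × ℝ | p.2 ∈ S p.1.1} :=
    (by fun_prop : Measurable fun p : (ℝ × Eu n) × ℝ => (p.1.1, p.2)) hS
  exact ((h1.indicator h2).stronglyMeasurable.integral_prod_right' (ν := volume)).measurable

lemma measurable_partInt (hψ : Measurable ψ) (hG : Nice G) (hI : MeasurableSet I) :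
    Measurable (partInt ψ G I) := by
  have e : partInt ψ G I = specInt ψ (cutTime I G) := funext fun ξ => (specInt_cutTime hI ξ).symm
  rw [e]
  exact measurable_specInt hψ (hG.cutTime hI).meas

lemma Nice.partInt_bdd (hG : Nice G) : ∃ K, 0 ≤ K ∧ ∀ I ξ, ‖partInt ψ G I ξ‖ ≤ K := by
  obtain ⟨κ, h1, -, h3, h2⟩ := hG.specKer_dom (ψ := ψ)
  refine ⟨∫ s, κ s, integral_nonneg h3, fun I ξ => ?_⟩
  refine (norm_integral_le_of_norm_le h1.integrableOn (ae_of_all _ fun s => h2 s ξ)).trans ?_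
  exact setIntegral_le_integral h1 (ae_of_all _ h3)

lemma annBdd_partInt (hψ : Measurable ψ) (hG : Nice G) (hI : MeasurableSet I) :
    AnnBdd (partInt ψ G I) :=
  let ⟨_, _, hK⟩ := hG.partInt_bdd (ψ := ψ)
  annBdd_of_bdd (measurable_partInt hψ hG hI) fun ξ _ => hK I ξ

lemma IsAnn.mul_annBdd {k w : Eu n → ℂ} (hk : IsAnn k) (hw : AnnBdd w) :
    IsAnn (fun ξ => k ξ * w ξ) := by
  simpa only [mul_comm] using hw.mul_isAnn hk

lemma annBdd_specKer (hψ : Measurable ψ) (hG : Nice G) (t : ℝ) : AnnBdd (specKer ψ G t) := by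
  obtain ⟨κ, -, -, -, h2⟩ := hG.specKer_dom (ψ := ψ)
  exact annBdd_of_bdd ((measurable_specKer hψ hG.meas).comp measurable_prodMk_left)
    fun ξ _ => h2 t ξ

lemma setIntegral_integral_specKer (hψ : Measurable ψ) (hG : Nice G) {a : Eu n → ℂ} (ha : IsAnn a) :
    ∫ s in I, ∫ ξ, a ξ * specKer ψ G s ξ = ∫ ξ, a ξ * partInt ψ G I ξ := by
  have h1 : Integrable (Function.uncurry fun (s : ℝ) (ξ : Eu n) => a ξ * specKer ψ G s ξ)
      ((volume.restrict I).prod volume) := by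
    simp_rw [mul_comm (a _)]
    have := integrable_specKer_mul hψ ha hG
    rw [← Measure.restrict_univ (μ := (volume : Measure (Eu n))), Measure.prod_restrict]
    exact this.integrableOn
  rw [integral_integral_swap h1]
  congr 1; funext ξ
  rw [integral_const_mul, partInt]

lemma setIntegral_integral_conj_specKer (hψ : Measurable ψ) (hG : Nice G) {a : Eu n → ℂ}
    (ha : IsAnn a) :
    ∫ s in I, ∫ ξ, a ξ * (starRingEnd ℂ) (specKer ψ G s ξ) =
      ∫ ξ, a ξ * (starRingEnd ℂ) (partInt ψ G I ξ) := by
  have h := congrArg (starRingEnd ℂ) (setIntegral_integral_specKer (I := I) hψ hG ha.conj)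
  rw [← integral_conj, ← integral_conj] at h
  simp_rw [← integral_conj, map_mul, Complex.conj_conj] at h
  exact h

/-- The bilinear form of the Duhamel operators. -/
noncomputable def bil (ψ : Eu n → ℝ) (k : Eu n → ℂ) (G H : ℝ → Eu n → ℂ) (s t : ℝ) : ℂ :=
  ∫ ξ, k ξ * (starRingEnd ℂ) (specKer ψ H t ξ) * specKer ψ G s ξ

variable {H : ℝ → Eu n → ℂ} {k : Eu n → ℂ}

lemma setIntegral_bil (hψ : Measurable ψ) (hk : IsAnn k) (hG : Nice G) (hH : Nice H) (t : ℝ) :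
    ∫ s in I, bil ψ k G H s t =
      ∫ ξ, k ξ * (starRingEnd ℂ) (specKer ψ H t ξ) * partInt ψ G I ξ :=
  setIntegral_integral_specKer hψ hG (hk.mul_annBdd (annBdd_specKer hψ hH t).conj)

/-- On a product of time sets the form factorises, for each $\xi$, into two partial spectral
integrals. A triangle $s<t$ has no such factorisation, which is why rectangles are used there. -/
lemma setIntegral_setIntegral_bil (hψ : Measurable ψ) (hk : IsAnn k) (hG : Nice G) (hH : Nice H)
    (hI : MeasurableSet I) :
    ∫ t in J, ∫ s in I, bil ψ k G H s t =
      ∫ ξ, k ξ * partInt ψ G I ξ * (starRingEnd ℂ) (partInt ψ H J ξ) := by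
  simp_rw [setIntegral_bil hψ hk hG hH]
  rw [← setIntegral_integral_conj_specKer hψ hH (hk.mul_annBdd (annBdd_partInt hψ hG hI))]
  congr 1; funext t; congr 1; funext ξ
  ring

lemma measurable_bil (hψ : Measurable ψ) (hk : IsAnn k) (hG : Nice G) (hH : Nice H) :
    Measurable (Function.uncurry (bil ψ k G H)) := by
  have e1 : Measurable fun p : (ℝ × ℝ) × Eu n => specKer ψ G p.1.1 p.2 :=
    (measurable_specKer hψ hG.meas).comp (f := fun p : (ℝ × ℝ) × Eu n => (p.1.1, p.2)) (by fun_prop)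
  have e2 : Measurable fun p : (ℝ × ℝ) × Eu n => specKer ψ H p.1.2 p.2 :=
    (measurable_specKer hψ hH.meas).comp (f := fun p : (ℝ × ℝ) × Eu n => (p.1.2, p.2)) (by fun_prop)
  have h : Measurable fun p : (ℝ × ℝ) × Eu n =>
      k p.2 * (starRingEnd ℂ) (specKer ψ H p.1.2 p.2) * specKer ψ G p.1.1 p.2 :=
    ((hk.meas.comp measurable_snd).mul (Complex.continuous_conj.measurable.comp e2)).mul e1
  exact (h.stronglyMeasurable.integral_prod_right' (ν := volume)).measurable

lemma bil_bdd (hk : IsAnn k) (hG : Nice G) (hH : Nice H) :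
    ∃ M, ∀ s t, ‖bil ψ k G H s t‖ ≤ M := by
  obtain ⟨K, -, hK, hK1, -⟩ := hG.FT_bdd
  obtain ⟨L, -, hL, hL1, -⟩ := hH.FT_bdd
  refine ⟨∫ ξ, ‖k ξ‖ * L * K, fun s t => norm_integral_le_of_norm_le
    ((hk.integrable.norm.mul_const L).mul_const K) (ae_of_all _ fun ξ => ?_)⟩
  rw [norm_mul, norm_mul, RCLike.norm_conj, norm_specKer, norm_specKer]
  gcongr
  · exact hL1 t ξ
  · exact hK1 s ξ

lemma bil_supp (hG : Nice G) (hH : Nice H) :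
    ∃ R, ∀ s t, R < |s| ∨ R < |t| → bil ψ k G H s t = 0 := by
  obtain ⟨-, R, -, -, hR⟩ := hG.FT_bdd
  obtain ⟨-, R', -, -, hR'⟩ := hH.FT_bdd
  refine ⟨max R R', fun s t h => ?_⟩
  unfold bil
  rw [← integral_zero (Eu n) ℂ]
  congr 1; funext ξ
  rcases h with h | h
  · rw [specKer, specKer, hR s ξ ((le_max_left _ _).trans_lt h)]; simp
  · rw [specKer, specKer, hR' t ξ ((le_max_right _ _).trans_lt h)]; simp

/-! ### Pairing with the Duhamel operators -/

lemma integral_IFT_mul {h f : Eu n → ℂ} (hh : Integrable h) (hf : Integrable f) :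
    ∫ x, IFT h x * f x = ∫ ξ, h ξ * (starRingEnd ℂ) (FT (fun x => (starRingEnd ℂ) (f x)) ξ) := by
  have h1 := congrArg (starRingEnd ℂ) (integral_mul_FT (integrable_conj hf) (integrable_conj hh))
  rw [← integral_conj, ← integral_conj] at h1
  simp only [map_mul, Complex.conj_conj] at h1
  simp only [IFT, mul_comm _ (f _)]
  rw [h1]
  congr 1; funext ξ; ring

lemma isAnn_duh (hψ : Measurable ψ) (hk : IsAnn k) (hG : Nice G) (t : ℝ) (hI : MeasurableSet I) :
    IsAnn (fun ξ => k ξ * (osc ψ t ξ * partInt ψ G I ξ)) :=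
  hk.mul_annBdd ((annBdd_osc hψ t).mul (annBdd_partInt hψ hG hI))

lemma measurable_duh (hψ : Measurable ψ) (hk : IsAnn k) (hG : Nice G) {S : ℝ → Set ℝ}
    (hS : MeasurableSet {p : ℝ × ℝ | p.2 ∈ S p.1}) :
    Measurable (Function.uncurry (duh ψ k S G)) := by
  refine Complex.continuous_conj.measurable.comp (measurable_FT_slice
    (G := fun t ξ => (starRingEnd ℂ) (k ξ * (osc ψ t ξ * partInt ψ G (S t) ξ))) ?_)
  exact Complex.continuous_conj.measurable.comp ((hk.meas.comp measurable_snd).mul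
    ((measurable_osc hψ).mul (measurable_partInt_family hψ hG.meas hS)))

lemma duh_bdd (hk : IsAnn k) (hG : Nice G) (S : ℝ → Set ℝ) :
    ∃ M, ∀ t x, ‖duh ψ k S G t x‖ ≤ M := by
  obtain ⟨K, hK0, hK⟩ := hG.partInt_bdd (ψ := ψ)
  refine ⟨ftConst n * ∫ ξ, ‖k ξ‖ * K, fun t x => ?_⟩
  rw [duh, IFT, RCLike.norm_conj]
  refine (norm_FT_le _ _).trans (mul_le_mul_of_nonneg_left ?_ (ftConst_pos n).le)
  refine integral_mono_of_nonneg (ae_of_all _ fun _ => norm_nonneg _)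
    (hk.integrable.norm.mul_const K) (ae_of_all _ fun ξ => ?_)
  simp only [RCLike.norm_conj, norm_mul, norm_osc, one_mul]
  gcongr
  exact hK _ ξ

/-- The form `bil` is conjugate-linear in its second function, hence the conjugate of $H$ when the
pairing is bilinear. -/
lemma integral_duh_mul (hψ : Measurable ψ) (hk : IsAnn k) (hG : Nice G) (hH : Nice H)
    {S : ℝ → Set ℝ} (hS : ∀ t, MeasurableSet (S t)) :
    ∫ t, ∫ x, duh ψ k S G t x * H t x =
      ∫ t, ∫ s in S t, bil ψ k G (fun t x => (starRingEnd ℂ) (H t x)) s t := by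
  congr 1; funext t
  rw [setIntegral_bil hψ hk hG hH.conj]
  simp only [duh]
  rw [integral_IFT_mul (isAnn_duh hψ hk hG t (hS t)).integrable (hH.integrable t)]
  congr 1; funext ξ
  simp only [specKer, map_mul, conj_osc, neg_neg]
  ring

lemma duh_sub_symbol (hψ : Measurable ψ) {k' : Eu n → ℂ} (hk : IsAnn k) (hk' : IsAnn k')
    (hG : Nice G) {S : ℝ → Set ℝ} (hS : ∀ t, MeasurableSet (S t)) (t : ℝ) (x : Eu n) :
    duh ψ (fun ξ => k ξ - k' ξ) S G t x = duh ψ k S G t x - duh ψ k' S G t x := by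
  simp only [duh, IFT]
  rw [← map_sub, ← FT_sub (isAnn_duh hψ hk hG t (hS t)).conj.integrable
    (isAnn_duh hψ hk' hG t (hS t)).conj.integrable]
  congr 2; funext ξ
  rw [← map_sub]
  congr 1; ring

lemma duh_sub (hψ : Measurable ψ) (hk : IsAnn k) (hG : Nice G) (hH : Nice H) {S : ℝ → Set ℝ}
    (hS : ∀ t, MeasurableSet (S t)) (t : ℝ) (x : Eu n) :
    duh ψ k S (fun t x => G t x - H t x) t x = duh ψ k S G t x - duh ψ k S H t x := by
  have h1 : ∀ ξ, partInt ψ (fun t x => G t x - H t x) (S t) ξ =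
      partInt ψ G (S t) ξ - partInt ψ H (S t) ξ := fun ξ => by
    simp only [partInt]
    rw [← integral_sub (hG.integrable_specKer hψ ξ).integrableOn
      (hH.integrable_specKer hψ ξ).integrableOn]
    congr 1; funext s
    simp only [specKer]
    rw [FT_sub (hG.integrable s) (hH.integrable s)]
    ring
  simp only [duh, IFT, h1]
  rw [← map_sub, ← FT_sub (isAnn_duh hψ hk hG t (hS t)).conj.integrable
    (isAnn_duh hψ hk hH t (hS t)).conj.integrable]
  congr 2; funext ξ
  rw [← map_sub]
  congr 1; ring

end


variable {n : ℕ}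

/-! ### Bounds for the Duhamel operators -/

/-- The power `‖G(s)‖_R^P` of a slice norm. -/
noncomputable def sliceNorm (P : ℝ) (R : ℝ≥0∞) (G : ℝ → Eu n → ℂ) (s : ℝ) : ℝ :=
  (eLpNorm (G s) R volume).toReal ^ P

section
variable {P : ℝ} {R : ℝ≥0∞} {G : ℝ → Eu n → ℂ}

lemma measurable_sliceNorm (hG : Nice G) : Measurable (sliceNorm P R G) :=
  (measurable_eLpNorm_slice hG.meas R).ennreal_toReal.pow_const P

lemma sliceNorm_nonneg (s : ℝ) : 0 ≤ sliceNorm P R G s := by unfold sliceNorm; positivity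

lemma sliceNorm_bdd (hP : 0 < P) (hG : Nice G) : ∃ M, ∀ s, sliceNorm P R G s ≤ M := by
  obtain ⟨M, hM⟩ := hG.bdd
  obtain ⟨ρ, hρ⟩ := hG.supp
  have hc : volume (Metric.closedBall (0 : Eu n) ρ) ≠ ⊤ :=
    (isCompact_closedBall _ _).measure_lt_top.ne
  have hB : MemLp ((Metric.closedBall (0 : Eu n) ρ).indicator fun _ => M) R volume :=
    memLp_indicator_const _ Metric.isClosed_closedBall.measurableSet _ (Or.inr hc)
  refine ⟨(eLpNorm ((Metric.closedBall (0 : Eu n) ρ).indicator fun _ => M) R volume).toReal ^ P,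
    fun s => ?_⟩
  unfold sliceNorm
  gcongr
  · exact hB.2.ne
  · refine eLpNorm_mono fun x => ?_
    by_cases hx : x ∈ Metric.closedBall (0 : Eu n) ρ
    · rw [indicator_of_mem hx]; exact (hM s x).trans (le_abs_self M)
    · rw [indicator_of_notMem hx, hρ s x (Or.inr (by simpa using hx))]
      simp

lemma intervalIntegrable_of_bdd_real {f : ℝ → ℝ} (hf : Measurable f) (h0 : ∀ s, 0 ≤ f s) {M : ℝ}
    (hM : ∀ s, f s ≤ M) (a c : ℝ) : IntervalIntegrable f volume a c := by
  rw [intervalIntegrable_iff]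
  refine Measure.integrableOn_of_bounded (M := M) (by simp) hf.aestronglyMeasurable
    (ae_of_all _ fun s => ?_)
  rw [Real.norm_of_nonneg (h0 s)]
  exact hM s

/-- Expresses the norm over a time interval as a power of an additive function of the interval, the
shape the Christ-Kiselev argument requires. -/
lemma mixedNorm_cutTime (hP : 0 < P) (hG : Nice G) {a m : ℝ} (ham : a ≤ m) :
    mixedNorm (ENNReal.ofReal P) R (cutTime (Ioc a m) G) =
      ENNReal.ofReal ((∫ s in a..m, sliceNorm P R G s) ^ (1 / P)) := by
  obtain ⟨M, hM⟩ := sliceNorm_bdd (R := R) hP hG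
  have hi := (intervalIntegrable_of_bdd_real (measurable_sliceNorm hG) sliceNorm_nonneg hM a m).1
  have h0 : 0 ≤ ∫ s in a..m, sliceNorm P R G s :=
    intervalIntegral.integral_nonneg ham fun s _ => sliceNorm_nonneg s
  have h1 : mixedNorm (ENNReal.ofReal P) R (cutTime (Ioc a m) G) ^ P =
      ENNReal.ofReal (∫ s in a..m, sliceNorm P R G s) := by
    rw [mixedNorm_ofReal_rpow hP, intervalIntegral.integral_of_le ham,
      ofReal_integral_eq_lintegral_ofReal hi (ae_of_all _ sliceNorm_nonneg),
      ← lintegral_indicator measurableSet_Ioc]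
    congr 1; funext s
    by_cases hs : s ∈ Ioc a m
    · rw [indicator_of_mem hs, cutTime_of_mem hs, sliceNorm,
        ← ENNReal.ofReal_rpow_of_nonneg ENNReal.toReal_nonneg hP.le,
        ENNReal.ofReal_toReal (hG.memLp s R).2.ne]
    · rw [indicator_of_notMem hs, cutTime_of_notMem hs]
      simp [hP]
  rw [← ENNReal.ofReal_rpow_of_nonneg h0 (by positivity), ← h1, ← ENNReal.rpow_mul,
    mul_one_div_cancel hP.ne', ENNReal.rpow_one]

lemma mixedNorm_cutTime_le (q r : ℝ≥0∞) (G : ℝ → Eu n → ℂ) (I : Set ℝ) :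
    mixedNorm q r (cutTime I G) ≤ mixedNorm q r G := by
  refine mixedNorm_mono fun t x => ?_
  by_cases ht : t ∈ I
  · rw [cutTime_of_mem ht]
  · rw [cutTime_of_notMem ht]; simp

lemma integral_sliceNorm_le (hP : 0 < P) (hG : Nice G) {a m B : ℝ} (ham : a ≤ m) (hB : 0 ≤ B)
    (h : mixedNorm (ENNReal.ofReal P) R G ≤ ENNReal.ofReal B) :
    ∫ s in a..m, sliceNorm P R G s ≤ B ^ P := by
  have h0 : 0 ≤ ∫ s in a..m, sliceNorm P R G s :=
    intervalIntegral.integral_nonneg ham fun s _ => sliceNorm_nonneg s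
  have h1 := (mixedNorm_cutTime_le _ _ G (Ioc a m)).trans h
  rw [mixedNorm_cutTime hP hG ham, ENNReal.ofReal_le_ofReal_iff hB] at h1
  have h2 := Real.rpow_le_rpow (by positivity) h1 hP.le
  rwa [← Real.rpow_mul h0, one_div_mul_cancel hP.ne', Real.rpow_one] at h2

end

lemma le_mul_of_forall {C F m : ℝ≥0∞} (hC : C ≠ ⊤) (hm : m ≠ ⊤)
    (h : ∀ a : ℝ, 0 < a → m ≤ ENNReal.ofReal a → F ≤ C * ENNReal.ofReal a) : F ≤ C * m := by
  have h1 : ∀ k : ℕ, F ≤ C * ENNReal.ofReal (m.toReal + 1 / ((k : ℝ) + 1)) := fun k => by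
    have hp : 0 < 1 / ((k : ℝ) + 1) := by positivity
    have h0 : 0 ≤ m.toReal := ENNReal.toReal_nonneg
    refine h _ (by linarith) ?_
    conv_lhs => rw [← ENNReal.ofReal_toReal hm]
    exact ENNReal.ofReal_le_ofReal (by linarith)
  have h2 : Tendsto (fun k : ℕ => m.toReal + 1 / ((k : ℝ) + 1)) atTop (𝓝 m.toReal) := by
    simpa using tendsto_const_nhds.add (tendsto_one_div_add_atTop_nhds_zero_nat (𝕜 := ℝ))
  have h3 := ENNReal.Tendsto.const_mul (a := C) (ENNReal.tendsto_ofReal h2) (Or.inr hC)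
  rw [ENNReal.ofReal_toReal hm] at h3
  exact ge_of_tendsto' h3 h1

section
variable {ψ : Eu n → ℝ} {W Wt ρ : Eu n → ℂ} {q q' r r' A : ℝ≥0∞} {G H : ℝ → Eu n → ℂ}

/-- The symbol of the Duhamel operators, with cutoff `ρ`. -/
noncomputable def cutSym (ρ W Wt : Eu n → ℂ) (ξ : Eu n) : ℂ := ρ ξ * (W ξ * Wt ξ)

lemma isAnn_cutSym (hρ : IsAnn ρ) (hW : AnnBdd W) (hWt : AnnBdd Wt) : IsAnn (cutSym ρ W Wt) :=
  hρ.mul_annBdd (hW.mul hWt)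

/-- The factorised form is split by Cauchy-Schwarz in $\xi$, giving $\rho\,\widetilde W$ to the
factor of $G$ and $W$ to that of $H$. The first norm is left unestimated, since it is later needed
both for boundedness and for smallness. -/
lemma enorm_setIntegral_bil_le (hB : SpecBound ψ W q' r' A) (hWt : AnnBdd Wt) (hρ : IsAnn ρ)
    (hG : Nice G) (hH : Nice H) {I J : Set ℝ} (hI : MeasurableSet I) (hJ : MeasurableSet J) :
    ‖∫ t in J, ∫ s in I, bil ψ (cutSym ρ W Wt) G H s t‖ₑ ≤
      eLpNorm (fun ξ => ρ ξ * (Wt ξ * partInt ψ G I ξ)) 2 volume *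
        (A * mixedNorm q' r' (cutTime J H)) := by
  rw [setIntegral_setIntegral_bil hB.phase (isAnn_cutSym hρ hB.weight hWt) hG hH hI]
  have hPG := measurable_partInt hB.phase hG hI
  have hPH := measurable_partInt hB.phase hH hJ
  have hWH : Measurable fun ξ => W ξ * (starRingEnd ℂ) (partInt ψ H J ξ) :=
    hB.weight.meas.mul (Complex.continuous_conj.measurable.comp hPH)
  have e : ∀ ξ, cutSym ρ W Wt ξ * partInt ψ G I ξ * (starRingEnd ℂ) (partInt ψ H J ξ) =
      (ρ ξ * (Wt ξ * partInt ψ G I ξ)) * (W ξ * (starRingEnd ℂ) (partInt ψ H J ξ)) := fun ξ => by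
    rw [cutSym]; ring
  simp_rw [e]
  refine (enorm_integral_mul_le (p := 2) (p' := 2)
    (hρ.meas.mul (hWt.meas.mul hPG)).aestronglyMeasurable
    hWH.aestronglyMeasurable).trans
    (mul_le_mul_right ?_ _)
  refine le_trans (le_of_eq ?_) (hB.bound _ (hH.cutTime hJ))
  refine eLpNorm_congr_norm_ae (ae_of_all _ fun ξ => ?_)
  simp only [norm_mul, RCLike.norm_conj, specInt_cutTime hJ]

/-- The bound for the full Duhamel operator. -/
theorem mixedNorm_duh_univ_le [ENNReal.HolderConjugate q q'] [ENNReal.HolderConjugate r r']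
    (hB : SpecBound ψ W q' r' A) (hq : 1 < q) (hr : 1 < r) (hWt : AnnBdd Wt) (hρ : IsAnn ρ)
    (hG : Nice G) :
    mixedNorm q r (duh ψ (cutSym ρ W Wt) (fun _ => univ) G) ≤
      eLpNorm (fun ξ => ρ ξ * (Wt ξ * specInt ψ G ξ)) 2 volume * A := by
  have hk := isAnn_cutSym hρ hB.weight hWt
  obtain ⟨M, hM⟩ := duh_bdd (ψ := ψ) hk hG (fun _ => univ)
  refine mixedNorm_le_of_pairing (q' := q') (r' := r') hq hr
    (measurable_duh hB.phase hk hG (by simp)) hM fun H hH => ?_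
  rw [integral_duh_mul hB.phase hk hG hH fun _ => MeasurableSet.univ]
  have h := enorm_setIntegral_bil_le hB hWt hρ hG hH.conj MeasurableSet.univ MeasurableSet.univ
  simp_rw [partInt_univ] at h
  rw [Measure.restrict_univ] at h ⊢
  refine h.trans ?_
  rw [mul_assoc]
  gcongr
  exact (mixedNorm_cutTime_le _ _ _ _).trans_eq (mixedNorm_conj _ _ _)

/-- The constant in the Christ–Kiselev argument. -/
noncomputable def ckConst (κ : ℝ) : ℝ := (1 - 2 ^ (1 - κ))⁻¹ * 3 ^ κ

lemma ckConst_nonneg {κ : ℝ} (hκ : 1 < κ) : 0 ≤ ckConst κ := by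
  have : (2 : ℝ) ^ (1 - κ) < 1 := Real.rpow_lt_one_of_one_lt_of_neg (by norm_num) (by linarith)
  have h : 0 < 1 - (2 : ℝ) ^ (1 - κ) := by linarith
  unfold ckConst; positivity

/-- The form vanishes when either time exceeds $R$ in absolute value, so the half-plane $s<t$
reduces to a bounded triangle. -/
lemma integral_Iio_eq_retInt {b : ℝ → ℝ → ℂ} {R : ℝ} (hR : ∀ s t, R < |s| ∨ R < |t| → b s t = 0)
    {R₁ : ℝ} (hR₁ : R < R₁) :
    ∫ t, ∫ s in Iio t, b s t = retInt b (-R₁) R₁ := by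
  by_cases h0 : 0 ≤ R₁
  swap
  · have hb : ∀ s t, b s t = 0 := fun s t => hR s t (Or.inl (by linarith [abs_nonneg s]))
    simp [retInt, hb]
  have h1 : ∀ t, t ∉ Ioc (-R₁) R₁ → ∫ s in Iio t, b s t = 0 := fun t ht => by
    rw [← integral_zero ℝ ℂ (μ := volume.restrict (Iio t))]
    congr 1; funext s
    refine hR s t (Or.inr (hR₁.trans_le ?_))
    by_contra hcon
    have := abs_lt.1 (not_le.1 hcon)
    exact ht ⟨this.1, this.2.le⟩
  rw [retInt, intervalIntegral.integral_of_le (by linarith),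
    ← setIntegral_eq_integral_of_forall_compl_eq_zero h1]
  refine setIntegral_congr_fun measurableSet_Ioc fun t ht => ?_
  rw [intervalIntegral.integral_of_le ht.1.le, setIntegral_congr_set Iio_ae_eq_Iic]
  refine setIntegral_eq_of_subset_of_forall_sdiff_eq_zero measurableSet_Iic (fun s hs => hs.2)
    fun s hs => hR s t (Or.inl (hR₁.trans_le ?_))
  have : s ≤ -R₁ := by
    by_contra hcon
    exact hs.2 ⟨not_le.1 hcon, hs.1⟩
  rw [le_abs]
  right; linarith

/-- The Christ–Kiselev bound, for a bilinear form bounded by powers of two integrals. -/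
lemma norm_retInt_le_of_bound {b : ℝ → ℝ → ℂ} (hbm : Measurable (Function.uncurry b)) {Mb : ℝ}
    (hMb : ∀ s t, ‖b s t‖ ≤ Mb) {μ ν : ℝ} (hμ : 0 < μ) (hν : 0 < ν) (hμν : 1 < μ + ν)
    {f h : ℝ → ℝ} (hf : Measurable f) (hf0 : ∀ s, 0 ≤ f s) {Mf : ℝ} (hfM : ∀ s, f s ≤ Mf)
    (hf1 : ∀ a c, a ≤ c → ∫ s in a..c, f s ≤ 1)
    (hh : Measurable h) (hh0 : ∀ s, 0 ≤ h s) {Mh : ℝ} (hhM : ∀ s, h s ≤ Mh)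
    (hh1 : ∀ a c, a ≤ c → ∫ s in a..c, h s ≤ 1) {B : ℝ} (hB : 0 ≤ B)
    (hrect : ∀ a m c, a ≤ m → m ≤ c → ‖∫ t in m..c, ∫ s in a..m, b s t‖ ≤
      B * (∫ s in a..m, f s) ^ μ * (∫ s in m..c, h s) ^ ν) {R : ℝ} (hR : 0 < R) :
    ‖retInt b (-R) R‖ ≤ ckConst (μ + ν) * B := by
  -- Adding the constant density $\varepsilon$ to the clock gives $c-a\le2R\,\Delta\Omega$, while
  -- over $[-R,R]$ it adds mass only $1$. With the masses of $f$ and $h$, at most $1$ each, the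
  -- total is at most $3$: the origin of $3^\kappa$ in `ckConst`.
  set ε : ℝ := 1 / (2 * R) with hε
  have hε0 : 0 < ε := by positivity
  have hfi := fun a c => intervalIntegrable_of_bdd_real hf hf0 hfM a c
  have hhi := fun a c => intervalIntegrable_of_bdd_real hh hh0 hhM a c
  have hci : ∀ a c, IntervalIntegrable (fun _ : ℝ => ε) volume a c := fun a c =>
    intervalIntegrable_const
  have hFi : ∀ a c, IntervalIntegrable (fun s => f s + h s + ε) volume a c := fun a c =>
    ((hfi a c).add (hhi a c)).add (hci a c)
  obtain ⟨Ω, hΩ⟩ : ∃ Ω : ℝ → ℝ, Ω = fun x => ∫ s in (0 : ℝ)..x, (f s + h s + ε) := ⟨_, rfl⟩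
  have hΩc : Continuous Ω := by rw [hΩ]; exact intervalIntegral.continuous_primitive hFi 0
  have hΩd : ∀ a c, Ω c - Ω a = (∫ s in a..c, f s) + (∫ s in a..c, h s) + ε * (c - a) :=
    fun a c => by
    simp only [hΩ]
    rw [intervalIntegral.integral_interval_sub_left (hFi 0 c) (hFi 0 a),
      intervalIntegral.integral_add ((hfi a c).add (hhi a c)) (hci a c),
      intervalIntegral.integral_add (hfi a c) (hhi a c), intervalIntegral.integral_const,
      smul_eq_mul, mul_comm ε]
  clear hΩ
  have hfp : ∀ a c, a ≤ c → 0 ≤ ∫ s in a..c, f s := fun a c hac =>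
    intervalIntegral.integral_nonneg hac fun s _ => hf0 s
  have hhp : ∀ a c, a ≤ c → 0 ≤ ∫ s in a..c, h s := fun a c hac =>
    intervalIntegral.integral_nonneg hac fun s _ => hh0 s
  have hΩm : Monotone Ω := fun a c hac => by
    have := hΩd a c
    have h1 := mul_nonneg hε0.le (sub_nonneg.2 hac)
    linarith [hfp a c hac, hhp a c hac]
  have hΩK : ∀ a c, a ≤ c → c - a ≤ (2 * R) * (Ω c - Ω a) := fun a c hac => by
    rw [hΩd]
    have h1 : (2 * R) * (ε * (c - a)) = c - a := by rw [hε]; field_simp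
    have h2 := mul_nonneg (by positivity : 0 ≤ 2 * R) (add_nonneg (hfp a c hac) (hhp a c hac))
    linarith
  have hint : ‖retInt b (-R) R‖ ≤ B * (1 - 2 ^ (1 - (μ + ν)))⁻¹ * (Ω R - Ω (-R)) ^ (μ + ν) := by
    refine norm_retInt_le hbm hMb hΩc hΩK hΩm hμν (fun a m c ham hmc => ?_) (by linarith)
    refine (hrect a m c ham hmc).trans ?_
    have hIf := hfp a m ham
    have hIh := hhp m c hmc
    have hD : 0 ≤ Ω c - Ω a := sub_nonneg.2 (hΩm (ham.trans hmc))
    have hεc := mul_nonneg hε0.le (sub_nonneg.2 (ham.trans hmc))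
    have hs1 : ∫ s in a..m, f s ≤ Ω c - Ω a := by
      have := intervalIntegral.integral_add_adjacent_intervals (hfi a m) (hfi m c)
      rw [hΩd]
      linarith [hfp m c hmc, hhp a c (ham.trans hmc)]
    have hs2 : ∫ s in m..c, h s ≤ Ω c - Ω a := by
      have := intervalIntegral.integral_add_adjacent_intervals (hhi a m) (hhi m c)
      rw [hΩd]
      linarith [hhp a m ham, hfp a c (ham.trans hmc)]
    calc _ ≤ B * (Ω c - Ω a) ^ μ * (Ω c - Ω a) ^ ν := by gcongr
      _ = B * (Ω c - Ω a) ^ (μ + ν) := by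
        rw [Real.rpow_add_of_nonneg hD hμ.le hν.le]; ring
  have h3 : Ω R - Ω (-R) ≤ 3 := by
    rw [hΩd]
    have e : ε * (R - -R) = 1 := by rw [hε]; field_simp; ring
    linarith [hf1 (-R) R (by linarith), hh1 (-R) R (by linarith)]
  have hD : 0 ≤ Ω R - Ω (-R) := sub_nonneg.2 (hΩm (by linarith))
  have hck : 0 ≤ (1 - (2 : ℝ) ^ (1 - (μ + ν)))⁻¹ := by
    have : (2 : ℝ) ^ (1 - (μ + ν)) < 1 :=
      Real.rpow_lt_one_of_one_lt_of_neg (by norm_num) (by linarith)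
    exact inv_nonneg.2 (by linarith)
  refine hint.trans ?_
  calc _ ≤ B * (1 - 2 ^ (1 - (μ + ν)))⁻¹ * 3 ^ (μ + ν) := by gcongr
    _ = _ := by rw [ckConst]; ring

/-- The bound on rectangles for the bilinear form of the Duhamel operators. -/
lemma norm_rect_bil_le {P : ℝ} (hP : 0 < P) (hB : SpecBound ψ W (ENNReal.ofReal P) r' A)
    (hWt : AnnBdd Wt) (hρ : IsAnn ρ) (hG : Nice G) {K : ℝ → Eu n → ℂ} (hK : Nice K) {a' : ℝ}
    (ha' : 0 < a') {N a m c : ℝ} (ham : a ≤ m) (hmc : m ≤ c) (hN0 : 0 ≤ N)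
    (hN : eLpNorm (fun ξ => ρ ξ * (Wt ξ * partInt ψ G (Ioc a m) ξ)) 2 volume ≤
      ENNReal.ofReal N) :
    ‖∫ t in m..c, ∫ s in a..m, bil ψ (cutSym ρ W Wt) G K s t‖ ≤
      N * (A.toReal * a') * (∫ s in m..c, sliceNorm P r' K s / a' ^ P) ^ (1 / P) := by
  have hap : 0 < a' ^ P := by positivity
  have h1 := enorm_setIntegral_bil_le hB hWt hρ hG hK
    (measurableSet_Ioc (a := a) (b := m)) (measurableSet_Ioc (a := m) (b := c))
  rw [mixedNorm_cutTime hP hK hmc] at h1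
  have hIh : 0 ≤ ∫ s in m..c, sliceNorm P r' K s :=
    intervalIntegral.integral_nonneg hmc fun s _ => sliceNorm_nonneg s
  have h4 := h1.trans (mul_le_mul_left hN _)
  rw [← ENNReal.ofReal_toReal hB.fin, ← ENNReal.ofReal_mul ENNReal.toReal_nonneg,
    ← ENNReal.ofReal_mul hN0, ← ofReal_norm,
    ENNReal.ofReal_le_ofReal_iff (by positivity)] at h4
  have e : ∫ t in m..c, ∫ s in a..m, bil ψ (cutSym ρ W Wt) G K s t =
      ∫ t in Ioc m c, ∫ s in Ioc a m, bil ψ (cutSym ρ W Wt) G K s t := by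
    rw [intervalIntegral.integral_of_le hmc]
    congr 1; funext t
    rw [intervalIntegral.integral_of_le ham]
  rw [e]
  refine h4.trans_eq ?_
  rw [intervalIntegral.integral_div, Real.div_rpow hIh hap.le, ← Real.rpow_mul ha'.le,
    mul_one_div_cancel hP.ne', Real.rpow_one]
  field_simp

/-- The Christ–Kiselev bound for the retarded bilinear form. -/
lemma enorm_retarded_bil_le {P : ℝ} (hP : 0 < P) (hB : SpecBound ψ W (ENNReal.ofReal P) r' A)
    (hr' : r' ≠ ⊤) (hWt : AnnBdd Wt) (hρ : IsAnn ρ) (hG : Nice G) {B μ : ℝ}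
    (hB0 : 0 ≤ B) (hμ : 0 < μ) (hμP : 1 < μ + 1 / P) {f : ℝ → ℝ} (hf : Measurable f)
    (hf0 : ∀ s, 0 ≤ f s) {Mf : ℝ} (hfM : ∀ s, f s ≤ Mf)
    (hf1 : ∀ a c, a ≤ c → ∫ s in a..c, f s ≤ 1)
    (hN : ∀ a m, a ≤ m → eLpNorm (fun ξ => ρ ξ * (Wt ξ * partInt ψ G (Ioc a m) ξ)) 2 volume ≤
      ENNReal.ofReal (B * (∫ s in a..m, f s) ^ μ)) {K : ℝ → Eu n → ℂ} (hK : Nice K) :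
    ‖∫ t, ∫ s in Iio t, bil ψ (cutSym ρ W Wt) G K s t‖ₑ ≤
      ENNReal.ofReal (ckConst (μ + 1 / P) * B) * A * mixedNorm (ENNReal.ofReal P) r' K := by
  have hk := isAnn_cutSym hρ hB.weight hWt
  have hrr : r' = ENNReal.ofReal r'.toReal := (ENNReal.ofReal_toReal hr').symm
  have hKfin : mixedNorm (ENNReal.ofReal P) r' K ≠ ⊤ := by
    rw [hrr]; exact (hK.mixedNorm_lt_top hP).ne
  refine le_mul_of_forall (ENNReal.mul_ne_top ENNReal.ofReal_ne_top hB.fin) hKfin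
    fun a' ha' hKa => ?_
  obtain ⟨R, hR⟩ := bil_supp (ψ := ψ) (k := cutSym ρ W Wt) hG hK
  obtain ⟨Mb, hMb⟩ := bil_bdd (ψ := ψ) hk hG hK
  have hbm := measurable_bil hB.phase hk hG hK
  -- The radius $|R|+1$ exceeds $R$ and is positive whatever the sign of $R$.
  rw [integral_Iio_eq_retInt hR (show R < |R| + 1 by linarith [le_abs_self R])]
  obtain ⟨Mh, hMh⟩ := sliceNorm_bdd (R := r') hP hK
  have hap : 0 < a' ^ P := by positivity
  have hck := ckConst_nonneg hμP
  have hAa : 0 ≤ A.toReal * a' := mul_nonneg ENNReal.toReal_nonneg ha'.le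
  have hrect : ∀ a m c, a ≤ m → m ≤ c →
      ‖∫ t in m..c, ∫ s in a..m, bil ψ (cutSym ρ W Wt) G K s t‖ ≤
      B * (A.toReal * a') * (∫ s in a..m, f s) ^ μ *
        (∫ s in m..c, sliceNorm P r' K s / a' ^ P) ^ (1 / P) := fun a m c ham hmc => by
    have hIf : 0 ≤ ∫ s in a..m, f s := intervalIntegral.integral_nonneg ham fun s _ => hf0 s
    refine (norm_rect_bil_le hP hB hWt hρ hG hK ha' ham hmc
      (mul_nonneg hB0 (Real.rpow_nonneg hIf _)) (hN a m ham)).trans_eq ?_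
    ring
  have hg0 : ∀ s, 0 ≤ sliceNorm P r' K s / a' ^ P := fun s =>
    div_nonneg (sliceNorm_nonneg s) hap.le
  have hg1 : ∀ s, sliceNorm P r' K s / a' ^ P ≤ Mh / a' ^ P := fun s =>
    div_le_div_of_nonneg_right (hMh s) hap.le
  have hg2 : ∀ a c, a ≤ c → ∫ s in a..c, sliceNorm P r' K s / a' ^ P ≤ 1 := fun a c hac => by
    rw [intervalIntegral.integral_div, div_le_one hap]
    exact integral_sliceNorm_le hP hK hac ha'.le hKa
  have key := norm_retInt_le_of_bound hbm hMb hμ (one_div_pos.2 hP) hμP hf hf0 hfM hf1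
    ((measurable_sliceNorm hK).div_const _) hg0 hg1 hg2 (mul_nonneg hB0 hAa) hrect
    (R := |R| + 1) (by positivity)
  rw [← ofReal_norm]
  refine (ENNReal.ofReal_le_ofReal key).trans_eq ?_
  have h0 : 0 ≤ ckConst (μ + 1 / P) * B := mul_nonneg hck hB0
  rw [show ckConst (μ + 1 / P) * (B * (A.toReal * a')) =
      ckConst (μ + 1 / P) * B * A.toReal * a' by ring,
    ENNReal.ofReal_mul (mul_nonneg h0 ENNReal.toReal_nonneg), ENNReal.ofReal_mul h0,
    ENNReal.ofReal_toReal hB.fin]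

/-- The bound for the retarded Duhamel operator, in terms of a bound for the spectral integrals over
intervals. -/
theorem mixedNorm_duh_Iio_le {P : ℝ} (hP : 0 < P) [ENNReal.HolderConjugate q (ENNReal.ofReal P)]
    [ENNReal.HolderConjugate r r'] (hB : SpecBound ψ W (ENNReal.ofReal P) r' A) (hq : 1 < q)
    (hr : 1 < r) (hr' : r' ≠ ⊤) (hWt : AnnBdd Wt) (hρ : IsAnn ρ) (hG : Nice G) {B μ : ℝ}
    (hB0 : 0 ≤ B) (hμ : 0 < μ) (hμP : 1 < μ + 1 / P) {f : ℝ → ℝ} (hf : Measurable f)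
    (hf0 : ∀ s, 0 ≤ f s) {Mf : ℝ} (hfM : ∀ s, f s ≤ Mf)
    (hf1 : ∀ a c, a ≤ c → ∫ s in a..c, f s ≤ 1)
    (hN : ∀ a m, a ≤ m → eLpNorm (fun ξ => ρ ξ * (Wt ξ * partInt ψ G (Ioc a m) ξ)) 2 volume ≤
      ENNReal.ofReal (B * (∫ s in a..m, f s) ^ μ)) :
    mixedNorm q r (duh ψ (cutSym ρ W Wt) (fun t => Iio t) G) ≤
      ENNReal.ofReal (ckConst (μ + 1 / P) * B) * A := by
  have hk := isAnn_cutSym hρ hB.weight hWt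
  obtain ⟨M, hM⟩ := duh_bdd (ψ := ψ) hk hG (fun t => Iio t)
  have hS : MeasurableSet {p : ℝ × ℝ | p.2 ∈ Iio p.1} :=
    measurableSet_lt measurable_snd measurable_fst
  have hmeas := measurable_duh (S := fun t => Iio t) hB.phase hk hG hS
  refine mixedNorm_le_of_pairing (q' := ENNReal.ofReal P) (r' := r') hq hr hmeas hM
    fun H hH => ?_
  rw [integral_duh_mul hB.phase hk hG hH fun _ => measurableSet_Iio,
    ← mixedNorm_conj _ _ H]
  exact enorm_retarded_bil_le hP hB hr' hWt hρ hG hB0 hμ hμP hf hf0 hfM hf1 hN hH.conj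

end


variable {n : ℕ}

/-! ### Removing the frequency cutoff -/

lemma ae_ne_zero (hn : 0 < n) : ∀ᵐ ξ : Eu n, ξ ≠ 0 := by
  have : Nonempty (Fin n) := ⟨⟨0, hn⟩⟩
  have : Nontrivial (Eu n) := inferInstance
  exact compl_mem_ae_iff.2 (measure_singleton 0)

/-- The frequencies where `cutoff M` may differ from one. -/
def tailSet (n M : ℕ) : Set (Eu n) := {ξ | (M : ℝ) + 2 < ‖ξ‖} ∪ {ξ | ((M : ℝ) + 2) * ‖ξ‖ < 2}

lemma measurableSet_tailSet (M : ℕ) : MeasurableSet (tailSet n M) :=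
  (measurableSet_lt measurable_const measurable_norm).union
    (measurableSet_lt (measurable_norm.const_mul _) measurable_const)

lemma cutoff_eq_one_of_notMem {M : ℕ} {ξ : Eu n} (h : ξ ∉ tailSet n M) : cutoff M ξ = 1 :=
  cutoff_eq_one (not_lt.1 fun h' => h (Or.inl h')) (not_lt.1 fun h' => h (Or.inr h'))

lemma tailSet_antitone : Antitone (tailSet n) := fun M N hMN ξ h => by
  have h1 : (M : ℝ) ≤ N := by exact_mod_cast hMN
  have h0 := norm_nonneg ξ
  rcases h with h | h
  · exact Or.inl (lt_of_le_of_lt (add_le_add_left h1 2) h)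
  · exact Or.inr (lt_of_le_of_lt (mul_le_mul_of_nonneg_right (add_le_add_left h1 2) h0) h)

lemma eventually_notMem_tailSet {ξ : Eu n} (hξ : ξ ≠ 0) : ∀ᶠ M in atTop, ξ ∉ tailSet n M := by
  have h0 := norm_pos_iff.2 hξ
  filter_upwards [eventually_ge_atTop (max ⌈‖ξ‖⌉₊ ⌈2 / ‖ξ‖⌉₊)] with M hM h
  have h1 : ‖ξ‖ ≤ M := (Nat.le_ceil _).trans (by exact_mod_cast (le_max_left _ _).trans hM)
  have h2 : 2 / ‖ξ‖ ≤ M := (Nat.le_ceil _).trans (by exact_mod_cast (le_max_right _ _).trans hM)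
  rw [div_le_iff₀ h0] at h2
  rcases h with h | h
  · have : (M : ℝ) + 2 < ‖ξ‖ := h
    linarith
  · have : ((M : ℝ) + 2) * ‖ξ‖ < 2 := h
    nlinarith

/-- The norms of an `L²` function over the tail sets tend to zero. -/
lemma tendsto_eLpNorm_tail (hn : 0 < n) {f : Eu n → ℂ} (hf : Measurable f)
    (hf2 : eLpNorm f 2 volume ≠ ⊤) :
    Tendsto (fun M => eLpNorm ((tailSet n M).indicator f) 2 volume) atTop (𝓝 0) := by
  simp_rw [← eLpNorm_enorm ((tailSet n _).indicator f)]
  refine tendsto_eLpNorm_of_dominated (B := fun ξ => ‖f ξ‖ₑ)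
    (fun M => (hf.indicator (measurableSet_tailSet M)).enorm) (by simp) (by simp)
    (fun M ξ => enorm_indicator_le_enorm_self _ _) (by simpa only [eLpNorm_enorm] using hf2) ?_
  filter_upwards [ae_ne_zero hn] with ξ hξ
  refine tendsto_const_nhds.congr' ?_
  filter_upwards [eventually_notMem_tailSet hξ] with M hM
  rw [indicator_of_notMem hM, enorm_zero]

/-! ### Uniform smallness of the spectral tails -/

section
variable {ψ : Eu n → ℝ} {Wt : Eu n → ℂ} {r' A : ℝ≥0∞} {G : ℝ → Eu n → ℂ} {P : ℝ}

lemma SpecBound.eLpNorm_partInt_le {q' : ℝ≥0∞} (hB : SpecBound ψ Wt q' r' A) (hG : Nice G)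
    {I : Set ℝ} (hI : MeasurableSet I) :
    eLpNorm (fun ξ => Wt ξ * partInt ψ G I ξ) 2 volume ≤ A * mixedNorm q' r' (cutTime I G) := by
  refine le_trans (le_of_eq ?_) (hB.bound _ (hG.cutTime hI))
  simp only [specInt_cutTime hI]

lemma SpecBound.eLpNorm_partInt_Ioc_le (hP : 0 < P) (hB : SpecBound ψ Wt (ENNReal.ofReal P) r' A)
    (hG : Nice G) {a m : ℝ} (ham : a ≤ m) :
    eLpNorm (fun ξ => Wt ξ * partInt ψ G (Ioc a m) ξ) 2 volume ≤
      ENNReal.ofReal (A.toReal * (∫ s in a..m, sliceNorm P r' G s) ^ (1 / P)) := by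
  refine (hB.eLpNorm_partInt_le hG measurableSet_Ioc).trans_eq ?_
  rw [mixedNorm_cutTime hP hG ham, ENNReal.ofReal_mul ENNReal.toReal_nonneg,
    ENNReal.ofReal_toReal hB.fin]

lemma partInt_Ioc (hψ : Measurable ψ) (hG : Nice G) {a m : ℝ} (ham : a ≤ m) (ξ : Eu n) :
    partInt ψ G (Ioc a m) ξ = partInt ψ G (Iic m) ξ - partInt ψ G (Iic a) ξ := by
  have h := hG.integrable_specKer hψ ξ
  rw [partInt, partInt, partInt, ← Iic_union_Ioc_eq_Iic ham,
    setIntegral_union (Iic_disjoint_Ioc le_rfl) measurableSet_Ioc h.integrableOn h.integrableOn]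
  ring

/-- Outside the time support of $G$ the integral over a half-line no longer depends on its endpoint;
endpoints may thus be taken in a compact interval, as Dini's theorem demands. -/
lemma partInt_Iic_clamp (hG : Nice G) : ∃ R : ℝ, 0 ≤ R ∧ ∀ m, ∃ m' ∈ Icc (-R) R, ∀ ξ,
    partInt ψ G (Iic m) ξ = partInt ψ G (Iic m') ξ := by
  obtain ⟨R, hR⟩ := hG.supp
  have hz : ∀ s, R < |s| → ∀ ξ, specKer ψ G s ξ = 0 := fun s hs ξ => by
    have : G s = 0 := funext fun x => hR s x (Or.inl hs)
    rw [specKer, this, FT_def]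
    simp
  have hR' := le_abs_self R
  have hR0 := abs_nonneg R
  have mono : ∀ a b : ℝ, a ≤ b → (∀ s, a < s → s ≤ b → R < |s|) → ∀ ξ,
      partInt ψ G (Iic b) ξ = partInt ψ G (Iic a) ξ := fun a b hab h ξ =>
    setIntegral_eq_of_subset_of_forall_sdiff_eq_zero measurableSet_Iic (Iic_subset_Iic.2 hab)
      fun s hs => hz s (h s (not_le.1 fun h' => hs.2 h') hs.1) ξ
  refine ⟨|R| + 1, by positivity, fun m => ?_⟩
  rcases lt_or_ge m (-(|R| + 1)) with h1 | h1
  · refine ⟨-(|R| + 1), ⟨le_rfl, by linarith⟩, fun ξ => (mono _ _ h1.le (fun s _ hs => ?_) ξ).symm⟩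
    exact lt_abs.2 (Or.inr (by linarith))
  rcases lt_or_ge (|R| + 1) m with h2 | h2
  · refine ⟨|R| + 1, ⟨by linarith, le_rfl⟩, fun ξ => mono _ _ h2.le (fun s hs _ => ?_) ξ⟩
    exact lt_abs.2 (Or.inl (by linarith))
  · exact ⟨m, ⟨h1, h2⟩, fun ξ => rfl⟩

/-- Triangle inequalities for the decomposition of $(-\infty,m]$ into $(-\infty,a]$ and $(a,m]$. The
first two serve for continuity in the endpoint, the third for smallness over intervals. -/
lemma eLpNorm_tail_le (hψ : Measurable ψ) (hWt : Measurable Wt) (hG : Nice G) {a m : ℝ}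
    (ham : a ≤ m) (M : ℕ) :
    eLpNorm ((tailSet n M).indicator fun ξ => Wt ξ * partInt ψ G (Iic m) ξ) 2 volume ≤
        eLpNorm ((tailSet n M).indicator fun ξ => Wt ξ * partInt ψ G (Iic a) ξ) 2 volume +
        eLpNorm (fun ξ => Wt ξ * partInt ψ G (Ioc a m) ξ) 2 volume ∧
    eLpNorm ((tailSet n M).indicator fun ξ => Wt ξ * partInt ψ G (Iic a) ξ) 2 volume ≤
        eLpNorm ((tailSet n M).indicator fun ξ => Wt ξ * partInt ψ G (Iic m) ξ) 2 volume +
        eLpNorm (fun ξ => Wt ξ * partInt ψ G (Ioc a m) ξ) 2 volume ∧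
    eLpNorm ((tailSet n M).indicator fun ξ => Wt ξ * partInt ψ G (Ioc a m) ξ) 2 volume ≤
        eLpNorm ((tailSet n M).indicator fun ξ => Wt ξ * partInt ψ G (Iic m) ξ) 2 volume +
        eLpNorm ((tailSet n M).indicator fun ξ => Wt ξ * partInt ψ G (Iic a) ξ) 2 volume := by
  have hmI : ∀ I, MeasurableSet I → AEStronglyMeasurable (fun ξ => Wt ξ * partInt ψ G I ξ)
      volume := fun I hI => (hWt.mul (measurable_partInt hψ hG hI)).aestronglyMeasurable
  have hm := fun I hI => (hmI I hI).indicator (measurableSet_tailSet (n := n) M)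
  have hc : eLpNorm ((tailSet n M).indicator fun ξ => Wt ξ * partInt ψ G (Ioc a m) ξ) 2 volume ≤
      eLpNorm (fun ξ => Wt ξ * partInt ψ G (Ioc a m) ξ) 2 volume := eLpNorm_indicator_le _
  have e1 : ((tailSet n M).indicator fun ξ => Wt ξ * partInt ψ G (Iic m) ξ) =
      ((tailSet n M).indicator fun ξ => Wt ξ * partInt ψ G (Iic a) ξ) +
      ((tailSet n M).indicator fun ξ => Wt ξ * partInt ψ G (Ioc a m) ξ) := by
    funext ξ
    simp only [indicator, Pi.add_apply, partInt_Ioc hψ hG ham]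
    split_ifs <;> ring
  have e2 : ((tailSet n M).indicator fun ξ => Wt ξ * partInt ψ G (Iic a) ξ) =
      ((tailSet n M).indicator fun ξ => Wt ξ * partInt ψ G (Iic m) ξ) -
      ((tailSet n M).indicator fun ξ => Wt ξ * partInt ψ G (Ioc a m) ξ) := by rw [e1]; simp
  have e3 : ((tailSet n M).indicator fun ξ => Wt ξ * partInt ψ G (Ioc a m) ξ) =
      ((tailSet n M).indicator fun ξ => Wt ξ * partInt ψ G (Iic m) ξ) -
      ((tailSet n M).indicator fun ξ => Wt ξ * partInt ψ G (Iic a) ξ) := by rw [e1]; simp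
  have h2 : (1 : ℝ≥0∞) ≤ 2 := one_le_two
  have ha := hm _ (measurableSet_Iic (a := a))
  have hm' := hm _ (measurableSet_Iic (a := m))
  have hi := hm _ (measurableSet_Ioc (a := a) (b := m))
  refine ⟨?_, ?_, ?_⟩
  · refine le_trans ?_ (add_le_add_right hc _)
    rw [e1]
    exact eLpNorm_add_le ha hi h2
  · refine le_trans ?_ (add_le_add_right hc _)
    conv_lhs => rw [e2]
    exact eLpNorm_sub_le hm' hi h2
  · rw [e3]
    exact eLpNorm_sub_le hm' ha h2

lemma abs_toReal_sub_le {x y d : ℝ≥0∞} {D : ℝ} (hx : x ≠ ⊤) (hy : y ≠ ⊤) (hD : 0 ≤ D)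
    (hd : d ≤ ENNReal.ofReal D) (h1 : x ≤ y + d) (h2 : y ≤ x + d) :
    |x.toReal - y.toReal| ≤ D := by
  have key : ∀ u v : ℝ≥0∞, v ≠ ⊤ → u ≤ v + d → u.toReal ≤ v.toReal + D := fun u v hv h => by
    have h3 := ENNReal.toReal_mono (ENNReal.add_ne_top.2 ⟨hv, ENNReal.ofReal_ne_top⟩)
      (h.trans (add_le_add_right hd v))
    rwa [ENNReal.toReal_add hv ENNReal.ofReal_ne_top, ENNReal.toReal_ofReal hD] at h3
  rw [abs_le]
  constructor <;> linarith [key x y hy h1, key y x hx h2]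

/-- Moving the endpoint from $a$ to $m$ changes the norm by at most the spectral bound over $(a,m]$,
which is $O(|m-a|^{1/P})$ because the slice norms of $G$ are bounded. -/
lemma continuous_tail (hP : 0 < P) (hB : SpecBound ψ Wt (ENNReal.ofReal P) r' A) (hG : Nice G)
    (hfin : ∀ m, eLpNorm (fun ξ => Wt ξ * partInt ψ G (Iic m) ξ) 2 volume ≠ ⊤) (M : ℕ) :
    Continuous fun m => (eLpNorm ((tailSet n M).indicator
      fun ξ => Wt ξ * partInt ψ G (Iic m) ξ) 2 volume).toReal := by
  obtain ⟨Ms, hMs⟩ := sliceNorm_bdd (R := r') hP hG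
  have hMs0 : 0 ≤ Ms := (sliceNorm_nonneg 0).trans (hMs 0)
  have hfin' : ∀ m, eLpNorm ((tailSet n M).indicator
      fun ξ => Wt ξ * partInt ψ G (Iic m) ξ) 2 volume ≠ ⊤ := fun m =>
    ((eLpNorm_indicator_le _).trans_lt (hfin m).lt_top).ne
  have key : ∀ a m, a ≤ m → |(eLpNorm ((tailSet n M).indicator
      fun ξ => Wt ξ * partInt ψ G (Iic m) ξ) 2 volume).toReal - (eLpNorm ((tailSet n M).indicator
      fun ξ => Wt ξ * partInt ψ G (Iic a) ξ) 2 volume).toReal| ≤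
      A.toReal * (Ms * |m - a|) ^ (1 / P) := fun a m ham => by
    obtain ⟨h1, h2, -⟩ := eLpNorm_tail_le hB.phase hB.weight.meas hG ham M
    refine abs_toReal_sub_le (hfin' m) (hfin' a) (by positivity)
      ((hB.eLpNorm_partInt_Ioc_le hP hG ham).trans (ENNReal.ofReal_le_ofReal ?_)) h1 h2
    have h0 : 0 ≤ ∫ s in a..m, sliceNorm P r' G s :=
      intervalIntegral.integral_nonneg ham fun s _ => sliceNorm_nonneg s
    have h3 : ∫ s in a..m, sliceNorm P r' G s ≤ Ms * |m - a| := by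
      refine (Real.le_norm_self _).trans (intervalIntegral.norm_integral_le_of_norm_le_const
        fun s _ => ?_)
      rw [Real.norm_of_nonneg (sliceNorm_nonneg s)]
      exact hMs s
    gcongr
  rw [continuous_iff_continuousAt]
  intro a
  rw [ContinuousAt, tendsto_iff_dist_tendsto_zero]
  have hc : Continuous fun m : ℝ => A.toReal * (Ms * |m - a|) ^ (1 / P) :=
    continuous_const.mul ((by fun_prop : Continuous fun m : ℝ => Ms * |m - a|).rpow_const
      fun _ => Or.inr (by positivity))
  have hc0 := hc.tendsto a
  simp only [sub_self, abs_zero, mul_zero] at hc0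
  rw [Real.zero_rpow (by positivity), mul_zero] at hc0
  refine squeeze_zero (fun _ => dist_nonneg) (fun m => ?_) hc0
  rw [Real.dist_eq]
  rcases le_total a m with h | h
  · exact key a m h
  · rw [abs_sub_comm, abs_sub_comm m a]
    exact key m a h

/-- The spectral integrals over half-lines are uniformly small on the tail sets. -/
theorem SpecBound.exists_tail_le (hn : 0 < n) (hP : 0 < P) (hr' : r' ≠ ⊤)
    (hB : SpecBound ψ Wt (ENNReal.ofReal P) r' A) (hG : Nice G) {ε : ℝ} (hε : 0 < ε) :
    ∃ M, ∀ m, eLpNorm ((tailSet n M).indicator fun ξ => Wt ξ * partInt ψ G (Iic m) ξ) 2 volume ≤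
      ENNReal.ofReal ε := by
  have hrr : r' = ENNReal.ofReal r'.toReal := (ENNReal.ofReal_toReal hr').symm
  have hfin : ∀ m, eLpNorm (fun ξ => Wt ξ * partInt ψ G (Iic m) ξ) 2 volume ≠ ⊤ := fun m => by
    refine ((hB.eLpNorm_partInt_le hG measurableSet_Iic).trans_lt
      (ENNReal.mul_lt_top hB.fin.lt_top ?_)).ne
    rw [hrr]
    exact (hG.cutTime measurableSet_Iic).mixedNorm_lt_top hP
  have hfin' : ∀ M m, eLpNorm ((tailSet n M).indicator
      fun ξ => Wt ξ * partInt ψ G (Iic m) ξ) 2 volume ≠ ⊤ := fun M m =>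
    ((eLpNorm_indicator_le _).trans_lt (hfin m).lt_top).ne
  obtain ⟨R, hR0, hR⟩ := partInt_Iic_clamp (ψ := ψ) hG
  -- Dini's theorem: the tail norms are continuous in $m$ and decrease to $0$ as $M$ grows, hence
  -- uniformly on the compact interval.
  have hD := Antitone.tendstoUniformlyOn_of_forall_tendsto
    (F := fun M m => (eLpNorm ((tailSet n M).indicator
      fun ξ => Wt ξ * partInt ψ G (Iic m) ξ) 2 volume).toReal) (f := fun _ => 0)
    (isCompact_Icc (a := -R) (b := R)) (fun M => (continuous_tail hP hB hG hfin M).continuousOn)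
    (fun m _ M N hMN => ENNReal.toReal_mono (hfin' M m) (eLpNorm_mono_enorm fun ξ =>
      enorm_indicator_le_of_subset (tailSet_antitone hMN) _ _)) continuousOn_const
    (fun m _ => by
      have hm : Measurable fun ξ => Wt ξ * partInt ψ G (Iic m) ξ := hB.weight.meas.mul
        (measurable_partInt hB.phase hG measurableSet_Iic)
      have := tendsto_eLpNorm_tail hn hm (hfin m)
      exact (ENNReal.tendsto_toReal ENNReal.zero_ne_top).comp this)
  obtain ⟨M, hM⟩ := (Metric.tendstoUniformlyOn_iff.1 hD ε hε).exists
  refine ⟨M, fun m => ?_⟩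
  obtain ⟨m', hm', he⟩ := hR m
  simp only [he]
  have h := (hM m' hm').le
  rw [Real.dist_eq, zero_sub, abs_neg, abs_of_nonneg ENNReal.toReal_nonneg] at h
  exact (ENNReal.le_ofReal_iff_toReal_le (hfin' M m') hε.le).2 h

lemma enorm_cutoff_sub_mul_le {M M₁ M₂ : ℕ} (h₁ : M ≤ M₁) (h₂ : M ≤ M₂) (f : Eu n → ℂ)
    (ξ : Eu n) : ‖((cutoff M₁ ξ : ℂ) - (cutoff M₂ ξ : ℂ)) * f ξ‖ₑ ≤
      ‖(tailSet n M).indicator f ξ‖ₑ := by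
  by_cases h : ξ ∈ tailSet n M
  · rw [indicator_of_mem h, enorm_mul]
    refine mul_le_of_le_one_left' ?_
    rw [← ofReal_norm, ← Complex.ofReal_sub, Complex.norm_real, ENNReal.ofReal_le_one,
      Real.norm_eq_abs, abs_le]
    constructor <;> linarith [cutoff_nonneg M₁ ξ, cutoff_nonneg M₂ ξ, cutoff_le_one M₁ ξ,
      cutoff_le_one M₂ ξ]
  · rw [cutoff_eq_one_of_notMem fun h' => h (tailSet_antitone h₁ h'),
      cutoff_eq_one_of_notMem fun h' => h (tailSet_antitone h₂ h')]
    simp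

lemma enorm_cutoff_mul_le (M : ℕ) (f : Eu n → ℂ) (ξ : Eu n) :
    ‖(cutoff M ξ : ℂ) * f ξ‖ₑ ≤ ‖f ξ‖ₑ := by
  rw [enorm_mul]
  refine mul_le_of_le_one_left' ?_
  rw [← ofReal_norm, Complex.norm_real, ENNReal.ofReal_le_one,
    Real.norm_of_nonneg (cutoff_nonneg M ξ)]
  exact cutoff_le_one M ξ

/-- Bounds for the Duhamel operators with the cutoffs `cutoff M`: uniform boundedness, and the
Cauchy property on bounded functions of bounded support. -/
structure DuhBound (ψ : Eu n → ℝ) (k : Eu n → ℂ) (S : ℝ → Set ℝ) (q r p s K : ℝ≥0∞) : Prop where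
  phase : Measurable ψ
  symbol : AnnBdd k
  meas : MeasurableSet {p : ℝ × ℝ | p.2 ∈ S p.1}
  fin : K ≠ ⊤
  bound : ∀ G : ℝ → Eu n → ℂ, Nice G → ∀ M,
    mixedNorm q r (duh ψ (fun ξ => (cutoff M ξ : ℂ) * k ξ) S G) ≤ K * mixedNorm p s G
  cauchy : ∀ G : ℝ → Eu n → ℂ, Nice G → ∀ ε : ℝ≥0∞, 0 < ε → ∃ M, ∀ M₁ M₂, M ≤ M₁ → M ≤ M₂ →
    mixedNorm q r (duh ψ (fun ξ => ((cutoff M₁ ξ : ℂ) - (cutoff M₂ ξ : ℂ)) * k ξ) S G) ≤ ε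

end

/-! ### Duhamel bounds with cutoff, over all times and retarded -/

section
variable {ψ : Eu n → ℝ} {W Wt : Eu n → ℂ} {q q' r r' rt' A At : ℝ≥0∞} {Pt : ℝ}

lemma eLpNorm_tail_specInt_le {G : ℝ → Eu n → ℂ} {M : ℕ} {B : ℝ≥0∞}
    (hG : Nice G)
    (h : ∀ m, eLpNorm ((tailSet n M).indicator fun ξ => Wt ξ * partInt ψ G (Iic m) ξ) 2 volume ≤ B) :
    eLpNorm ((tailSet n M).indicator fun ξ => Wt ξ * specInt ψ G ξ) 2 volume ≤ B := by
  obtain ⟨R, hR⟩ := hG.supp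
  have e : ∀ ξ, specInt ψ G ξ = partInt ψ G (Iic R) ξ := fun ξ => by
    rw [← partInt_univ, partInt, partInt]
    refine setIntegral_eq_of_subset_of_forall_sdiff_eq_zero MeasurableSet.univ (subset_univ _)
      fun s hs => ?_
    have : G s = 0 := funext fun x => hR s x (Or.inl ((not_le.1 hs.2).trans_le (le_abs_self s)))
    rw [specKer, this, FT_def]
    simp
  simp only [e]
  exact h R

lemma eLpNorm_cutoff_mul_le (M : ℕ) (f : Eu n → ℂ) :
    eLpNorm (fun ξ => (cutoff M ξ : ℂ) * f ξ) 2 volume ≤ eLpNorm f 2 volume :=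
  eLpNorm_mono_enorm fun ξ => enorm_cutoff_mul_le M f ξ

lemma eLpNorm_cutoff_sub_mul_le {M M₁ M₂ : ℕ} (h₁ : M ≤ M₁) (h₂ : M ≤ M₂) (f : Eu n → ℂ) :
    eLpNorm (fun ξ => ((cutoff M₁ ξ : ℂ) - (cutoff M₂ ξ : ℂ)) * f ξ) 2 volume ≤
      eLpNorm ((tailSet n M).indicator f) 2 volume :=
  eLpNorm_mono_enorm fun ξ => enorm_cutoff_sub_mul_le h₁ h₂ f ξ

lemma exists_ofReal_mul_le {A ε : ℝ≥0∞} (hA : A ≠ ⊤) (hε : 0 < ε) {f : ℝ → ℝ}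
    (hf : ContinuousAt f 0) (hf0 : f 0 = 0) :
    ∃ x : ℝ, 0 < x ∧ ENNReal.ofReal (f x) * A ≤ ε := by
  have ht : Tendsto (fun x : ℝ => ENNReal.ofReal (f x) * A) (𝓝[>] 0) (𝓝 0) := by
    have := ENNReal.Tendsto.mul_const (b := A) (ENNReal.tendsto_ofReal hf.tendsto) (Or.inr hA)
    simp only [hf0, ENNReal.ofReal_zero, zero_mul] at this
    exact this.mono_left nhdsWithin_le_nhds
  obtain ⟨x, hx1, hx2⟩ := (((tendsto_order.1 ht).2 ε hε).and self_mem_nhdsWithin).exists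
  exact ⟨x, hx2, hx1.le⟩

/-- Over all times both properties follow from `mixedNorm_duh_univ_le`: the bound from the spectral
bound for $\widetilde W$, the Cauchy property from the smallness of its tail, where alone the
difference of two cutoffs lives. -/
theorem SpecBound.duhBound_univ (hn : 0 < n) [ENNReal.HolderConjugate q q']
    [ENNReal.HolderConjugate r r'] (hB : SpecBound ψ W q' r' A) (hq : 1 < q) (hr : 1 < r)
    (hPt : 0 < Pt) (hrt : rt' ≠ ⊤) (hBt : SpecBound ψ Wt (ENNReal.ofReal Pt) rt' At) :
    DuhBound ψ (fun ξ => W ξ * Wt ξ) (fun _ => univ) q r (ENNReal.ofReal Pt) rt' (A * At) where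
  phase := hB.phase
  symbol := hB.weight.mul hBt.weight
  meas := by simp
  fin := ENNReal.mul_ne_top hB.fin hBt.fin
  bound G hG M := by
    have h1 : mixedNorm q r (duh ψ (fun ξ => (cutoff M ξ : ℂ) * (W ξ * Wt ξ)) (fun _ => univ) G) ≤
        eLpNorm (fun ξ => (cutoff M ξ : ℂ) * (Wt ξ * specInt ψ G ξ)) 2 volume * A :=
      mixedNorm_duh_univ_le hB hq hr hBt.weight (isAnn_cutoff M) hG
    have h2 := (eLpNorm_cutoff_mul_le M fun ξ => Wt ξ * specInt ψ G ξ).trans (hBt.bound G hG)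
    refine h1.trans ((mul_le_mul_left h2 A).trans_eq ?_)
    ring
  cauchy G hG ε hε := by
    obtain ⟨ε', hε', h⟩ := exists_ofReal_mul_le hB.fin hε continuousAt_id rfl
    obtain ⟨M, hM⟩ := hBt.exists_tail_le hn hPt hrt hG hε'
    refine ⟨M, fun M₁ M₂ h₁ h₂ => ?_⟩
    have h1 : mixedNorm q r (duh ψ (fun ξ => ((cutoff M₁ ξ : ℂ) - (cutoff M₂ ξ : ℂ)) *
        (W ξ * Wt ξ)) (fun _ => univ) G) ≤ eLpNorm (fun ξ => ((cutoff M₁ ξ : ℂ) -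
          (cutoff M₂ ξ : ℂ)) * (Wt ξ * specInt ψ G ξ)) 2 volume * A :=
      mixedNorm_duh_univ_le hB hq hr hBt.weight ((isAnn_cutoff M₁).sub (isAnn_cutoff M₂)) hG
    have h2 := (eLpNorm_cutoff_sub_mul_le h₁ h₂ fun ξ => Wt ξ * specInt ψ G ξ).trans
      (eLpNorm_tail_specInt_le hG hM)
    exact h1.trans ((mul_le_mul_left h2 A).trans h)

/-- Writing $x=x^{1-\lambda}x^\lambda$ keeps a small factor and still a power of the second bound.
-/
lemma min_rpow_bound {x ε Y lam : ℝ} (hx : 0 ≤ x) (h1 : x ≤ ε) (h2 : x ≤ Y) (hl0 : 0 ≤ lam)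
    (hl1 : lam ≤ 1) : x ≤ ε ^ (1 - lam) * Y ^ lam := by
  calc x = x ^ (1 - lam) * x ^ lam := by
        rw [← Real.rpow_add_of_nonneg hx (by linarith) hl0, sub_add_cancel, Real.rpow_one]
    _ ≤ _ := by
      have h3 : 0 ≤ 1 - lam := by linarith
      have h4 : 0 ≤ ε ^ (1 - lam) := Real.rpow_nonneg (hx.trans h1) _
      gcongr

/-- Two bounds are combined: $2\varepsilon$, since the interval is a difference of two half-lines
with tail at most $\varepsilon$, and the spectral bound with power $1/\tilde P$ of the mass. The
geometric mean with $\lambda=\tilde P/2$ leaves the power $\frac12$ of the mass and the small factor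
$(2\varepsilon)^{1-\tilde P/2}$. -/
lemma SpecBound.eLpNorm_cutoff_sub_partInt_le {G : ℝ → Eu n → ℂ} (hPt : 0 < Pt) (hPt2 : Pt ≤ 2)
    (hBt : SpecBound ψ Wt (ENNReal.ofReal Pt) rt' At) (hG : Nice G) {M M₁ M₂ : ℕ} (h₁ : M ≤ M₁)
    (h₂ : M ≤ M₂) {ε : ℝ} (hε : 0 < ε) (hM : ∀ m, eLpNorm ((tailSet n M).indicator
      fun ξ => Wt ξ * partInt ψ G (Iic m) ξ) 2 volume ≤ ENNReal.ofReal ε) {a m : ℝ} (ham : a ≤ m)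
    {c : ℝ} (hc : 0 < c) :
    eLpNorm (fun ξ => ((cutoff M₁ ξ : ℂ) - (cutoff M₂ ξ : ℂ)) *
      (Wt ξ * partInt ψ G (Ioc a m) ξ)) 2 volume ≤
    ENNReal.ofReal ((2 * ε) ^ (1 - Pt / 2) * (At.toReal * c) ^ (Pt / 2) *
      (∫ s in a..m, sliceNorm Pt rt' G s / c ^ Pt) ^ (1 / 2 : ℝ)) := by
  have hcp : 0 < c ^ Pt := by positivity
  have h0 : 0 ≤ ∫ s in a..m, sliceNorm Pt rt' G s :=
    intervalIntegral.integral_nonneg ham fun s _ => sliceNorm_nonneg s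
  have e1 := eLpNorm_cutoff_sub_mul_le h₁ h₂ fun ξ => Wt ξ * partInt ψ G (Ioc a m) ξ
  obtain ⟨-, -, e2⟩ := eLpNorm_tail_le hBt.phase hBt.weight.meas hG ham M
  have e3 := e1.trans (e2.trans (add_le_add (hM m) (hM a)))
  rw [← ENNReal.ofReal_add hε.le hε.le, ← two_mul] at e3
  have e4 := (e1.trans (eLpNorm_indicator_le _)).trans (hBt.eLpNorm_partInt_Ioc_le hPt hG ham)
  set x := eLpNorm (fun ξ => ((cutoff M₁ ξ : ℂ) - (cutoff M₂ ξ : ℂ)) *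
      (Wt ξ * partInt ψ G (Ioc a m) ξ)) 2 volume
  have hx : x ≠ ⊤ := (e3.trans_lt ENNReal.ofReal_lt_top).ne
  rw [ENNReal.le_ofReal_iff_toReal_le hx (by positivity)] at e3 e4
  rw [intervalIntegral.integral_div]
  have hY : At.toReal * (∫ s in a..m, sliceNorm Pt rt' G s) ^ (1 / Pt) =
      (At.toReal * c) * ((∫ s in a..m, sliceNorm Pt rt' G s) / c ^ Pt) ^ (1 / Pt) := by
    rw [Real.div_rpow h0 hcp.le, ← Real.rpow_mul hc.le, mul_one_div_cancel hPt.ne', Real.rpow_one]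
    field_simp
  have hAt : 0 ≤ At.toReal := ENNReal.toReal_nonneg
  rw [ENNReal.le_ofReal_iff_toReal_le hx (by positivity)]
  refine (min_rpow_bound ENNReal.toReal_nonneg e3 e4 (by positivity)
    (by linarith : Pt / 2 ≤ 1)).trans_eq ?_
  rw [hY, Real.mul_rpow (x := At.toReal * c) (by positivity) (by positivity),
    ← Real.rpow_mul (by positivity), show 1 / Pt * (Pt / 2) = 1 / 2 by field_simp]
  ring

/-- Christ-Kiselev with exponents $\frac12$ and $\frac1P$; their sum exceeds $1$ since $P<2$.
Reducing $1/\tilde P$ to $\frac12$ is the price of the small factor, and the condition still holds.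
-/
lemma SpecBound.mixedNorm_duh_sub_le {P : ℝ} {G : ℝ → Eu n → ℂ} (hP : 0 < P) (hP2 : P < 2)
    [ENNReal.HolderConjugate q (ENNReal.ofReal P)] [ENNReal.HolderConjugate r r']
    (hB : SpecBound ψ W (ENNReal.ofReal P) r' A) (hq : 1 < q) (hr : 1 < r) (hr' : r' ≠ ⊤)
    (hPt : 0 < Pt) (hPt2 : Pt ≤ 2) (hBt : SpecBound ψ Wt (ENNReal.ofReal Pt) rt' At)
    (hG : Nice G) {M M₁ M₂ : ℕ} (h₁ : M ≤ M₁) (h₂ : M ≤ M₂) {ε : ℝ} (hε : 0 < ε)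
    (hM : ∀ m, eLpNorm ((tailSet n M).indicator
      fun ξ => Wt ξ * partInt ψ G (Iic m) ξ) 2 volume ≤ ENNReal.ofReal ε) {c : ℝ} (hc : 0 < c)
    (hGc : mixedNorm (ENNReal.ofReal Pt) rt' G ≤ ENNReal.ofReal c) :
    mixedNorm q r (duh ψ (fun ξ => ((cutoff M₁ ξ : ℂ) - (cutoff M₂ ξ : ℂ)) * (W ξ * Wt ξ))
      (fun t => Iio t) G) ≤ ENNReal.ofReal (ckConst (1 / 2 + 1 / P) *
        ((2 * ε) ^ (1 - Pt / 2) * (At.toReal * c) ^ (Pt / 2))) * A := by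
  have hcp : 0 < c ^ Pt := by positivity
  obtain ⟨Ms, hMs⟩ := sliceNorm_bdd (R := rt') hPt hG
  have hAt : 0 ≤ At.toReal := ENNReal.toReal_nonneg
  have hμ : 1 < 1 / 2 + 1 / P := by
    have : 1 / 2 < 1 / P := one_div_lt_one_div_of_lt hP hP2
    linarith
  have hB0 : 0 ≤ (2 * ε) ^ (1 - Pt / 2) * (At.toReal * c) ^ (Pt / 2) := by positivity
  have hf0 : ∀ s, 0 ≤ sliceNorm Pt rt' G s / c ^ Pt := fun s =>
    div_nonneg (sliceNorm_nonneg s) hcp.le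
  have hfM : ∀ s, sliceNorm Pt rt' G s / c ^ Pt ≤ Ms / c ^ Pt := fun s =>
    div_le_div_of_nonneg_right (hMs s) hcp.le
  have hf1 : ∀ a m, a ≤ m → ∫ s in a..m, sliceNorm Pt rt' G s / c ^ Pt ≤ 1 := fun a m ham => by
    rw [intervalIntegral.integral_div, div_le_one hcp]
    exact integral_sliceNorm_le hPt hG ham hc.le hGc
  exact mixedNorm_duh_Iio_le (μ := 1 / 2) hP hB hq hr hr' hBt.weight
    ((isAnn_cutoff M₁).sub (isAnn_cutoff M₂)) hG hB0 (by norm_num) hμ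
    ((measurable_sliceNorm hG).div_const _) hf0 hfM hf1
    fun a m ham => hBt.eLpNorm_cutoff_sub_partInt_le hPt hPt2 hG h₁ h₂ hε hM ham hc

/-- Christ-Kiselev with exponents $\frac1{\tilde P}\ge\frac12$ and $\frac1P>\frac12$, applied to the
slice norms of $G$ normalised to total mass at most $1$. -/
lemma SpecBound.mixedNorm_duh_Iio_le {P : ℝ} {G : ℝ → Eu n → ℂ} (hP : 0 < P) (hP2 : P < 2)
    [ENNReal.HolderConjugate q (ENNReal.ofReal P)] [ENNReal.HolderConjugate r r']
    (hB : SpecBound ψ W (ENNReal.ofReal P) r' A) (hq : 1 < q) (hr : 1 < r) (hr' : r' ≠ ⊤)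
    (hPt : 0 < Pt) (hPt2 : Pt ≤ 2) (hBt : SpecBound ψ Wt (ENNReal.ofReal Pt) rt' At)
    (hG : Nice G) (M : ℕ) {c : ℝ} (hc : 0 < c)
    (hGc : mixedNorm (ENNReal.ofReal Pt) rt' G ≤ ENNReal.ofReal c) :
    mixedNorm q r (duh ψ (fun ξ => (cutoff M ξ : ℂ) * (W ξ * Wt ξ)) (fun t => Iio t) G) ≤
      ENNReal.ofReal (ckConst (1 / Pt + 1 / P)) * (A * At) * ENNReal.ofReal c := by
  have hcp : 0 < c ^ Pt := by positivity
  obtain ⟨Ms, hMs⟩ := sliceNorm_bdd (R := rt') hPt hG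
  have hAt : 0 ≤ At.toReal := ENNReal.toReal_nonneg
  have hμ : 1 < 1 / Pt + 1 / P := by
    have h1 : 1 / 2 < 1 / P := one_div_lt_one_div_of_lt hP hP2
    have h2 : 1 / 2 ≤ 1 / Pt := one_div_le_one_div_of_le hPt hPt2
    linarith
  have hf0 : ∀ s, 0 ≤ sliceNorm Pt rt' G s / c ^ Pt := fun s =>
    div_nonneg (sliceNorm_nonneg s) hcp.le
  have hfM : ∀ s, sliceNorm Pt rt' G s / c ^ Pt ≤ Ms / c ^ Pt := fun s =>
    div_le_div_of_nonneg_right (hMs s) hcp.le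
  have hf1 : ∀ a m, a ≤ m → ∫ s in a..m, sliceNorm Pt rt' G s / c ^ Pt ≤ 1 := fun a m ham => by
    rw [intervalIntegral.integral_div, div_le_one hcp]
    exact integral_sliceNorm_le hPt hG ham hc.le hGc
  have hN : ∀ a m, a ≤ m → eLpNorm (fun ξ => (cutoff M ξ : ℂ) *
      (Wt ξ * partInt ψ G (Ioc a m) ξ)) 2 volume ≤ ENNReal.ofReal ((At.toReal * c) *
        (∫ s in a..m, sliceNorm Pt rt' G s / c ^ Pt) ^ (1 / Pt)) := fun a m ham => by
    have h0 : 0 ≤ ∫ s in a..m, sliceNorm Pt rt' G s :=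
      intervalIntegral.integral_nonneg ham fun s _ => sliceNorm_nonneg s
    refine ((eLpNorm_cutoff_mul_le M fun ξ => Wt ξ * partInt ψ G (Ioc a m) ξ).trans
      (hBt.eLpNorm_partInt_Ioc_le hPt hG ham)).trans_eq ?_
    congr 1
    rw [intervalIntegral.integral_div, Real.div_rpow h0 hcp.le, ← Real.rpow_mul hc.le,
      mul_one_div_cancel hPt.ne', Real.rpow_one]
    field_simp
  refine (Strichartz.mixedNorm_duh_Iio_le hP hB hq hr hr' hBt.weight (isAnn_cutoff M) hG
    (mul_nonneg hAt hc.le) (one_div_pos.2 hPt) hμ ((measurable_sliceNorm hG).div_const _)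
    hf0 hfM hf1 hN).trans_eq ?_
  have hck := ckConst_nonneg hμ
  rw [← mul_assoc, ENNReal.ofReal_mul (mul_nonneg hck hAt), ENNReal.ofReal_mul hck,
    ENNReal.ofReal_toReal hBt.fin]
  ring

/-- The strict inequality $\tilde P<2$ keeps the power $1-\tilde P/2$ of the tail size positive, so
the differences of cutoff operators can be made arbitrarily small. -/
theorem SpecBound.duhBound_Iio (hn : 0 < n) {P : ℝ} (hP : 0 < P) (hP2 : P < 2)
    [ENNReal.HolderConjugate q (ENNReal.ofReal P)] [ENNReal.HolderConjugate r r']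
    (hB : SpecBound ψ W (ENNReal.ofReal P) r' A) (hq : 1 < q) (hr : 1 < r) (hr' : r' ≠ ⊤)
    (hPt : 0 < Pt) (hPt2 : Pt < 2) (hrt : rt' ≠ ⊤)
    (hBt : SpecBound ψ Wt (ENNReal.ofReal Pt) rt' At) :
    DuhBound ψ (fun ξ => W ξ * Wt ξ) (fun t => Iio t) q r (ENNReal.ofReal Pt) rt'
      (ENNReal.ofReal (ckConst (1 / Pt + 1 / P)) * (A * At)) where
  phase := hB.phase
  symbol := hB.weight.mul hBt.weight
  meas := measurableSet_lt measurable_snd measurable_fst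
  fin := ENNReal.mul_ne_top ENNReal.ofReal_ne_top (ENNReal.mul_ne_top hB.fin hBt.fin)
  bound G hG M := by
    have hfin : mixedNorm (ENNReal.ofReal Pt) rt' G ≠ ⊤ := by
      rw [(ENNReal.ofReal_toReal hrt).symm]; exact (hG.mixedNorm_lt_top hPt).ne
    exact le_mul_of_forall (ENNReal.mul_ne_top ENNReal.ofReal_ne_top
      (ENNReal.mul_ne_top hB.fin hBt.fin)) hfin fun c hc hGc =>
      hB.mixedNorm_duh_Iio_le hP hP2 hq hr hr' hPt hPt2.le hBt hG M hc hGc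
  cauchy G hG ε hε := by
    have hfin : mixedNorm (ENNReal.ofReal Pt) rt' G ≠ ⊤ := by
      rw [(ENNReal.ofReal_toReal hrt).symm]; exact (hG.mixedNorm_lt_top hPt).ne
    set c := (mixedNorm (ENNReal.ofReal Pt) rt' G).toReal + 1 with hc
    have hc0 : 0 < c := by positivity
    have hGc : mixedNorm (ENNReal.ofReal Pt) rt' G ≤ ENNReal.ofReal c :=
      (ENNReal.le_ofReal_iff_toReal_le hfin hc0.le).2 (by linarith)
    have hl : 0 < 1 - Pt / 2 := by linarith
    obtain ⟨ε', hε', h⟩ := exists_ofReal_mul_le (f := fun x => ckConst (1 / 2 + 1 / P) *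
      ((2 * x) ^ (1 - Pt / 2) * (At.toReal * c) ^ (Pt / 2))) hB.fin hε
      ((continuous_const.mul (((continuous_const.mul continuous_id).rpow_const
        fun _ => Or.inr hl.le).mul continuous_const)).continuousAt)
      (by simp [Real.zero_rpow hl.ne'])
    obtain ⟨M, hM⟩ := hBt.exists_tail_le hn hPt hrt hG hε'
    exact ⟨M, fun M₁ M₂ h₁ h₂ => (hB.mixedNorm_duh_sub_le hP hP2 hq hr hr' hPt hPt2.le hBt hG
      h₁ h₂ hε' hM hc0 hGc).trans h⟩

end


variable {n : ℕ}

/-! ### The zero frequency -/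

section
variable {r p : ℝ≥0∞} [ENNReal.HolderConjugate r p]

lemma enorm_integral_sub_le {u v φ : Eu n → ℂ} (hu : MemLp u 2 volume)
    (hv : AEStronglyMeasurable v volume) (hφ2 : MemLp φ 2 volume) (hφp : MemLp φ p volume)
    (hfin : eLpNorm (fun x => u x - v x) r volume ≠ ⊤) :
    ‖(∫ x, v x * φ x) - ∫ x, u x * φ x‖ₑ ≤
      eLpNorm (fun x => u x - v x) r volume * eLpNorm φ p volume := by
  have h1 : Integrable fun x => u x * φ x := hu.integrable_mul hφ2
  have hd : MemLp (fun x => u x - v x) r volume := ⟨hu.1.sub hv, hfin.lt_top⟩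
  have h2 : Integrable fun x => (u x - v x) * φ x := hd.integrable_mul hφp
  have e : ∫ x, v x * φ x = (∫ x, u x * φ x) - ∫ x, (u x - v x) * φ x := by
    rw [← integral_sub h1 h2]
    congr 1; funext x; ring
  rw [e, sub_sub_cancel_left, enorm_neg]
  exact enorm_integral_mul_le hd.1 hφp.1

lemma tendsto_integral_of_eLpNorm_sub {u : ℕ → Eu n → ℂ} {v φ : Eu n → ℂ}
    (hu : ∀ j, MemLp (u j) 2 volume) (hv : AEStronglyMeasurable v volume) (hφ2 : MemLp φ 2 volume)
    (hφp : MemLp φ p volume)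
    (h : Tendsto (fun j => eLpNorm (fun x => u j x - v x) r volume) atTop (𝓝 0)) :
    Tendsto (fun j => ∫ x, u j x * φ x) atTop (𝓝 (∫ x, v x * φ x)) := by
  rw [tendsto_iff_edist_tendsto_0]
  have h1 := ENNReal.Tendsto.mul_const (b := eLpNorm φ p volume) h (Or.inr hφp.2.ne)
  rw [zero_mul] at h1
  refine tendsto_of_tendsto_of_tendsto_of_le_of_le' tendsto_const_nhds h1
    (Eventually.of_forall fun _ => zero_le) ?_
  filter_upwards [(tendsto_order.1 h).2 ⊤ ENNReal.zero_lt_top] with j hj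
  rw [edist_comm, edist_eq_enorm_sub]
  exact enorm_integral_sub_le (hu j) hv hφ2 hφp hj.ne

end

lemma eLpNorm_comp_smul {φ : Eu n → ℂ} (hφ : Continuous φ) {ε : ℝ} (hε : 0 < ε) (p : ℝ≥0∞) :
    eLpNorm (fun x => φ (ε • x)) p volume =
      ENNReal.ofReal (ε ^ n)⁻¹ ^ (1 / p).toReal * eLpNorm φ p volume := by
  have h1 := eLpNorm_map_measure (p := p) (μ := volume) (f := fun x : Eu n => ε • x) (g := φ)
    hφ.aestronglyMeasurable (measurable_const_smul ε).aemeasurable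
  have h2 : Module.finrank ℝ (Eu n) = n := by simp
  rw [Measure.map_addHaar_smul _ hε.ne', h2, abs_of_pos (by positivity),
    eLpNorm_smul_measure_of_ne_zero (ENNReal.ofReal_pos.2 (by positivity)).ne'] at h1
  exact h1.symm

lemma memLp_comp_smul (φ : 𝓢(Eu n, ℂ)) {ε : ℝ} (hε : 0 < ε) (p : ℝ≥0∞) :
    MemLp (fun x => φ (ε • x)) p volume := by
  refine ⟨(φ.continuous.comp (continuous_const_smul ε)).aestronglyMeasurable, ?_⟩
  rw [eLpNorm_comp_smul φ.continuous hε]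
  exact ENNReal.mul_lt_top (ENNReal.rpow_lt_top_of_nonneg ENNReal.toReal_nonneg
    ENNReal.ofReal_ne_top) (φ.memLp p volume).2

/-- The rescaled functions $\varepsilon^n\phi(\varepsilon\cdot)$ are bounded in $L^p$ uniformly in
$\varepsilon\le1$, including $p=1$; this is the stability used when limits are taken in $L^\infty$.
-/
lemma ofReal_mul_rpow_le_one {ε : ℝ} (hε : 0 < ε) (hε1 : ε ≤ 1) {p : ℝ≥0∞} (hp : 1 ≤ p) :
    ENNReal.ofReal (ε ^ n) * ENNReal.ofReal (ε ^ n)⁻¹ ^ (1 / p).toReal ≤ 1 := by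
  have h1 : (1 : ℝ≥0∞) ≤ ENNReal.ofReal (ε ^ n)⁻¹ := by
    rw [ENNReal.one_le_ofReal]
    exact (one_le_inv₀ (by positivity)).2 (pow_le_one₀ hε.le hε1)
  have h2 : (1 / p).toReal ≤ 1 := by
    rw [one_div, ← ENNReal.toReal_one]
    exact ENNReal.toReal_mono ENNReal.one_ne_top (ENNReal.inv_le_one.2 hp)
  calc _ ≤ ENNReal.ofReal (ε ^ n) * ENNReal.ofReal (ε ^ n)⁻¹ ^ (1 : ℝ) := by
        gcongr
    _ = 1 := by
        rw [ENNReal.rpow_one, ← ENNReal.ofReal_mul (by positivity),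
          mul_inv_cancel₀ (by positivity), ENNReal.ofReal_one]

/-- Cauchy-Schwarz: the $L^2$ norm of $\varepsilon^n\phi(\varepsilon\cdot)$ is
$\varepsilon^{n/2}\|\phi\|_2$, and $n>0$. -/
lemma vanishesAtZeroFreq_of_memLp_two (hn : 0 < n) {v : Eu n → ℂ} (hv : MemLp v 2 volume) :
    VanishesAtZeroFreq v := fun φ => by
  rw [tendsto_zero_iff_enorm_tendsto_zero]
  have h1 : Tendsto (fun ε : ℝ => ENNReal.ofReal (ε ^ n) ^ (1 / 2 : ℝ) *
      (eLpNorm v 2 volume * eLpNorm φ 2 volume)) (𝓝[>] 0) (𝓝 0) := by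
    have hc : Tendsto (fun ε : ℝ => ENNReal.ofReal (ε ^ n) ^ (1 / 2 : ℝ)) (𝓝[>] 0) (𝓝 0) := by
      have h2 : Continuous fun ε : ℝ => ENNReal.ofReal (ε ^ n) ^ (1 / 2 : ℝ) :=
        ENNReal.continuous_rpow_const.comp (ENNReal.continuous_ofReal.comp (continuous_pow n))
      have h3 := h2.tendsto 0
      rw [zero_pow hn.ne', ENNReal.ofReal_zero, ENNReal.zero_rpow_of_pos (by norm_num)] at h3
      exact h3.mono_left nhdsWithin_le_nhds
    have h4 := ENNReal.Tendsto.mul_const (b := eLpNorm v 2 volume * eLpNorm φ 2 volume) hc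
      (Or.inr (ENNReal.mul_lt_top hv.2 (φ.memLp 2 volume).2).ne)
    rwa [zero_mul] at h4
  refine tendsto_of_tendsto_of_tendsto_of_le_of_le' tendsto_const_nhds h1
    (Eventually.of_forall fun _ => zero_le) ?_
  filter_upwards [self_mem_nhdsWithin] with ε hε
  have hε0 : 0 < ε := hε
  have hp : 0 < ε ^ n := by positivity
  rw [enorm_mul, ← ofReal_norm ((ε ^ n : ℝ) : ℂ), Complex.norm_real, Real.norm_of_nonneg hp.le]
  refine (mul_le_mul_right (enorm_integral_mul_le (p := 2) (p' := 2) hv.1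
    (memLp_comp_smul φ hε0 2).1) _).trans_eq ?_
  rw [eLpNorm_comp_smul φ.continuous hε0, mul_left_comm (eLpNorm v 2 volume), ← mul_assoc]
  congr 1
  rw [show (1 / (2 : ℝ≥0∞)).toReal = (1 / 2 : ℝ) by simp, ENNReal.ofReal_rpow_of_pos (by positivity),
    ENNReal.ofReal_rpow_of_pos hp, ← ENNReal.ofReal_mul hp.le]
  congr 1
  rw [Real.inv_rpow hp.le, ← Real.rpow_neg hp.le]
  nth_rewrite 1 [← Real.rpow_one (ε ^ n)]
  rw [← Real.rpow_add hp]
  norm_num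

/-- Replacing $v$ by $u_j$ changes the averages by at most $\|u_j-v\|_r\|\phi\|_p$ for every
$\varepsilon\le1$, so $j$ can be fixed before $\varepsilon\to0$. In $L^\infty$ this excludes
constants that the frequency tests do not see. -/
lemma vanishesAtZeroFreq_of_tendsto {r p : ℝ≥0∞} [ENNReal.HolderConjugate r p]
    {u : ℕ → Eu n → ℂ} {v : Eu n → ℂ} (hu : ∀ j, MemLp (u j) 2 volume)
    (hu0 : ∀ j, VanishesAtZeroFreq (u j)) (hv : AEStronglyMeasurable v volume)
    (h : Tendsto (fun j => eLpNorm (fun x => u j x - v x) r volume) atTop (𝓝 0)) :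
    VanishesAtZeroFreq v := fun φ => by
  have hp1 : 1 ≤ p := (ENNReal.HolderConjugate.symm (p := r) (q := p)).one_le
  have hφ := (φ.memLp p volume).2
  rw [tendsto_zero_iff_enorm_tendsto_zero, ENNReal.tendsto_nhds_zero]
  intro η hη
  have hη2 : 0 < η / 2 := ENNReal.half_pos hη.ne'
  have h1 := ENNReal.Tendsto.mul_const (b := eLpNorm φ p volume) h (Or.inr hφ.ne)
  rw [zero_mul] at h1
  obtain ⟨j, hj1, hj2⟩ := (((tendsto_order.1 h).2 ⊤ ENNReal.zero_lt_top).and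
    ((tendsto_order.1 h1).2 _ hη2)).exists
  have h2 := hu0 j φ
  rw [tendsto_zero_iff_enorm_tendsto_zero, ENNReal.tendsto_nhds_zero] at h2
  have hε1 : ∀ᶠ ε : ℝ in 𝓝[>] 0, ε ≤ 1 := by
    filter_upwards [nhdsWithin_le_nhds (Iic_mem_nhds (zero_lt_one' ℝ))] with ε hε using hε
  filter_upwards [h2 _ hη2, self_mem_nhdsWithin, hε1] with ε h3 hε hε1
  have hε0 : 0 < ε := hε
  have hp : 0 < ε ^ n := by positivity
  have h4 := enorm_integral_sub_le (p := p) (hu j) hv (memLp_comp_smul φ hε0 2)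
    (memLp_comp_smul φ hε0 p) hj1.ne
  have h5 : ‖((ε ^ n : ℝ) : ℂ) * ((∫ x, v x * φ (ε • x)) - ∫ x, u j x * φ (ε • x))‖ₑ ≤ η / 2 := by
    rw [enorm_mul, ← ofReal_norm ((ε ^ n : ℝ) : ℂ), Complex.norm_real, Real.norm_of_nonneg hp.le]
    refine (mul_le_mul_right h4 _).trans ?_
    rw [eLpNorm_comp_smul φ.continuous hε0]
    refine le_trans (le_of_eq ?_) ((mul_le_of_le_one_left' (ofReal_mul_rpow_le_one (n := n)
      hε0 hε1 hp1)).trans hj2.le)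
    ring
  have e : ((ε ^ n : ℝ) : ℂ) * ∫ x, v x * φ (ε • x) =
      ((ε ^ n : ℝ) : ℂ) * ((∫ x, v x * φ (ε • x)) - ∫ x, u j x * φ (ε • x)) +
        ((ε ^ n : ℝ) : ℂ) * ∫ x, u j x * φ (ε • x) := by ring
  rw [e]
  exact (enorm_add_le _ _).trans ((add_le_add h5 h3).trans_eq (ENNReal.add_halves η))

/-! ### The Duhamel operators without cutoff -/

section
variable {ψ : Eu n → ℝ} {k : Eu n → ℂ} {S : ℝ → Set ℝ} {q r qt rt p s K : ℝ≥0∞}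

lemma memLp_duh (hψ : Measurable ψ) {k : Eu n → ℂ} (hk : IsAnn k) {G : ℝ → Eu n → ℂ} (hG : Nice G)
    {S : ℝ → Set ℝ} {t : ℝ} (hS : MeasurableSet (S t)) : MemLp (duh ψ k S G t) 2 volume := by
  have h := isAnn_duh hψ hk hG t hS
  exact memLp_IFT h.integrable (h.memLp 2)

lemma integral_duh_mul_FT (hψ : Measurable ψ) {k : Eu n → ℂ} (hk : IsAnn k) {G : ℝ → Eu n → ℂ}
    (hG : Nice G) {S : ℝ → Set ℝ} {t : ℝ} (hS : MeasurableSet (S t)) {θ : Eu n → ℂ}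
    (hθ : IsAnn θ) :
    ∫ x, duh ψ k S G t x * FT θ x =
      ∫ s in S t, ∫ x, G s x * evol ψ (fun ξ => k ξ * (osc ψ t ξ * θ ξ)) s x := by
  have h := isAnn_duh hψ hk hG t hS
  have ha : IsAnn fun ξ => k ξ * (osc ψ t ξ * θ ξ) := hk.mul_annBdd (isAnn_osc_mul hψ hθ t).annBdd
  simp only [duh]
  rw [integral_IFT_mul_FT h.integrable (h.memLp 2) hθ.integrable (hθ.memLp 2)]
  simp_rw [integral_mul_evol_slice hψ ha hG, mul_comm (specKer _ _ _ _)]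
  rw [setIntegral_integral_specKer hψ hG ha]
  congr 1; funext ξ; ring

/-- The Cauchy property holds for each nice function separately, so the cutoff index has to be
chosen along the approximating sequence. -/
lemma DuhBound.exists_subseq (hD : DuhBound ψ k S q r p s K) {T : ℕ → ℝ → Eu n → ℂ}
    (hT : ∀ j, Nice (T j)) : ∃ M : ℕ → ℕ, (∀ j, j ≤ M j) ∧ ∀ j,
      mixedNorm q r (duh ψ (fun ξ => ((cutoff (M (j + 1)) ξ : ℂ) - (cutoff (M j) ξ : ℂ)) * k ξ)
        S (T j)) ≤ (1 / 4) ^ j := by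
  choose N hN using fun j => hD.cauchy (T j) (hT j) ((1 / 4) ^ j) (ENNReal.pow_pos (by simp) j)
  -- Partial sums make both $M_j$ and $M_{j+1}$ at least $N_j$, and the summand $j$ sends the
  -- indices to infinity.
  refine ⟨fun j => j + ∑ i ∈ Finset.range (j + 1), N i, fun j => Nat.le_add_right _ _,
    fun j => hN j _ _ ?_ ?_⟩
  · simp only [Finset.sum_range_succ]; omega
  · simp only [Finset.sum_range_succ]; omega

/-- The function is changed under a fixed cutoff, controlled by the uniform bound; then the cutoff
is changed on a fixed nice function, controlled by the Cauchy property. -/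
lemma DuhBound.mixedNorm_succ_sub_le (hD : DuhBound ψ k S q r p s K) (hq : 1 ≤ q) (hr : 1 ≤ r)
    {G H : ℝ → Eu n → ℂ} (hG : Nice G) (hH : Nice H) (M N : ℕ) :
    mixedNorm q r (fun t x => duh ψ (fun ξ => (cutoff M ξ : ℂ) * k ξ) S G t x -
      duh ψ (fun ξ => (cutoff N ξ : ℂ) * k ξ) S H t x) ≤
      K * mixedNorm p s (fun t x => G t x - H t x) +
      mixedNorm q r (duh ψ (fun ξ => ((cutoff M ξ : ℂ) - (cutoff N ξ : ℂ)) * k ξ) S H) := by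
  have hSt : ∀ t, MeasurableSet (S t) := fun t => measurable_prodMk_left (x := t) hD.meas
  have hM := (isAnn_cutoff (n := n) M).mul_annBdd hD.symbol
  have hN := (isAnn_cutoff (n := n) N).mul_annBdd hD.symbol
  have hMN := ((isAnn_cutoff (n := n) M).sub (isAnn_cutoff N)).mul_annBdd hD.symbol
  have e : (fun t x => duh ψ (fun ξ => (cutoff M ξ : ℂ) * k ξ) S G t x -
      duh ψ (fun ξ => (cutoff N ξ : ℂ) * k ξ) S H t x) = fun t x =>
      duh ψ (fun ξ => (cutoff M ξ : ℂ) * k ξ) S (fun t x => G t x - H t x) t x +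
      duh ψ (fun ξ => ((cutoff M ξ : ℂ) - (cutoff N ξ : ℂ)) * k ξ) S H t x := by
    funext t x
    simp_rw [sub_mul]
    rw [duh_sub hD.phase hM hG hH hSt, duh_sub_symbol hD.phase hM hN hH hSt]
    ring
  rw [e]
  refine (mixedNorm_add_le hq hr (measurable_duh hD.phase hM (hG.sub hH) hD.meas)
    (measurable_duh hD.phase hMN hH hD.meas)).trans ?_
  gcongr
  exact hD.bound _ (hG.sub hH) M

lemma eventually_cutoff_mul {M : ℕ → ℕ} (hM : ∀ j, j ≤ M j) {h : Eu n → ℂ} (hh : IsAnn h) :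
    ∀ᶠ j in atTop, ∀ ξ, (cutoff (M j) ξ : ℂ) * h ξ = h ξ := by
  obtain ⟨c, R, hc, hs⟩ := hh.supp
  have := (tendsto_atTop_mono hM tendsto_id).eventually (eventually_cutoff_eq_one (n := n) hc R)
  filter_upwards [this] with j hj ξ
  by_cases h1 : ‖ξ‖ < c ∨ R < ‖ξ‖
  · rw [hs ξ h1, mul_zero]
  · push Not at h1
    rw [hj ξ h1.1 h1.2, Complex.ofReal_one, one_mul]

lemma memLp_FT_of_isFreqTest {θ : Eu n → ℂ} (hθ : IsFreqTest θ) (p : ℝ≥0∞) :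
    MemLp (FT θ) p volume := by
  obtain ⟨φ, hφ⟩ := exists_schwartz_FT hθ.smooth hθ.compact
  rw [show FT θ = φ from (funext hφ).symm]
  exact φ.memLp p volume

/-- The Duhamel operator on `L^p_t L^s_x`, as a limit of operators with frequency cutoffs. -/
theorem DuhBound.exists_duhamel (hn : 0 < n) (hD : DuhBound ψ k S q r p s K) (hq : 1 ≤ q)
    (hr : 1 ≤ r) [ENNReal.HolderConjugate qt p] [ENNReal.HolderConjugate rt s] (hp : p ≠ ⊤)
    (hs : s ≠ ⊤) (hE : ∀ h : Eu n → ℂ, IsAnn h → mixedNorm qt rt (evol ψ fun ξ => k ξ * h ξ) < ⊤)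
    {G : ℝ → Eu n → ℂ} (hG : Measurable (Function.uncurry G)) (hGf : mixedNorm p s G < ⊤) :
    ∃ u : ℝ → Eu n → ℂ, Measurable (Function.uncurry u) ∧
      mixedNorm q r u ≤ K * mixedNorm p s G ∧
      ∀ᵐ t, VanishesAtZeroFreq (u t) ∧ ∀ θ : Eu n → ℂ, IsFreqTest θ →
        IntegrableOn (fun s => ∫ x, G s x * evol ψ (fun ξ => k ξ * (osc ψ t ξ * θ ξ)) s x) (S t) ∧
        ∫ x, u t x * FT θ x =
          ∫ s in S t, ∫ x, G s x * evol ψ (fun ξ => k ξ * (osc ψ t ξ * θ ξ)) s x := by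
  have hp1 : 1 ≤ p := (ENNReal.HolderConjugate.symm (p := qt) (q := p)).one_le
  have hs1 : 1 ≤ s := (ENNReal.HolderConjugate.symm (p := rt) (q := s)).one_le
  obtain ⟨T, hTn, hTG, hGT, hTT⟩ := exists_fast_nice hp1 hp hs1 hs hG hGf.ne
  obtain ⟨M, hM, hMc⟩ := hD.exists_subseq hTn
  have hSt : ∀ t, MeasurableSet (S t) := fun t => measurable_prodMk_left (x := t) hD.meas
  have hk := fun M => (isAnn_cutoff (n := n) M).mul_annBdd hD.symbol
  -- Successive terms differ by at most $(2K+1)4^{-j}$: $2K\,4^{-j}$ from the approximating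
  -- functions and $4^{-j}$ from the cutoffs.
  obtain ⟨u, hum, hut, hub⟩ := exists_mixed_limit hq hr
    (u := fun j => duh ψ (fun ξ => (cutoff (M j) ξ : ℂ) * k ξ) S (T j))
    (fun j => measurable_duh hD.phase (hk _) (hTn j) hD.meas) (K := K * 2 + 1)
    (ENNReal.add_ne_top.2 ⟨ENNReal.mul_ne_top hD.fin (by simp), by simp⟩) fun j => by
      refine (hD.mixedNorm_succ_sub_le hq hr (hTn (j + 1)) (hTn j) _ _).trans ?_
      refine (add_le_add (mul_le_mul_right (hTT j _ _ (Nat.le_succ j) le_rfl) K)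
        (hMc j)).trans_eq ?_
      ring
  refine ⟨u, hum, hub _ fun j => (hD.bound _ (hTn j) _).trans (mul_le_mul_right (hTG j) K), ?_⟩
  filter_upwards [hut] with t ht
  have huL2 := fun j => memLp_duh hD.phase (hk (M j)) (hTn j) (hSt t)
  have hu := (measurable_slice hum t).aestronglyMeasurable (μ := (volume : Measure (Eu n)))
  have : ENNReal.HolderConjugate r r.conjExponent := ENNReal.HolderConjugate.conjExponent hr
  refine ⟨vanishesAtZeroFreq_of_tendsto (p := r.conjExponent) huL2
    (fun j => vanishesAtZeroFreq_of_memLp_two hn (huL2 j)) hu ht, fun θ hθ => ?_⟩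
  have hh := isAnn_osc_mul hD.phase hθ.isAnn t
  have hkh := hD.symbol.mul_isAnn hh
  -- Cutting the evolution to the times in $S(t)$ turns the integral over $S(t)$ into a pairing over
  -- all times, to which Hölder in mixed norms applies.
  have hEm : Measurable (Function.uncurry (cutTime (S t)
      (evol ψ fun ξ => k ξ * (osc ψ t ξ * θ ξ)))) := by
    have e : Function.uncurry (cutTime (S t) (evol ψ fun ξ => k ξ * (osc ψ t ξ * θ ξ))) =
        {p : ℝ × Eu n | p.1 ∈ S t}.indicator
          (Function.uncurry (evol ψ fun ξ => k ξ * (osc ψ t ξ * θ ξ))) := by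
      funext p
      simp [Function.uncurry, cutTime, indicator]
    rw [e]
    exact (measurable_evol hD.phase hkh.meas).indicator (measurable_fst (hSt t))
  have hEf : mixedNorm qt rt (cutTime (S t) (evol ψ fun ξ => k ξ * (osc ψ t ξ * θ ξ))) < ⊤ :=
    (mixedNorm_cutTime_le _ _ _ _).trans_lt (hE _ hh)
  have ecut : ∀ (F : ℝ → Eu n → ℂ), (fun s => ∫ x, F s x * cutTime (S t)
      (evol ψ fun ξ => k ξ * (osc ψ t ξ * θ ξ)) s x) = (S t).indicator
        fun s => ∫ x, F s x * evol ψ (fun ξ => k ξ * (osc ψ t ξ * θ ξ)) s x := fun F => by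
    funext s
    by_cases hs : s ∈ S t
    · rw [indicator_of_mem hs, cutTime_of_mem hs]
    · rw [indicator_of_notMem hs, cutTime_of_notMem hs]; simp
  have hint := (integrable_mixed_mul hEm hG hEf hGf).integral_prod_left
  simp only [Function.uncurry] at hint
  rw [ecut, integrable_indicator_iff (hSt t)] at hint
  refine ⟨hint, ?_⟩
  have hlim := tendsto_integral_mixed_mul hEm hG (fun j => (hTn j).meas) hEf hGf
    (fun j => (hTG j).trans_lt hGf) (tendsto_of_tendsto_of_tendsto_of_le_of_le tendsto_const_nhds
      tendsto_quarter_pow (fun _ => zero_le) hGT)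
  simp_rw [ecut, integral_indicator (hSt t)] at hlim
  -- The pairings of the approximate solutions have two limits: convergence of the slices in $L^r$
  -- gives the pairing with $u(t)$, and convergence of the nice approximations gives the time
  -- integral for $G$. They agree since the cutoff is eventually $1$ on the support of the test
  -- function.
  refine tendsto_nhds_unique (tendsto_integral_of_eLpNorm_sub huL2 hu
    (memLp_FT_of_isFreqTest hθ 2) (memLp_FT_of_isFreqTest hθ r.conjExponent) ht)
    (hlim.congr' ?_)
  filter_upwards [eventually_cutoff_mul hM hkh] with j hj
  rw [integral_duh_mul_FT hD.phase (hk _) (hTn j) (hSt t) hθ.isAnn]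
  simp_rw [mul_assoc, hj]

end


variable {n : ℕ}

/-! ### The Littlewood–Paley sum -/

section
variable {φ₀ : ℝ → ℝ}

lemma IsLPBump.Q_nonneg (h : IsLPBump φ₀) (k : ℤ) {y : ℝ} (hy : 0 ≤ y) : 0 ≤ Q φ₀ k y := by
  unfold Q
  rw [sub_nonneg]
  refine h.antitone (mem_Ici.2 (by positivity)) (mem_Ici.2 (by positivity)) ?_
  gcongr
  · norm_num
  · linarith

lemma IsLPBump.le_one (h : IsLPBump φ₀) {y : ℝ} (hy : 0 ≤ y) : φ₀ y ≤ 1 := by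
  rw [← h.eq_one 0 (by constructor <;> norm_num)]
  exact h.antitone (mem_Ici.2 le_rfl) (mem_Ici.2 hy) hy

/-- A finite set of indices lies in a block of consecutive ones; the terms are nonnegative and the
block telescopes to a difference of two values of $\varphi_0$, both in $[0,1]$. -/
lemma IsLPBump.sum_Q_le_one (h : IsLPBump φ₀) (s : Finset ℤ) {y : ℝ} (hy : 0 ≤ y) :
    ∑ k ∈ s, Q φ₀ k y ≤ 1 := by
  have tel : ∀ (a : ℤ) (N : ℕ), ∑ i ∈ Finset.range N, Q φ₀ (a + i) y =
      φ₀ ((2 : ℝ) ^ (-(a + N)) * y) - φ₀ ((2 : ℝ) ^ (-a) * y) := fun a N => by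
    induction N with
    | zero => simp
    | succ N ih =>
      rw [Finset.sum_range_succ, ih, Q]
      push_cast
      rw [show -(a + (N : ℤ)) - 1 = -(a + ((N : ℤ) + 1)) by ring]
      ring
  obtain ⟨N, hN⟩ : ∃ N : ℕ, ∀ k ∈ s, |k| < N := by
    refine ⟨∑ k ∈ s, k.natAbs + 1, fun k hk => ?_⟩
    have := Finset.single_le_sum (f := fun k : ℤ => k.natAbs) (fun _ _ => Nat.zero_le _) hk
    rw [Int.abs_eq_natAbs]
    exact_mod_cast Nat.lt_succ_of_le this
  have hsub : s ⊆ (Finset.range (2 * N)).image fun i : ℕ => -(N : ℤ) + i := fun k hk => by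
    have := abs_lt.1 (hN k hk)
    rw [Finset.mem_image]
    refine ⟨(k + N).toNat, ?_, ?_⟩
    · rw [Finset.mem_range]; omega
    · omega
  refine (Finset.sum_le_sum_of_subset_of_nonneg hsub fun k _ _ => h.Q_nonneg k hy).trans ?_
  rw [Finset.sum_image (by intro a _ b _ hab; simpa using hab), tel]
  have h1 := h.le_one (y := (2 : ℝ) ^ (-(-(N : ℤ) + (2 * N : ℕ))) * y) (by positivity)
  have h2 := h.nonneg ((2 : ℝ) ^ (- -(N : ℤ)) * y)
  linarith

lemma IsLPBump.sumQ_nonneg (h : IsLPBump φ₀) (J : Set ℝ) {y : ℝ} (hy : 0 ≤ y) :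
    0 ≤ sumQ φ₀ J y := tsum_nonneg fun k => h.Q_nonneg k hy

lemma IsLPBump.sumQ_le_one (h : IsLPBump φ₀) (J : Set ℝ) {y : ℝ} (hy : 0 ≤ y) :
    sumQ φ₀ J y ≤ 1 := by
  refine Real.tsum_le_of_sum_le (fun k => h.Q_nonneg k hy) fun s => ?_
  have := h.sum_Q_le_one (s.map (Function.Embedding.subtype _)) hy
  rwa [Finset.sum_map] at this

lemma IsLPBump.measurable_sumQ (h : IsLPBump φ₀) (J : Set ℝ) (δ : ℝ) :
    Measurable fun ξ : Eu n => sumQ φ₀ J (δ * ‖ξ‖) := by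
  have hφ := h.smooth.continuous.measurable
  unfold sumQ
  refine Measurable.tsum fun k => ?_
  unfold Q
  exact (hφ.comp (by fun_prop)).sub (hφ.comp (by fun_prop))

end

/-! ### Symbols -/

/-- Continuity is known only on the open half-line and the value at $0$ is arbitrary, so the
function is treated as piecewise continuous. -/
lemma measurable_comp_norm {E : Type*} [TopologicalSpace E] [TopologicalSpace.PseudoMetrizableSpace E]
    [MeasurableSpace E] [BorelSpace E] {g : ℝ → E} (hg : ContinuousOn g (Ioi 0)) {δ : ℝ}
    (hδ : 0 < δ) : Measurable fun ξ : Eu n => g (δ * ‖ξ‖) := by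
  classical
  have h1 : Measurable ((Ioi (0 : ℝ)).piecewise g fun _ => g 0) :=
    hg.measurable_piecewise continuousOn_const measurableSet_Ioi
  have h2 : (fun ξ : Eu n => g (δ * ‖ξ‖)) =
      fun ξ : Eu n => (Ioi (0 : ℝ)).piecewise g (fun _ => g 0) (δ * ‖ξ‖) := by
    funext ξ
    rcases (norm_nonneg ξ).eq_or_lt with h | h
    · rw [← h, mul_zero, piecewise_eq_of_notMem _ _ _ (by simp)]
    · rw [piecewise_eq_of_mem _ _ _ (show δ * ‖ξ‖ ∈ Ioi 0 from mul_pos hδ h)]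
  rw [h2]
  exact h1.comp (by fun_prop)

lemma rpow_le_max {c R x : ℝ} (hc : 0 < c) (h1 : c ≤ x) (h2 : x ≤ R) (a : ℝ) :
    x ^ a ≤ max (c ^ a) (R ^ a) := by
  rcases le_total 0 a with ha | ha
  · exact (Real.rpow_le_rpow (hc.le.trans h1) h2 ha).trans (le_max_right _ _)
  · exact (Real.rpow_le_rpow_of_nonpos hc h1 ha).trans (le_max_left _ _)

lemma annBdd_norm_rpow (a : ℝ) : AnnBdd (fun ξ : Eu n => ((‖ξ‖ ^ a : ℝ) : ℂ)) := by
  refine ⟨by fun_prop, fun c R hc => ⟨max (c ^ a) (R ^ a), fun ξ h1 h2 => ?_⟩⟩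
  rw [Complex.norm_real, Real.norm_of_nonneg (by positivity)]
  exact rpow_le_max hc h1 h2 a

/-- The phase `ψ(ξ) = g(δ|ξ|)/δ`. -/
noncomputable def phase (n : ℕ) (g : ℝ → ℝ) (δ : ℝ) (ξ : Eu n) : ℝ := g (δ * ‖ξ‖) / δ

lemma propSymbol_eq_osc (g : ℝ → ℝ) (δ t : ℝ) : propSymbol (n := n) g δ t = osc (phase n g δ) t := by
  funext ξ
  rw [propSymbol, osc, phase]
  congr 3
  ring

/-- The set where the symbol `X` does not vanish, without the origin. -/
def symSupp (X : Eu n → ℂ) : Set (Eu n) := {ξ | ξ ≠ 0} ∩ {ξ | X ξ ≠ 0}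

/-- The weight `|ξ|^{-a}` on the support of the symbol `X`. -/
noncomputable def wt (X : Eu n → ℂ) (a : ℝ) : Eu n → ℂ :=
  (symSupp X).indicator fun ξ => ((‖ξ‖ ^ (-a) : ℝ) : ℂ)

section
variable {X : Eu n → ℂ}

lemma measurableSet_symSupp (hX : Measurable X) : MeasurableSet (symSupp X) :=
  (measurableSet_singleton 0).compl.inter (hX (measurableSet_singleton 0).compl)

lemma annBdd_wt (hX : Measurable X) (a : ℝ) : AnnBdd (wt X a) := by
  have h := annBdd_norm_rpow (n := n) (-a)
  refine ⟨h.meas.indicator (measurableSet_symSupp hX), fun c R hc => ?_⟩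
  obtain ⟨M, hM⟩ := h.bdd c R hc
  exact ⟨M, fun ξ h1 h2 => (norm_indicator_le_norm_self _ _).trans (hM ξ h1 h2)⟩

lemma wt_mul (X : Eu n → ℂ) (a b : ℝ) (ξ : Eu n) : wt X a ξ * wt X b ξ = wt X (a + b) ξ := by
  by_cases h : ξ ∈ symSupp X
  · have h0 : 0 < ‖ξ‖ := norm_pos_iff.2 h.1
    rw [wt, wt, wt, indicator_of_mem h, indicator_of_mem h, indicator_of_mem h,
      ← Complex.ofReal_mul, ← Real.rpow_add h0]
    congr 2; ring
  · simp [wt, indicator_of_notMem h]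

lemma conj_wt (X : Eu n → ℂ) (a : ℝ) (ξ : Eu n) : (starRingEnd ℂ) (wt X a ξ) = wt X a ξ := by
  by_cases h : ξ ∈ symSupp X
  · rw [wt, indicator_of_mem h, Complex.conj_ofReal]
  · simp [wt, indicator_of_notMem h]

lemma powSym_mul_wt (X : Eu n → ℂ) (a : ℝ) {ξ : Eu n} (hξ : ξ ≠ 0) :
    ((‖ξ‖ ^ a : ℝ) : ℂ) * X ξ * wt X a ξ = X ξ := by
  by_cases h : ξ ∈ symSupp X
  · have h0 : 0 < ‖ξ‖ := norm_pos_iff.2 hξ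
    rw [wt, indicator_of_mem h, mul_right_comm, ← Complex.ofReal_mul, ← Real.rpow_add h0]
    simp
  · have : X ξ = 0 := by
      by_contra h1
      exact h ⟨hξ, h1⟩
    simp [this]

end

/-! ### The spectral bound from the dispersive estimate -/

section
variable {φ₀ : ℝ → ℝ} {J : Set ℝ} {g : ℝ → ℝ} {δ σ β γ C : ℝ}

/-- Puts the bound on the oscillatory integral into the form needed by the $TT^*$ computation: the
kernel is paired with $\hat\theta$ and estimated in $L^\infty\times L^1$. -/
lemma enorm_integral_osc_le (hC : 0 ≤ C) (hδ : 0 < δ) {m : Eu n → ℂ} {t : ℝ}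
    {K : Eu n → ℂ} (hK : IsOscIntegral (fun ξ => propSymbol g δ t ξ * m ξ) K)
    (hKb : ∀ x, ‖K x‖ ≤ C * (δ ^ β / |t| ^ σ)) {θ : Eu n → ℂ} (hθ : IsFreqTest θ) :
    ‖∫ ξ, osc (phase n g δ) t ξ * m ξ * θ ξ‖ₑ ≤
      ENNReal.ofReal (ftConst n * C * δ ^ β) * riesz σ t * ∫⁻ x, ‖FT θ x‖ₑ := by
  have h := hK θ hθ
  simp_rw [propSymbol_eq_osc] at h
  rw [← ftConst_inv] at h
  have hc := ftConst_pos n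
  have hc' : ((ftConst n : ℝ) : ℂ) ≠ 0 := by exact_mod_cast hc.ne'
  have e : ∫ ξ, osc (phase n g δ) t ξ * m ξ * θ ξ = (ftConst n : ℂ) * ∫ x, K x * FT θ x := by
    rw [h, Complex.ofReal_inv, mul_inv_cancel_left₀ hc']
  rw [e, enorm_mul, ← ofReal_norm ((ftConst n : ℝ) : ℂ), Complex.norm_real,
    Real.norm_of_nonneg hc.le]
  have h1 : ‖∫ x, K x * FT θ x‖ₑ ≤ ENNReal.ofReal (C * (δ ^ β / |t| ^ σ)) * ∫⁻ x, ‖FT θ x‖ₑ := by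
    refine (enorm_integral_le_lintegral_enorm _).trans ?_
    have hm : Measurable fun x => ‖FT θ x‖ₑ :=
      (continuous_FT hθ.isAnn.integrable).measurable.enorm
    rw [← lintegral_const_mul _ hm]
    refine lintegral_mono fun x => ?_
    rw [enorm_mul]
    refine mul_le_mul_left ?_ _
    rw [← ofReal_norm]
    exact ENNReal.ofReal_le_ofReal (hKb x)
  refine (mul_le_mul_right h1 _).trans_eq ?_
  rw [← mul_assoc, ← ENNReal.ofReal_mul hc.le, riesz, ← ENNReal.ofReal_mul (by positivity)]
  congr 2
  rw [Real.rpow_neg (abs_nonneg t)]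
  ring

/-- The constant in the spectral bound. -/
noncomputable def specConst (n : ℕ) (σ θ C : ℝ) : ℝ≥0∞ :=
  interpConst σ θ (dispConst n * ENNReal.ofReal (ftConst n * C)) ^ (1 / 2 : ℝ)

lemma specConst_ne_top (n : ℕ) (σ θ C : ℝ) : specConst n σ θ C ≠ ⊤ :=
  ENNReal.rpow_ne_top_of_nonneg (by norm_num) (interpConst_ne_top
    (ENNReal.mul_ne_top dispConst_ne_top ENNReal.ofReal_ne_top))

/-- On the support of $X$ the Littlewood-Paley sum is $1$, so there $m=|\xi|^{-\gamma}$. The factor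
$\delta^\beta$ of the dispersive bound cancels against the one in the weight, leaving a constant
independent of $\delta$. -/
lemma lintegral_symSupp_le (hn : 0 < n) (hφ₀ : IsLPBump φ₀) (hg : ContinuousOn g (Ioi 0))
    (hC : 0 ≤ C) (hδ : 0 < δ)
    (hsum : ∀ t : ℝ, t ≠ 0 → ∃ K : Eu n → ℂ,
      IsOscIntegral (fun ξ => propSymbol g δ t ξ *
        ((‖ξ‖ ^ (-γ) * sumQ φ₀ J (δ * ‖ξ‖) : ℝ) : ℂ)) K ∧ ∀ x, ‖K x‖ ≤ C * (δ ^ β / |t| ^ σ))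
    {X : Eu n → ℂ} (hX : Measurable X)
    (hXJ : ∀ ξ ∈ symSupp X, sumQ φ₀ J (δ * ‖ξ‖) = 1) {G : ℝ → Eu n → ℂ} (hG : Nice G) :
    ∫⁻ ξ in symSupp X, ENNReal.ofReal (δ ^ β * ‖ξ‖ ^ γ)⁻¹ * ‖specInt (phase n g δ) G ξ‖ₑ ^ 2 ≤
      dispConst n * ENNReal.ofReal (ftConst n * C) * ∫⁻ t, ∫⁻ s,
        eLpNorm (G t) 1 volume * eLpNorm (G s) 1 volume * riesz σ (t - s) := by
  have hψ : Measurable (phase n g δ) := (measurable_comp_norm hg hδ).div_const δ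
  have hmQ := hφ₀.measurable_sumQ (n := n) J δ
  have hZ := measurable_specInt hψ hG.meas
  set m : Eu n → ℝ := fun ξ => ‖ξ‖ ^ (-γ) * sumQ φ₀ J (δ * ‖ξ‖) with hm
  have hmm : Measurable m := by
    have : Measurable fun ξ : Eu n => ‖ξ‖ ^ (-γ) := by fun_prop
    exact this.mul hmQ
  have hm0 : ∀ ξ, 0 ≤ m ξ := fun ξ => mul_nonneg (by positivity)
    (hφ₀.sumQ_nonneg J (by positivity))
  have hmA : AnnBdd (fun ξ => (m ξ : ℂ)) := by
    have h1 : AnnBdd (fun ξ : Eu n => ((sumQ φ₀ J (δ * ‖ξ‖) : ℝ) : ℂ)) := by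
      refine annBdd_of_bdd (M := 1) (Complex.measurable_ofReal.comp hmQ) fun ξ _ => ?_
      rw [Complex.norm_real, Real.norm_of_nonneg (hφ₀.sumQ_nonneg J (by positivity))]
      exact hφ₀.sumQ_le_one J (by positivity)
    have := (annBdd_norm_rpow (n := n) (-γ)).mul h1
    simpa only [hm, Complex.ofReal_mul] using this
  have hK : ∀ t, t ≠ 0 → ∀ θ : Eu n → ℂ, IsFreqTest θ →
      ‖∫ ξ, osc (phase n g δ) t ξ * (m ξ : ℂ) * θ ξ‖ₑ ≤
        ENNReal.ofReal (ftConst n * C * δ ^ β) * riesz σ t * ∫⁻ x, ‖FT θ x‖ₑ := fun t ht θ hθ => by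
    obtain ⟨K, h1, h2⟩ := hsum t ht
    exact enorm_integral_osc_le hC hδ h1 h2 hθ
  have key := lintegral_mul_specInt_sq_le hn hψ hm0 hmA hK hG
  have hmZ : Measurable fun ξ => ENNReal.ofReal (m ξ) * ‖specInt (phase n g δ) G ξ‖ₑ ^ 2 :=
    hmm.ennreal_ofReal.mul (hZ.enorm.pow_const 2)
  calc _ = ∫⁻ ξ in symSupp X, ENNReal.ofReal (δ ^ (-β)) *
        (ENNReal.ofReal (m ξ) * ‖specInt (phase n g δ) G ξ‖ₑ ^ 2) := by
        refine setLIntegral_congr_fun (measurableSet_symSupp hX) fun ξ hξ => ?_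
        rw [← mul_assoc, ← ENNReal.ofReal_mul (by positivity), hm]
        simp only
        rw [hXJ ξ hξ, mul_one, mul_inv, Real.rpow_neg hδ.le, Real.rpow_neg (norm_nonneg ξ)]
    _ ≤ ENNReal.ofReal (δ ^ (-β)) * ∫⁻ ξ, ENNReal.ofReal (m ξ) *
        ‖specInt (phase n g δ) G ξ‖ₑ ^ 2 := by
        rw [lintegral_const_mul _ hmZ]
        exact mul_le_mul_right (setLIntegral_le_lintegral _ _) _
    _ ≤ _ := by
        refine (mul_le_mul_right key _).trans_eq ?_
        have e : ENNReal.ofReal (ftConst n * C * δ ^ β) =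
            ENNReal.ofReal (ftConst n * C) * ENNReal.ofReal (δ ^ β) :=
          ENNReal.ofReal_mul (mul_nonneg (ftConst_pos n).le hC)
        have e2 : ENNReal.ofReal (δ ^ (-β)) * ENNReal.ofReal (δ ^ β) = 1 := by
          rw [← ENNReal.ofReal_mul (by positivity), ← Real.rpow_add hδ]
          simp
        rw [e]
        calc _ = (ENNReal.ofReal (δ ^ (-β)) * ENNReal.ofReal (δ ^ β)) * (dispConst n *
              ENNReal.ofReal (ftConst n * C) * ∫⁻ t, ∫⁻ s, eLpNorm (G t) 1 volume *
                eLpNorm (G s) 1 volume * riesz σ (t - s)) := by ring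
          _ = _ := by rw [e2, one_mul]

/-- The spectral bound for sharp admissible pairs. -/
theorem specBound_wt (hn : 0 < n) (hφ₀ : IsLPBump φ₀) (hg : ContinuousOn g (Ioi 0))
    (hσ : 0 < σ) (hσ1 : σ < 1) (hC : 0 ≤ C) (hδ : 0 < δ)
    (hsum : ∀ t : ℝ, t ≠ 0 → ∃ K : Eu n → ℂ,
      IsOscIntegral (fun ξ => propSymbol g δ t ξ *
        ((‖ξ‖ ^ (-γ) * sumQ φ₀ J (δ * ‖ξ‖) : ℝ) : ℂ)) K ∧ ∀ x, ‖K x‖ ≤ C * (δ ^ β / |t| ^ σ))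
    {X : Eu n → ℂ} (hX : Measurable X)
    (hXJ : ∀ ξ ∈ symSupp X, sumQ φ₀ J (δ * ‖ξ‖) = 1) {q r : ℝ≥0∞} (h : SharpAdmissible σ q r) :
    SpecBound (phase n g δ) (wt X (γ * (1 / 2 - recip r))) q.conjExponent r.conjExponent
      (ENNReal.ofReal (δ ^ (β * (1 / 2 - recip r))) * specConst n σ (interpParam r) C) := by
  have hψ : Measurable (phase n g δ) := (measurable_comp_norm hg hδ).div_const δ
  refine ⟨hψ, annBdd_wt hX _, ENNReal.mul_ne_top ENNReal.ofReal_ne_top (specConst_ne_top _ _ _ _),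
    fun G hG => ?_⟩
  have hθ0 := h.interpParam_nonneg
  have hθ1 := interpParam_le_one r
  have hθ : 1 / 2 - recip r = interpParam r / 2 := by unfold interpParam; ring
  rw [hθ, h.conj_left hσ hσ1, h.conj_right]
  have hE := measurableSet_symSupp hX
  -- Including $\delta^\beta$ in the weight makes the interpolation itself produce the right power
  -- of $\delta$ for each $\theta$.
  have hw : Measurable fun ξ : Eu n => δ ^ β * ‖ξ‖ ^ γ := by fun_prop
  have hwE : ∀ ξ ∈ symSupp X, 0 < δ ^ β * ‖ξ‖ ^ γ := fun ξ hξ => by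
    have : 0 < ‖ξ‖ := norm_pos_iff.2 hξ.1
    positivity
  have key := lintegral_rpow_specInt_le hσ hσ1 hθ0 hθ1 hψ hw hE hwE
    (ENNReal.mul_ne_top dispConst_ne_top ENNReal.ofReal_ne_top)
    (fun G hG => lintegral_symSupp_le hn hφ₀ hg hC hδ hsum hX hXJ hG) hG
  refine ENNReal.le_of_sq_le_sq ?_
  rw [eLpNorm_two_sq, mul_pow, mul_pow, specConst, ← ENNReal.rpow_natCast (_ ^ (1 / 2 : ℝ)),
    ← ENNReal.rpow_mul, show (1 / 2 : ℝ) * (2 : ℕ) = 1 by norm_num, ENNReal.rpow_one, mul_assoc]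
  refine le_trans (le_of_eq ?_) (mul_le_mul_right key _)
  have hZ := measurable_specInt hψ hG.meas
  have hm : Measurable fun ξ => ENNReal.ofReal ((δ ^ β * ‖ξ‖ ^ γ) ^ (-interpParam r)) *
      ‖specInt (phase n g δ) G ξ‖ₑ ^ 2 := by
    have h1 : Measurable fun ξ : Eu n => (δ ^ β * ‖ξ‖ ^ γ) ^ (-interpParam r) := by fun_prop
    exact h1.ennreal_ofReal.mul (hZ.enorm.pow_const 2)
  rw [← lintegral_const_mul _ hm, ← lintegral_indicator hE]
  congr 1; funext ξ
  by_cases hξ : ξ ∈ symSupp X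
  · have h0 : 0 < ‖ξ‖ := norm_pos_iff.2 hξ.1
    rw [indicator_of_mem hξ, wt, indicator_of_mem hξ, enorm_mul, mul_pow, ← mul_assoc]
    congr 1
    rw [← ofReal_norm, Complex.norm_real, Real.norm_of_nonneg (by positivity),
      ← ENNReal.ofReal_pow (by positivity), ← ENNReal.ofReal_pow (by positivity),
      ← ENNReal.ofReal_mul (by positivity)]
    congr 1
    rw [Real.mul_rpow (by positivity) (by positivity), ← Real.rpow_mul hδ.le,
      ← Real.rpow_mul h0.le, ← Real.rpow_natCast, ← Real.rpow_natCast, ← Real.rpow_mul hδ.le,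
      ← Real.rpow_mul h0.le, ← mul_assoc, ← Real.rpow_add hδ]
    -- After squaring, the factor $\delta^{\beta\theta}$ from the constant cancels
    -- $\delta^{-\beta\theta}$ from $w^{-\theta}$, and $|\xi|^{-\gamma\theta}$ remains.
    have e1 : β * (interpParam r / 2) * ((2 : ℕ) : ℝ) + β * -interpParam r = 0 := by push_cast; ring
    have e2 : -(γ * (interpParam r / 2)) * ((2 : ℕ) : ℝ) = γ * -interpParam r := by push_cast; ring
    rw [e1, e2, Real.rpow_zero, one_mul]
  · rw [indicator_of_notMem hξ, wt, indicator_of_notMem hξ]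
    simp

end


variable {n : ℕ}

/-! ### Fourier transforms of functions in `L^p`, `1 ≤ p ≤ 2` -/

/-- The Fourier transform of a function in `L^p`, `1 ≤ p ≤ 2`, as a function away from zero. -/
theorem exists_hat_of_memLp {p : ℝ≥0∞} (hp1 : 1 ≤ p) (hp2 : p ≤ 2) {f : Eu n → ℂ}
    (hf : MemLp f p volume) :
    ∃ fh : Eu n → ℂ, Measurable fh ∧ ∀ h : Eu n → ℂ, IsAnn h →
      Integrable (fun ξ => fh ξ * h ξ) ∧ ∫ x, f x * FT h x = ∫ ξ, fh ξ * h ξ := by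
  obtain ⟨f', hf'm, hff'⟩ := hf.1
  have hf' : MemLp f' p volume := hf.ae_eq hff'
  have hpt : p ≠ ⊤ := (hp2.trans_lt (by simp)).ne
  have hp0 : p ≠ 0 := (zero_lt_one.trans_le hp1).ne'
  have hP1 : 1 ≤ p.toReal := by
    rw [← ENNReal.toReal_one]; exact ENNReal.toReal_mono hpt hp1
  have hP2 : p.toReal ≤ 2 := by
    have := ENNReal.toReal_mono (by simp) hp2
    simpa using this
  -- The function is split at height $1$: the large values are in $L^1$ since $p\ge1$, the others in
  -- $L^2$ since $p\le2$. Each part has a Fourier transform that is a function.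
  set B : Set (Eu n) := {x | 1 < ‖f' x‖ₑ} with hB
  have hBm : MeasurableSet B := measurableSet_lt measurable_const hf'm.measurable.enorm
  have hI : ∫⁻ x, ‖f' x‖ₑ ^ p.toReal < ⊤ := by
    have := hf'.2
    rw [eLpNorm_lt_top_iff_lintegral_rpow_enorm_lt_top hp0 hpt] at this
    exact this
  have h1 : Integrable (B.indicator f') := by
    refine ⟨(hf'm.indicator hBm).aestronglyMeasurable, lt_of_le_of_lt (lintegral_mono fun x => ?_) hI⟩
    by_cases hx : x ∈ B
    · rw [indicator_of_mem hx]
      calc ‖f' x‖ₑ = ‖f' x‖ₑ ^ (1 : ℝ) := (ENNReal.rpow_one _).symm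
        _ ≤ _ := ENNReal.rpow_le_rpow_of_exponent_le (le_of_lt hx) hP1
    · rw [indicator_of_notMem hx]; simp
  have h2 : MemLp (Bᶜ.indicator f') 2 volume := by
    refine ⟨(hf'm.indicator hBm.compl).aestronglyMeasurable, ?_⟩
    rw [eLpNorm_lt_top_iff_lintegral_rpow_enorm_lt_top (by simp) (by simp)]
    refine lt_of_le_of_lt (lintegral_mono fun x => ?_) hI
    by_cases hx : x ∈ B
    · rw [indicator_of_notMem (not_not.2 hx)]; simp
    · rw [indicator_of_mem hx]
      simpa using ENNReal.rpow_le_rpow_of_exponent_ge (not_lt.1 hx) hP2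
  obtain ⟨k, hk, -, hkh⟩ := exists_hat h2
  obtain ⟨k', hk'm, hkk'⟩ := hk.1
  have hk' : MemLp k' 2 volume := hk.ae_eq hkk'
  have hc := continuous_FT h1
  refine ⟨fun ξ => FT (B.indicator f') ξ + k' ξ, hc.measurable.add hk'm.measurable, fun h hh => ?_⟩
  have hi1 : Integrable fun ξ => FT (B.indicator f') ξ * h ξ :=
    hh.integrable.bdd_mul hc.aestronglyMeasurable (ae_of_all _ fun ξ => norm_FT_le _ ξ)
  have hi2 : Integrable fun ξ => k' ξ * h ξ := hk'.integrable_mul (hh.memLp 2)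
  have hFc := continuous_FT hh.integrable
  have hj1 : Integrable fun x => B.indicator f' x * FT h x :=
    h1.mul_bdd hFc.aestronglyMeasurable (ae_of_all _ fun ξ => norm_FT_le _ ξ)
  have hj2 : Integrable fun x => Bᶜ.indicator f' x * FT h x :=
    h2.integrable_mul (memLp_FT hh.integrable (hh.memLp 2))
  refine ⟨by simp_rw [add_mul]; exact hi1.add hi2, ?_⟩
  have e : ∫ x, f x * FT h x = ∫ x, (B.indicator f' x * FT h x + Bᶜ.indicator f' x * FT h x) := by
    refine integral_congr_ae ?_
    filter_upwards [hff'] with x hx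
    rw [hx, ← add_mul]
    congr 1
    exact (congrFun (indicator_self_add_compl B f') x).symm
  rw [e, integral_add hj1 hj2, integral_mul_FT h1 hh.integrable, hkh h hh.integrable (hh.memLp 2)]
  simp_rw [add_mul]
  rw [integral_add hi1 hi2]
  congr 1
  refine integral_congr_ae ?_
  filter_upwards [hkk'] with x hx
  rw [hx]

/-- Integrability against annular symbols is local integrability away from the origin, where smooth
test functions determine $d$; the origin is null since $n>0$. -/
lemma ae_eq_zero_of_forall_isFreqTest (hn : 0 < n) {d : Eu n → ℂ}
    (hint : ∀ h : Eu n → ℂ, IsAnn h → Integrable fun ξ => d ξ * h ξ)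
    (h0 : ∀ θ : Eu n → ℂ, IsFreqTest θ → ∫ ξ, d ξ * θ ξ = 0) : ∀ᵐ ξ, d ξ = 0 := by
  have hloc : LocallyIntegrableOn d ({0}ᶜ : Set (Eu n)) := by
    intro x hx
    have hx0 : 0 < ‖x‖ := norm_pos_iff.2 hx
    have hO : IsOpen ({ξ : Eu n | ‖x‖ / 2 < ‖ξ‖} ∩ {ξ | ‖ξ‖ < 2 * ‖x‖}) :=
      (isOpen_lt continuous_const continuous_norm).inter
        (isOpen_lt continuous_norm continuous_const)
    refine ⟨_, mem_nhdsWithin_of_mem_nhds (hO.mem_nhds ⟨?_, ?_⟩), ?_⟩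
    · change ‖x‖ / 2 < ‖x‖; linarith
    · change ‖x‖ < 2 * ‖x‖; linarith
    · set A := {ξ : Eu n | ‖x‖ / 2 < ‖ξ‖} ∩ {ξ | ‖ξ‖ < 2 * ‖x‖}
      have hA : IsAnn (A.indicator fun _ => (1 : ℂ)) := by
        refine ⟨measurable_const.indicator hO.measurableSet, ⟨1, fun ξ => ?_⟩, ‖x‖ / 2, 2 * ‖x‖,
          by positivity, fun ξ hξ => indicator_of_notMem (fun h => ?_) _⟩
        · exact (norm_indicator_le_norm_self _ _).trans (by simp)
        · have h1 : ‖x‖ / 2 < ‖ξ‖ := h.1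
          have h2 : ‖ξ‖ < 2 * ‖x‖ := h.2
          rcases hξ with h3 | h3 <;> linarith
      rw [← integrable_indicator_iff hO.measurableSet]
      refine (hint _ hA).congr (ae_of_all _ fun ξ => ?_)
      by_cases h : ξ ∈ A
      · simp [indicator_of_mem h]
      · simp [indicator_of_notMem h]
  have h1 := (isOpen_compl_singleton (x := (0 : Eu n))).ae_eq_zero_of_integral_contDiff_smul_eq_zero
    hloc fun g hg hgc hg0 => by
      have hθ : IsFreqTest fun ξ => ((g ξ : ℝ) : ℂ) := by
        refine ⟨Complex.ofRealCLM.contDiff.comp hg, hgc.comp_left Complex.ofReal_zero, fun h => ?_⟩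
        refine hg0 (closure_mono (fun ξ hξ => ?_) h) rfl
        simpa using hξ
      rw [← h0 _ hθ]
      congr 1; funext ξ
      rw [Complex.real_smul, mul_comm]
  filter_upwards [h1, ae_ne_zero hn] with ξ h h' using h h'

/-! ### Transfer from `F` to `|D|^a χ(δ|D|) F` -/

/-- The symbol `|ξ|^a X(ξ)`. -/
noncomputable def powSym (a : ℝ) (X : Eu n → ℂ) (ξ : Eu n) : ℂ := ((‖ξ‖ ^ a : ℝ) : ℂ) * X ξ

section
variable {X : Eu n → ℂ} {a : ℝ}

lemma powSym_mul_wt_mul (X : Eu n → ℂ) (a : ℝ) {h : Eu n → ℂ} (hh : IsAnn h) (ξ : Eu n) :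
    powSym a X ξ * (wt X a ξ * h ξ) = X ξ * h ξ := by
  by_cases hξ : ξ = 0
  · obtain ⟨c, R, hc, hs⟩ := hh.supp
    rw [hs ξ (Or.inl (by simpa [hξ] using hc))]
    simp
  · rw [← mul_assoc, powSym, powSym_mul_wt X a hξ]

lemma annBdd_powSym (hX : AnnBdd X) (a : ℝ) : AnnBdd (powSym a X) := (annBdd_norm_rpow a).mul hX

lemma IsMultiplierImage.hat_eq (hn : 0 < n) {m : Eu n → ℂ} (hm : AnnBdd m) {u v uh vh : Eu n → ℂ}
    (huh : ∀ h : Eu n → ℂ, IsAnn h →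
      Integrable (fun ξ => uh ξ * h ξ) ∧ ∫ x, u x * FT h x = ∫ ξ, uh ξ * h ξ)
    (hvh : ∀ h : Eu n → ℂ, IsAnn h →
      Integrable (fun ξ => vh ξ * h ξ) ∧ ∫ x, v x * FT h x = ∫ ξ, vh ξ * h ξ)
    (h : IsMultiplierImage m u v) : ∀ᵐ ξ, vh ξ = uh ξ * m ξ := by
  have key := ae_eq_zero_of_forall_isFreqTest hn (d := fun ξ => vh ξ - uh ξ * m ξ)
    (fun k hk => by
      have := (hvh k hk).1.sub (huh _ (hm.mul_isAnn hk)).1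
      refine this.congr (ae_of_all _ fun ξ => ?_)
      simp only [Pi.sub_apply]; ring)
    (fun θ hθ => by
      have h1 := hvh θ hθ.isAnn
      have h2 := huh _ (hm.mul_isAnn hθ.isAnn)
      have h3 := h θ hθ
      rw [h1.2, h2.2] at h3
      have e : ∀ ξ, (vh ξ - uh ξ * m ξ) * θ ξ = vh ξ * θ ξ - uh ξ * (m ξ * θ ξ) := fun ξ => by ring
      simp_rw [e]
      rw [integral_sub h1.1 h2.1, h3, sub_self])
  filter_upwards [key] with ξ hξ using sub_eq_zero.1 hξ

/-- Both functions have Fourier transforms that are functions away from $0$, and $\hat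
v=|\xi|^aX\hat u$ almost everywhere; the weight `wt` divides the power out again. The two Lebesgue
exponents may differ, as for an inhomogeneity known only in the first of the two spaces. -/
theorem IsMultiplierImage.integral_mul_FT_eq (hn : 0 < n) (hX : AnnBdd X) {p p' : ℝ≥0∞}
    (hp1 : 1 ≤ p) (hp2 : p ≤ 2) (hp1' : 1 ≤ p') (hp2' : p' ≤ 2) {u v : Eu n → ℂ}
    (hu : MemLp u p volume) (hv : MemLp v p' volume) (h : IsMultiplierImage (powSym a X) u v)
    {k : Eu n → ℂ} (hk : IsAnn k) :
    ∫ x, u x * FT (fun ξ => X ξ * k ξ) x = ∫ x, v x * FT (fun ξ => wt X a ξ * k ξ) x := by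
  obtain ⟨uh, -, huh⟩ := exists_hat_of_memLp hp1 hp2 hu
  obtain ⟨vh, -, hvh⟩ := exists_hat_of_memLp hp1' hp2' hv
  have key := IsMultiplierImage.hat_eq hn (annBdd_powSym hX a) huh hvh h
  rw [(huh _ (hX.mul_isAnn hk)).2, (hvh _ ((annBdd_wt hX.meas a).mul_isAnn hk)).2]
  refine integral_congr_ae ?_
  filter_upwards [key] with ξ hξ
  rw [hξ, mul_assoc, powSym_mul_wt_mul X a hk]

end


variable {n : ℕ}

/-! ### Strichartz estimates -/

lemma exists_measurable_rep {F : ℝ → Eu n → ℂ}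
    (hF : AEStronglyMeasurable (Function.uncurry F) (volume : Measure (ℝ × Eu n))) :
    ∃ F' : ℝ → Eu n → ℂ, Measurable (Function.uncurry F') ∧ ∀ᵐ s, F s =ᵐ[volume] F' s := by
  obtain ⟨g, hg, hFg⟩ := hF
  exact ⟨fun s x => g (s, x), hg.measurable, Measure.ae_ae_of_ae_prod hFg⟩

lemma MemMixed.ae_memLp {p s : ℝ≥0∞} (hp : p ≠ 0) {F : ℝ → Eu n → ℂ} (hF : MemMixed p s F) :
    ∀ᵐ t, MemLp (F t) s volume := by
  obtain ⟨F', hm, he⟩ := exists_measurable_rep hF.1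
  have h1 : mixedNorm p s F' < ⊤ := by rw [← mixedNorm_congr he]; exact hF.2
  filter_upwards [he, ae_lt_top_of_eLpNorm (measurable_eLpNorm_slice hm s) hp h1] with t h2 h3
  exact MemLp.ae_eq h2.symm ⟨(measurable_slice hm t).aestronglyMeasurable, h3⟩

section
variable {ψ : Eu n → ℝ} {X : Eu n → ℂ} {a : ℝ} {q r q' r' A : ℝ≥0∞}

/-- The dual homogeneous estimate. -/
theorem SpecBound.dual_estimate (hn : 0 < n) (hX : AnnBdd X) [ENNReal.HolderConjugate q q']
    [ENNReal.HolderConjugate r r'] (hB : SpecBound ψ (wt X a) q' r' A) (hq : 1 < q) (hr : 1 < r)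
    (hr2 : r' ≤ 2) {F G : ℝ → Eu n → ℂ} (hF : MemMixed q' r' F) (hG : MemMixed q' r' G)
    (hFG : ∀ᵐ s, IsMultiplierImage (powSym a X) (F s) (G s)) :
    ∃ v : Eu n → ℂ, MemLp v 2 volume ∧
      IsTimeIntegral univ (fun s ξ => osc ψ (-s) ξ * X ξ) F v ∧
      eLpNorm v 2 volume ≤ A * mixedNorm q' r' G := by
  have hr1 : 1 ≤ r' := (ENNReal.HolderConjugate.symm (p := r) (q := r')).one_le
  have hq0 : q' ≠ 0 :=
    (zero_lt_one.trans_le (ENNReal.HolderConjugate.symm (p := q) (q := q')).one_le).ne'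
  obtain ⟨G', hG'm, hGG'⟩ := exists_measurable_rep hG.1
  have hG'f : mixedNorm q' r' G' < ⊤ := by rw [← mixedNorm_congr hGG']; exact hG.2
  obtain ⟨V, hV, hVn, hVh⟩ := hB.exists_dual hq hr hG'm hG'f
  obtain ⟨v, hv, hvn, hvh⟩ := exists_unhat hV
  refine ⟨v, hv, fun θ hθ => ?_, by rw [hvn, mixedNorm_congr hGG']; exact hVn⟩
  have hθ' := hθ.isAnn
  -- The estimate has been proved with $G$ and the weight, the identity is claimed for $F$ and the
  -- symbol $X$; for almost every time the two pairings coincide.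
  have key : ∀ᵐ s, ∫ x, G' s x * evol ψ (fun ξ => wt X a ξ * θ ξ) s x =
      ∫ x, F s x * FT (fun ξ => osc ψ (-s) ξ * X ξ * θ ξ) x := by
    filter_upwards [hFG, hGG', hF.ae_memLp hq0, hG.ae_memLp hq0] with s h1 h2 h3 h4
    have h5 := h1.integral_mul_FT_eq hn hX hr1 hr2 hr1 hr2 h3 h4 (isAnn_osc_mul hB.phase hθ' (-s))
    have e1 : (fun ξ => osc ψ (-s) ξ * X ξ * θ ξ) = fun ξ => X ξ * (osc ψ (-s) ξ * θ ξ) := by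
      funext ξ; ring
    have e2 : evol ψ (fun ξ => wt X a ξ * θ ξ) s =
        FT (fun ξ => wt X a ξ * (osc ψ (-s) ξ * θ ξ)) := by
      funext x
      rw [evol]
      congr 1; funext ξ; ring
    rw [e1, h5, e2]
    refine integral_congr_ae ?_
    filter_upwards [h2] with x hx
    rw [hx]
  obtain ⟨h1, h2⟩ := hVh θ hθ'
  refine ⟨?_, ?_⟩
  · rw [integrableOn_univ]
    exact h1.congr key
  · rw [Measure.restrict_univ, hvh θ hθ'.integrable (hθ'.memLp 2), h2]
    exact integral_congr_ae key

/-- The inhomogeneous estimates. -/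
theorem DuhBound.duhamel_estimate (hn : 0 < n) (hX : AnnBdd X) {S : ℝ → Set ℝ}
    {qt rt p s p₁ s₁ K : ℝ≥0∞} (hD : DuhBound ψ (wt X a) S q r p s K) (hq : 1 ≤ q) (hr : 1 ≤ r)
    [ENNReal.HolderConjugate qt p] [ENNReal.HolderConjugate rt s] (hp : p ≠ ⊤) (hs2 : s ≤ 2)
    (hE : ∀ h : Eu n → ℂ, IsAnn h → mixedNorm qt rt (evol ψ fun ξ => wt X a ξ * h ξ) < ⊤)
    (hp₁ : p₁ ≠ 0) (hs₁ : 1 ≤ s₁) (hs₁2 : s₁ ≤ 2) {F G : ℝ → Eu n → ℂ} (hF : MemMixed p₁ s₁ F)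
    (hG : MemMixed p s G) (hFG : ∀ᵐ t, IsMultiplierImage (powSym a X) (F t) (G t)) :
    ∃ u : ℝ → Eu n → ℂ,
      AEStronglyMeasurable (Function.uncurry u) (volume : Measure (ℝ × Eu n)) ∧
      (∀ᵐ t, VanishesAtZeroFreq (u t) ∧
        IsTimeIntegral (S t) (fun s ξ => osc ψ (t - s) ξ * X ξ) F (u t)) ∧
      mixedNorm q r u ≤ K * mixedNorm p s G := by
  have hs1 : 1 ≤ s := (ENNReal.HolderConjugate.symm (p := rt) (q := s)).one_le
  have hp0 : p ≠ 0 :=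
    (zero_lt_one.trans_le (ENNReal.HolderConjugate.symm (p := qt) (q := p)).one_le).ne'
  obtain ⟨G', hG'm, hGG'⟩ := exists_measurable_rep hG.1
  have hG'f : mixedNorm p s G' < ⊤ := by rw [← mixedNorm_congr hGG']; exact hG.2
  obtain ⟨u, hum, hun, hut⟩ := hD.exists_duhamel hn hq hr hp (hs2.trans_lt (by simp)).ne hE hG'm hG'f
  refine ⟨u, hum.aestronglyMeasurable, ?_, by rw [mixedNorm_congr hGG']; exact hun⟩
  filter_upwards [hut] with t ht
  refine ⟨ht.1, fun θ hθ => ?_⟩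
  have hθ' := hθ.isAnn
  have key : ∀ᵐ s, ∫ x, G' s x * evol ψ (fun ξ => wt X a ξ * (osc ψ t ξ * θ ξ)) s x =
      ∫ x, F s x * FT (fun ξ => osc ψ (t - s) ξ * X ξ * θ ξ) x := by
    filter_upwards [hFG, hGG', hF.ae_memLp hp₁, hG.ae_memLp hp0] with s h1 h2 h3 h4
    have h5 := h1.integral_mul_FT_eq hn hX hs₁ hs₁2 hs1 hs2 h3 h4
      (isAnn_osc_mul hD.phase hθ' (t - s))
    have e1 : (fun ξ => osc ψ (t - s) ξ * X ξ * θ ξ) =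
        fun ξ => X ξ * (osc ψ (t - s) ξ * θ ξ) := by
      funext ξ; ring
    have e2 : evol ψ (fun ξ => wt X a ξ * (osc ψ t ξ * θ ξ)) s =
        FT (fun ξ => wt X a ξ * (osc ψ (t - s) ξ * θ ξ)) := by
      funext x
      rw [evol]
      congr 1; funext ξ
      rw [sub_eq_add_neg, osc_add]; ring
    rw [e1, h5, e2]
    refine integral_congr_ae ?_
    filter_upwards [h2] with x hx
    rw [hx]
  obtain ⟨h1, h2⟩ := ht.2 θ hθ
  refine ⟨?_, ?_⟩
  · exact Integrable.congr h1 (ae_restrict_of_ae key)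
  · rw [h2]
    exact integral_congr_ae (ae_restrict_of_ae key)

end


variable {n : ℕ}

/-! ### The homogeneous estimate -/

/-- Convergence in $L^2$ gives convergence in measure, which suffices for Fatou in any exponent $p$
along a subsequence realising the lower limit. -/
lemma eLpNorm_le_liminf_of_tendsto {f : ℕ → Eu n → ℂ} {g : Eu n → ℂ} {p : ℝ≥0∞}
    (hf : ∀ N, AEStronglyMeasurable (f N) volume) (hg : AEStronglyMeasurable g volume)
    (h : Tendsto (fun N => eLpNorm (fun x => f N x - g x) 2 volume) atTop (𝓝 0)) :
    eLpNorm g p volume ≤ liminf (fun N => eLpNorm (f N) p volume) atTop := by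
  refine le_of_forall_gt_imp_ge_of_dense fun C hC => ?_
  obtain ⟨φ, hφ, hφC⟩ := extraction_of_frequently_atTop (frequently_lt_of_liminf_lt (by isBoundedDefault) hC)
  have h2 : TendstoInMeasure volume (fun N => f (φ N)) atTop g :=
    tendstoInMeasure_of_tendsto_eLpNorm (p := 2) (by simp) (fun N => hf _) hg
      (h.comp hφ.tendsto_atTop)
  exact eLpNorm_le_of_tendstoInMeasure (Eventually.of_forall fun N => (hφC N).le) h2
    fun N => hf _

/-- Restriction of a symbol to an annulus where it is bounded. -/
noncomputable def annTrunc (N : ℕ) (f : Eu n → ℂ) : Eu n → ℂ :=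
  ((tailSet n N)ᶜ ∩ {ξ | ‖f ξ‖ ≤ N}).indicator f

lemma isAnn_annTrunc (N : ℕ) {f : Eu n → ℂ} (hf : Measurable f) : IsAnn (annTrunc N f) := by
  have hN : (0 : ℝ) < (N : ℝ) + 2 := by positivity
  refine ⟨hf.indicator ((measurableSet_tailSet N).compl.inter
    (measurableSet_le hf.norm measurable_const)), ⟨N, fun ξ => ?_⟩, 2 / ((N : ℝ) + 2), (N : ℝ) + 2,
    by positivity, fun ξ hξ => indicator_of_notMem (fun h => h.1 ?_) _⟩
  · unfold annTrunc
    by_cases h : ξ ∈ (tailSet n N)ᶜ ∩ {ξ | ‖f ξ‖ ≤ N}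
    · rw [indicator_of_mem h]; exact h.2
    · rw [indicator_of_notMem h]; simp
  · rcases hξ with h1 | h1
    · rw [lt_div_iff₀ hN, mul_comm] at h1
      exact Or.inr h1
    · exact Or.inl h1

lemma tendsto_annTrunc (hn : 0 < n) {f : Eu n → ℂ} (hf : Measurable f) (hf2 : MemLp f 2 volume) :
    Tendsto (fun N => eLpNorm (fun ξ => f ξ - annTrunc N f ξ) 2 volume) atTop (𝓝 0) := by
  simp_rw [← eLpNorm_enorm (fun ξ => f ξ - annTrunc _ f ξ)]
  have hm : ∀ N, Measurable fun ξ => ‖f ξ - annTrunc N f ξ‖ₑ := fun N =>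
    (hf.sub (isAnn_annTrunc N hf).meas).enorm
  refine tendsto_eLpNorm_of_dominated (B := fun ξ => ‖f ξ‖ₑ)
    hm (by simp) (by simp) (fun N ξ => ?_)
    (by simpa only [eLpNorm_enorm] using hf2.2.ne) ?_
  · unfold annTrunc
    by_cases h : ξ ∈ (tailSet n N)ᶜ ∩ {ξ | ‖f ξ‖ ≤ N}
    · rw [indicator_of_mem h]; simp
    · rw [indicator_of_notMem h]; simp
  · filter_upwards [ae_ne_zero hn] with ξ hξ
    refine tendsto_const_nhds.congr' ?_
    filter_upwards [eventually_notMem_tailSet hξ, eventually_ge_atTop ⌈‖f ξ‖⌉₊] with N h1 h2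
    have h3 : ‖f ξ‖ ≤ N := (Nat.le_ceil _).trans (by exact_mod_cast h2)
    rw [annTrunc, indicator_of_mem (show ξ ∈ (tailSet n N)ᶜ ∩ {ξ | ‖f ξ‖ ≤ N} from ⟨h1, h3⟩)]
    simp

lemma exists_fast_ann (hn : 0 < n) {f : Eu n → ℂ} (hf : Measurable f) (hf2 : MemLp f 2 volume) :
    ∃ φ : ℕ → ℕ, (∀ j, eLpNorm (fun ξ => f ξ - annTrunc (φ j) f ξ) 2 volume ≤ (1 / 4) ^ j) ∧
      ∀ j, eLpNorm (fun ξ => annTrunc (φ (j + 1)) f ξ - annTrunc (φ j) f ξ) 2 volume ≤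
        2 * (1 / 4) ^ j := by
  have h1 := tendsto_annTrunc hn hf hf2
  have h2 : ∀ j : ℕ, ∃ N, eLpNorm (fun ξ => f ξ - annTrunc N f ξ) 2 volume < (1 / 4) ^ j :=
    fun j => ((tendsto_order.1 h1).2 _ (ENNReal.pow_pos (by simp) j)).exists
  choose φ hφ using h2
  refine ⟨φ, fun j => (hφ j).le, fun j => ?_⟩
  have hm : ∀ j, AEStronglyMeasurable (fun ξ => f ξ - annTrunc (φ j) f ξ) volume := fun j =>
    (hf.sub (isAnn_annTrunc (φ j) hf).meas).aestronglyMeasurable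
  have e : (fun ξ => annTrunc (φ (j + 1)) f ξ - annTrunc (φ j) f ξ) =
      (fun ξ => f ξ - annTrunc (φ j) f ξ) - fun ξ => f ξ - annTrunc (φ (j + 1)) f ξ := by
    funext ξ; simp
  rw [e]
  refine (eLpNorm_sub_le (hm j) (hm (j + 1)) one_le_two).trans ?_
  rw [two_mul]
  refine add_le_add (hφ j).le ((hφ (j + 1)).le.trans ?_)
  exact pow_le_pow_right_of_le_one' (by rw [ENNReal.div_le_iff (by simp) (by simp)]; norm_num)
    (Nat.le_succ j)

/-! ### The flow of a square-integrable datum -/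

section
variable {ψ : Eu n → ℝ}

/-- The evolution `e^{itψ(D)}` of a function with Fourier transform `f`. -/
noncomputable def flow (ψ : Eu n → ℝ) (f : Eu n → ℂ) (t : ℝ) : Eu n → ℂ :=
  IFT fun ξ => osc ψ t ξ * f ξ

lemma flow_eq (f : Eu n → ℂ) (t : ℝ) (x : Eu n) :
    flow ψ f t x = (starRingEnd ℂ) (evol ψ (fun ξ => (starRingEnd ℂ) (f ξ)) t x) := by
  simp only [flow, IFT, evol, map_mul, conj_osc]

lemma measurable_flow (hψ : Measurable ψ) {f : Eu n → ℂ} (hf : Measurable f) :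
    Measurable (Function.uncurry (flow ψ f)) := by
  have e : Function.uncurry (flow ψ f) = fun p => (starRingEnd ℂ)
      (Function.uncurry (evol ψ fun ξ => (starRingEnd ℂ) (f ξ)) p) := by
    funext p; exact flow_eq _ _ _
  rw [e]
  exact Complex.continuous_conj.measurable.comp
    (measurable_evol hψ (Complex.continuous_conj.measurable.comp hf))

lemma mixedNorm_flow (q r : ℝ≥0∞) (f : Eu n → ℂ) :
    mixedNorm q r (flow ψ f) = mixedNorm q r (evol ψ fun ξ => (starRingEnd ℂ) (f ξ)) := by
  rw [← mixedNorm_conj]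
  congr 1; funext t x
  rw [flow_eq, Complex.conj_conj]

lemma memLp_flow (hψ : Measurable ψ) {f : Eu n → ℂ} (hf : IsAnn f) (t : ℝ) :
    MemLp (flow ψ f t) 2 volume := by
  have h := isAnn_osc_mul hψ hf t
  exact memLp_IFT h.integrable (h.memLp 2)

lemma eLpNorm_flow (hψ : Measurable ψ) {f : Eu n → ℂ} (hf : IsAnn f) (t : ℝ) :
    eLpNorm (flow ψ f t) 2 volume = eLpNorm f 2 volume := by
  have h := (isAnn_osc_mul hψ hf t).conj
  calc eLpNorm (flow ψ f t) 2 volume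
      = eLpNorm (FT fun ξ => (starRingEnd ℂ) (osc ψ t ξ * f ξ)) 2 volume :=
        eLpNorm_congr_enorm_ae (ae_of_all _ fun x => enorm_IFT _ x)
    _ = eLpNorm (fun ξ => (starRingEnd ℂ) (osc ψ t ξ * f ξ)) 2 volume :=
        eLpNorm_FT h.integrable (h.memLp 2)
    _ = eLpNorm f 2 volume := eLpNorm_congr_norm_ae (ae_of_all _ fun ξ => by simp [norm_osc])

lemma flow_sub (hψ : Measurable ψ) {f g : Eu n → ℂ} (hf : IsAnn f) (hg : IsAnn g) (t : ℝ)
    (x : Eu n) : flow ψ (fun ξ => f ξ - g ξ) t x = flow ψ f t x - flow ψ g t x := by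
  simp only [flow, IFT]
  rw [← map_sub, ← FT_sub (isAnn_osc_mul hψ hf t).conj.integrable
    (isAnn_osc_mul hψ hg t).conj.integrable]
  congr 2; funext ξ
  rw [← map_sub, mul_sub]

/-- The evolution of an `L²` function, as a limit. -/
lemma exists_flow (hn : 0 < n) (hψ : Measurable ψ) {g : Eu n → ℂ} (hg : Measurable g)
    (hg2 : MemLp g 2 volume) : ∃ φ : ℕ → ℕ, ∃ v : ℝ → Eu n → ℂ, Measurable (Function.uncurry v) ∧
      ∀ᵐ t, Tendsto (fun j => eLpNorm (fun x => flow ψ (annTrunc (φ j) g) t x - v t x) 2 volume)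
        atTop (𝓝 0) ∧ MemLp (v t) 2 volume ∧ ∀ θ : Eu n → ℂ, IsFreqTest θ →
          ∫ x, v t x * FT θ x = ∫ ξ, osc ψ t ξ * g ξ * θ ξ := by
  obtain ⟨φ, hφ1, hφ2⟩ := exists_fast_ann hn hg hg2
  have hA := fun j => isAnn_annTrunc (φ j) hg
  -- By unitarity the approximations are Cauchy in $L^2$ uniformly in $t$, that is in
  -- $L^\infty_tL^2_x$; completeness with slicewise limits gives a jointly measurable solution.
  obtain ⟨v, hvm, hvt, -⟩ := exists_mixed_limit (q := ⊤) (r := 2) le_top one_le_two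
    (u := fun j => flow ψ (annTrunc (φ j) g)) (fun j => measurable_flow hψ (hA j).meas) (K := 2)
    (by simp) fun j => by
      have h1 : ∀ t, eLpNorm (fun x => flow ψ (annTrunc (φ (j + 1)) g) t x -
          flow ψ (annTrunc (φ j) g) t x) 2 volume ≤ 2 * (1 / 4) ^ j := fun t => by
        simp_rw [← flow_sub hψ (hA (j + 1)) (hA j)]
        exact (eLpNorm_flow hψ ((hA (j + 1)).sub (hA j)) t).trans_le (hφ2 j)
      unfold mixedNorm
      rw [eLpNorm_exponent_top]
      exact essSup_le_of_ae_le _ (ae_of_all _ fun t => by simpa using h1 t)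
  refine ⟨φ, v, hvm, ?_⟩
  filter_upwards [hvt] with t ht
  have hvs : AEStronglyMeasurable (v t) volume := (measurable_slice hvm t).aestronglyMeasurable
  have hfs := fun j => memLp_flow hψ (hA j) t
  refine ⟨ht, ⟨hvs, ?_⟩, fun θ hθ => ?_⟩
  · obtain ⟨j, hj⟩ := ((tendsto_order.1 ht).2 ⊤ ENNReal.zero_lt_top).exists
    have hd : MemLp (fun x => flow ψ (annTrunc (φ j) g) t x - v t x) 2 volume :=
      ⟨(hfs j).1.sub hvs, hj⟩
    have e : v t = flow ψ (annTrunc (φ j) g) t -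
        fun x => flow ψ (annTrunc (φ j) g) t x - v t x := by funext x; simp
    rw [e]
    exact ((hfs j).sub hd).2
  · have hθ' := hθ.isAnn
    have l1 := tendsto_integral_of_eLpNorm_sub (p := 2) hfs hvs (memLp_FT_of_isFreqTest hθ 2)
      (memLp_FT_of_isFreqTest hθ 2) ht
    have hg4 : Tendsto (fun j => eLpNorm (fun ξ => annTrunc (φ j) g ξ - g ξ) 2 volume) atTop
        (𝓝 0) := by
      refine tendsto_of_tendsto_of_tendsto_of_le_of_le tendsto_const_nhds tendsto_quarter_pow
        (fun _ => zero_le) fun j => le_trans (le_of_eq ?_) (hφ1 j)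
      exact eLpNorm_congr_enorm_ae (ae_of_all _ fun ξ => enorm_sub_rev _ _)
    have hoθ := isAnn_osc_mul hψ hθ' t
    have l2 := tendsto_integral_of_eLpNorm_sub (p := 2) (fun j => (hA j).memLp 2) hg2.1
      (hoθ.memLp 2) (hoθ.memLp 2) hg4
    have e1 : ∀ j, ∫ x, flow ψ (annTrunc (φ j) g) t x * FT θ x =
        ∫ ξ, annTrunc (φ j) g ξ * (osc ψ t ξ * θ ξ) := fun j => by
      have h := isAnn_osc_mul hψ (hA j) t
      simp only [flow]
      rw [integral_IFT_mul_FT h.integrable (h.memLp 2) hθ'.integrable (hθ'.memLp 2)]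
      congr 1; funext ξ; ring
    have e2 : ∫ ξ, osc ψ t ξ * g ξ * θ ξ = ∫ ξ, g ξ * (osc ψ t ξ * θ ξ) := by
      congr 1; funext ξ; ring
    rw [e2]
    simp_rw [e1] at l1
    exact tendsto_nhds_unique l1 l2

variable {X : Eu n → ℂ} {a : ℝ} {q r q' r' A : ℝ≥0∞}

/-- Conjugation turns the flow into `evol`, and inserting $|\xi|^{-a}|\xi|^a$ on the support of $X$
produces the weight of the spectral bound and the symbol of the right-hand side. -/
lemma SpecBound.mixedNorm_flow_le [ENNReal.HolderConjugate q q'] [ENNReal.HolderConjugate r r']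
    (hB : SpecBound ψ (wt X a) q' r' A) (hq : 1 < q) (hr : 1 < r) {k : Eu n → ℂ}
    (hXm : Measurable fun ξ => X ξ * k ξ) (N : ℕ) : mixedNorm q r (flow ψ (annTrunc N fun ξ => X ξ * k ξ)) ≤
      A * eLpNorm (fun ξ => k ξ * powSym a X ξ) 2 volume := by
  have hA := isAnn_annTrunc N hXm
  have hP := (annBdd_norm_rpow (n := n) a).mul_isAnn hA
  have e : (fun ξ => (starRingEnd ℂ) (annTrunc N (fun ξ => X ξ * k ξ) ξ)) =
      fun ξ => wt X a ξ * (starRingEnd ℂ)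
        (((‖ξ‖ ^ a : ℝ) : ℂ) * annTrunc N (fun ξ => X ξ * k ξ) ξ) := by
    funext ξ
    rw [← conj_wt, ← map_mul]
    congr 1
    by_cases h : ξ ∈ (tailSet n N)ᶜ ∩ {ξ | ‖X ξ * k ξ‖ ≤ N}
    · have hξ : ξ ≠ 0 := fun h0 => h.1 (Or.inr (by simp [h0]))
      rw [annTrunc, indicator_of_mem h]
      have := powSym_mul_wt X a hξ
      linear_combination (-(k ξ)) * this
    · rw [annTrunc, indicator_of_notMem h]; simp
  rw [mixedNorm_flow, e]
  refine (hB.mixedNorm_evol_le hq hr hP.conj).trans (mul_le_mul_right ?_ _)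
  refine eLpNorm_mono fun ξ => ?_
  rw [RCLike.norm_conj, powSym]
  have h1 : ‖annTrunc N (fun ξ => X ξ * k ξ) ξ‖ ≤ ‖X ξ * k ξ‖ := norm_indicator_le_norm_self _ _
  calc _ ≤ ‖((‖ξ‖ ^ a : ℝ) : ℂ)‖ * ‖X ξ * k ξ‖ := by rw [norm_mul]; gcongr
    _ = _ := by simp only [norm_mul]; ring

/-- The homogeneous estimate. -/
theorem SpecBound.homogeneous_estimate (hn : 0 < n) (hX : Measurable X) {B : ℝ}
    (hXB : ∀ ξ, ξ ≠ 0 → ‖X ξ‖ ≤ B) [ENNReal.HolderConjugate q q'] [ENNReal.HolderConjugate r r']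
    (hB : SpecBound ψ (wt X a) q' r' A) (hq : 1 < q) (hr : 1 < r) {f h : Eu n → ℂ}
    (hf : MemLp f 2 volume) (hh : MemLp h 2 volume) (hfh : IsMultiplierImage (powSym a X) f h) :
    ∃ u : ℝ → Eu n → ℂ,
      AEStronglyMeasurable (Function.uncurry u) (volume : Measure (ℝ × Eu n)) ∧
      (∀ t, MemLp (u t) 2 volume ∧ IsMultiplierImage (fun ξ => osc ψ t ξ * X ξ) f (u t)) ∧
      mixedNorm q r u ≤ A * eLpNorm h 2 volume := by
  have hXA : AnnBdd X := annBdd_of_bdd hX hXB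
  have hψ := hB.phase
  obtain ⟨fh', hfh'2, -, hfh'⟩ := exists_hat hf
  obtain ⟨hh', hhh'2, hhn, hhh'⟩ := exists_hat hh
  obtain ⟨k, hkm, hk⟩ := hfh'2.1
  have hk2 := hfh'2.ae_eq hk
  have hfk : ∀ e : Eu n → ℂ, IsAnn e → Integrable (fun ξ => k ξ * e ξ) ∧
      ∫ x, f x * FT e x = ∫ ξ, k ξ * e ξ := fun e he => by
    refine ⟨hk2.integrable_mul (he.memLp 2), ?_⟩
    rw [hfh' e he.integrable (he.memLp 2)]
    refine integral_congr_ae ?_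
    filter_upwards [hk] with ξ hξ
    rw [hξ]
  have hhat := IsMultiplierImage.hat_eq hn (annBdd_powSym hXA a) hfk
    (fun e he => ⟨hhh'2.integrable_mul (he.memLp 2), hhh' e he.integrable (he.memLp 2)⟩) hfh
  have hgm : Measurable fun ξ => X ξ * k ξ := hX.mul hkm.measurable
  have hg2 : MemLp (fun ξ => X ξ * k ξ) 2 volume := by
    refine hk2.of_le_mul (c := B) hgm.aestronglyMeasurable ?_
    filter_upwards [ae_ne_zero hn] with ξ hξ
    rw [norm_mul]
    exact mul_le_mul_of_nonneg_right (hXB ξ hξ) (norm_nonneg _)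
  obtain ⟨φ, v, hvm, hv⟩ := exists_flow hn hψ hgm hg2
  -- The limit is good only for almost every $t$, whereas the evolution is required at every $t$;
  -- this supplies a value at each remaining time.
  have hU : ∀ t, ∃ w : Eu n → ℂ, MemLp w 2 volume ∧ ∀ θ : Eu n → ℂ, IsFreqTest θ →
      ∫ x, w x * FT θ x = ∫ ξ, osc ψ t ξ * (X ξ * k ξ) * θ ξ := fun t => by
    have h2 : MemLp (fun ξ => osc ψ t ξ * (X ξ * k ξ)) 2 volume := by
      have hm : Measurable fun ξ => osc ψ t ξ * (X ξ * k ξ) := (measurable_osc_right hψ t).mul hgm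
      refine hg2.of_le hm.aestronglyMeasurable (ae_of_all _ fun ξ => ?_)
      rw [norm_mul, norm_osc, one_mul]
    obtain ⟨w, hw, -, hwh⟩ := exists_unhat h2
    exact ⟨w, hw, fun θ hθ => hwh θ hθ.isAnn.integrable (hθ.isAnn.memLp 2)⟩
  choose U hU2 hUθ using hU
  classical
  -- The measurable solution is corrected on a null set of times, which affects neither
  -- almost-everywhere strong measurability nor the mixed norm.
  obtain ⟨u, hu⟩ : ∃ u : ℝ → Eu n → ℂ, u = fun t => if MemLp (v t) 2 volume ∧
    (∀ θ : Eu n → ℂ, IsFreqTest θ →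
      ∫ x, v t x * FT θ x = ∫ ξ, osc ψ t ξ * (X ξ * k ξ) * θ ξ) then v t else U t := ⟨_, rfl⟩
  have huv : ∀ᵐ t, u t = v t := by
    filter_upwards [hv] with t ht
    rw [hu]
    exact if_pos ht.2
  refine ⟨u, ?_, fun t => ?_, ?_⟩
  · refine hvm.aestronglyMeasurable.congr ?_
    have h1 : ∀ᵐ p : ℝ × Eu n, u p.1 = v p.1 := Measure.quasiMeasurePreserving_fst.ae huv
    filter_upwards [h1] with p hp
    simp only [Function.uncurry, hp]
  · have key : MemLp (u t) 2 volume ∧ ∀ θ : Eu n → ℂ, IsFreqTest θ →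
        ∫ x, u t x * FT θ x = ∫ ξ, osc ψ t ξ * (X ξ * k ξ) * θ ξ := by
      rw [hu]
      simp only
      split_ifs with hc
      · exact hc
      · exact ⟨hU2 t, hUθ t⟩
    refine ⟨key.1, fun θ hθ => ?_⟩
    have hm := (annBdd_osc hψ t).mul hXA
    rw [key.2 θ hθ, (hfk _ (hm.mul_isAnn hθ.isAnn)).2]
    congr 1; funext ξ; ring
  · have hA := fun j => isAnn_annTrunc (φ j) hgm
    -- Fatou is used in $x$ at almost every time and then in $t$; this covers infinite exponents as
    -- well, where truncations need not converge in norm.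
    refine eLpNorm_le_of_liminf (F := fun j t =>
      eLpNorm (flow ψ (annTrunc (φ j) fun ξ => X ξ * k ξ) t) r volume)
      (fun j => measurable_eLpNorm_slice (measurable_flow hψ (hA j).meas) r) ?_ fun j => ?_
    · filter_upwards [hv, huv] with t ht hut
      rw [hut]
      exact eLpNorm_le_liminf_of_tendsto (fun j => (memLp_flow hψ (hA j) t).1)
        (measurable_slice hvm t).aestronglyMeasurable ht.1
    · refine (hB.mixedNorm_flow_le hq hr hgm (φ j)).trans_eq ?_
      rw [← hhn]
      congr 1
      exact eLpNorm_congr_ae (hhat.mono fun ξ hξ => hξ.symm)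

end


variable {n : ℕ}

/-! ### Uniform constants -/

lemma ofReal_mul_le_of_toReal_le {x c : ℝ} (hx : 0 ≤ x) {S : ℝ≥0∞} (hS : S ≠ ⊤)
    (h : S.toReal ≤ c) : ENNReal.ofReal x * S ≤ ENNReal.ofReal (c * x) := by
  conv_lhs => rw [← ENNReal.ofReal_toReal hS]
  rw [← ENNReal.ofReal_mul hx, mul_comm]
  exact ENNReal.ofReal_le_ofReal (mul_le_mul_of_nonneg_right h hx)

section
variable {σ : ℝ} {q r : ℝ≥0∞}

lemma SharpAdmissible.one_lt_left (h : SharpAdmissible σ q r) : 1 < q :=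
  ENNReal.one_lt_two.trans_le h.1

lemma SharpAdmissible.one_lt_right (h : SharpAdmissible σ q r) : 1 < r :=
  ENNReal.one_lt_two.trans_le h.2.1

lemma SharpAdmissible.conjExponent_right_le (h : SharpAdmissible σ q r) : r.conjExponent ≤ 2 := by
  rw [h.conj_right, ← ENNReal.ofReal_ofNat]
  have := h.interpParam_nonneg
  exact ENNReal.ofReal_le_ofReal (by rw [div_le_iff₀ (by linarith)]; linarith)

lemma SharpAdmissible.conjExponent_right_ne_top (h : SharpAdmissible σ q r) :
    r.conjExponent ≠ ⊤ := (h.conjExponent_right_le.trans_lt (by simp)).ne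

/-- Here $\sigma<1$ enters decisively: $q'<2$ for every sharp admissible pair, so the sum of two
reciprocals $1/q'$ always exceeds $1$, as Christ-Kiselev requires. -/
lemma SharpAdmissible.exponent_lt_two (h : SharpAdmissible σ q r) (hσ : 0 < σ) (hσ1 : σ < 1) :
    2 / (2 - σ * interpParam r) < 2 := by
  have h1 := interpParam_le_one r
  have h2 := h.interpParam_nonneg
  rw [div_lt_iff₀ (h.denom_pos hσ hσ1)]
  nlinarith

end

section
variable {φ₀ : ℝ → ℝ} {J : Set ℝ} {g : ℝ → ℝ} {δ σ β γ C : ℝ} {X : Eu n → ℂ}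
  {q r qt rt : ℝ≥0∞} {ψ : Eu n → ℝ} {a b : ℝ} {A At : ℝ≥0∞}

/-- Finiteness for the combined weight uses only the bound for the exponent $b$: on an annulus the
remaining factor is bounded and joins the datum. It provides the absolute integrability in the weak
time integrals. -/
lemma SpecBound.mixedNorm_evol_lt_top {qt' rt' : ℝ≥0∞} [ENNReal.HolderConjugate qt qt']
    [ENNReal.HolderConjugate rt rt'] (hX : Measurable X) (hBt : SpecBound ψ (wt X b) qt' rt' At)
    (hq : 1 < qt) (hr : 1 < rt) {h : Eu n → ℂ} (hh : IsAnn h) :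
    mixedNorm qt rt (evol ψ fun ξ => wt X (a + b) ξ * h ξ) < ⊤ := by
  have e : (fun ξ => wt X (a + b) ξ * h ξ) = fun ξ => wt X b ξ * (wt X a ξ * h ξ) := by
    funext ξ
    rw [← wt_mul]; ring
  have h1 := (annBdd_wt hX a).mul_isAnn hh
  rw [e]
  exact (hBt.mixedNorm_evol_le hq hr h1).trans_lt
    (ENNReal.mul_lt_top hBt.fin.lt_top (h1.memLp 2).2)

/-- The constant in the retarded estimates. -/
noncomputable def retConst (σ : ℝ) (r rt : ℝ≥0∞) : ℝ :=
  ckConst (1 / (2 / (2 - σ * interpParam rt)) + 1 / (2 / (2 - σ * interpParam r)))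

/-- The inhomogeneous estimates for a pair of spectral bounds. -/
theorem SpecBound.inhomogeneous_estimates (hn : 0 < n) (hσ : 0 < σ) (hσ1 : σ < 1) (hX : AnnBdd X)
    (hqr : SharpAdmissible σ q r) (hqrt : SharpAdmissible σ qt rt)
    (hB : SpecBound ψ (wt X a) q.conjExponent r.conjExponent A)
    (hBt : SpecBound ψ (wt X b) qt.conjExponent rt.conjExponent At) {F G : ℝ → Eu n → ℂ}
    (hF : MemMixed q.conjExponent r.conjExponent F ∨
      MemMixed qt.conjExponent rt.conjExponent F)
    (hG : MemMixed qt.conjExponent rt.conjExponent G)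
    (hFG : ∀ᵐ t, IsMultiplierImage (powSym (a + b) X) (F t) (G t)) :
    (∃ u : ℝ → Eu n → ℂ,
      AEStronglyMeasurable (Function.uncurry u) (volume : Measure (ℝ × Eu n)) ∧
      (∀ᵐ t, VanishesAtZeroFreq (u t) ∧
        IsTimeIntegral univ (fun s ξ => osc ψ (t - s) ξ * X ξ) F (u t)) ∧
      mixedNorm q r u ≤ A * At * mixedNorm qt.conjExponent rt.conjExponent G) ∧
    ∃ u : ℝ → Eu n → ℂ,
      AEStronglyMeasurable (Function.uncurry u) (volume : Measure (ℝ × Eu n)) ∧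
      (∀ᵐ t, VanishesAtZeroFreq (u t) ∧
        IsTimeIntegral (Iio t) (fun s ξ => osc ψ (t - s) ξ * X ξ) F (u t)) ∧
      mixedNorm q r u ≤ ENNReal.ofReal (retConst σ r rt) * (A * At) *
        mixedNorm qt.conjExponent rt.conjExponent G := by
  have i1 := ENNReal.HolderConjugate.conjExponent hqr.one_le_left
  have i2 := ENNReal.HolderConjugate.conjExponent hqr.one_le_right
  have i3 := ENNReal.HolderConjugate.conjExponent hqrt.one_le_left
  have i4 := ENNReal.HolderConjugate.conjExponent hqrt.one_le_right
  have hE : ∀ h : Eu n → ℂ, IsAnn h →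
      mixedNorm qt rt (evol ψ fun ξ => wt X (a + b) ξ * h ξ) < ⊤ := fun h hh =>
    hBt.mixedNorm_evol_lt_top hX.meas hqrt.one_lt_left hqrt.one_lt_right hh
  have hP := hqr.denom_pos hσ hσ1
  have hPt := hqrt.denom_pos hσ hσ1
  have ew : (fun ξ => wt X a ξ * wt X b ξ) = wt X (a + b) := funext fun ξ => wt_mul X a b ξ
  have hpt : qt.conjExponent ≠ ⊤ := by rw [hqrt.conj_left hσ hσ1]; exact ENNReal.ofReal_ne_top
  -- Of $F$ only this is needed: almost every slice lies in some $L^{s_1}$ with $1\le s_1\le2$. Both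
  -- admitted spaces provide it.
  obtain ⟨p₁, s₁, hp₁, hs₁, hs₁2, hF'⟩ : ∃ p₁ s₁ : ℝ≥0∞, p₁ ≠ 0 ∧ 1 ≤ s₁ ∧ s₁ ≤ 2 ∧
      MemMixed p₁ s₁ F := by
    rcases hF with hF | hF
    · exact ⟨_, _, (zero_lt_one.trans_le i1.symm.one_le).ne', i2.symm.one_le,
        hqr.conjExponent_right_le, hF⟩
    · exact ⟨_, _, (zero_lt_one.trans_le i3.symm.one_le).ne', i4.symm.one_le,
        hqrt.conjExponent_right_le, hF⟩
  have main : ∀ {S : ℝ → Set ℝ} {K : ℝ≥0∞},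
      DuhBound ψ (fun ξ => wt X a ξ * wt X b ξ) S q r qt.conjExponent rt.conjExponent K → _ :=
    fun {S K} hD => DuhBound.duhamel_estimate (S := S) (K := K) hn hX (ew ▸ hD)
      hqr.one_le_left hqr.one_le_right hpt hqrt.conjExponent_right_le hE hp₁ hs₁ hs₁2 hF' hG hFG
  constructor
  · refine main ?_
    rw [hqrt.conj_left hσ hσ1] at hBt ⊢
    exact hB.duhBound_univ hn hqr.one_lt_left hqr.one_lt_right (by positivity)
      hqrt.conjExponent_right_ne_top hBt
  · refine main ?_
    rw [hqrt.conj_left hσ hσ1] at hBt ⊢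
    rw [hqr.conj_left hσ hσ1] at hB i1
    exact hB.duhBound_Iio hn (by positivity) (hqr.exponent_lt_two hσ hσ1) hqr.one_lt_left
      hqr.one_lt_right hqr.conjExponent_right_ne_top (by positivity)
      (hqrt.exponent_lt_two hσ hσ1) hqrt.conjExponent_right_ne_top hBt

end

end Strichartz

/-! ### The four estimates with a constant independent of $\delta$ -/

theorem mainTheorem3 (n : ℕ) (hn : n = 1 ∨ n = 2)
    (φ₀ : ℝ → ℝ) (hφ₀ : Strichartz.IsLPBump φ₀)
    (J : Set ℝ) (hJ : J ⊆ Set.Ici 0)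
    (g : ℝ → ℝ) (hg : ContDiffOn ℝ 2 g (Set.Ioi 0))
    (σ β₀ β γ : ℝ) (hσ : 0 < σ) (hσ1 : σ < 1)
    (hdyadic : ∃ P : ℝ → ℂ, Strichartz.IsAnnulusProfile P ∧ ∃ C : ℝ, 0 < C ∧
      ∀ t : ℝ, t ≠ 0 → ∀ δ : ℝ, 0 < δ → ∀ k ∈ Strichartz.ZJ J, ∀ x : Strichartz.Eu n,
        ‖Strichartz.dyadicIntegral g P δ t k x‖ ≤ C * (2 : ℝ) ^ (γ * k) * (δ ^ β₀ / |t| ^ σ))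
    (hsum : ∃ C : ℝ, 0 < C ∧ ∀ t : ℝ, t ≠ 0 → ∀ δ : ℝ, 0 < δ →
      ∃ K : Strichartz.Eu n → ℂ, AEStronglyMeasurable K volume ∧
        Strichartz.IsOscIntegral (fun ξ => Strichartz.propSymbol g δ t ξ *
          ((‖ξ‖ ^ (-γ) * Strichartz.sumQ φ₀ J (δ * ‖ξ‖) : ℝ) : ℂ)) K ∧
        ∀ x, ‖K x‖ ≤ C * (δ ^ β / |t| ^ σ))
    (χ : ℝ → ℂ) (hχ : ContDiffOn ℝ ∞ χ (Set.Ioi 0))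
    (hχb : ∃ B : ℝ, ∀ y : ℝ, 0 < y → ‖χ y‖ ≤ B)
    (hχJ : ∀ y : ℝ, 0 < y → χ y * (Strichartz.sumQ φ₀ J y : ℂ) = χ y)
    (q r qt rt : ℝ≥0∞) (hqr : Strichartz.SharpAdmissible σ q r)
    (hqrt : Strichartz.SharpAdmissible σ qt rt) :
    ∃ C₂ : ℝ, 0 < C₂ ∧ ∀ δ : ℝ, 0 < δ →
      -- homogeneous estimate
      (∀ f h : Strichartz.Eu n → ℂ, MemLp f 2 volume → MemLp h 2 volume →
        Strichartz.IsMultiplierImage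
          (Strichartz.powCutSymbol (γ * (1 / 2 - Strichartz.recip r)) χ δ) f h →
        ∃ u : ℝ → Strichartz.Eu n → ℂ,
          AEStronglyMeasurable (Function.uncurry u) (volume : Measure (ℝ × Strichartz.Eu n)) ∧
          (∀ t, MemLp (u t) 2 volume ∧ Strichartz.IsMultiplierImage
            (fun ξ => Strichartz.propSymbol g δ t ξ * Strichartz.cutSymbol χ δ ξ) f (u t)) ∧
          Strichartz.mixedNorm q r u ≤
            ENNReal.ofReal (C₂ * δ ^ (β * (1 / 2 - Strichartz.recip r))) * eLpNorm h 2 volume) ∧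
      -- dual homogeneous estimate
      (∀ F G : ℝ → Strichartz.Eu n → ℂ,
        Strichartz.MemMixed q.conjExponent r.conjExponent F →
        Strichartz.MemMixed q.conjExponent r.conjExponent G →
        Strichartz.IsPowCut (γ * (1 / 2 - Strichartz.recip r)) χ δ F G →
        ∃ v : Strichartz.Eu n → ℂ, MemLp v 2 volume ∧
          Strichartz.IsTimeIntegral Set.univ
            (fun s ξ => Strichartz.propSymbol g δ (-s) ξ * Strichartz.cutSymbol χ δ ξ) F v ∧
          eLpNorm v 2 volume ≤
            ENNReal.ofReal (C₂ * δ ^ (β * (1 / 2 - Strichartz.recip r))) *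
              Strichartz.mixedNorm q.conjExponent r.conjExponent G) ∧
      -- inhomogeneous estimates
      (∀ F G : ℝ → Strichartz.Eu n → ℂ,
        (Strichartz.MemMixed q.conjExponent r.conjExponent F ∨
          Strichartz.MemMixed qt.conjExponent rt.conjExponent F) →
        Strichartz.MemMixed qt.conjExponent rt.conjExponent G →
        Strichartz.IsPowCut (γ * (1 - Strichartz.recip r - Strichartz.recip rt)) χ δ F G →
        (∃ u : ℝ → Strichartz.Eu n → ℂ,
          Strichartz.IsDuhamel g χ δ (fun _ => Set.univ) F u ∧
          Strichartz.mixedNorm q r u ≤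
            ENNReal.ofReal (C₂ * δ ^ (β * (1 - Strichartz.recip r - Strichartz.recip rt))) *
              Strichartz.mixedNorm qt.conjExponent rt.conjExponent G) ∧
        -- retarded inhomogeneous estimate
        ((r = 2 ∧ rt = ⊤) ∨ (r = ⊤ ∧ rt = 2) ∨ (r = ⊤ ∧ rt = ⊤) →
          ∃ u : ℝ → Strichartz.Eu n → ℂ,
            Strichartz.IsDuhamel g χ δ (fun t => Set.Iio t) F u ∧
            Strichartz.mixedNorm q r u ≤
              ENNReal.ofReal (C₂ * δ ^ (β * (1 - Strichartz.recip r - Strichartz.recip rt))) *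
                Strichartz.mixedNorm qt.conjExponent rt.conjExponent G)) := by
  have hn0 : 0 < n := by omega
  obtain ⟨C, hC, hK⟩ := hsum
  have hgc : ContinuousOn g (Set.Ioi 0) := hg.continuousOn
  obtain ⟨B, hB⟩ := hχb
  set c₁ := (Strichartz.specConst n σ (Strichartz.interpParam r) C) with hc₁
  set c₂ := (Strichartz.specConst n σ (Strichartz.interpParam rt) C) with hc₂
  have hc₁t : c₁ ≠ ⊤ := Strichartz.specConst_ne_top _ _ _ _
  have hc₂t : c₂ ≠ ⊤ := Strichartz.specConst_ne_top _ _ _ _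
  have hct : c₁ * c₂ ≠ ⊤ := ENNReal.mul_ne_top hc₁t hc₂t
  set κ := ENNReal.ofReal (Strichartz.retConst σ r rt) with hκ
  have hκt : κ * (c₁ * c₂) ≠ ⊤ := ENNReal.mul_ne_top ENNReal.ofReal_ne_top hct
  have p₁ : 0 ≤ c₁.toReal := ENNReal.toReal_nonneg
  have p₂ : 0 ≤ (c₁ * c₂).toReal := ENNReal.toReal_nonneg
  have p₃ : 0 ≤ (κ * (c₁ * c₂)).toReal := ENNReal.toReal_nonneg
  -- One constant dominates those of the homogeneous, inhomogeneous and retarded estimates; none of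
  -- them depends on $\delta$, and the summand $1$ ensures positivity.
  refine ⟨c₁.toReal + (c₁ * c₂).toReal + (κ * (c₁ * c₂)).toReal + 1, by linarith, fun δ hδ => ?_⟩
  set C₂ := c₁.toReal + (c₁ * c₂).toReal + (κ * (c₁ * c₂)).toReal + 1
  have hX : Measurable (Strichartz.cutSymbol (n := n) χ δ) :=
    Strichartz.measurable_comp_norm hχ.continuousOn hδ
  have hXB : ∀ ξ : Strichartz.Eu n, ξ ≠ 0 → ‖Strichartz.cutSymbol χ δ ξ‖ ≤ B := fun ξ hξ =>
    hB _ (mul_pos hδ (norm_pos_iff.2 hξ))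
  have hXJ : ∀ ξ ∈ Strichartz.symSupp (Strichartz.cutSymbol (n := n) χ δ),
      Strichartz.sumQ φ₀ J (δ * ‖ξ‖) = 1 := fun ξ hξ => by
    have h1 := hχJ _ (mul_pos hδ (norm_pos_iff.2 hξ.1))
    -- Where $\chi\ne0$, the identity $\chi\sum_kQ_k=\chi$ can be divided by $\chi$.
    exact_mod_cast mul_left_cancel₀ hξ.2 (h1.trans (mul_one _).symm)
  have hKδ : ∀ t : ℝ, t ≠ 0 → ∃ K : Strichartz.Eu n → ℂ,
      Strichartz.IsOscIntegral (fun ξ => Strichartz.propSymbol g δ t ξ *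
        ((‖ξ‖ ^ (-γ) * Strichartz.sumQ φ₀ J (δ * ‖ξ‖) : ℝ) : ℂ)) K ∧
        ∀ x, ‖K x‖ ≤ C * (δ ^ β / |t| ^ σ) := fun t ht => by
    obtain ⟨K, -, h1, h2⟩ := hK t ht δ hδ
    exact ⟨K, h1, h2⟩
  have hS := Strichartz.specBound_wt hn0 hφ₀ hgc hσ hσ1 hC.le hδ hKδ hX hXJ hqr
  have hSt := Strichartz.specBound_wt hn0 hφ₀ hgc hσ hσ1 hC.le hδ hKδ hX hXJ hqrt
  have i1 := ENNReal.HolderConjugate.conjExponent hqr.one_le_left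
  have i2 := ENNReal.HolderConjugate.conjExponent hqr.one_le_right
  have e1 : ENNReal.ofReal (δ ^ (β * (1 / 2 - Strichartz.recip r))) * c₁ ≤
      ENNReal.ofReal (C₂ * δ ^ (β * (1 / 2 - Strichartz.recip r))) :=
    Strichartz.ofReal_mul_le_of_toReal_le (by positivity) hc₁t (by linarith)
  -- The powers of $\delta$ from the two spectral bounds multiply, their exponents adding up to
  -- $\beta(1-\frac1r-\frac1{\tilde r})$.
  have e2 : ∀ S : ENNReal, S ≠ ⊤ → S.toReal ≤ C₂ →
      S * (ENNReal.ofReal (δ ^ (β * (1 / 2 - Strichartz.recip r))) *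
        ENNReal.ofReal (δ ^ (β * (1 / 2 - Strichartz.recip rt)))) ≤
      ENNReal.ofReal (C₂ * δ ^ (β * (1 - Strichartz.recip r - Strichartz.recip rt))) :=
    fun S hS hS' => by
      rw [← ENNReal.ofReal_mul (by positivity), ← Real.rpow_add hδ, mul_comm S]
      refine le_trans (le_of_eq ?_) (Strichartz.ofReal_mul_le_of_toReal_le (by positivity) hS hS')
      congr 3
      ring
  simp only [Strichartz.IsDuhamel, Strichartz.propSymbol_eq_osc]
  refine ⟨fun f h hf hh hfh => ?_, fun F G hF hG hFG => ?_, fun F G hF hG hFG => ?_⟩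
  · obtain ⟨u, hu1, hu2, hu3⟩ := hS.homogeneous_estimate hn0 hX hXB hqr.one_lt_left
      hqr.one_lt_right hf hh hfh
    exact ⟨u, hu1, hu2, hu3.trans (mul_le_mul_left e1 _)⟩
  · obtain ⟨v, hv1, hv2, hv3⟩ := hS.dual_estimate hn0 (Strichartz.annBdd_of_bdd hX hXB)
      hqr.one_lt_left hqr.one_lt_right hqr.conjExponent_right_le hF hG hFG
    exact ⟨v, hv1, hv2, hv3.trans (mul_le_mul_left e1 _)⟩
  -- The derivative in the inhomogeneous estimate is the sum of those of the two pairs, one for each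
  -- factor of the bilinear form.
  · have ea : γ * (1 - Strichartz.recip r - Strichartz.recip rt) =
        γ * (1 / 2 - Strichartz.recip r) + γ * (1 / 2 - Strichartz.recip rt) := by ring
    rw [ea] at hFG
    obtain ⟨⟨u, hu1, hu2, hu3⟩, w, hw1, hw2, hw3⟩ := hS.inhomogeneous_estimates hn0 hσ hσ1
      (Strichartz.annBdd_of_bdd hX hXB) hqr hqrt hSt hF hG hFG
    refine ⟨⟨u, ⟨hu1, hu2⟩, hu3.trans (mul_le_mul_left (le_trans (le_of_eq ?_)
      (e2 _ hct (by linarith))) _)⟩, fun _ => ⟨w, ⟨hw1, hw2⟩, hw3.trans (mul_le_mul_left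
        (le_trans (le_of_eq ?_) (e2 _ hκt (by linarith))) _)⟩⟩ <;> ring
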